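/- Let $M$ be a closed oriented smooth manifold of dimension $n = 2k \ge 2$, let $Z \subset M$ be a smooth compact hypersurface, and let ${}^bTM$ be the vector bundle over $M$ whose smooth sections are the vector fields on $M$ tangent to $Z$, with anchor map $a \colon {}^bTM \to TM$ and with the canonical section $e$ of $\ker(a|_Z)$ (locally $e = yY|_Z$, where $y$ is a local defining function of $Z$ and $Yy = 1$). Let $\omega$ be a $b$-symplectic form, i.e. a closed nondegenerate section of $\wedge^2\,{}^bT^*M$; it orients ${}^bTM$. There are a global defining function $x$ of $Z$ such that $a$ preserves orientations on $\{x>0\}$ and reverses them on $\{x<0\}$, and a complex structure $J$ on ${}^bTM$ compatible with $\omega$, i.e. such that $g_J(u,w)=\omega(u,Jw)$ is a $J$-invariant metric. For each such $J$, let ${}^bP \to P_O({}^bTM)$ be the graded principal $\mathrm{Pin}_c(n)$-bundle associated to the unitary frame bundle of $({}^bTM,J)$ by the canonical homomorphism $U(k) \to \mathrm{Spin}_c(n)$, with its natural map to the orthonormal frame bundle (graded by the symplectic orientation); it is a spin-c structure on ${}^bTM$. Let $\hat e = e/|e|$, let $\Gamma = i^{n/2} v_1 \cdots v_n$ be the chirality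 element of ${}^bTM$ ($v_1, \dots, v_n$ an oriented orthonormal frame), and let $r$ be the orthogonal reflection of ${}^bTM|_Z$ in $e^\perp$. Then the gauge transformation $\Gamma \hat e$ of ${}^bP|_Z$ is an involution which lifts $r$. Let $P$ be the principal $\mathrm{Pin}_c(n)$-bundle obtained by gluing ${}^bP|_{\{x \ge 0\}}$ to ${}^bP|_{\{x \le 0\}}$ along $Z$ by $\Gamma\hat e$ (smoothly, by means of a smooth extension of $e$ to a neighbourhood of $Z$), graded by the grading of ${}^bP$ over $\{x \ge 0\}$ and by the opposite grading over $\{x \le 0\}$. Let $g$ be any Riemannian metric on $M$, and let $P_O(TM)$ be graded by the orientation of $M$. (1) The bundle $P_O({}^bTM)^r$ obtained from $P_O({}^bTM)$ by the same gluing using $r$ is isomorphic to $P_O(TM)$ by an isomorphism which is a deformation of the anchor: over $M$ it is given by fibrewise linear maps $\Phi$ such that $\Phi + s\,a$ is invertible for all $s \ge 0$, and along $Z$, on the side $\{x \ge 0\}$, $\Phi(e)$ points into $\{x \ge 0\}$. (2) The composition $P \to P_O({}^bTM)^r \cong P_O(TM)$ is a spin-c structure on $TM$, i.e. $P$ is a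 graded principal $\mathrm{Pin}_c(n)$-bundle and the map is a map of graded bundles that is equivariant along $\mathrm{Ad} \colon \mathrm{Pin}_c(n) \to O(n)$. (3) This spin-c structure is canonical: up to isomorphism of spin-c structures on $(TM,g)$ it does not depend on the choices of $x$, $J$, the extension of $e$, and the isomorphism in (1). (4) The determinant line bundle $P \times_{\det} \mathbb{C}$ is isomorphic to the determinant line bundle of the spin-c structure on ${}^bTM$ coming from any compatible complex structure. -/

import Mathlib

open scoped Manifold ContDiff Topology

universe u v w

noncomputable section

/-! ## The groups `Pin_c(n)`, `n = 2k` -/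

/-- The Euclidean space `ℝⁿ`, `n = 2k`. -/
abbrev Euc (k : ℕ) : Type := EuclideanSpace ℝ (Fin (2 * k))

/-- The complex quadratic form `z ↦ - ∑ zᵢ²` on `ℂⁿ`. -/
def cliffordForm (k : ℕ) : QuadraticForm ℂ (Fin (2 * k) → ℂ) :=
  QuadraticMap.weightedSumSquares ℂ (fun _ => (-1 : ℂ))

/-- The complexified Clifford algebra `ℂl(n) = Cl(ℝⁿ) ⊗ ℂ`, with `v w + w v = -2 ⟨v, w⟩`
for `v, w ∈ ℝⁿ`. -/
abbrev CCl (k : ℕ) : Type := CliffordAlgebra (cliffordForm k)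

/-- The inclusion of the real vectors `ℝⁿ` into `ℂl(n)`. -/
def cvec {k : ℕ} (v : Euc k) : CCl k :=
  CliffordAlgebra.ι (cliffordForm k) (fun i => (v i : ℂ))

theorem cliffordForm_real {k : ℕ} (v : Euc k) :
    cliffordForm k (fun i => (v i : ℂ)) = -((‖v‖ ^ 2 : ℝ) : ℂ) := by
  rw [EuclideanSpace.norm_sq_eq]
  simp [cliffordForm, QuadraticMap.weightedSumSquares_apply, pow_two]

theorem cvec_mul_self {k : ℕ} (v : Euc k) :
    cvec v * cvec v = algebraMap ℂ (CCl k) (-((‖v‖ ^ 2 : ℝ) : ℂ)) := by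
  rw [cvec, CliffordAlgebra.ι_sq_scalar, cliffordForm_real]

theorem cvec_add {k : ℕ} (v w : Euc k) : cvec (v + w) = cvec v + cvec w := by
  simp only [cvec, ← map_add]
  congr 1
  ext i
  simp

theorem cvec_smul {k : ℕ} (c : ℝ) (v : Euc k) : cvec (c • v) = (c : ℂ) • cvec v := by
  simp only [cvec, ← map_smul]
  congr 1
  ext i
  simp

theorem cvec_mul_add_swap {k : ℕ} (v w : Euc k) :
    cvec v * cvec w + cvec w * cvec v
      = algebraMap ℂ (CCl k) (((-2 * inner ℝ v w : ℝ)) : ℂ) := by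
  have h := cvec_mul_self (v + w)
  rw [cvec_add, add_mul, mul_add, mul_add, cvec_mul_self, cvec_mul_self] at h
  have h2 : ‖v + w‖ ^ 2 = ‖v‖ ^ 2 + 2 * inner ℝ v w + ‖w‖ ^ 2 := norm_add_sq_real v w
  rw [h2] at h
  have h3 : cvec v * cvec w + cvec w * cvec v
      = algebraMap ℂ (CCl k) (-((‖v‖ ^ 2 + 2 * inner ℝ v w + ‖w‖ ^ 2 : ℝ) : ℂ))
        - algebraMap ℂ (CCl k) (-((‖v‖ ^ 2 : ℝ) : ℂ))
        - algebraMap ℂ (CCl k) (-((‖w‖ ^ 2 : ℝ) : ℂ)) := by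
    rw [← h]; abel
  rw [h3, ← map_sub, ← map_sub]
  congr 1
  push_cast
  ring

theorem cvec_injective {k : ℕ} : Function.Injective (cvec (k := k)) := by
  intro v w h
  have h0 : cvec (v + (-1 : ℝ) • w) = 0 := by
    rw [cvec_add, cvec_smul, h]; simp
  have h1 := cvec_mul_self (v + (-1 : ℝ) • w)
  rw [h0, zero_mul] at h1
  have h2 : -((‖v + (-1 : ℝ) • w‖ ^ 2 : ℝ) : ℂ) = 0 := by
    apply (algebraMap ℂ (CCl k)).injective
    rw [← h1, map_zero]
  have h3 : ‖v + (-1 : ℝ) • w‖ ^ 2 = 0 := by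
    have := neg_eq_zero.mp h2
    exact_mod_cast this
  have h4 : v + (-1 : ℝ) • w = 0 := by
    rw [← norm_eq_zero]; exact pow_eq_zero_iff (two_ne_zero) |>.mp h3
  have h5 : v - w = 0 := by rw [← h4]; simp [sub_eq_add_neg]
  exact sub_eq_zero.mp h5

/-- `Pin_c(n)`: the group of all products `z v₁ ⋯ v_j` in `ℂl(n)` with `z ∈ U(1)` and unit vectors
`vᵢ ∈ ℝⁿ`. -/
def PinC (k : ℕ) : Subgroup (CCl k)ˣ :=
  Subgroup.closure
    ({a | ∃ z : ℂ, ‖z‖ = 1 ∧ (a : CCl k) = algebraMap ℂ (CCl k) z} ∪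
      {a | ∃ v : Euc k, ‖v‖ = 1 ∧ (a : CCl k) = cvec v})

/-- A scalar `z ∈ U(1)`, as an element of `Pin_c(n)`. -/
def pinScalar (k : ℕ) (z : ℂ) (hz : ‖z‖ = 1) : PinC k :=
  ⟨Units.map (algebraMap ℂ (CCl k)).toMonoidHom
      (Units.mk0 z (by rintro rfl; simp at hz)),
    Subgroup.subset_closure (Or.inl ⟨z, hz, rfl⟩)⟩

theorem cvec_mul_neg_self {k : ℕ} (v : Euc k) (hv : ‖v‖ = 1) : cvec v * -cvec v = 1 := by
  rw [mul_neg, cvec_mul_self, hv]; simp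

theorem cvec_neg_self_mul {k : ℕ} (v : Euc k) (hv : ‖v‖ = 1) : -cvec v * cvec v = 1 := by
  rw [neg_mul, cvec_mul_self, hv]; simp

open Classical in
/-- A unit vector `v`, as an element of `Pin_c(n)` (and `1` if `v` is not a unit vector). -/
def pinVec {k : ℕ} (v : Euc k) : PinC k :=
  if h : ‖v‖ = 1 then
    ⟨⟨cvec v, -cvec v, cvec_mul_neg_self v h, cvec_neg_self_mul v h⟩,
      Subgroup.subset_closure (Or.inr ⟨v, h, rfl⟩)⟩
  else 1

/-- The chirality element `Γ = i^{n/2} e₁ ⋯ e_n` of `ℝⁿ` with its standard orientation. -/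
def pinGamma (k : ℕ) : PinC k :=
  pinScalar k (Complex.I ^ k) (by simp) *
    (List.ofFn fun i : Fin (2 * k) => pinVec (EuclideanSpace.single i (1 : ℝ))).prod

open Classical in
/-- The grading `∂` of `Pin_c(n)`: `0` on even and `1` on odd elements of the Clifford algebra. -/
def pinDeg {k : ℕ} (a : PinC k) : ZMod 2 :=
  if ((a : (CCl k)ˣ) : CCl k) ∈ CliffordAlgebra.evenOdd (cliffordForm k) 0 then 0 else 1

/-- Every `a ∈ Pin_c(n)` normalizes `ℝⁿ ⊆ ℂl(n)` and acts on it by an orthogonal map. -/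
theorem exists_pinAd {k : ℕ} (a : PinC k) :
    ∃ T : Euc k ≃ₗᵢ[ℝ] Euc k, ∀ v : Euc k,
      ((a : (CCl k)ˣ) : CCl k) * cvec v = cvec (T v) * ((a : (CCl k)ˣ) : CCl k) := by
  obtain ⟨a, ha⟩ := a
  induction ha using Subgroup.closure_induction with
  | mem x hx =>
    rcases hx with ⟨z, -, hz⟩ | ⟨w, hw, hx⟩
    · refine ⟨LinearIsometryEquiv.refl ℝ _, fun v => ?_⟩
      simp only [hz]
      exact Algebra.commutes _ _
    · refine ⟨Submodule.reflection (Submodule.span ℝ {w}), fun v => ?_⟩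
      simp only [hx]
      have e1 : (Submodule.reflection (Submodule.span ℝ {w})) v
          = (2 * inner ℝ w v : ℝ) • w + (-1 : ℝ) • v := by
        rw [Submodule.reflection_singleton_apply, hw]
        simp [sub_eq_add_neg, two_smul, ← add_smul, two_mul]
      rw [e1, cvec_add, cvec_smul, cvec_smul, add_mul, smul_mul_assoc, smul_mul_assoc,
        cvec_mul_self, hw, ← sub_eq_iff_eq_add]
      have := cvec_mul_add_swap w v
      rw [Algebra.algebraMap_eq_smul_one] at this ⊢
      push_cast at this ⊢
      rw [neg_one_smul, sub_neg_eq_add, this]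
      simp
  | one => exact ⟨LinearIsometryEquiv.refl ℝ _, fun v => by simp⟩
  | mul x y hx hy ihx ihy =>
    obtain ⟨S, hS⟩ := ihx
    obtain ⟨T, hT⟩ := ihy
    refine ⟨T.trans S, fun v => ?_⟩
    simp only [Units.val_mul, LinearIsometryEquiv.trans_apply] at hS hT ⊢
    rw [mul_assoc, hT, ← mul_assoc, hS, mul_assoc]
  | inv x hx ih =>
    obtain ⟨T, hT⟩ := ih
    refine ⟨T.symm, fun v => ?_⟩
    have h := hT (T.symm v)
    simp only [LinearIsometryEquiv.apply_symm_apply] at h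
    calc ((x⁻¹ : (CCl k)ˣ) : CCl k) * cvec v
        = ((x⁻¹ : (CCl k)ˣ) : CCl k) * (cvec v * (x : CCl k)) * ((x⁻¹ : (CCl k)ˣ) : CCl k) := by
          rw [mul_assoc, mul_assoc, Units.mul_inv, mul_one]
      _ = cvec (T.symm v) * ((x⁻¹ : (CCl k)ˣ) : CCl k) := by
          rw [← h, ← mul_assoc, Units.inv_mul, one_mul]

/-- The homomorphism `Ad : Pin_c(n) → O(n)`, `a v a⁻¹ = Ad_a v`. -/
def pinAd {k : ℕ} (a : PinC k) : Euc k ≃ₗᵢ[ℝ] Euc k := (exists_pinAd a).choose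

theorem pinAd_spec {k : ℕ} (a : PinC k) (v : Euc k) :
    ((a : (CCl k)ˣ) : CCl k) * cvec v = cvec (pinAd a v) * ((a : (CCl k)ˣ) : CCl k) :=
  (exists_pinAd a).choose_spec v

theorem pinAd_mul {k : ℕ} (a b : PinC k) (v : Euc k) :
    pinAd (a * b) v = pinAd a (pinAd b v) := by
  apply cvec_injective
  have h := pinAd_spec (a * b) v
  have h2 : (((a * b : PinC k) : (CCl k)ˣ) : CCl k) * cvec v
      = cvec (pinAd a (pinAd b v)) * (((a * b : PinC k) : (CCl k)ˣ) : CCl k) := by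
    simp only [Subgroup.coe_mul, Units.val_mul]
    rw [mul_assoc, pinAd_spec b, ← mul_assoc, pinAd_spec a, mul_assoc]
  rw [h2] at h
  exact ((((a * b : PinC k) : (CCl k)ˣ)).isUnit.mul_left_injective h).symm

/-- The transpose of `z v₁ ⋯ v_j` times `z v₁ ⋯ v_j` is `z²`, the transpose being
`(-1)^j z v_j ⋯ v₁`. -/
theorem exists_pinDet {k : ℕ} (a : PinC k) :
    ∃ d : ℂ, d ≠ 0 ∧
      CliffordAlgebra.reverse (CliffordAlgebra.involute ((a : (CCl k)ˣ) : CCl k)) *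
        ((a : (CCl k)ˣ) : CCl k) = algebraMap ℂ (CCl k) d := by
  obtain ⟨a, ha⟩ := a
  induction ha using Subgroup.closure_induction with
  | mem x hx =>
    rcases hx with ⟨z, hz1, hz⟩ | ⟨w, hw, hx⟩
    · refine ⟨z * z, mul_ne_zero ?_ ?_, ?_⟩
      · rintro rfl; simp at hz1
      · rintro rfl; simp at hz1
      · simp [hz]
    · refine ⟨1, one_ne_zero, ?_⟩
      simp only [hx]
      have : CliffordAlgebra.reverse (CliffordAlgebra.involute (cvec w)) = -cvec w := by
        simp [cvec]
      rw [this, cvec_neg_self_mul w hw, map_one]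
  | one => exact ⟨1, one_ne_zero, by simp⟩
  | mul x y hx hy ihx ihy =>
    obtain ⟨c, hc, hcx⟩ := ihx
    obtain ⟨d, hd, hdy⟩ := ihy
    refine ⟨c * d, mul_ne_zero hc hd, ?_⟩
    simp only [Units.val_mul, map_mul, CliffordAlgebra.reverse.map_mul] at hcx hdy ⊢
    rw [mul_assoc, ← mul_assoc _ (x : CCl k) (y : CCl k), hcx, ← mul_assoc,
      ← Algebra.commutes, mul_assoc, hdy]
  | inv x hx ih =>
    obtain ⟨c, hc, hcx⟩ := ih
    refine ⟨c⁻¹, inv_ne_zero hc, ?_⟩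
    simp only at hcx ⊢
    set t : CCl k → CCl k := fun b => CliffordAlgebra.reverse (CliffordAlgebra.involute b)
      with ht
    have hmul : ∀ b b', t (b * b') = t b' * t b := fun b b' => by
      simp [ht, CliffordAlgebra.reverse.map_mul]
    have h1 : t ((x⁻¹ : (CCl k)ˣ) : CCl k) * t (x : CCl k) = 1 := by
      rw [← hmul, Units.mul_inv]; simp [ht]
    have h2 : t (x : CCl k) = algebraMap ℂ (CCl k) c * ((x⁻¹ : (CCl k)ˣ) : CCl k) := by
      rw [← hcx, mul_assoc, Units.mul_inv, mul_one]
    change t ((x⁻¹ : (CCl k)ˣ) : CCl k) * ((x⁻¹ : (CCl k)ˣ) : CCl k) = _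
    have h3 : ((x⁻¹ : (CCl k)ˣ) : CCl k) = algebraMap ℂ (CCl k) c⁻¹ * t (x : CCl k) := by
      rw [h2, ← mul_assoc, ← map_mul, inv_mul_cancel₀ hc, map_one, one_mul]
    calc t ((x⁻¹ : (CCl k)ˣ) : CCl k) * ((x⁻¹ : (CCl k)ˣ) : CCl k)
        = t ((x⁻¹ : (CCl k)ˣ) : CCl k) * (algebraMap ℂ (CCl k) c⁻¹ * t (x : CCl k)) := by
          rw [← h3]
      _ = algebraMap ℂ (CCl k) c⁻¹ * (t ((x⁻¹ : (CCl k)ˣ) : CCl k) * t (x : CCl k)) := by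
          rw [← mul_assoc, ← Algebra.commutes, mul_assoc]
      _ = _ := by rw [h1, mul_one]

/-- The homomorphism `det : Pin_c(n) → U(1)`, `z v₁ ⋯ v_j ↦ z²`. -/
def pinDet {k : ℕ} (a : PinC k) : ℂ := (exists_pinDet a).choose

theorem pinDet_spec {k : ℕ} (a : PinC k) :
    CliffordAlgebra.reverse (CliffordAlgebra.involute ((a : (CCl k)ˣ) : CCl k)) *
      ((a : (CCl k)ˣ) : CCl k) = algebraMap ℂ (CCl k) (pinDet a) :=
  (exists_pinDet a).choose_spec.2

/-- The standard complex structure of `ℝⁿ = ℂᵏ`: `e₁ ↦ e₂`, `e₂ ↦ -e₁`, `e₃ ↦ e₄`, … -/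
def stdJ (k : ℕ) : Euc k →ₗ[ℝ] Euc k where
  toFun v := WithLp.toLp 2 fun i =>
    if h : (i : ℕ) % 2 = 0 then -v ⟨i + 1, by omega⟩ else v ⟨i - 1, by omega⟩
  map_add' v w := by
    ext i
    by_cases h : (i : ℕ) % 2 = 0 <;> simp [h]; ring
  map_smul' c v := by
    ext i
    by_cases h : (i : ℕ) % 2 = 0 <;> simp [h]

/-- The image of the canonical homomorphism `U(k) → Spin_c(2k)` (the lift of `(incl, det_ℂ)` to
`Spin_c(2k) → SO(2k) × U(1)`).  The group `U(k)` is generated by the maps that multiply a unit vector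
`v` by `ζ ∈ U(1)` and fix its complex orthogonal complement; with `ζ = exp(iθ)` the canonical lift
of such a map is
`exp(iθ/2) (cos(θ/2) + sin(θ/2) v · Jv) = (1 + ζ)/2 + (ζ - 1)/(2i) v · Jv`. -/
def unitaryLift (k : ℕ) : Subgroup (PinC k) :=
  Subgroup.closure
    {a | ∃ (ζ : ℂ) (v : Euc k), ‖ζ‖ = 1 ∧ ‖v‖ = 1 ∧
      ((a : (CCl k)ˣ) : CCl k) = algebraMap ℂ (CCl k) ((1 + ζ) / 2) +
        ((ζ - 1) / (2 * Complex.I)) • (cvec v * cvec (stdJ k v))}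

theorem unitaryLift_even {k : ℕ} {a : PinC k} (ha : a ∈ unitaryLift k) :
    ((a : (CCl k)ˣ) : CCl k) ∈ CliffordAlgebra.evenOdd (cliffordForm k) 0 ∧
    (((a⁻¹ : PinC k) : (CCl k)ˣ) : CCl k) ∈ CliffordAlgebra.evenOdd (cliffordForm k) 0 := by
  have hone : (1 : CCl k) ∈ CliffordAlgebra.evenOdd (cliffordForm k) 0 :=
    Submodule.one_le.mp (CliffordAlgebra.one_le_evenOdd_zero _)
  have hmul : ∀ {b c : CCl k}, b ∈ CliffordAlgebra.evenOdd (cliffordForm k) 0 →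
      c ∈ CliffordAlgebra.evenOdd (cliffordForm k) 0 →
      b * c ∈ CliffordAlgebra.evenOdd (cliffordForm k) 0 := fun {b c} hb hc => by
    simpa using CliffordAlgebra.evenOdd_mul_le (cliffordForm k) 0 0 (Submodule.mul_mem_mul hb hc)
  have halg : ∀ z : ℂ, algebraMap ℂ (CCl k) z ∈
      CliffordAlgebra.evenOdd (cliffordForm k) 0 := fun z => by
    rw [Algebra.algebraMap_eq_smul_one]; exact Submodule.smul_mem _ _ hone
  induction ha using Subgroup.closure_induction with
  | mem x hx =>
    obtain ⟨ζ, v, -, -, hx⟩ := hx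
    have hxe : ((x : (CCl k)ˣ) : CCl k) ∈ CliffordAlgebra.evenOdd (cliffordForm k) 0 := by
      rw [hx]
      exact Submodule.add_mem _ (halg _)
        (Submodule.smul_mem _ _ (CliffordAlgebra.ι_mul_ι_mem_evenOdd_zero _ _ _))
    refine ⟨hxe, ?_⟩
    obtain ⟨d, hd, h⟩ := exists_pinDet x
    have hrev : CliffordAlgebra.reverse (CliffordAlgebra.involute ((x : (CCl k)ˣ) : CCl k)) ∈
        CliffordAlgebra.evenOdd (cliffordForm k) 0 := by
      rw [hx]
      simp only [map_add, map_smul, map_mul, CliffordAlgebra.reverse.map_mul, cvec,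
        CliffordAlgebra.involute_ι, CliffordAlgebra.reverse_ι, AlgHom.commutes,
        CliffordAlgebra.reverse.commutes, neg_mul_neg]
      exact Submodule.add_mem _ (halg _)
        (Submodule.smul_mem _ _ (CliffordAlgebra.ι_mul_ι_mem_evenOdd_zero _ _ _))
    have : (((x⁻¹ : PinC k) : (CCl k)ˣ) : CCl k) = d⁻¹ •
        CliffordAlgebra.reverse (CliffordAlgebra.involute ((x : (CCl k)ˣ) : CCl k)) := by
      have h4 : CliffordAlgebra.reverse (CliffordAlgebra.involute ((x : (CCl k)ˣ) : CCl k))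
          = algebraMap ℂ (CCl k) d * (((x⁻¹ : PinC k) : (CCl k)ˣ) : CCl k) := by
        rw [← h, mul_assoc, Subgroup.coe_inv, Units.mul_inv, mul_one]
      rw [h4, Algebra.smul_def, ← mul_assoc, ← map_mul, inv_mul_cancel₀ hd, map_one, one_mul]
    rw [this]
    exact Submodule.smul_mem _ _ hrev
  | one => simpa using hone
  | mul x y hx hy ihx ihy =>
    refine ⟨?_, ?_⟩
    · simpa using hmul ihx.1 ihy.1
    · simpa [mul_inv_rev] using hmul ihy.2 ihx.2
  | inv x hx ih => exact ⟨ih.2, by simpa using ih.1⟩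

theorem pinDeg_unitaryLift_mul {k : ℕ} {c : PinC k} (hc : c ∈ unitaryLift k) (a : PinC k) :
    pinDeg (c * a) = pinDeg a := by
  have hmul : ∀ {b c : CCl k}, b ∈ CliffordAlgebra.evenOdd (cliffordForm k) 0 →
      c ∈ CliffordAlgebra.evenOdd (cliffordForm k) 0 →
      b * c ∈ CliffordAlgebra.evenOdd (cliffordForm k) 0 := fun {b c} hb hc => by
    simpa using CliffordAlgebra.evenOdd_mul_le (cliffordForm k) 0 0 (Submodule.mul_mem_mul hb hc)
  obtain ⟨h1, h2⟩ := unitaryLift_even hc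
  have key : (((c * a : PinC k) : (CCl k)ˣ) : CCl k) ∈ CliffordAlgebra.evenOdd (cliffordForm k) 0 ↔
      ((a : (CCl k)ˣ) : CCl k) ∈ CliffordAlgebra.evenOdd (cliffordForm k) 0 := by
    constructor
    · intro h
      have := hmul h2 h
      rw [Subgroup.coe_mul, Units.val_mul, Subgroup.coe_inv, ← mul_assoc, Units.inv_mul,
        one_mul] at this
      exact this
    · intro h
      rw [Subgroup.coe_mul, Units.val_mul]
      exact hmul h1 h
  unfold pinDeg
  by_cases h : ((a : (CCl k)ˣ) : CCl k) ∈ CliffordAlgebra.evenOdd (cliffordForm k) 0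
  · rw [if_pos h, if_pos (key.mpr h)]
  · rw [if_neg h, if_neg (fun h' => h (key.mp h'))]

/-! ## Principal bundles, Euclidean bundles, spin-c structures -/

/-- A group with a distinguished set of complex valued functions (matrix coefficients), which
determine what a smooth map into the group is. -/
class MatrixGroup (G : Type) extends Group G where
  coeffs : Set (G → ℂ)

/-- A map into `Pin_c(n)` is smooth if it is smooth as a map into the finite dimensional vector
space `ℂl(n)`, that is, if its composition with each linear functional is. -/
instance (k : ℕ) : MatrixGroup (PinC k) where
  coeffs := {c | ∃ l : CCl k →ₗ[ℂ] ℂ, ∀ a : PinC k, c a = l ((a : (CCl k)ˣ) : CCl k)}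

/-- The orthogonal group `O(n)`; the smooth maps into it are those with smooth matrix
coefficients `⟨w, A v⟩`. -/
instance (k : ℕ) : MatrixGroup (Euc k ≃ₗᵢ[ℝ] Euc k) where
  coeffs := {c | ∃ v w : Euc k, ∀ A : Euc k ≃ₗᵢ[ℝ] Euc k, c A = ((inner ℝ w (A v) : ℝ) : ℂ)}

section Bundles

variable {k : ℕ} {M : Type u} [TopologicalSpace M] [ChartedSpace (Euc k) M]

/-- The complex valued function `f` is smooth on a neighbourhood of `m`. -/
def SmoothNear (k : ℕ) {M : Type u} [TopologicalSpace M] [ChartedSpace (Euc k) M]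
    (f : M → ℂ) (m : M) : Prop :=
  ∀ᶠ m' in 𝓝 m, ContMDiffAt (𝓡 (2 * k)) 𝓘(ℝ, ℂ) ∞ f m'

/-- The `G`-valued map `a` is smooth on a neighbourhood of `m`. -/
def SmoothGroupNear (k : ℕ) {M : Type u} [TopologicalSpace M] [ChartedSpace (Euc k) M]
    {G : Type} [MatrixGroup G] (a : M → G) (m : M) : Prop :=
  ∀ c ∈ MatrixGroup.coeffs (G := G), SmoothNear k (fun m' => c (a m')) m

/-- The data of a family of sets over `M` with right action of `G` on them, together with the
information which sections are smooth on a neighbourhood of which point (the values of a section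
far from the point do not matter, so this describes the sheaf of smooth local sections). -/
structure BundleData (G : Type) (M : Type u) where
  /-- the fibres -/
  Fib : M → Type v
  /-- the right action -/
  act : ∀ m, Fib m → G → Fib m
  /-- the section `σ` is smooth on a neighbourhood of the point -/
  smooth : (∀ m, Fib m) → M → Prop

/-- The data form a smooth principal `G`-bundle: `G` acts simply transitively on the fibres, there
are smooth local sections through each point, and two smooth local sections differ by a smooth
`G`-valued function (so the smooth local sections are a torsor under the sheaf of smooth `G`-valued
functions, and every one of them gives a local trivialization). -/
structure BundleData.IsPrincipal (k : ℕ) {M : Type u} [TopologicalSpace M]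
    [ChartedSpace (Euc k) M] {G : Type} [MatrixGroup G] (P : BundleData.{u, v} G M) : Prop where
  act_one : ∀ m (p : P.Fib m), P.act m p 1 = p
  act_mul : ∀ m (p : P.Fib m) (a b : G), P.act m p (a * b) = P.act m (P.act m p a) b
  torsor : ∀ m (p q : P.Fib m), ∃! a : G, P.act m p a = q
  local_eq : ∀ (σ τ : ∀ m, P.Fib m) (m : M), (∀ᶠ m' in 𝓝 m, σ m' = τ m') →
    P.smooth σ m → P.smooth τ m
  smooth_open : ∀ (σ : ∀ m, P.Fib m) (m : M), P.smooth σ m → ∀ᶠ m' in 𝓝 m, P.smooth σ m'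
  exists_smooth : ∀ m, ∃ σ : ∀ m, P.Fib m, P.smooth σ m
  smooth_iff : ∀ (σ : ∀ m, P.Fib m) (a : M → G) (m : M), P.smooth σ m →
    (P.smooth (fun m' => P.act m' (σ m') (a m')) m ↔ SmoothGroupNear k a m)

/-- `∂` is a grading of `P`, where `deg` is the grading of the structure group. -/
structure BundleData.IsGrading {G : Type} (P : BundleData.{u, v} G M) (deg : G → ZMod 2)
    (d : ∀ m, P.Fib m → ZMod 2) : Prop where
  act : ∀ m (p : P.Fib m) (a : G), d m (P.act m p a) = d m p + deg a
  locally_const : ∀ (σ : ∀ m, P.Fib m) (m : M), P.smooth σ m →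
    ∀ᶠ m' in 𝓝 m, d m' (σ m') = d m (σ m)

/-- Surgery of `P` along the hypersurface `Z = {x = 0}` using (the restriction to `Z` of) the gauge
transformation `g`: the copies of `P` over `{x ≥ 0}` and over `{x ≤ 0}` are glued along `Z` by
identifying `p` in the first copy with `g p` in the second copy.

The fibre of the result over `z ∈ Z` is written as the fibre `P_z` of the first copy. A smooth local
section near `z` is then given by `s` over `{x ≥ 0}` and by `g s` over `{x < 0}` with a smooth
local section `s` of `P`. -/
def BundleData.surgery {G : Type} (P : BundleData.{u, v} G M) (x : M → ℝ)
    (g : ∀ m, P.Fib m → P.Fib m) : BundleData.{u, v} G M where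
  Fib := P.Fib
  act := P.act
  smooth σ m := (x m ≠ 0 → P.smooth σ m) ∧
    (x m = 0 → ∃ s : ∀ m, P.Fib m, P.smooth s m ∧
      ∀ᶠ m' in 𝓝 m, (0 ≤ x m' → σ m' = s m') ∧ (x m' < 0 → σ m' = g m' (s m')))

open Classical in
/-- The grading of the surgery by an odd gauge transformation: the given one over the first copy
`{x ≥ 0}`, and the opposite one over the second copy. -/
def surgeryGrading {F : M → Type v} (x : M → ℝ) (d : ∀ m, F m → ZMod 2) (m : M) (p : F m) :
    ZMod 2 :=
  if 0 ≤ x m then d m p else d m p + 1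

/-- The data of a Euclidean vector bundle over `M`: fibres, metric, and the information which
sections are smooth on a neighbourhood of which point. -/
structure EucBundle (M : Type u) where
  /-- the fibres -/
  Fib : M → Type v
  [addCommGroup : ∀ m, AddCommGroup (Fib m)]
  [module : ∀ m, Module ℝ (Fib m)]
  /-- the Euclidean metric of the fibres -/
  metric : ∀ m, Fib m → Fib m → ℝ
  /-- the section is smooth on a neighbourhood of the point -/
  smooth : (∀ m, Fib m) → M → Prop

attribute [instance] EucBundle.addCommGroup EucBundle.module

/-- Orthonormal frames of the fibre `V_m`, written as linear isometries `ℝⁿ → V_m`. -/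
def OFrame (k : ℕ) {M : Type u} (V : EucBundle.{u, v} M) (m : M) : Type v :=
  {p : Euc k ≃ₗ[ℝ] V.Fib m // ∀ v w, V.metric m (p v) (p w) = inner ℝ v w}

/-- The action of `O(n)` on orthonormal frames, `p ↦ p ∘ A`. -/
def OFrame.act {V : EucBundle.{u, v} M} {m : M} (p : OFrame k V m)
    (A : Euc k ≃ₗᵢ[ℝ] Euc k) : OFrame k V m :=
  ⟨A.toLinearEquiv.trans p.1, fun v w => by
    simpa using (p.2 (A v) (A w)).trans (A.inner_map_map v w)⟩

/-- The orthonormal frame bundle `P_O(V)`. -/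
def frameBundle (k : ℕ) {M : Type u} (V : EucBundle.{u, v} M) :
    BundleData.{u, v} (Euc k ≃ₗᵢ[ℝ] Euc k) M where
  Fib := OFrame k V
  act _ p A := p.act A
  smooth σ m := ∀ v : Euc k, V.smooth (fun m' => (σ m').1 v) m

open Classical in
/-- The grading of `O(n)`. -/
def orthDeg {k : ℕ} (A : Euc k ≃ₗᵢ[ℝ] Euc k) : ZMod 2 :=
  if 0 < LinearMap.det (A.toLinearEquiv : Euc k →ₗ[ℝ] Euc k) then 0 else 1

/-- The data of a spin-c structure on `V`: a grading of `P_O(V)`, a family `P` of sets with right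
action of `Pin_c(n)`, a grading of `P`, and a map `P → P_O(V)`. -/
structure SpinCData (k : ℕ) {M : Type u} (V : EucBundle.{u, v} M) where
  /-- the grading of the orthonormal frame bundle, that is, the orientation of `V` -/
  gradO : ∀ m, OFrame k V m → ZMod 2
  /-- the `Pin_c(n)`-bundle -/
  P : BundleData.{u, w} (PinC k) M
  /-- its grading -/
  grad : ∀ m, P.Fib m → ZMod 2
  /-- the map to the orthonormal frame bundle -/
  f : ∀ m, P.Fib m → OFrame k V m

/-- `S` is a spin-c structure on the Euclidean vector bundle `V`: `P` is a graded principal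
`Pin_c(n)`-bundle and `f : P → P_O(V)` is a map of graded bundles with `f(p a) = f(p) Ad_a`. -/
structure SpinCData.IsSpinC {V : EucBundle.{u, v} M} (S : SpinCData.{u, v, w} k V) : Prop where
  frame_principal : (frameBundle k V).IsPrincipal k
  frame_grading : (frameBundle k V).IsGrading orthDeg S.gradO
  principal : S.P.IsPrincipal k
  grading : S.P.IsGrading pinDeg S.grad
  map_act : ∀ m (p : S.P.Fib m) (a : PinC k), S.f m (S.P.act m p a) = (S.f m p).act (pinAd a)
  map_smooth : ∀ (σ : ∀ m, S.P.Fib m) (m : M), S.P.smooth σ m →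
    (frameBundle k V).smooth (fun m' => S.f m' (σ m')) m
  map_grading : ∀ m (p : S.P.Fib m), S.gradO m (S.f m p) = S.grad m p

/-- Isomorphism of spin-c structures on `V`: they have the same orientation, and there is an
isomorphism of the graded principal bundles over the identity of `P_O(V)`. -/
def SpinCData.Iso {V : EucBundle.{u, v} M} (S S' : SpinCData.{u, v, w} k V) : Prop :=
  S.gradO = S'.gradO ∧
  ∃ φ : ∀ m, S.P.Fib m ≃ S'.P.Fib m,
    (∀ m p a, φ m (S.P.act m p a) = S'.P.act m (φ m p) a) ∧
    (∀ (σ : ∀ m, S.P.Fib m) (m : M), S.P.smooth σ m ↔ S'.P.smooth (fun m' => φ m' (σ m')) m) ∧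
    (∀ m p, S'.grad m (φ m p) = S.grad m p) ∧
    (∀ m p, S'.f m (φ m p) = S.f m p)

/-- The fibre over `m` of the associated line bundle `P ×_det ℂ`. The class `[p, c]`, where
`[p a, c] = [p, det(a) c]`, is written as the function `u : P_m → ℂ` with `u(p a) = det(a)⁻¹ u(p)`
and `u(p) = c`. -/
def detLine (P : BundleData.{u, v} (PinC k) M) (m : M) : Submodule ℂ (P.Fib m → ℂ) where
  carrier := {u | ∀ p a, u (P.act m p a) = (pinDet a)⁻¹ * u p}
  add_mem' hu hv p a := by simp [hu p a, hv p a, mul_add]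
  zero_mem' p a := by simp
  smul_mem' c u hu p a := by simp [hu p a, mul_left_comm]

/-- A section of `P ×_det ℂ` is smooth near `m` if its components with respect to the smooth local
sections of `P` are. -/
def DetLineSmooth (P : BundleData.{u, v} (PinC k) M) (s : ∀ m, detLine P m) (m : M) : Prop :=
  ∀ σ : ∀ m, P.Fib m, P.smooth σ m → SmoothNear k (fun m' => (s m').1 (σ m')) m

/-- The complex line bundles `P ×_det ℂ` and `P' ×_det ℂ` are isomorphic. -/
def DetLineIso (P P' : BundleData.{u, v} (PinC k) M) : Prop :=
  ∃ L : ∀ m, detLine P m ≃ₗ[ℂ] detLine P' m,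
    ∀ (s : ∀ m, detLine P m) (m : M),
      DetLineSmooth P s m ↔ DetLineSmooth P' (fun m' => L m' (s m')) m

/-- The unit vector of `ℝⁿ` that represents `w / |w|` in the frame `p` (it is `0` if `w = 0`). -/
def OFrame.unitOf {V : EucBundle.{u, v} M} {m : M} (p : OFrame k V m) (w : V.Fib m) : Euc k :=
  ‖p.1.symm w‖⁻¹ • p.1.symm w

/-- The orthogonal reflection of `V_m` in the hyperplane perpendicular to `w`, as a gauge
transformation of the orthonormal frame bundle. -/
def reflGauge {V : EucBundle.{u, v} M} (w : ∀ m, V.Fib m) (m : M) (p : OFrame k V m) :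
    OFrame k V m :=
  p.act (Submodule.reflection (Submodule.span ℝ {p.unitOf (w m)})ᗮ)

/-- The gauge transformation `Γ w/|w|` of the bundle `P` of a spin-c structure, where `Γ` is the
chirality element. The element `c ∈ Pin_c(V_m)` acts by `p ↦ p · c_p`, where `c_p ∈ Pin_c(n)` is
the element that corresponds to `c` in the orthonormal frame `f(p)`. For `Γ` this is the
chirality element of `ℝⁿ` or its negative, according to the orientation of the frame. -/
def chiralGauge {V : EucBundle.{u, v} M} (S : SpinCData.{u, v, w} k V) (w : ∀ m, V.Fib m) (m : M)
    (p : S.P.Fib m) : S.P.Fib m :=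
  S.P.act m p ((if S.grad m p = 0 then 1 else pinScalar k (-1) (by simp)) * pinGamma k *
    pinVec ((S.f m p).unitOf (w m)))

end Bundles

/-! ## b-symplectic manifolds -/

section BGeometry

variable {k : ℕ} {M : Type u} [TopologicalSpace M] [ChartedSpace (Euc k) M]

/-- `y` is a defining function of `Z` on a neighbourhood of the point `z`. -/
def IsLocalDefining (Z : Set M) (y : M → ℝ) (z : M) : Prop :=
  (∀ᶠ m in 𝓝 z, ContMDiffAt (𝓡 (2 * k)) 𝓘(ℝ, ℝ) ∞ y m) ∧
  (∀ᶠ m in 𝓝 z, m ∈ Z ↔ y m = 0) ∧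
  mvfderiv (𝓡 (2 * k)) y z ≠ 0

/-- `Z` is a smooth closed embedded hypersurface. -/
def IsHypersurface (k : ℕ) {M : Type u} [TopologicalSpace M] [ChartedSpace (Euc k) M]
    (Z : Set M) : Prop :=
  IsClosed Z ∧ ∀ z ∈ Z, ∃ y : M → ℝ, IsLocalDefining (k := k) Z y z

/-- `x` is a global defining function of `Z`. -/
def IsGlobalDefining (k : ℕ) {M : Type u} [TopologicalSpace M] [ChartedSpace (Euc k) M]
    (Z : Set M) (x : M → ℝ) : Prop :=
  ContMDiff (𝓡 (2 * k)) 𝓘(ℝ, ℝ) ∞ x ∧ (∀ m, m ∈ Z ↔ x m = 0) ∧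
  ∀ z ∈ Z, mvfderiv (𝓡 (2 * k)) x z ≠ 0

variable [IsManifold (𝓡 (2 * k)) ∞ M]

/-- Smooth vector fields on `M`. -/
abbrev VField (k : ℕ) (M : Type u) [TopologicalSpace M] [ChartedSpace (Euc k) M]
    [IsManifold (𝓡 (2 * k)) ∞ M] : Type u :=
  Cₛ^∞⟮𝓡 (2 * k); Euc k, (TangentSpace (𝓡 (2 * k)) : M → Type)⟯

/-- The vector field `X` is smooth on a neighbourhood of `m`. -/
def VSmoothNear (X : ∀ m : M, TangentSpace (𝓡 (2 * k)) m) (m : M) : Prop :=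
  ∀ᶠ m' in 𝓝 m, ContMDiffAt (𝓡 (2 * k)) (𝓡 (2 * k)).tangent ∞
    (fun m => (⟨m, X m⟩ : TangentBundle (𝓡 (2 * k)) M)) m'

/-- The smooth vector fields on `M` that are tangent to `Z`. -/
def bFields (k : ℕ) {M : Type u} [TopologicalSpace M] [ChartedSpace (Euc k) M]
    [IsManifold (𝓡 (2 * k)) ∞ M] (Z : Set M) : Submodule ℝ (VField k M) where
  carrier := {X | ∀ z ∈ Z, ∀ y : M → ℝ, IsLocalDefining (k := k) Z y z →
    mvfderiv (𝓡 (2 * k)) y z (X z) = 0}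
  add_mem' hX hY z hz y hy := by simp [hX z hz y hy, hY z hz y hy]
  zero_mem' z hz y hy := by simp
  smul_mem' c X hX z hz y hy := by simp [hX z hz y hy]

/-- The span of the `f X`, where `X` is a vector field tangent to `Z` and `f` is a smooth function
with `f(m) = 0`. -/
def bVanishing (Z : Set M) (m : M) : Submodule ℝ (bFields k Z) :=
  Submodule.span ℝ {Y | ∃ (f : M → ℝ) (X : bFields k Z),
    ContMDiff (𝓡 (2 * k)) 𝓘(ℝ, ℝ) ∞ f ∧ f m = 0 ∧ ∀ m', Y.1 m' = f m' • X.1 m'}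

/-- The fibre at `m` of the b-tangent bundle, the vector bundle whose smooth sections are the
vector fields tangent to `Z`: the quotient of the module of these vector fields by its submodule of
sections that vanish at `m`. -/
abbrev BTangent (k : ℕ) {M : Type u} [TopologicalSpace M] [ChartedSpace (Euc k) M]
    [IsManifold (𝓡 (2 * k)) ∞ M] (Z : Set M) (m : M) : Type u :=
  bFields k Z ⧸ bVanishing (k := k) Z m

/-- The value at `m` of the section of the b-tangent bundle given by `X`. -/
def bval {Z : Set M} (X : bFields k Z) (m : M) : BTangent k Z m :=
  (bVanishing Z m).mkQ X

/-- Evaluation of vector fields at `m`. -/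
def evalAt (Z : Set M) (m : M) : bFields k Z →ₗ[ℝ] TangentSpace (𝓡 (2 * k)) m where
  toFun X := X.1 m
  map_add' X Y := by simp
  map_smul' c X := by simp

/-- The anchor map, from the b-tangent bundle to the tangent bundle. -/
def anchor (Z : Set M) (m : M) : BTangent k Z m →ₗ[ℝ] TangentSpace (𝓡 (2 * k)) m :=
  (bVanishing Z m).liftQ (evalAt Z m) (by
    rw [bVanishing, Submodule.span_le]
    rintro Y ⟨f, X, -, hf, hY⟩
    simp [evalAt, hY, hf])

/-- `e` is the value at `z ∈ Z` of the canonical section of the kernel of the anchor: it is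
represented by a vector field that near `z` is of the form `y Y`, where `y` is a defining
function of `Z` and `Y` is a smooth vector field with `Y y = 1`. -/
def IsCanonicalAt (Z : Set M) (z : M) (e : BTangent k Z z) : Prop :=
  ∃ (X : bFields k Z) (y : M → ℝ) (Y : ∀ m : M, TangentSpace (𝓡 (2 * k)) m),
    IsLocalDefining (k := k) Z y z ∧ VSmoothNear Y z ∧
    (∀ᶠ m in 𝓝 z, mvfderiv (𝓡 (2 * k)) y m (Y m) = 1) ∧
    (∀ᶠ m in 𝓝 z, X.1 m = y m • Y m) ∧ e = bval X z

/-- Families of bilinear forms on the fibres of the b-tangent bundle. -/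
abbrev BForm (k : ℕ) {M : Type u} [TopologicalSpace M] [ChartedSpace (Euc k) M]
    [IsManifold (𝓡 (2 * k)) ∞ M] (Z : Set M) : Type u :=
  ∀ m : M, BTangent k Z m →ₗ[ℝ] BTangent k Z m →ₗ[ℝ] ℝ

/-- `Ω` is a b-symplectic form: a smooth, closed, nondegenerate b-2-form. Closedness is
`dΩ(X, Y, W) = 0` for vector fields tangent to `Z`; their brackets are again tangent to `Z`. -/
structure IsBSymplectic (Z : Set M) (Ω : BForm k Z) : Prop where
  alternating : ∀ m u, Ω m u u = 0
  smooth : ∀ X Y : bFields k Z,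
    ContMDiff (𝓡 (2 * k)) 𝓘(ℝ, ℝ) ∞ fun m => Ω m (bval X m) (bval Y m)
  closed : ∀ X Y W XY YW WX : bFields k Z,
    (∀ m, XY.1 m = VectorField.mlieBracket (𝓡 (2 * k)) (fun m => X.1 m) (fun m => Y.1 m) m) →
    (∀ m, YW.1 m = VectorField.mlieBracket (𝓡 (2 * k)) (fun m => Y.1 m) (fun m => W.1 m) m) →
    (∀ m, WX.1 m = VectorField.mlieBracket (𝓡 (2 * k)) (fun m => W.1 m) (fun m => X.1 m) m) →
    ∀ m,
      mvfderiv (𝓡 (2 * k)) (fun m => Ω m (bval Y m) (bval W m)) m (X.1 m) +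
      mvfderiv (𝓡 (2 * k)) (fun m => Ω m (bval W m) (bval X m)) m (Y.1 m) +
      mvfderiv (𝓡 (2 * k)) (fun m => Ω m (bval X m) (bval Y m)) m (W.1 m) -
      Ω m (bval XY m) (bval W m) - Ω m (bval YW m) (bval X m) - Ω m (bval WX m) (bval Y m) = 0
  nondegenerate : ∀ m u, (∀ w, Ω m u w = 0) → u = 0

/-- Families of endomorphisms of the fibres of the b-tangent bundle. -/
abbrev BEnd (k : ℕ) {M : Type u} [TopologicalSpace M] [ChartedSpace (Euc k) M]
    [IsManifold (𝓡 (2 * k)) ∞ M] (Z : Set M) : Type u :=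
  ∀ m : M, BTangent k Z m →ₗ[ℝ] BTangent k Z m

/-- `J` is a smooth complex structure on the b-tangent bundle that is compatible with `Ω`. -/
structure IsCompatible {Z : Set M} (Ω : BForm k Z) (J : BEnd k Z) : Prop where
  sq : ∀ m u, J m (J m u) = -u
  invariant : ∀ m u w, Ω m (J m u) (J m w) = Ω m u w
  pos : ∀ m u, u ≠ 0 → 0 < Ω m u (J m u)
  smooth : ∀ X : bFields k Z, ∃ Y : bFields k Z, ∀ m, J m (bval X m) = bval Y m

/-- The b-tangent bundle with the metric `Ω(u, J w)`. -/
def bTangentEuc {Z : Set M} (Ω : BForm k Z) (J : BEnd k Z) : EucBundle.{u, u} M where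
  Fib := BTangent k Z
  metric m u w := Ω m u (J m w)
  smooth s m := ∃ X : bFields k Z, ∀ᶠ m' in 𝓝 m, s m' = bval X m'

/-- Unitary frames of the fibre at `m` of the b-tangent bundle: complex linear isometries from
`ℂᵏ = ℝⁿ`. -/
def UFrame {Z : Set M} (Ω : BForm k Z) (J : BEnd k Z) (m : M) : Type u :=
  {b : OFrame k (bTangentEuc Ω J) m // ∀ v, J m (b.1 v) = b.1 (stdJ k v)}

/-- The relation on `UFrame × Pin_c(n)` whose quotient is the bundle associated to the unitary frame
bundle by the homomorphism `U(k) → Spin_c(n)`: `(b ∘ Ad_c, a) ~ (b, c a)` for `c` in the image of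
this homomorphism. -/
def acRel {Z : Set M} (Ω : BForm k Z) (J : BEnd k Z) (m : M)
    (q q' : UFrame Ω J m × PinC k) : Prop :=
  ∃ c ∈ unitaryLift k, q.1.1 = q'.1.1.act (pinAd c) ∧ q'.2 = c * q.2

/-- The `Pin_c(n)`-bundle associated to the bundle of unitary frames of `(bTM, J)` by the canonical
homomorphism `U(k) → Spin_c(n) ⊆ Pin_c(n)`. -/
def acBundle {Z : Set M} (Ω : BForm k Z) (J : BEnd k Z) : BundleData.{u, u} (PinC k) M where
  Fib m := Quot (acRel Ω J m)
  act m p a := Quot.map (fun q => (q.1, q.2 * a))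
    (by
      rintro ⟨b, c⟩ ⟨b', c'⟩ ⟨d, hd, h1, h2⟩
      exact ⟨d, hd, h1, by simp only at h2 ⊢; rw [h2, mul_assoc]⟩) p
  smooth σ m := ∃ (b : ∀ m, UFrame Ω J m) (a : M → PinC k),
    (frameBundle k (bTangentEuc Ω J)).smooth (fun m' => (b m').1) m ∧ SmoothGroupNear k a m ∧
    ∀ᶠ m' in 𝓝 m, σ m' = Quot.mk _ (b m', a m')

/-- `b : ℝⁿ → bT_mM` is a symplectic frame, with the standard symplectic form `⟨J v, w⟩` on `ℝⁿ`. -/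
def IsSymplecticFrame {Z : Set M} (Ω : BForm k Z) (m : M) (b : Euc k ≃ₗ[ℝ] BTangent k Z m) :
    Prop :=
  ∀ v w, Ω m (b v) (b w) = inner ℝ (stdJ k v) w

open Classical in
/-- The symplectic orientation of the b-tangent bundle, as a grading of its orthonormal frame
bundle. -/
def sympGrad {Z : Set M} (Ω : BForm k Z) (J : BEnd k Z) (m : M)
    (p : OFrame k (bTangentEuc Ω J) m) : ZMod 2 :=
  if ∃ b : Euc k ≃ₗ[ℝ] BTangent k Z m, IsSymplecticFrame Ω m b ∧
    0 < LinearMap.det ((p.1.trans b.symm : Euc k ≃ₗ[ℝ] Euc k) : Euc k →ₗ[ℝ] Euc k)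
  then 0 else 1

/-- The spin-c structure on the b-tangent bundle that comes from the compatible complex structure
`J`: `f [b, a] = b ∘ Ad_a`. -/
def acSpinC {Z : Set M} (Ω : BForm k Z) (J : BEnd k Z) : SpinCData k (bTangentEuc Ω J) where
  gradO := sympGrad Ω J
  P := acBundle Ω J
  grad m := Quot.lift (fun q => pinDeg q.2) (by
    rintro ⟨b, c⟩ ⟨b', c'⟩ ⟨d, hd, h1, h2⟩
    simp only at h2 ⊢
    rw [h2, pinDeg_unitaryLift_mul hd])
  f m := Quot.lift (fun q => q.1.1.act (pinAd q.2)) (by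
    rintro ⟨b, c⟩ ⟨b', c'⟩ ⟨d, hd, h1, h2⟩
    simp only at h1 h2 ⊢
    rw [h1, h2]
    apply Subtype.ext
    apply LinearEquiv.ext
    intro v
    simp [OFrame.act, pinAd_mul])

/-- The vector field `W` tangent to `Z` represents a smooth section of the b-tangent bundle that
extends the canonical section along `Z`. -/
def ExtendsCanonical (Z : Set M) (W : bFields k Z) : Prop :=
  ∀ z ∈ Z, IsCanonicalAt Z z (bval W z)

/-! ## The clutched spin-c structure on the tangent bundle -/

/-- The orientation of `T_mM` in which the frame `q` is positive. -/
def frameOrientation {m : M} (q : Euc k ≃ₗ[ℝ] TangentSpace (𝓡 (2 * k)) m) :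
    Orientation ℝ (TangentSpace (𝓡 (2 * k)) m) (Fin (2 * k)) :=
  ((EuclideanSpace.basisFun (Fin (2 * k)) ℝ).toBasis.map q).orientation

/-- Orientations of the tangent spaces of `M`. -/
abbrev TOrientation (k : ℕ) (M : Type u) [TopologicalSpace M] [ChartedSpace (Euc k) M] : Type u :=
  ∀ m : M, Orientation ℝ (TangentSpace (𝓡 (2 * k)) m) (Fin (2 * k))

/-- `o` is an orientation of `M`: near each point it is given by a smooth local frame. -/
def IsOrientation (o : TOrientation k M) : Prop :=
  ∀ m : M, ∃ q : ∀ m' : M, Euc k ≃ₗ[ℝ] TangentSpace (𝓡 (2 * k)) m',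
    (∀ v, VSmoothNear (fun m' => q m' v) m) ∧ ∀ᶠ m' in 𝓝 m, frameOrientation (q m') = o m'

/-- The anchor at `m` is an orientation preserving isomorphism, for the symplectic orientation of
the b-tangent bundle. -/
def AnchorPreserves {Z : Set M} (Ω : BForm k Z) (o : TOrientation k M) (m : M) : Prop :=
  ∃ (b : Euc k ≃ₗ[ℝ] BTangent k Z m) (q : Euc k ≃ₗ[ℝ] TangentSpace (𝓡 (2 * k)) m),
    IsSymplecticFrame Ω m b ∧ (∀ v, q v = anchor Z m (b v)) ∧ frameOrientation q = o m

/-- `x` is a global defining function of `Z` in the class determined by the orientations of `TM` and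
of the b-tangent bundle: the anchor preserves orientations where `x > 0` and reverses them where
`x < 0`. -/
def IsOrientedDefining {Z : Set M} (Ω : BForm k Z) (o : TOrientation k M) (x : M → ℝ) : Prop :=
  IsGlobalDefining k Z x ∧ ∀ m ∉ Z, 0 < x m ↔ AnchorPreserves Ω o m

/-- Smooth Riemannian metrics on `M`. -/
abbrev RMetric (k : ℕ) (M : Type u) [TopologicalSpace M] [ChartedSpace (Euc k) M]
    [IsManifold (𝓡 (2 * k)) ∞ M] : Type u :=
  Bundle.ContMDiffRiemannianMetric (𝓡 (2 * k)) ∞ (Euc k)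
    (TangentSpace (𝓡 (2 * k)) : M → Type)

/-- The tangent bundle with a Riemannian metric. -/
def tangentEuc (g : RMetric k M) : EucBundle.{u, 0} M where
  Fib m := TangentSpace (𝓡 (2 * k)) m
  metric m v w := g.inner m v w
  smooth s m := VSmoothNear s m

/-- The tangent vector `q v`, for an orthonormal frame `q` of `T_mM`. -/
def tangentFrame {g : RMetric k M} {m : M} (q : OFrame k (tangentEuc g) m) (v : Euc k) :
    TangentSpace (𝓡 (2 * k)) m := q.1 v

/-- `φ` is an identification of `P_O(TM)` with the surgery of `P_O(bTM)` along `Z` using the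
reflection `r` in the hyperplane perpendicular to the canonical section, and it is a deformation of
the anchor: if `Φ_m : bT_mM → T_mM` denotes the linear map with `φ(p) = Φ_m ∘ p`, then
`Φ_m + s · anchor` is an isomorphism for all `s ≥ 0`, and along `Z` (where the fibre of the surgery
is the one on the side of `{x ≥ 0}`) the map `Φ` sends the canonical section to vectors that point
into `{x ≥ 0}`. These two conditions determine `Φ` up to homotopy. -/
structure IsFrameClutching {Z : Set M} (Ω : BForm k Z) (J : BEnd k Z) (W : bFields k Z)
    (x : M → ℝ) (g : RMetric k M)
    (φ : ∀ m, OFrame k (bTangentEuc Ω J) m → OFrame k (tangentEuc g) m) : Prop where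
  map_act : ∀ m p (A : Euc k ≃ₗᵢ[ℝ] Euc k), φ m (p.act A) = (φ m p).act A
  map_smooth : ∀ (σ : ∀ m, OFrame k (bTangentEuc Ω J) m) (m : M),
    ((frameBundle k (bTangentEuc Ω J)).surgery x
      (reflGauge (V := bTangentEuc Ω J) (bval W))).smooth σ m →
    (frameBundle k (tangentEuc g)).smooth (fun m' => φ m' (σ m')) m
  deformation : ∀ (m : M) (p : OFrame k (bTangentEuc Ω J) m) (s : ℝ), 0 ≤ s →
    Function.Injective fun v : Euc k =>
      tangentFrame (φ m p) v + s • anchor Z m (p.1 v)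
  inward : ∀ z ∈ Z, ∀ p : OFrame k (bTangentEuc Ω J) z,
    0 < mvfderiv (𝓡 (2 * k)) x z (tangentFrame (φ z p) (p.1.symm (bval W z)))

open Classical in
/-- The clutched data on `TM`: the bundle is the surgery of the `Pin_c(n)`-bundle of `(bTM, J)`
along `Z` using the gauge transformation `Γ e/|e|`, with the grading reversed over `{x < 0}`; the
map to the orthonormal frames of `TM` is the composition of
`f : P_J → P_O(bTM)` (after surgery on both sides) with `φ : P_O(bTM)^r → P_O(TM)`; and the grading
of `P_O(TM)` is given by the orientation `o`. -/
def clutchedSpinC {Z : Set M} (Ω : BForm k Z) (o : TOrientation k M) (J : BEnd k Z)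
    (W : bFields k Z) (x : M → ℝ) (g : RMetric k M)
    (φ : ∀ m, OFrame k (bTangentEuc Ω J) m → OFrame k (tangentEuc g) m) :
    SpinCData.{u, 0, u} k (tangentEuc g) where
  gradO m q := if frameOrientation q.1 = o m then 0 else 1
  P := (acBundle Ω J).surgery x (chiralGauge (acSpinC Ω J) (bval W))
  grad := surgeryGrading x (acSpinC Ω J).grad
  f m p := φ m ((acSpinC Ω J).f m p)

/-- The auxiliary choices in the clutching construction are admissible: a global defining function
`x` in the class given by the orientations, a compatible complex structure `J`, a smooth extension
`W` of the canonical section, and an identification `φ` of `P_O(bTM)^r` with `P_O(TM)`. -/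
structure IsClutchingChoice {Z : Set M} (Ω : BForm k Z) (o : TOrientation k M) (J : BEnd k Z)
    (W : bFields k Z) (x : M → ℝ) (g : RMetric k M)
    (φ : ∀ m, OFrame k (bTangentEuc Ω J) m → OFrame k (tangentEuc g) m) : Prop where
  defining : IsOrientedDefining Ω o x
  compatible : IsCompatible Ω J
  canonical : ExtendsCanonical Z W
  clutching : IsFrameClutching Ω J W x g φ

end BGeometry

end

open Filter
open Function (Injective)
open EuclideanSpace (single basisFun)
open CliffordAlgebra (involute reverse)
open ContinuousLinearMap (adjoint adjoint_inner_left)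
open LinearEquiv (apply_symm_apply)
open Submodule (span)

noncomputable section

local notation:max "T[" k "]" => TangentSpace (𝓡 (2 * k))
local notation:max "∂[" k "]" => mvfderiv (𝓡 (2 * k))
local notation:max "E[" k "]" => Euc k →L[ℝ] Euc k
local notation:max "O[" k "]" => Euc k ≃ₗᵢ[ℝ] Euc k
local notation:max "det[" f "]" => LinearMap.det (LinearEquiv.toLinearMap f)

/-! ## Inverse square roots of positive definite operators -/

section InvSqrt

variable {E : Type*} [NormedAddCommGroup E] [InnerProductSpace ℝ E]

theorem clm_mul_apply (A B : E →L[ℝ] E) (v : E) : (A * B) v = A (B v) := rfl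

/-- Symmetric positive definite operators. -/
structure IsPD (P : E →L[ℝ] E) : Prop where
  symm : ∀ u v, inner ℝ (P u) v = inner ℝ u (P v)
  pos : ∀ v, v ≠ 0 → 0 < inner ℝ v (P v)

theorem IsPD.one : IsPD (1 : E →L[ℝ] E) := ⟨fun u v => by simp, fun v hv => by
    have : 0 < ‖v‖ := norm_pos_iff.mpr hv
    simp only [ContinuousLinearMap.one_apply, real_inner_self_eq_norm_sq]
    positivity⟩

theorem IsPD.nonneg {P : E →L[ℝ] E} (hP : IsPD P) (v : E) : 0 ≤ inner ℝ v (P v) := by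
  by_cases hv : v = 0
  · simp [hv]
  · exact (hP.pos v hv).le

theorem IsPD.injective {P : E →L[ℝ] E} (hP : IsPD P) : Injective P := by
  rw [injective_iff_map_eq_zero]
  intro v hv
  by_contra h
  have := hP.pos v h
  simp [hv] at this

theorem IsPD.inv {S R : E →L[ℝ] E} (hS : IsPD S) (h : S * R = 1) : IsPD R := by
  have hSR : ∀ v, S (R v) = v := fun v => congrArg (fun T : E →L[ℝ] E => T v) h
  have hpos : ∀ v, v ≠ 0 → 0 < inner ℝ v (R v) := fun v hv => by
    have h0 : R v ≠ 0 := fun h0 => hv (by rw [← hSR v, h0, map_zero])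
    have := hS.pos _ h0
    rwa [hSR, real_inner_comm] at this
  refine ⟨fun u v => ?_, hpos⟩
  conv_rhs => rw [← hSR u]
  rw [hS.symm, hSR]

variable [FiniteDimensional ℝ E]

theorem isUnit_of_injective {P : E →L[ℝ] E} (hP : Injective P) : IsUnit P := by
  have h1 : Function.Bijective P.toLinearMap := ⟨hP, LinearMap.injective_iff_surjective.mp hP⟩
  let e : E ≃ₗ[ℝ] E := LinearEquiv.ofBijective P.toLinearMap h1
  refine ⟨⟨P, (e.symm : E →ₗ[ℝ] E).toContinuousLinearMap, ?_, ?_⟩, rfl⟩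
  · ext v
    exact e.apply_symm_apply v
  · ext v
    exact e.symm_apply_apply v

theorem IsPD.isUnit {P : E →L[ℝ] E} (hP : IsPD P) : IsUnit P := isUnit_of_injective hP.injective

theorem IsPD.exists_eigenbasis {P : E →L[ℝ] E} (hP : IsPD P) :
    ∃ (b : OrthonormalBasis (Fin (Module.finrank ℝ E)) ℝ E) (μ : Fin (Module.finrank ℝ E) → ℝ),
      (∀ i, 0 < μ i) ∧ ∀ i, P (b i) = μ i • b i := by
  have hs : P.toLinearMap.IsSymmetric := hP.symm
  refine ⟨hs.eigenvectorBasis rfl, hs.eigenvalues rfl, fun i => ?_, fun i => ?_⟩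
  · have h := hs.apply_eigenvectorBasis rfl i
    have h2 := hP.pos (hs.eigenvectorBasis rfl i) (by
      intro h0
      have := (hs.eigenvectorBasis rfl).orthonormal.1 i
      rw [h0] at this; simp at this)
    have h3 : P (hs.eigenvectorBasis rfl i) = _ := h
    rw [h3, inner_smul_right, real_inner_self_eq_norm_sq,
      (hs.eigenvectorBasis rfl).orthonormal.1 i] at h2
    simpa using h2
  · exact hs.apply_eigenvectorBasis rfl i

theorem IsPD.sylvester {A B H : E →L[ℝ] E} (hA : IsPD A) (hB : IsPD B)
    (h : A * H + H * B = 0) : H = 0 := by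
  obtain ⟨b, μ, hμ, hb⟩ := hB.exists_eigenbasis
  have key : ∀ i, H (b i) = 0 := fun i => by
    by_contra h0
    have h1 := hA.pos _ h0
    have h2 : A (H (b i)) = -(μ i • H (b i)) := by
      have := congrArg (fun T : E →L[ℝ] E => T (b i)) h
      simp only [add_apply, clm_mul_apply, hb, map_smul, zero_apply] at this
      exact eq_neg_of_add_eq_zero_left this
    rw [h2, inner_neg_right, inner_smul_right, real_inner_self_eq_norm_sq] at h1
    have := mul_nonneg (hμ i).le (sq_nonneg ‖H (b i)‖)
    linarith
  have : H.toLinearMap = 0 := b.toBasis.ext fun i => by simpa using key i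
  ext v
  exact congrArg (fun T : E →ₗ[ℝ] E => T v) this

theorem IsPD.sq_inj {A B : E →L[ℝ] E} (hA : IsPD A) (hB : IsPD B) (h : A * A = B * B) : A = B := by
  refine sub_eq_zero.mp (hA.sylvester hB ?_)
  rw [mul_sub, sub_mul, h]
  abel

theorem IsPD.exists_sqrt {P : E →L[ℝ] E} (hP : IsPD P) : ∃ S, IsPD S ∧ S * S = P := by
  obtain ⟨b, μ, hμ, hb⟩ := hP.exists_eigenbasis
  let S : E →L[ℝ] E := (b.toBasis.constr ℝ fun i => √(μ i) • b i).toContinuousLinearMap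
  have hS : ∀ i, S (b i) = √(μ i) • b i := fun i => by
    have := b.toBasis.constr_basis ℝ (fun i => √(μ i) • b i) i
    simpa [S] using this
  have hSv : ∀ v, S v = ∑ i, (√(μ i) * inner ℝ (b i) v) • b i := fun v => by
    conv_lhs => rw [← b.sum_repr' v]
    rw [map_sum]
    refine Finset.sum_congr rfl fun i _ => ?_
    rw [map_smul, hS, smul_smul, mul_comm]
  have hin : ∀ u v, inner ℝ u (S v) = ∑ i, √(μ i) * (inner ℝ (b i) u * inner ℝ (b i) v) :=
    fun u v => by
      rw [hSv, inner_sum]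
      refine Finset.sum_congr rfl fun i _ => ?_
      rw [inner_smul_right, real_inner_comm (b i) u]; ring
  refine ⟨S, ⟨fun u v => ?_, fun v hv => ?_⟩, ?_⟩
  · rw [real_inner_comm, hin, hin]
    exact Finset.sum_congr rfl fun i _ => by ring
  · rw [hin]
    have hnn : ∀ i ∈ Finset.univ, 0 ≤ √(μ i) * (inner ℝ (b i) v * inner ℝ (b i) v) :=
      fun i _ => mul_nonneg (Real.sqrt_nonneg _) (mul_self_nonneg _)
    refine lt_of_le_of_ne (Finset.sum_nonneg hnn) fun h0 => hv ?_
    have h1 := (Finset.sum_eq_zero_iff_of_nonneg hnn).mp h0.symm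
    rw [← b.sum_repr' v]
    refine Finset.sum_eq_zero fun i hi => ?_
    have h2 := h1 i hi
    have h3 : inner ℝ (b i) v = 0 := by
      rcases mul_eq_zero.mp h2 with h | h
      · exact absurd h (Real.sqrt_pos.mpr (hμ i)).ne'
      · exact mul_self_eq_zero.mp h
    rw [h3, zero_smul]
  · have : (S * S).toLinearMap = P.toLinearMap := b.toBasis.ext fun i => by
      simp [hS, hb, smul_smul, Real.mul_self_sqrt (hμ i).le]
    ext v
    exact congrArg (fun T : E →ₗ[ℝ] E => T v) this

open Classical in
def sqrtPD (P : E →L[ℝ] E) : E →L[ℝ] E := if h : IsPD P then h.exists_sqrt.choose else 0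

theorem IsPD.sqrtPD {P : E →L[ℝ] E} (hP : IsPD P) : IsPD (sqrtPD P) := by
  rw [_root_.sqrtPD, dif_pos hP]; exact hP.exists_sqrt.choose_spec.1

theorem IsPD.sqrtPD_sq {P : E →L[ℝ] E} (hP : IsPD P) : _root_.sqrtPD P * _root_.sqrtPD P = P := by
  rw [_root_.sqrtPD, dif_pos hP]; exact hP.exists_sqrt.choose_spec.2

theorem IsPD.sqrtPD_eq {P S : E →L[ℝ] E} (hP : IsPD P) (hS : IsPD S) (h : S * S = P) :
    _root_.sqrtPD P = S := hP.sqrtPD.sq_inj hS (by rw [hP.sqrtPD_sq, h])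

theorem IsPD.sqrtPD_comm {P X : E →L[ℝ] E} (hP : IsPD P) (h : X * P = P * X) :
    X * _root_.sqrtPD P = _root_.sqrtPD P * X := by
  refine sub_eq_zero.mp (hP.sqrtPD.sylvester hP.sqrtPD ?_)
  set S := _root_.sqrtPD P
  have hS : S * S = P := hP.sqrtPD_sq
  calc S * (X * S - S * X) + (X * S - S * X) * S = X * (S * S) - (S * S) * X := by noncomm_ring
    _ = 0 := by rw [hS, h, sub_self]

/-- `P ↦ P ^ (-1/2)`. -/
def invSqrt (P : E →L[ℝ] E) : E →L[ℝ] E := Ring.inverse (_root_.sqrtPD P)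

theorem IsPD.invSqrt_mul_sqrt {P : E →L[ℝ] E} (hP : IsPD P) : invSqrt P * _root_.sqrtPD P = 1 :=
  Ring.inverse_mul_cancel _ hP.sqrtPD.isUnit

theorem IsPD.sqrt_mul_invSqrt {P : E →L[ℝ] E} (hP : IsPD P) : _root_.sqrtPD P * invSqrt P = 1 :=
  Ring.mul_inverse_cancel _ hP.sqrtPD.isUnit

theorem IsPD.invSqrt {P : E →L[ℝ] E} (hP : IsPD P) : IsPD (invSqrt P) :=
  hP.sqrtPD.inv hP.sqrt_mul_invSqrt

theorem IsPD.invSqrt_comm {P X : E →L[ℝ] E} (hP : IsPD P) (h : X * P = P * X) :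
    X * _root_.invSqrt P = _root_.invSqrt P * X := by
  have h1 := hP.sqrtPD_comm h
  calc X * _root_.invSqrt P
      = _root_.invSqrt P * (_root_.sqrtPD P * X) * _root_.invSqrt P := by
        rw [← mul_assoc, hP.invSqrt_mul_sqrt, one_mul]
    _ = _root_.invSqrt P * X := by
        rw [← h1, mul_assoc, mul_assoc, hP.sqrt_mul_invSqrt, mul_one]

theorem IsPD.invSqrt_mul_self {P : E →L[ℝ] E} (hP : IsPD P) :
    _root_.invSqrt P * P * _root_.invSqrt P = 1 := by
  conv_lhs => enter [1, 2]; rw [← hP.sqrtPD_sq]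
  rw [← mul_assoc, hP.invSqrt_mul_sqrt, one_mul, hP.sqrt_mul_invSqrt]

theorem invSqrt_one : invSqrt (1 : E →L[ℝ] E) = 1 := by
  rw [invSqrt, IsPD.one.sqrtPD_eq IsPD.one (one_mul 1), Ring.inverse_one]

theorem IsPD.invSqrt_eq {P R : E →L[ℝ] E} (hP : IsPD P) (hR : IsPD R) (h : R * P * R = 1) :
    _root_.invSqrt P = R := by
  obtain ⟨u, rfl⟩ := hR.isUnit
  have h1 : P = (↑u⁻¹ : E →L[ℝ] E) * ↑u⁻¹ := by
    have h2 : (u : E →L[ℝ] E) * P = ↑u⁻¹ := (Units.mul_eq_one_iff_eq_inv).mp h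
    calc P = ↑u⁻¹ * (↑u * P) := by rw [← mul_assoc, Units.inv_mul, one_mul]
      _ = _ := by rw [h2]
  rw [_root_.invSqrt, hP.sqrtPD_eq (hR.inv u.mul_inv) h1.symm, Ring.inverse_unit, inv_inv]

theorem IsPD.conj {P : E →L[ℝ] E} (hP : IsPD P) {U V : E →L[ℝ] E}
    (hUV : ∀ u v, inner ℝ (U u) v = inner ℝ u (V v)) (hU : Injective U) :
    IsPD (V * P * U) := by
  have hVU : ∀ u v, inner ℝ u (U v) = inner ℝ (V u) v := fun u v => by
    rw [real_inner_comm, hUV, real_inner_comm]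
  refine ⟨fun u v => ?_, fun v hv => ?_⟩
  · simp only [clm_mul_apply]
    rw [← hVU, hP.symm, hUV]
  · simp only [clm_mul_apply]
    rw [← hUV]
    exact hP.pos _ fun h => hv (hU (by rw [h, map_zero]))

theorem IsPD.invSqrt_conj {P : E →L[ℝ] E} (hP : IsPD P) {U V : E →L[ℝ] E}
    (hUV : ∀ u v, inner ℝ (U u) v = inner ℝ u (V v)) (h1 : V * U = 1) (h2 : U * V = 1) :
    _root_.invSqrt (V * P * U) = V * _root_.invSqrt P * U := by
  have hU : Injective U := Function.LeftInverse.injective (g := V) fun v =>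
    congrArg (fun T : E →L[ℝ] E => T v) h1
  refine (hP.conj hUV hU).invSqrt_eq (hP.invSqrt.conj hUV hU) ?_
  calc V * _root_.invSqrt P * U * (V * P * U) * (V * _root_.invSqrt P * U)
      = V * _root_.invSqrt P * (U * V) * P * (U * V) * _root_.invSqrt P * U := by
        simp only [mul_assoc]
    _ = V * (_root_.invSqrt P * P * _root_.invSqrt P) * U := by
        rw [h2]; simp only [mul_one, mul_assoc]
    _ = 1 := by rw [hP.invSqrt_mul_self, mul_one, h1]

theorem IsPD.exists_bound {P : E →L[ℝ] E} (hP : IsPD P) :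
    ∃ c > 0, ∀ v, c * ‖v‖ ^ 2 ≤ inner ℝ v (P v) := by
  obtain ⟨R, hR⟩ := hP.sqrtPD.isUnit
  refine ⟨(‖(↑R⁻¹ : E →L[ℝ] E)‖ ^ 2 + 1)⁻¹, by positivity, fun v => ?_⟩
  have h1 : inner ℝ v (P v) = ‖_root_.sqrtPD P v‖ ^ 2 := by
    conv_lhs => rw [← hP.sqrtPD_sq]
    rw [clm_mul_apply, ← hP.sqrtPD.symm, real_inner_self_eq_norm_sq]
  have h2 : v = (↑R⁻¹ : E →L[ℝ] E) (_root_.sqrtPD P v) := by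
    rw [← hR]
    exact (congrArg (fun T : E →L[ℝ] E => T v) R.inv_mul).symm
  rw [h1, inv_mul_le_iff₀ (by positivity)]
  calc ‖v‖ ^ 2 ≤ (‖(↑R⁻¹ : E →L[ℝ] E)‖ * ‖_root_.sqrtPD P v‖) ^ 2 := by
        gcongr
        conv_lhs => rw [h2]
        exact ContinuousLinearMap.le_opNorm _ _
    _ ≤ _ := by rw [mul_pow]; nlinarith [sq_nonneg ‖_root_.sqrtPD P v‖]

theorem IsPD.eventually {P : E →L[ℝ] E} (hP : IsPD P) :
    ∀ᶠ Q in 𝓝 P, (∀ u v, inner ℝ (Q u) v = inner ℝ u (Q v)) → IsPD Q := by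
  obtain ⟨c, hc, h⟩ := hP.exists_bound
  filter_upwards [Metric.ball_mem_nhds P hc] with Q hQ hs
  refine ⟨hs, fun v hv => ?_⟩
  have h1 : |inner ℝ v ((P - Q) v)| ≤ ‖P - Q‖ * ‖v‖ ^ 2 := by
    calc _ ≤ ‖v‖ * ‖(P - Q) v‖ := abs_real_inner_le_norm _ _
      _ ≤ ‖v‖ * (‖P - Q‖ * ‖v‖) := by gcongr; exact ContinuousLinearMap.le_opNorm _ _
      _ = _ := by ring
  have h2 : ‖P - Q‖ < c := by rwa [← dist_eq_norm, dist_comm]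
  have h3 : inner ℝ v ((P - Q) v) = inner ℝ v (P v) - inner ℝ v (Q v) := by
    rw [sub_apply, inner_sub_right]
  have h4 : 0 < ‖v‖ ^ 2 := by positivity
  have h5 := h v
  have h6 := (abs_le.mp h1).2
  nlinarith

theorem IsPD.invSqrt_smooth {P : E →L[ℝ] E} (hP : IsPD P) :
    ∃ G : (E →L[ℝ] E) → (E →L[ℝ] E), ContDiffAt ℝ ∞ G P ∧
      ∀ᶠ Q in 𝓝 P, IsPD Q → _root_.invSqrt Q = G Q := by
  haveI := FiniteDimensional.complete ℝ E
  set S := _root_.sqrtPD P with hSdef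
  have hS : IsPD S := hP.sqrtPD
  have hSS : S * S = P := hP.sqrtPD_sq
  let f : (E →L[ℝ] E) → (E →L[ℝ] E) := fun X => X * X
  have hf : ContDiff ℝ ∞ f := contDiff_id.mul contDiff_id
  let D : (E →L[ℝ] E) →L[ℝ] (E →L[ℝ] E) :=
    S • ContinuousLinearMap.id ℝ (E →L[ℝ] E) + MulOpposite.op S • ContinuousLinearMap.id ℝ (E →L[ℝ] E)
  have hD : HasFDerivAt f D S := (hasFDerivAt_id S).mul' (hasFDerivAt_id S)
  have hDi : Injective D := by
    rw [injective_iff_map_eq_zero]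
    intro H hH
    exact hS.sylvester hS (by simpa [D] using hH)
  let e : (E →L[ℝ] E) ≃L[ℝ] (E →L[ℝ] E) :=
    (LinearEquiv.ofInjectiveEndo D.toLinearMap hDi).toContinuousLinearEquiv
  have he : HasFDerivAt f (e : (E →L[ℝ] E) →L[ℝ] (E →L[ℝ] E)) S := by
    have hec : (e : (E →L[ℝ] E) →L[ℝ] (E →L[ℝ] E)) = D := by ext H; rfl
    rw [hec]; exact hD
  have hfS : ContDiffAt ℝ ∞ f S := hf.contDiffAt
  have hn : (∞ : WithTop ℕ∞) ≠ 0 := by simp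
  have hg := hfS.to_localInverse he hn
  have hstrict : HasStrictFDerivAt f (e : (E →L[ℝ] E) →L[ℝ] (E →L[ℝ] E)) S :=
    hfS.hasStrictFDerivAt' he hn
  set g := hfS.localInverse he hn with hgdef
  have hfP : f S = P := hSS
  rw [hfP] at hg
  have hgP : g P = S := by
    rw [← hfP]
    exact hstrict.localInverse_apply_image
  have hgc : Filter.Tendsto g (𝓝 P) (𝓝 S) := by
    have := hg.continuousAt.tendsto
    rwa [hgP] at this
  have hright : ∀ᶠ Q in 𝓝 P, g Q * g Q = Q := by
    have := hstrict.eventually_right_inverse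
    rw [hfP] at this
    exact this
  have hadj : adjoint S = S := ((ContinuousLinearMap.eq_adjoint_iff S S).mpr hS.symm).symm
  have hinj' : ∃ U ∈ 𝓝 S, ∀ X ∈ U, ∀ Y ∈ U, f X = f Y → X = Y := by
    have hsrc := hstrict.mem_toOpenPartialHomeomorph_source
    exact ⟨_, (hstrict.toOpenPartialHomeomorph f).open_source.mem_nhds hsrc,
      fun X hX Y hY h => (hstrict.toOpenPartialHomeomorph f).injOn hX hY h⟩
  obtain ⟨U, hU, hUinj⟩ := hinj'
  have hadjc : Filter.Tendsto (fun Q => adjoint (g Q)) (𝓝 P) (𝓝 S) := by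
    have h1 : Continuous fun X : E →L[ℝ] E => adjoint X := ContinuousLinearMap.adjoint.continuous
    have := (h1.tendsto S).comp hgc
    rwa [hadj] at this
  refine ⟨fun Q => Ring.inverse (g Q), ?_, ?_⟩
  · obtain ⟨s, hs⟩ := hS.isUnit
    have h1 : ContDiffAt ℝ ∞ Ring.inverse (g P) := by
      rw [hgP, ← hs]
      exact contDiffAt_ringInverse ℝ s
    exact h1.comp P hg
  · filter_upwards [hright, hgc hU, hadjc hU, hgc hS.eventually] with Q h1 h2 h3 h4 hQ
    have h5 : adjoint (g Q) = g Q := by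
      refine hUinj _ h3 _ h2 ?_
      change adjoint (g Q) * adjoint (g Q) = g Q * g Q
      have h6 : adjoint (g Q * g Q) = adjoint (g Q) * adjoint (g Q) :=
        ContinuousLinearMap.adjoint_comp _ _
      rw [← h6, h1]
      exact ((ContinuousLinearMap.eq_adjoint_iff Q Q).mpr hQ.symm).symm
    have h7 : IsPD (g Q) := h4 ((ContinuousLinearMap.eq_adjoint_iff _ _).mp h5.symm)
    rw [_root_.invSqrt, hQ.sqrtPD_eq h7 h1]

theorem det_mul_det_pos {A B : E →ₗ[ℝ] E}
    (h : ∀ t ∈ Set.Icc (0 : ℝ) 1, Injective (((1 - t) • A + t • B : E →ₗ[ℝ] E))) :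
    0 < LinearMap.det A * LinearMap.det B := by
  let b := Module.finBasis ℝ E
  let f : ℝ → ℝ := fun t => LinearMap.det ((1 - t) • A + t • B)
  have hf : Continuous f := by
    have : f = fun t => ((1 - t) • LinearMap.toMatrix b b A +
        t • LinearMap.toMatrix b b B).det := by
      ext t
      rw [← map_smul, ← map_smul, ← map_add, LinearMap.det_toMatrix]
    rw [this]
    exact Continuous.matrix_det (by fun_prop)
  have hne : ∀ t ∈ Set.Icc (0 : ℝ) 1, f t ≠ 0 := fun t ht h0 => by
    have h1 := LinearMap.bot_lt_ker_of_det_eq_zero h0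
    rw [LinearMap.ker_eq_bot.mpr (h t ht)] at h1
    exact lt_irrefl _ h1
  have h0 : f 0 = LinearMap.det A := by simp [f]
  have h1 : f 1 = LinearMap.det B := by simp [f]
  rw [← h0, ← h1]
  have n0 := hne 0 (by simp)
  have n1 := hne 1 (by simp)
  by_contra hle
  have hlt : f 0 * f 1 < 0 := lt_of_le_of_ne (not_lt.mp hle) (mul_ne_zero n0 n1)
  rcases mul_neg_iff.mp hlt with ⟨ha, hb⟩ | ⟨ha, hb⟩
  · obtain ⟨t, ht, h2⟩ := intermediate_value_Icc' zero_le_one hf.continuousOn ⟨hb.le, ha.le⟩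
    exact hne t ht h2
  · obtain ⟨t, ht, h2⟩ := intermediate_value_Icc zero_le_one hf.continuousOn ⟨ha.le, hb.le⟩
    exact hne t ht h2

end InvSqrt

/-! ## The trace of the Clifford algebra -/

section CliffordTrace

variable {k : ℕ}

instance : Module.Finite ℂ (CCl k) :=
  haveI : Module.Finite ℂ (ExteriorAlgebra ℂ (Fin (2 * k) → ℂ)) :=
    Module.Finite.of_basis (Pi.basisFun ℂ (Fin (2 * k))).ExteriorAlgebra
  Module.Finite.equiv (CliffordAlgebra.equivExterior (cliffordForm k)).symm

def cE (i : Fin (2 * k)) : CCl k := cvec (single i (1 : ℝ))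

theorem cE_sq (i : Fin (2 * k)) : cE i * cE i = -1 := by
  rw [cE, cvec_mul_self]; simp

theorem cE_anti {i j : Fin (2 * k)} (h : i ≠ j) : cE i * cE j = -(cE j * cE i) := by
  have := cvec_mul_add_swap (k := k) (single i (1 : ℝ)) (single j 1)
  rw [EuclideanSpace.inner_single_left] at this
  simp [h] at this
  exact eq_neg_of_add_eq_zero_left this

theorem ι_eq_sum (v : Fin (2 * k) → ℂ) :
    CliffordAlgebra.ι (cliffordForm k) v = ∑ i, v i • cE i := by
  have : v = ∑ i, v i • (Pi.single i (1 : ℂ) : Fin (2 * k) → ℂ) := by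
    ext j; simp [Finset.sum_apply, Pi.single_apply]
  conv_lhs => rw [this]
  rw [map_sum]
  refine Finset.sum_congr rfl fun i _ => ?_
  rw [map_smul, cE, cvec]
  congr 2
  ext j
  by_cases h : j = i
  · subst h; simp
  · simp [h]

theorem cvec_eq_sum (v : Euc k) : cvec v = ∑ i, (v i : ℂ) • cE i := ι_eq_sum _

def conjE (i : Fin (2 * k)) : Module.End ℂ (CCl k) :=
  -(LinearMap.mulLeft ℂ (cE i) * LinearMap.mulRight ℂ (cE i))

theorem conjE_apply (i : Fin (2 * k)) (z : CCl k) : conjE i z = -(cE i * z * cE i) := by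
  simp [conjE, mul_assoc]

theorem conjE_sq (i : Fin (2 * k)) : conjE i * conjE i = 1 := by
  ext1 z
  simp only [Module.End.mul_apply, conjE_apply, Module.End.one_apply]
  calc -(cE i * -(cE i * z * cE i) * cE i) = (cE i * cE i) * z * (cE i * cE i) := by noncomm_ring
    _ = z := by rw [cE_sq]; simp

theorem conjE_comm (i j : Fin (2 * k)) : Commute (conjE i) (conjE j) := by
  by_cases h : i = j
  · subst h; exact Commute.refl _
  ext1 z
  simp only [Module.End.mul_apply, conjE_apply]
  calc -(cE i * -(cE j * z * cE j) * cE i) = (cE i * cE j) * z * (cE j * cE i) := by noncomm_ring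
    _ = (cE j * cE i) * z * (cE i * cE j) := by
      rw [cE_anti h, cE_anti (Ne.symm h)]; simp
    _ = _ := by noncomm_ring

/-- The projection to the commutant of a standard generator. -/
def projE (i : Fin (2 * k)) : Module.End ℂ (CCl k) := (1 / 2 : ℂ) • (1 + conjE i)

theorem projE_mul_conjE (i : Fin (2 * k)) : projE i * conjE i = projE i := by
  rw [projE, smul_mul_assoc, add_mul, one_mul, conjE_sq, add_comm]

def projList (l : List (Fin (2 * k))) : Module.End ℂ (CCl k) := (l.map projE).prod

theorem projList_cons (i : Fin (2 * k)) (l : List (Fin (2 * k))) :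
    projList (i :: l) = projE i * projList l := by simp [projList]

theorem projList_comm_conjE (l : List (Fin (2 * k))) (i : Fin (2 * k)) :
    Commute (projList l) (conjE i) := by
  induction l with
  | nil => exact Commute.one_left _
  | cons j l ih =>
    rw [projList_cons]
    refine Commute.mul_left ?_ ih
    exact ((Commute.one_left _).add_left (conjE_comm j i)).smul_left _

theorem projList_mul_conjE {l : List (Fin (2 * k))} {i : Fin (2 * k)} (h : i ∈ l) :
    projList l * conjE i = projList l := by
  induction l with
  | nil => simp at h
  | cons j l ih =>
    rw [projList_cons]
    by_cases hij : i = j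
    · subst hij
      rw [mul_assoc, (projList_comm_conjE l i).eq, ← mul_assoc, projE_mul_conjE]
    · rw [mul_assoc, ih (List.mem_of_ne_of_mem hij h)]

def cMon (l : List (Fin (2 * k))) : CCl k := (l.map cE).prod

theorem cMon_cons (i : Fin (2 * k)) (l : List (Fin (2 * k))) : cMon (i :: l) = cE i * cMon l := by
  simp [cMon]

theorem cMon_append (l l' : List (Fin (2 * k))) : cMon (l ++ l') = cMon l * cMon l' := by
  simp [cMon]

theorem cE_mul_cMon (i : Fin (2 * k)) (l : List (Fin (2 * k))) :
    cE i * cMon l = (-1 : ℂ) ^ (l.length + l.count i) • (cMon l * cE i) := by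
  induction l with
  | nil => simp [cMon]
  | cons j l ih =>
    rw [cMon_cons]
    by_cases h : i = j
    · subst h
      have h2 : cMon l * cE i = (-1 : ℂ) ^ (l.length + l.count i) • (cE i * cMon l) := by
        rw [ih, smul_smul, ← mul_pow]; simp
      rw [List.count_cons_self, List.length_cons, mul_assoc, h2, mul_smul_comm, smul_smul,
        ← pow_add]
      have : (-1 : ℂ) ^ (l.length + 1 + (l.count i + 1) + (l.length + l.count i)) = 1 :=
        Even.neg_one_pow ⟨l.length + l.count i + 1, by ring⟩
      rw [this, one_smul]
    · rw [← mul_assoc, cE_anti h, List.length_cons, List.count_cons_of_ne (Ne.symm h), neg_mul,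
        mul_assoc, ih, mul_smul_comm, ← neg_smul, mul_assoc]
      congr 1
      ring

theorem conjE_cMon (i : Fin (2 * k)) (l : List (Fin (2 * k))) :
    conjE i (cMon l) = (-1 : ℂ) ^ (l.length + l.count i) • cMon l := by
  rw [conjE_apply, cE_mul_cMon, smul_mul_assoc, mul_assoc, cE_sq]
  simp

theorem cMon_scalar (l : List (Fin (2 * k))) (h : ∀ i, Even (l.count i)) :
    ∃ c : ℂ, cMon l = algebraMap ℂ (CCl k) c := by
  induction hn : l.length using Nat.strong_induction_on generalizing l with
  | _ n ih =>
    cases l with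
    | nil => exact ⟨1, by simp [cMon]⟩
    | cons i l =>
      have hi := h i
      rw [List.count_cons_self] at hi
      have hmem : i ∈ l := by
        rw [← List.count_pos_iff]
        rcases Nat.eq_zero_or_pos (l.count i) with h0 | h0
        · rw [h0] at hi; simp at hi
        · exact h0
      obtain ⟨a, b, rfl⟩ := List.append_of_mem hmem
      obtain ⟨c, hc⟩ := ih (a ++ b).length (by rw [← hn]; simp) (a ++ b) (fun j => by
        have := h j
        simp only [List.count_cons, List.count_append] at this ⊢
        by_cases hij : i = j
        · simp [hij] at this
          rw [← add_assoc] at this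
          rcases this with ⟨r, hr⟩
          exact ⟨r - 1, by omega⟩
        · simpa [hij] using this) rfl
      refine ⟨-((-1) ^ (a.length + a.count i)) * c, ?_⟩
      rw [cMon_append] at hc
      rw [cMon_cons, cMon_append, cMon_cons, ← mul_assoc, cE_mul_cMon, smul_mul_assoc, mul_assoc,
        ← mul_assoc (cE i), cE_sq, map_mul, ← hc, Algebra.algebraMap_eq_smul_one]
      simp

theorem projList_cMon (s l : List (Fin (2 * k))) (hs : ∃ i ∈ s, ¬ Even (l.length + l.count i)) :
    projList s (cMon l) = 0 := by
  obtain ⟨i, hi, h⟩ := hs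
  have h1 : projList s (conjE i (cMon l)) = projList s (cMon l) :=
    congrArg (fun T : Module.End ℂ (CCl k) => T (cMon l)) (projList_mul_conjE hi)
  rw [conjE_cMon, (Nat.not_even_iff_odd.mp h).neg_one_pow, neg_one_smul, map_neg] at h1
  have h2 : (2 : ℂ) • projList s (cMon l) = 0 := by
    rw [two_smul]; nth_rewrite 1 [← h1]; simp
  exact (smul_eq_zero.mp h2).resolve_left two_ne_zero

theorem projList_eq_self (s : List (Fin (2 * k))) (z : CCl k) (h : ∀ i, conjE i z = z) :
    projList s z = z := by
  induction s with
  | nil => simp [projList]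
  | cons i s ih =>
    rw [projList_cons, Module.End.mul_apply, ih, projE, LinearMap.smul_apply, LinearMap.add_apply,
      Module.End.one_apply, h, ← two_smul ℂ z, smul_smul]
    norm_num

theorem projList_finRange_cMon (l : List (Fin (2 * k))) :
    ∃ c : ℂ, projList (List.finRange (2 * k)) (cMon l) = algebraMap ℂ (CCl k) c := by
  by_cases h : ∀ i, Even (l.length + l.count i)
  · have hev : ∀ i, Even (l.count i) := by
      have hsum : ∑ i, l.count i = l.length := by
        have := Multiset.sum_count_eq_card (s := Finset.univ) (m := (l : Multiset (Fin (2 * k))))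
          (fun a _ => Finset.mem_univ a)
        simpa using this
      have h2 : Even (∑ i, (l.length + l.count i)) := Finset.even_sum _ fun i _ => h i
      rw [Finset.sum_add_distrib, hsum] at h2
      simp only [Finset.sum_const, Finset.card_univ, Fintype.card_fin, smul_eq_mul] at h2
      have h3 : Even l.length := by
        rw [mul_assoc] at h2
        exact (Nat.even_add.mp h2).mp (even_two_mul _)
      intro i
      exact (Nat.even_add.mp (h i)).mp h3
    obtain ⟨c, hc⟩ := cMon_scalar l hev
    refine ⟨c, ?_⟩
    rw [projList_eq_self _ _ fun i => ?_, hc]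
    rw [conjE_cMon, (h i).neg_one_pow, one_smul]
  · push Not at h
    obtain ⟨i, hi⟩ := h
    exact ⟨0, by rw [projList_cMon _ _ ⟨i, List.mem_finRange i, hi⟩, map_zero]⟩

theorem span_cMon : span ℂ (Set.range (cMon (k := k))) = ⊤ := by
  rw [eq_top_iff]
  rintro z -
  induction z using CliffordAlgebra.induction with
  | algebraMap r =>
    rw [Algebra.algebraMap_eq_smul_one]
    exact Submodule.smul_mem _ _ (Submodule.subset_span ⟨[], by simp [cMon]⟩)
  | ι x =>
    rw [ι_eq_sum]
    exact Submodule.sum_mem _ fun i _ => Submodule.smul_mem _ _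
      (Submodule.subset_span ⟨[i], by simp [cMon]⟩)
  | mul a b ha hb =>
    have := Submodule.mul_mem_mul ha hb
    rw [Submodule.span_mul_span] at this
    refine Submodule.span_mono ?_ this
    rintro _ ⟨_, ⟨l, rfl⟩, _, ⟨l', rfl⟩, rfl⟩
    exact ⟨l ++ l', cMon_append l l'⟩
  | add a b ha hb => exact Submodule.add_mem _ ha hb

theorem projList_finRange_mem (z : CCl k) :
    projList (List.finRange (2 * k)) z ∈ LinearMap.range (Algebra.linearMap ℂ (CCl k)) := by
  have h : z ∈ span ℂ (Set.range (cMon (k := k))) := by rw [span_cMon]; trivial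
  induction h using Submodule.span_induction with
  | mem x hx =>
    obtain ⟨l, rfl⟩ := hx
    obtain ⟨c, hc⟩ := projList_finRange_cMon l
    exact ⟨c, hc.symm⟩
  | zero => simp
  | add x y _ _ hx hy => rw [map_add]; exact Submodule.add_mem _ hx hy
  | smul c x _ hx => rw [map_smul]; exact Submodule.smul_mem _ _ hx

theorem algebraMap_CCl_injective : Injective (algebraMap ℂ (CCl k)) :=
  (algebraMap ℂ (CCl k)).injective

/-- The normalized trace of the complex Clifford algebra (the scalar part). -/
def ctr : CCl k →ₗ[ℂ] ℂ :=
  (LinearEquiv.ofInjective (Algebra.linearMap ℂ (CCl k)) algebraMap_CCl_injective).symm.toLinearMap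
    ∘ₗ (projList (List.finRange (2 * k))).codRestrict _ projList_finRange_mem

theorem algebraMap_ctr (z : CCl k) :
    algebraMap ℂ (CCl k) (ctr z) = projList (List.finRange (2 * k)) z := by
  have := congrArg Subtype.val ((LinearEquiv.ofInjective (Algebra.linearMap ℂ (CCl k))
    algebraMap_CCl_injective).apply_symm_apply
      ((projList (List.finRange (2 * k))).codRestrict _ projList_finRange_mem z))
  exact this

theorem eq_algebraMap_ctr {z : CCl k} (h : ∀ i, cE i * z = z * cE i) :
    z = algebraMap ℂ (CCl k) (ctr z) := by
  rw [algebraMap_ctr, projList_eq_self]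
  intro i
  rw [conjE_apply, h, mul_assoc, cE_sq]
  simp

theorem ctr_algebraMap (c : ℂ) : ctr (algebraMap ℂ (CCl k) c) = c :=
  algebraMap_CCl_injective (eq_algebraMap_ctr fun _ => (Algebra.commutes _ _).symm).symm

theorem ctr_one : ctr (1 : CCl k) = 1 := by
  rw [← map_one (algebraMap ℂ (CCl k)), ctr_algebraMap]

theorem ctr_mul_comm (x y : CCl k) : ctr (x * y) = ctr (y * x) := by
  have hE : ∀ (i : Fin (2 * k)) (z : CCl k), ctr (z * cE i) = ctr (cE i * z) := fun i z => by
    apply algebraMap_CCl_injective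
    rw [algebraMap_ctr, algebraMap_ctr]
    have h1 := congrArg (fun T : Module.End ℂ (CCl k) => T (cE i * z))
      (projList_mul_conjE (List.mem_finRange i))
    simp only [Module.End.mul_apply, conjE_apply] at h1
    rw [← h1]
    congr 1
    rw [← mul_assoc, cE_sq]
    simp
  induction y using CliffordAlgebra.induction generalizing x with
  | algebraMap r => rw [Algebra.commutes]
  | ι v =>
    rw [ι_eq_sum, Finset.mul_sum, Finset.sum_mul, map_sum, map_sum]
    refine Finset.sum_congr rfl fun i _ => ?_
    rw [mul_smul_comm, smul_mul_assoc, map_smul, map_smul, hE]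
  | mul a b ha hb => rw [← mul_assoc, hb, ← mul_assoc, ha, mul_assoc]
  | add a b ha hb => rw [mul_add, add_mul, map_add, map_add, ha, hb]

theorem ctr_reverse (z : CCl k) : ctr (reverse z) = ctr z := by
  have h : ∀ s : List (Fin (2 * k)),
      projList s (reverse z) = reverse (projList s z) := fun s => by
    induction s with
    | nil => simp [projList]
    | cons i s ih =>
      rw [projList_cons, Module.End.mul_apply, ih, Module.End.mul_apply]
      simp only [projE, LinearMap.smul_apply, LinearMap.add_apply, Module.End.one_apply,
        conjE_apply, map_smul, map_add, map_neg, CliffordAlgebra.reverse.map_mul]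
      simp [cE, cvec, mul_assoc]
  apply algebraMap_CCl_injective
  rw [algebraMap_ctr, h, ← algebraMap_ctr, CliffordAlgebra.reverse.commutes]

theorem ctr_involute (z : CCl k) : ctr (involute z) = ctr z := by
  have h : ∀ s : List (Fin (2 * k)),
      projList s (involute z) = involute (projList s z) := fun s => by
    induction s with
    | nil => simp [projList]
    | cons i s ih =>
      rw [projList_cons, Module.End.mul_apply, ih, Module.End.mul_apply]
      simp only [projE, LinearMap.smul_apply, LinearMap.add_apply, Module.End.one_apply,
        conjE_apply, map_smul, map_add, map_neg, map_mul]
      simp [cE, cvec, mul_assoc]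
  apply algebraMap_CCl_injective
  rw [algebraMap_ctr, h, ← algebraMap_ctr, AlgHom.commutes]

theorem exists_ctr_sum : ∃ l : List (CCl k × CCl k), ∀ z,
    algebraMap ℂ (CCl k) (ctr z) = (l.map fun p => p.1 * z * p.2).sum := by
  have h : ∀ s : List (Fin (2 * k)), ∃ l : List (CCl k × CCl k), ∀ z,
      projList s z = (l.map fun p => p.1 * z * p.2).sum := fun s => by
    induction s with
    | nil => exact ⟨[(1, 1)], fun z => by simp [projList]⟩
    | cons i s ih =>
      obtain ⟨l, hl⟩ := ih
      refine ⟨l.map (fun p => ((1 / 2 : ℂ) • p.1, p.2)) ++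
        l.map (fun p => (-((1 / 2 : ℂ) • (cE i * p.1)), p.2 * cE i)), fun z => ?_⟩
      rw [projList_cons, Module.End.mul_apply, hl]
      generalize l = l
      clear hl
      induction l with
      | nil => simp
      | cons p l ih =>
        simp only [List.map_cons, List.sum_cons, map_add, ih, List.map_append, List.sum_append,
          List.map_map]
        have : projE i (p.1 * z * p.2) = (1 / 2 : ℂ) • p.1 * z * p.2 +
            -((1 / 2 : ℂ) • (cE i * p.1)) * z * (p.2 * cE i) := by
          rw [projE, LinearMap.smul_apply, LinearMap.add_apply, Module.End.one_apply, conjE_apply]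
          simp only [smul_add, smul_neg, smul_mul_assoc, neg_mul, mul_assoc]
        rw [this]
        abel
  obtain ⟨l, hl⟩ := h (List.finRange (2 * k))
  exact ⟨l, fun z => by rw [algebraMap_ctr, hl]⟩

end CliffordTrace

/-! ## The groups `Pin_c(n)` and `Pin(n)` -/

section PinGroups

variable {k : ℕ}

abbrev pv (a : PinC k) : CCl k := ((a : (CCl k)ˣ) : CCl k)

theorem pv_mul (a b : PinC k) : pv (a * b) = pv a * pv b := by simp [pv]

theorem pv_one : pv (1 : PinC k) = 1 := by simp [pv]

theorem pv_mul_inv (a : PinC k) : pv a * pv a⁻¹ = 1 := by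
  rw [← pv_mul, mul_inv_cancel, pv_one]

theorem pv_inv_mul (a : PinC k) : pv a⁻¹ * pv a = 1 := by
  rw [← pv_mul, inv_mul_cancel, pv_one]

theorem pv_injective : Injective (pv (k := k)) := fun _ _ h =>
  Subtype.ext (Units.ext h)

theorem pv_ne_zero (a : PinC k) : pv a ≠ 0 := (a : (CCl k)ˣ).ne_zero

theorem pv_pinScalar (z : ℂ) (hz : ‖z‖ = 1) : pv (pinScalar k z hz) = algebraMap ℂ (CCl k) z := rfl

theorem pv_pinVec {v : Euc k} (hv : ‖v‖ = 1) : pv (pinVec v) = cvec v := by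
  rw [pinVec, dif_pos hv]

theorem PinC.induction {motive : PinC k → Prop}
    (scalar : ∀ z hz, motive (pinScalar k z hz)) (vec : ∀ v : Euc k, ‖v‖ = 1 → motive (pinVec v))
    (mul : ∀ a b, motive a → motive b → motive (a * b)) (inv : ∀ a, motive a → motive a⁻¹)
    (a : PinC k) : motive a := by
  obtain ⟨a, ha⟩ := a
  induction ha using Subgroup.closure_induction with
  | mem x hx =>
    rcases hx with ⟨z, hz, h⟩ | ⟨v, hv, h⟩
    · convert scalar z hz using 1
      exact pv_injective h
    · convert vec v hv using 1
      exact pv_injective (by rw [pv_pinVec hv]; exact h)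
  | one =>
    convert scalar 1 (by simp) using 1
    exact pv_injective (by simp [pv, pinScalar])
  | mul x y hx hy ihx ihy => exact mul _ _ ihx ihy
  | inv x hx ih => exact inv _ ih

theorem pinAd_eq {a : PinC k} {T : O[k]}
    (h : ∀ v, pv a * cvec v = cvec (T v) * pv a) : pinAd a = T := by
  ext1 v
  apply cvec_injective
  have := pinAd_spec a v
  rw [show ((a : (CCl k)ˣ) : CCl k) = pv a from rfl, h] at this
  exact ((a : (CCl k)ˣ).isUnit.mul_left_injective this).symm

theorem pinAd_mul' (a b : PinC k) : pinAd (a * b) = pinAd a * pinAd b := by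
  ext1 v; exact pinAd_mul a b v

theorem pinAd_one : pinAd (1 : PinC k) = 1 := pinAd_eq fun v => by simp [pv_one]

theorem pinAd_inv (a : PinC k) : pinAd a⁻¹ = (pinAd a)⁻¹ := by
  rw [eq_inv_iff_mul_eq_one, ← pinAd_mul', inv_mul_cancel, pinAd_one]

theorem pinAd_scalar (z : ℂ) (hz : ‖z‖ = 1) : pinAd (pinScalar k z hz) = 1 :=
  pinAd_eq fun v => Algebra.commutes _ _

theorem cvec_pinAd (a : PinC k) (v : Euc k) : cvec (pinAd a v) = pv a * cvec v * pv a⁻¹ := by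
  rw [pinAd_spec, mul_assoc, show ((a : (CCl k)ˣ) : CCl k) = pv a from rfl, pv_mul_inv, mul_one]

theorem pinAd_vec {v : Euc k} (hv : ‖v‖ = 1) :
    pinAd (pinVec v) = Submodule.reflection (span ℝ {v}) := by
  apply pinAd_eq
  intro w
  rw [pv_pinVec hv]
  have e1 : (Submodule.reflection (span ℝ {v})) w
      = (2 * inner ℝ v w : ℝ) • v + (-1 : ℝ) • w := by
    rw [Submodule.reflection_singleton_apply, hv]
    simp [sub_eq_add_neg, two_smul, ← add_smul, two_mul]
  rw [e1, cvec_add, cvec_smul, cvec_smul, add_mul, smul_mul_assoc, smul_mul_assoc,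
    cvec_mul_self, hv, ← sub_eq_iff_eq_add]
  have := cvec_mul_add_swap v w
  rw [Algebra.algebraMap_eq_smul_one] at this ⊢
  push_cast at this ⊢
  rw [neg_one_smul, sub_neg_eq_add, this]
  simp

theorem involute_cvec (v : Euc k) : involute (cvec v) = -cvec v := by simp [cvec]

theorem pv_involute (a : PinC k) :
    involute (pv a) = pv a ∨ involute (pv a) = -pv a := by
  induction a using PinC.induction with
  | scalar z hz => left; rw [pv_pinScalar, AlgHom.commutes]
  | vec v hv => right; rw [pv_pinVec hv, involute_cvec]
  | mul a b ha hb =>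
    rw [pv_mul, map_mul]
    rcases ha with ha | ha <;> rcases hb with hb | hb <;> rw [ha, hb] <;> simp
  | inv a ha =>
    have h1 : involute (pv a⁻¹) * involute (pv a) = 1 := by
      rw [← map_mul, pv_inv_mul, map_one]
    have h2 : involute (pv a⁻¹) = involute (pv a⁻¹) * pv a * pv a⁻¹ := by
      rw [mul_assoc, pv_mul_inv, mul_one]
    rcases ha with ha | ha
    · left; rw [ha] at h1; rw [h2, h1, one_mul]
    · right; rw [ha, mul_neg] at h1
      rw [h2, neg_eq_iff_eq_neg.mp h1, neg_one_mul]

theorem mem_evenOdd_zero_iff {x : CCl k} :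
    x ∈ CliffordAlgebra.evenOdd (cliffordForm k) 0 ↔ involute x = x := by
  refine ⟨CliffordAlgebra.involute_eq_of_mem_even, fun h => ?_⟩
  obtain ⟨y, hy, z, hz, rfl⟩ := Submodule.mem_sup.mp
    ((CliffordAlgebra.evenOdd_isCompl (cliffordForm k)).codisjoint.eq_top ▸
      (Submodule.mem_top : x ∈ (⊤ : Submodule ℂ (CCl k))))
  rw [map_add, CliffordAlgebra.involute_eq_of_mem_even hy,
    CliffordAlgebra.involute_eq_of_mem_odd hz] at h
  have h1 : (2 : ℂ) • z = 0 := by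
    rw [two_smul]
    nth_rewrite 1 [← neg_neg z]
    rw [add_left_cancel h]; simp
  rw [(smul_eq_zero.mp h1).resolve_left two_ne_zero, add_zero]
  exact hy

theorem pinDeg_eq_zero_iff {a : PinC k} :
    pinDeg a = 0 ↔ involute (pv a) = pv a := by
  rw [← mem_evenOdd_zero_iff, pinDeg]
  split_ifs with h <;> simp [h]

theorem pinDeg_eq_one_iff {a : PinC k} :
    pinDeg a = 1 ↔ involute (pv a) = -pv a := by
  constructor
  · intro h
    refine (pv_involute a).resolve_left fun h0 => ?_
    rw [pinDeg_eq_zero_iff.mpr h0] at h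
    exact absurd h (by decide)
  · intro h
    have : pinDeg a ≠ 0 := fun h0 => by
      rw [pinDeg_eq_zero_iff.mp h0] at h
      have h2 : (2 : ℂ) • pv a = 0 := by
        rw [two_smul]; nth_rewrite 1 [h]; simp
      exact pv_ne_zero a ((smul_eq_zero.mp h2).resolve_left two_ne_zero)
    rw [pinDeg] at this ⊢
    split_ifs at this ⊢ with h1
    · exact absurd rfl this
    · rfl

theorem pinDeg_zero_or_one (a : PinC k) : pinDeg a = 0 ∨ pinDeg a = 1 := by
  rw [pinDeg]; split_ifs <;> simp

theorem pinDeg_mul (a b : PinC k) : pinDeg (a * b) = pinDeg a + pinDeg b := by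
  have key : involute (pv (a * b)) = involute (pv a) * involute (pv b) := by rw [pv_mul, map_mul]
  rcases pinDeg_zero_or_one a with ha | ha <;> rcases pinDeg_zero_or_one b with hb | hb <;>
    rw [ha, hb]
  · rw [pinDeg_eq_zero_iff.mp ha, pinDeg_eq_zero_iff.mp hb, ← pv_mul] at key
    rw [pinDeg_eq_zero_iff.mpr key]; rfl
  · rw [pinDeg_eq_zero_iff.mp ha, pinDeg_eq_one_iff.mp hb, mul_neg, ← pv_mul] at key
    rw [pinDeg_eq_one_iff.mpr key]; rfl
  · rw [pinDeg_eq_one_iff.mp ha, pinDeg_eq_zero_iff.mp hb, neg_mul, ← pv_mul] at key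
    rw [pinDeg_eq_one_iff.mpr key]; rfl
  · rw [pinDeg_eq_one_iff.mp ha, pinDeg_eq_one_iff.mp hb, neg_mul_neg, ← pv_mul] at key
    rw [pinDeg_eq_zero_iff.mpr key]; rfl

theorem pinDeg_one : pinDeg (1 : PinC k) = 0 := pinDeg_eq_zero_iff.mpr (by rw [pv_one, map_one])

theorem pinDeg_inv (a : PinC k) : pinDeg a⁻¹ = pinDeg a := by
  have h := pinDeg_mul a a⁻¹
  rw [mul_inv_cancel, pinDeg_one] at h
  rcases pinDeg_zero_or_one a with ha | ha <;> rcases pinDeg_zero_or_one a⁻¹ with hb | hb <;>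
    rw [ha, hb] at h ⊢ <;> revert h <;> decide

theorem pinDeg_scalar (z : ℂ) (hz : ‖z‖ = 1) : pinDeg (pinScalar k z hz) = 0 :=
  pinDeg_eq_zero_iff.mpr (by rw [pv_pinScalar, AlgHom.commutes])

theorem pinDeg_vec {v : Euc k} (hv : ‖v‖ = 1) : pinDeg (pinVec v) = 1 :=
  pinDeg_eq_one_iff.mpr (by rw [pv_pinVec hv, involute_cvec])

theorem pinDet_eq {a : PinC k} {d : ℂ}
    (h : reverse (involute (pv a)) * pv a =
      algebraMap ℂ (CCl k) d) : pinDet a = d :=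
  algebraMap_CCl_injective (by rw [← h]; exact (pinDet_spec a).symm)

theorem pinDet_mul (a b : PinC k) : pinDet (a * b) = pinDet a * pinDet b := by
  apply pinDet_eq
  have h1 := pinDet_spec a
  have h2 := pinDet_spec b
  rw [pv_mul, map_mul, CliffordAlgebra.reverse.map_mul, mul_assoc,
    ← mul_assoc _ (pv a) (pv b), h1, ← mul_assoc, ← Algebra.commutes, mul_assoc, h2, map_mul]

theorem pinDet_scalar (z : ℂ) (hz : ‖z‖ = 1) : pinDet (pinScalar k z hz) = z ^ 2 :=
  pinDet_eq (by rw [pv_pinScalar, AlgHom.commutes, CliffordAlgebra.reverse.commutes, sq, map_mul])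

theorem pinDet_vec {v : Euc k} (hv : ‖v‖ = 1) : pinDet (pinVec v) = 1 := pinDet_eq (by
    rw [pv_pinVec hv, involute_cvec, map_neg]
    simp only [cvec, CliffordAlgebra.reverse_ι]
    rw [map_one]
    exact cvec_neg_self_mul v hv)

theorem pinDet_one : pinDet (1 : PinC k) = 1 := pinDet_eq (by simp [pv_one])

theorem pinDet_ne_zero (a : PinC k) : pinDet a ≠ 0 := (exists_pinDet a).choose_spec.1

theorem pinDet_inv (a : PinC k) : pinDet a⁻¹ = (pinDet a)⁻¹ := by
  refine eq_inv_of_mul_eq_one_left ?_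
  rw [← pinDet_mul, inv_mul_cancel, pinDet_one]

theorem pv_inv (a : PinC k) :
    pv a⁻¹ = (pinDet a)⁻¹ • reverse (involute (pv a)) := by
  have h : reverse (involute (pv a)) =
      algebraMap ℂ (CCl k) (pinDet a) * pv a⁻¹ := by
    rw [← pinDet_spec a, mul_assoc, show ((a : (CCl k)ˣ) : CCl k) = pv a from rfl,
      pv_mul_inv, mul_one]
  rw [h, Algebra.smul_def, ← mul_assoc, ← map_mul, inv_mul_cancel₀ (pinDet_ne_zero a), map_one,
    one_mul]

theorem det_pinAd (a : PinC k) :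
    LinearMap.det ((pinAd a).toLinearEquiv : Euc k →ₗ[ℝ] Euc k) =
      if pinDeg a = 0 then 1 else -1 := by
  have hmul : ∀ a b : PinC k, LinearMap.det ((pinAd (a * b)).toLinearEquiv : Euc k →ₗ[ℝ] Euc k) =
      LinearMap.det ((pinAd a).toLinearEquiv : Euc k →ₗ[ℝ] Euc k) *
      LinearMap.det ((pinAd b).toLinearEquiv : Euc k →ₗ[ℝ] Euc k) := fun a b => by
    rw [← LinearMap.det_comp]
    congr 1
    ext1 v
    simp [pinAd_mul]
  have hone : LinearMap.det ((pinAd (1 : PinC k)).toLinearEquiv : Euc k →ₗ[ℝ] Euc k) = 1 := by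
    rw [pinAd_one]; exact LinearMap.det_id
  induction a using PinC.induction with
  | scalar z hz =>
    rw [pinAd_scalar, pinDeg_scalar, if_pos rfl]; exact LinearMap.det_id
  | vec v hv =>
    rw [pinAd_vec hv, pinDeg_vec hv, if_neg (by decide)]
    have h0 : v ≠ 0 := by rintro rfl; simp at hv
    have h1 : Module.finrank ℝ (span ℝ {v})ᗮ + 1 = 2 * k := by
      have := Submodule.finrank_add_finrank_orthogonal (span ℝ {v})
      rw [finrank_span_singleton h0] at this
      simp at this
      omega
    have h2 := Submodule.det_reflection (span ℝ {v})
    have h3 : Odd (Module.finrank ℝ (span ℝ {v})ᗮ) := by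
      rcases Nat.even_or_odd (Module.finrank ℝ (span ℝ {v})ᗮ) with ⟨r, hr⟩ | h
      · omega
      · exact h
    rw [h3.neg_one_pow] at h2
    exact h2
  | mul a b ha hb =>
    rw [hmul, ha, hb, pinDeg_mul]
    rcases pinDeg_zero_or_one a with ha | ha <;> rcases pinDeg_zero_or_one b with hb | hb <;>
      rw [ha, hb]
    · rw [if_pos rfl, if_pos (by decide)]; norm_num
    · rw [if_pos rfl, if_neg (by decide), if_neg (by decide)]; norm_num
    · rw [if_pos rfl, if_neg (by decide), if_neg (by decide)]; norm_num
    · rw [if_neg (by decide), if_pos (by decide)]; norm_num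
  | inv a ha =>
    have := hmul a a⁻¹
    rw [mul_inv_cancel, hone, ha] at this
    rw [pinDeg_inv]
    split_ifs at this ⊢ <;> linarith

theorem orthDeg_pinAd (a : PinC k) : orthDeg (pinAd a) = pinDeg a := by
  rw [orthDeg, det_pinAd]
  rcases pinDeg_zero_or_one a with ha | ha <;> rw [ha] <;> norm_num

abbrev pinNeg (k : ℕ) : PinC k := pinScalar k (-1) (by simp)

theorem pv_pinNeg_mul (a : PinC k) : pv (pinNeg k * a) = -pv a := by
  rw [pv_mul, pv_pinScalar, map_neg, map_one, neg_one_mul]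

def PinR (k : ℕ) : Subgroup (PinC k) :=
  Subgroup.closure ({a | ∃ v : Euc k, ‖v‖ = 1 ∧ a = pinVec v} ∪ {pinNeg k})

theorem pinNeg_mem_PinR : pinNeg k ∈ PinR k := Subgroup.subset_closure (Or.inr rfl)

theorem pinVec_mem_PinR {v : Euc k} (hv : ‖v‖ = 1) : pinVec v ∈ PinR k :=
  Subgroup.subset_closure (Or.inl ⟨v, hv, rfl⟩)

theorem pinDet_of_mem_PinR {a : PinC k} (ha : a ∈ PinR k) : pinDet a = 1 := by
  induction ha using Subgroup.closure_induction with
  | mem x hx =>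
    rcases hx with ⟨v, hv, rfl⟩ | rfl
    · exact pinDet_vec hv
    · rw [pinDet_scalar]; norm_num
  | one => exact pinDet_one
  | mul x y _ _ hx hy => rw [pinDet_mul, hx, hy, mul_one]
  | inv x _ hx => rw [pinDet_inv, hx, inv_one]

theorem pinVec_conj (a : PinC k) {v : Euc k} (hv : ‖v‖ = 1) :
    a * pinVec v * a⁻¹ = pinVec (pinAd a v) := by
  apply pv_injective
  rw [pv_mul, pv_mul, pv_pinVec hv, pv_pinVec (by rw [LinearIsometryEquiv.norm_map, hv]),
    cvec_pinAd]

theorem PinR_conj (a : PinC k) {b : PinC k} (hb : b ∈ PinR k) : a * b * a⁻¹ ∈ PinR k := by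
  induction hb using Subgroup.closure_induction with
  | mem x hx =>
    rcases hx with ⟨v, hv, rfl⟩ | rfl
    · rw [pinVec_conj a hv]
      exact pinVec_mem_PinR (by rw [LinearIsometryEquiv.norm_map, hv])
    · convert pinNeg_mem_PinR (k := k) using 1
      apply pv_injective
      rw [pv_mul, pv_mul, pv_pinScalar, ← Algebra.commutes, mul_assoc, pv_mul_inv, mul_one]
  | one => simpa using one_mem _
  | mul x y _ _ hx hy =>
    have := mul_mem hx hy
    rwa [show a * x * a⁻¹ * (a * y * a⁻¹) = a * (x * y) * a⁻¹ by group] at this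
  | inv x _ hx =>
    have := inv_mem hx
    rwa [show (a * x * a⁻¹)⁻¹ = a * x⁻¹ * a⁻¹ by group] at this

theorem pv_eq_algebraMap {a : PinC k} (h : pinAd a = 1) :
    pv a = algebraMap ℂ (CCl k) (ctr (pv a)) := by
  apply eq_algebraMap_ctr
  intro i
  have := pinAd_spec a (single i (1 : ℝ))
  rw [h] at this
  exact this.symm

theorem PinR_eq_or_neg {a b : PinC k} (ha : a ∈ PinR k) (hb : b ∈ PinR k)
    (h : pinAd a = pinAd b) : pv a = pv b ∨ pv a = -pv b := by
  have h1 : pinAd (a * b⁻¹) = 1 := by rw [pinAd_mul', pinAd_inv, h, mul_inv_cancel]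
  have h2 := pv_eq_algebraMap h1
  set c := ctr (pv (a * b⁻¹))
  have h3 : pinDet (a * b⁻¹) = c ^ 2 := pinDet_eq (by
    rw [h2, AlgHom.commutes, CliffordAlgebra.reverse.commutes, sq, map_mul])
  rw [pinDet_of_mem_PinR (mul_mem ha (inv_mem hb))] at h3
  have h4 : pv a = algebraMap ℂ (CCl k) c * pv b := by
    rw [← h2, ← pv_mul, inv_mul_cancel_right]
  rcases sq_eq_one_iff.mp h3.symm with h5 | h5 <;> rw [h5] at h4
  · left; simpa using h4
  · right; simpa using h4

end PinGroups

/-! ## Smooth lifts from `O(n)` to `Pin(n)` -/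

section PinLift

variable {k : ℕ}

def cclCoord (k : ℕ) : CCl k ≃ₗ[ℂ] (Fin (Module.finrank ℂ (CCl k)) → ℂ) :=
  (Module.finBasis ℂ (CCl k)).equivFun

instance : NormedAddCommGroup (CCl k) :=
  NormedAddCommGroup.induced (CCl k) (Fin (Module.finrank ℂ (CCl k)) → ℂ)
    (cclCoord k).toLinearMap (cclCoord k).injective

instance : NormedSpace ℂ (CCl k) :=
  NormedSpace.induced ℂ (CCl k) (Fin (Module.finrank ℂ (CCl k)) → ℂ) (cclCoord k).toLinearMap

def cmulL (k : ℕ) : CCl k →L[ℂ] CCl k →L[ℂ] CCl k := LinearMap.toContinuousLinearMap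
    ((LinearMap.toContinuousLinearMap : (CCl k →ₗ[ℂ] CCl k) ≃ₗ[ℂ] _).toLinearMap ∘ₗ
      LinearMap.mul ℂ (CCl k))

theorem contDiff_cmul : ContDiff ℝ ∞ fun p : CCl k × CCl k => p.1 * p.2 :=
  ((cmulL k).isBoundedBilinearMap.contDiff (n := ∞)).restrict_scalars ℝ

theorem contDiff_clinear {F : Type*} [NormedAddCommGroup F] [NormedSpace ℂ F] (l : CCl k →ₗ[ℂ] F) :
    ContDiff ℝ ∞ l := (l.toContinuousLinearMap.contDiff (n := ∞)).restrict_scalars ℝ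

theorem ContDiff.cmul {E : Type*} [NormedAddCommGroup E] [NormedSpace ℝ E] {f g : E → CCl k}
    (hf : ContDiff ℝ ∞ f) (hg : ContDiff ℝ ∞ g) : ContDiff ℝ ∞ fun x => f x * g x :=
  contDiff_cmul.comp (hf.prodMk hg)

theorem contDiff_cvec : ContDiff ℝ ∞ (cvec (k := k)) := by
  have : (cvec (k := k)) = fun v => ∑ i, (v i : ℂ) • cE i := funext cvec_eq_sum
  rw [this]
  refine ContDiff.sum fun i _ => ContDiff.fun_smul ?_ contDiff_const
  exact Complex.ofRealCLM.contDiff.comp (EuclideanSpace.proj (𝕜 := ℝ) i).contDiff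

abbrev isoL (A : O[k]) : E[k] := (A.toContinuousLinearEquiv : E[k])

theorem exists_conj_smooth (x : CCl k) : ∃ F : E[k] → CCl k, ContDiff ℝ ∞ F ∧
    ∀ c : PinC k, F (isoL (pinAd c)) = pv c * x * pv c⁻¹ := by
  induction x using CliffordAlgebra.induction with
  | algebraMap r =>
    refine ⟨fun _ => algebraMap ℂ (CCl k) r, contDiff_const, fun c => ?_⟩
    rw [← Algebra.commutes, mul_assoc, pv_mul_inv, mul_one]
  | ι v =>
    refine ⟨fun T => ∑ i, v i • cvec (T (single i 1)), ?_, fun c => ?_⟩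
    · refine ContDiff.sum fun i _ => contDiff_const.fun_smul (contDiff_cvec.comp ?_)
      exact (ContinuousLinearMap.apply ℝ (Euc k) (single i (1 : ℝ))).contDiff
    · rw [ι_eq_sum, Finset.mul_sum, Finset.sum_mul]
      refine Finset.sum_congr rfl fun i _ => ?_
      rw [mul_smul_comm, smul_mul_assoc, cE, ← cvec_pinAd]
      rfl
  | mul a b ha hb =>
    obtain ⟨F, hF, hF'⟩ := ha
    obtain ⟨G, hG, hG'⟩ := hb
    refine ⟨fun T => F T * G T, hF.cmul hG, fun c => ?_⟩
    simp only [hF', hG']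
    calc pv c * a * pv c⁻¹ * (pv c * b * pv c⁻¹) = pv c * a * (pv c⁻¹ * pv c) * b * pv c⁻¹ := by
          noncomm_ring
      _ = _ := by rw [pv_inv_mul, mul_one, mul_assoc (pv c) a b]
  | add a b ha hb =>
    obtain ⟨F, hF, hF'⟩ := ha
    obtain ⟨G, hG, hG'⟩ := hb
    exact ⟨fun T => F T + G T, hF.add hG, fun c => by simp only [hF', hG', mul_add, add_mul]⟩

theorem exists_conj_sum_smooth (l : List (CCl k × CCl k)) :
    ∃ F : E[k] → CCl k, ContDiff ℝ ∞ F ∧ ∀ c : PinC k, F (isoL (pinAd c)) =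
        pv c * (l.map fun p => p.1 * pv c⁻¹ * p.2).sum := by
  induction l with
  | nil => exact ⟨fun _ => 0, contDiff_const, fun c => by simp⟩
  | cons p l ih =>
    obtain ⟨F, hF, hF'⟩ := ih
    obtain ⟨G, hG, hG'⟩ := exists_conj_smooth p.1
    refine ⟨fun T => G T * p.2 + F T, (hG.cmul contDiff_const).add hF, fun c => ?_⟩
    simp only [hF', hG', List.map_cons, List.sum_cons, mul_add, mul_assoc]

theorem exists_cL : ∃ F : E[k] → CCl k, ContDiff ℝ ∞ F ∧
    ∀ c : PinC k, F (isoL (pinAd c)) = ctr (pv c⁻¹) • pv c := by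
  obtain ⟨l, hl⟩ := exists_ctr_sum (k := k)
  obtain ⟨F, hF, hF'⟩ := exists_conj_sum_smooth l
  exact ⟨F, hF, fun c => by rw [hF', ← hl, ← Algebra.commutes, Algebra.smul_def]⟩

/-- The smooth map with `cL (Ad_c) = tr(c⁻¹) c`. -/
def cL : E[k] → CCl k := exists_cL.choose

theorem contDiff_cL : ContDiff ℝ ∞ (cL (k := k)) := exists_cL.choose_spec.1

theorem cL_pinAd {c : PinC k} (hc : c ∈ PinR k) : cL (isoL (pinAd c)) = ctr (pv c) • pv c := by
  have h : cL (isoL (pinAd c)) = ctr (pv c⁻¹) • pv c := exists_cL.choose_spec.2 c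
  rw [h, pv_inv, pinDet_of_mem_PinR hc, inv_one, one_smul, ctr_reverse, ctr_involute]

theorem pv_list_prod (l : List (PinC k)) : pv l.prod = (l.map pv).prod := by
  induction l with
  | nil => exact pv_one
  | cons a l ih => rw [List.prod_cons, pv_mul, ih, List.map_cons, List.prod_cons]

def pinVol (k : ℕ) : PinC k := (List.ofFn fun i : Fin (2 * k) => pinVec (single i (1 : ℝ))).prod

theorem pv_pinVol : pv (pinVol k) = cMon (List.finRange (2 * k)) := by
  rw [pinVol, pv_list_prod, List.ofFn_eq_map, cMon, List.map_map]
  congr 1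
  refine List.map_congr_left fun i _ => ?_
  exact pv_pinVec (by simp)

theorem pinVol_mem_PinR : pinVol k ∈ PinR k := by
  refine list_prod_mem fun a ha => ?_
  rw [List.mem_ofFn] at ha
  obtain ⟨i, rfl⟩ := ha
  exact pinVec_mem_PinR (by simp)

theorem cE_mul_pinVol (i : Fin (2 * k)) : cE i * pv (pinVol k) = -(pv (pinVol k) * cE i) := by
  rw [pv_pinVol, cE_mul_cMon, List.count_eq_one_of_mem (List.nodup_finRange _)
    (List.mem_finRange i), List.length_finRange]
  have : Odd (2 * k + 1) := ⟨k, rfl⟩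
  rw [this.neg_one_pow, neg_one_smul]

theorem pinVol_mul_cvec (v : Euc k) : pv (pinVol k) * cvec v = cvec (-v) * pv (pinVol k) := by
  have h2 : cvec (-v) = -cvec v := by
    have := cvec_smul (-1) v
    simpa using this
  rw [h2, cvec_eq_sum, Finset.mul_sum, neg_mul, Finset.sum_mul, ← Finset.sum_neg_distrib]
  refine Finset.sum_congr rfl fun i _ => ?_
  rw [mul_smul_comm, smul_mul_assoc, cE_mul_pinVol, smul_neg, neg_neg]

theorem cvec_neg (v : Euc k) : cvec (-v) = -cvec v := by simpa using cvec_smul (-1) v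

theorem pinAd_pinVol : pinAd (pinVol k) = LinearIsometryEquiv.neg ℝ :=
  pinAd_eq fun v => pinVol_mul_cvec v

theorem cMon_sq (l : List (Fin (2 * k))) (h : l.Nodup) :
    cMon l * cMon l = (-1 : ℂ) ^ (l.length * (l.length + 1) / 2) • 1 := by
  induction l with
  | nil => simp [cMon]
  | cons i l ih =>
    have hi : i ∉ l := (List.nodup_cons.mp h).1
    have h1 := cE_mul_cMon i l
    rw [List.count_eq_zero_of_not_mem hi, add_zero] at h1
    have h2 : cMon l * cE i = (-1 : ℂ) ^ l.length • (cE i * cMon l) := by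
      rw [h1, smul_smul, ← mul_pow]; simp
    rw [cMon_cons, mul_assoc, ← mul_assoc (cMon l), h2, smul_mul_assoc, mul_smul_comm,
      ← mul_assoc, ← mul_assoc, cE_sq, mul_assoc, ih (List.nodup_cons.mp h).2, List.length_cons]
    have h3 : (l.length + 1) * (l.length + 1 + 1) / 2 = l.length * (l.length + 1) / 2 +
        (l.length + 1) := by
      rw [← Nat.add_mul_div_right _ _ (by norm_num : 0 < 2)]
      congr 1
      ring
    rw [h3, neg_one_mul, smul_neg, smul_smul, ← neg_smul, pow_add, pow_succ]
    congr 1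
    ring

theorem pinVol_sq : pv (pinVol k) * pv (pinVol k) = (-1 : ℂ) ^ k • 1 := by
  rw [pv_pinVol, cMon_sq _ (List.nodup_finRange _), List.length_finRange]
  have : 2 * k * (2 * k + 1) / 2 = 2 * (k * k) + k := by
    rw [mul_assoc, Nat.mul_div_cancel_left _ (by norm_num)]; ring
  rw [this, pow_add, pow_mul]
  simp

theorem pinGamma_eq : pinGamma k = pinScalar k (Complex.I ^ k) (by simp) * pinVol k := rfl

theorem pv_pinGamma : pv (pinGamma k) = (Complex.I ^ k) • pv (pinVol k) := by
  rw [pinGamma_eq, pv_mul, pv_pinScalar, Algebra.smul_def]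

theorem pinGamma_sq : pinGamma k * pinGamma k = 1 := by
  apply pv_injective
  rw [pv_mul, pv_pinGamma, smul_mul_assoc, mul_smul_comm, pinVol_sq, smul_smul, smul_smul, pv_one,
    ← mul_pow, ← mul_pow]
  simp

theorem pinGamma_mul_cvec (v : Euc k) : pv (pinGamma k) * cvec v = -(cvec v * pv (pinGamma k)) := by
  rw [pv_pinGamma, smul_mul_assoc, pinVol_mul_cvec, cvec_neg, neg_mul, mul_smul_comm, smul_neg]

theorem pinAd_pinGamma : pinAd (pinGamma k) = LinearIsometryEquiv.neg ℝ := by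
  rw [pinGamma_eq, pinAd_mul', pinAd_scalar, one_mul, pinAd_pinVol]

theorem pinDet_pinGamma : pinDet (pinGamma k) = (-1) ^ k := by
  rw [pinGamma_eq, pinDet_mul, pinDet_scalar, pinDet_of_mem_PinR pinVol_mem_PinR, mul_one,
    ← pow_mul, mul_comm k 2, pow_mul, Complex.I_sq]

theorem pinDeg_pinGamma : pinDeg (pinGamma k) = 0 := by
  rw [pinDeg_eq_zero_iff, pv_pinGamma, map_smul, pv_pinVol]
  have : ∀ l : List (Fin (2 * k)), involute (cMon l) = (-1 : ℂ) ^ l.length • cMon l := fun l => by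
      induction l with
      | nil => simp [cMon]
      | cons i l ih =>
        rw [cMon_cons, map_mul, ih, cE, involute_cvec, List.length_cons, pow_succ, mul_smul_comm]
        simp
  rw [this, List.length_finRange, pow_mul]
  simp

theorem reflection_orthogonal_eq (v : Euc k) :
    Submodule.reflection (span ℝ {v})ᗮ =
      LinearIsometryEquiv.neg ℝ * Submodule.reflection (span ℝ {v}) := by
  ext1 w
  rw [Submodule.reflection_orthogonal_apply]
  rfl

theorem exists_PinR_pinAd (A : O[k]) : ∃ c ∈ PinR k, pinAd c = A := by
  have hA : A ∈ Subgroup.closure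
      (Set.range fun v : Euc k => Submodule.reflection (span ℝ {v})ᗮ) := by
    rw [LinearIsometryEquiv.reflections_generate]; trivial
  induction hA using Subgroup.closure_induction with
  | mem x hx =>
    obtain ⟨v, rfl⟩ := hx
    by_cases hv : v = 0
    · refine ⟨1, one_mem _, ?_⟩
      rw [pinAd_one]
      ext1 w
      subst hv
      simp only [Submodule.span_zero_singleton, Submodule.bot_orthogonal_eq_top]
      exact (Submodule.reflection_mem_subspace_eq_self Submodule.mem_top).symm
    · have hn : ‖(‖v‖⁻¹ : ℝ) • v‖ = 1 := norm_smul_inv_norm (𝕜 := ℝ) hv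
      refine ⟨pinVol k * pinVec ((‖v‖⁻¹ : ℝ) • v), mul_mem pinVol_mem_PinR (pinVec_mem_PinR hn), ?_⟩
      have hspan : span ℝ {(‖v‖⁻¹ : ℝ) • v} = span ℝ {v} :=
        Submodule.span_singleton_smul_eq (by simpa using hv) v
      simp only [pinAd_mul', pinAd_pinVol, pinAd_vec hn, reflection_orthogonal_eq, hspan]
  | one => exact ⟨1, one_mem _, pinAd_one⟩
  | mul x y _ _ hx hy =>
    obtain ⟨a, ha, rfl⟩ := hx
    obtain ⟨b, hb, rfl⟩ := hy
    exact ⟨a * b, mul_mem ha hb, pinAd_mul' a b⟩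
  | inv x _ hx =>
    obtain ⟨a, ha, rfl⟩ := hx
    exact ⟨a⁻¹, inv_mem ha, pinAd_inv a⟩

def HasPosLift (A : O[k]) : Prop := ∃ c ∈ PinR k, pinAd c = A ∧ 0 < (ctr (pv c)).re

open Classical in
/-- The lift of `A` to `Pin(n)` whose trace has positive real part, if there is one. -/
def posLift (A : O[k]) : PinC k := if h : HasPosLift A then h.choose else 1

theorem HasPosLift.mem {A : O[k]} (h : HasPosLift A) : posLift A ∈ PinR k := by
  rw [posLift, dif_pos h]; exact h.choose_spec.1

theorem HasPosLift.pinAd {A : O[k]} (h : HasPosLift A) : pinAd (posLift A) = A := by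
  rw [posLift, dif_pos h]; exact h.choose_spec.2.1

theorem HasPosLift.re_pos {A : O[k]} (h : HasPosLift A) :
    0 < (ctr (pv (posLift A))).re := by
  rw [posLift, dif_pos h]; exact h.choose_spec.2.2

theorem eq_of_re_pos {a b : PinC k} (ha : a ∈ PinR k) (hb : b ∈ PinR k) (h : pinAd a = pinAd b)
    (l : CCl k →ₗ[ℂ] ℂ) (hla : 0 < (l (pv a)).re) (hlb : 0 < (l (pv b)).re) : a = b := by
  rcases PinR_eq_or_neg ha hb h with h | h
  · exact pv_injective h
  · rw [h, map_neg, Complex.neg_re] at hla; linarith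

theorem posLift_eq {A : O[k]} {c : PinC k} (hc : c ∈ PinR k) (h : pinAd c = A)
    (hpos : 0 < (ctr (pv c)).re) : posLift A = c := by
  have hA : HasPosLift A := ⟨c, hc, h, hpos⟩
  exact eq_of_re_pos hA.mem hc (by rw [hA.pinAd, h]) ctr hA.re_pos hpos

theorem hasPosLift_one : HasPosLift (1 : O[k]) :=
  ⟨1, one_mem _, pinAd_one, by rw [pv_one, ctr_one]; simp⟩

theorem posLift_one : posLift (1 : O[k]) = 1 :=
  posLift_eq (one_mem _) pinAd_one (by rw [pv_one, ctr_one]; simp)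

theorem ctr_conj (a : PinC k) (x : CCl k) : ctr (pv a * x * pv a⁻¹) = ctr x := by
  rw [ctr_mul_comm, ← mul_assoc, pv_inv_mul, one_mul]

theorem HasPosLift.conj {A : O[k]} (h : HasPosLift A) (a : PinC k) :
    HasPosLift (_root_.pinAd a * A * (_root_.pinAd a)⁻¹) :=
  ⟨a * posLift A * a⁻¹, PinR_conj a h.mem, by rw [pinAd_mul', pinAd_mul', h.pinAd, pinAd_inv], by
    rw [pv_mul, pv_mul, ctr_conj]; exact h.re_pos⟩

theorem HasPosLift.posLift_conj {A : O[k]} (h : HasPosLift A) (a : PinC k) :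
    posLift (_root_.pinAd a * A * (_root_.pinAd a)⁻¹) = a * posLift A * a⁻¹ :=
  posLift_eq (PinR_conj a h.mem) (by rw [pinAd_mul', pinAd_mul', h.pinAd, pinAd_inv])
    (by rw [pv_mul, pv_mul, ctr_conj]; exact h.re_pos)

theorem HasPosLift.pinDeg {A : O[k]} (h : HasPosLift A) : pinDeg (posLift A) = 0 := by
  refine (pinDeg_zero_or_one _).resolve_right fun h1 => ?_
  have h2 := congrArg ctr (pinDeg_eq_one_iff.mp h1)
  rw [ctr_involute, map_neg] at h2
  have h3 := congrArg Complex.re h2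
  have := h.re_pos
  rw [Complex.neg_re] at h3
  linarith

theorem HasPosLift.smooth {A : O[k]} (h : HasPosLift A) :
    ∃ G : E[k] → CCl k, ContDiffAt ℝ ∞ G (isoL A) ∧ ∀ᶠ T in 𝓝 (isoL A), ∀ B : O[k], isoL B = T →
        HasPosLift B ∧ pv (posLift B) = G T := by
  have hctr : ∀ B : O[k], ∀ c ∈ PinR k, _root_.pinAd c = B →
      ctr (cL (isoL B)) = ctr (pv c) ^ 2 := fun B c hc hB => by
    rw [← hB, cL_pinAd hc, map_smul, smul_eq_mul, sq]
  have hsq : ∀ w : ℂ, 0 < w.re → w ^ 2 ∈ Complex.slitPlane := fun w hw => by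
    rw [Complex.mem_slitPlane_iff, sq, Complex.mul_re, Complex.mul_im]
    by_cases hi : w.im = 0
    · left; rw [hi]; nlinarith
    · right; rw [show w.re * w.im + w.im * w.re = 2 * (w.re * w.im) by ring]
      exact mul_ne_zero two_ne_zero (mul_ne_zero hw.ne' hi)
  have hre : ∀ w : ℂ, w ^ 2 ∈ Complex.slitPlane → w.re ≠ 0 := fun w hw h0 => by
    rw [Complex.mem_slitPlane_iff, sq, Complex.mul_re, Complex.mul_im, h0] at hw
    rcases hw with hw | hw
    · nlinarith [mul_self_nonneg w.im]
    · simp at hw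
  have hexp : ∀ w : ℂ, 0 < w.re → Complex.exp (Complex.log (w ^ 2) / 2) = w := fun w hw => by
    have h0 : w ≠ 0 := by rintro rfl; simp at hw
    have harg := Complex.abs_arg_lt_pi_div_two_iff.mpr (Or.inl hw)
    have h1 := abs_lt.mp harg
    have h2 : Complex.log (w ^ 2) = 2 * Complex.log w := by
      rw [sq, Complex.log_mul h0 h0 ⟨by linarith, by linarith⟩, two_mul]
    rw [h2, mul_div_cancel_left₀ _ two_ne_zero, Complex.exp_log h0]
  have hsm : ContDiff ℝ ∞ fun T : E[k] => ctr (cL T) := (contDiff_clinear ctr).comp contDiff_cL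
  have hA : ctr (cL (isoL A)) ∈ Complex.slitPlane := by
    rw [hctr A _ h.mem h.pinAd]; exact hsq _ h.re_pos
  refine ⟨fun T => (Complex.exp (Complex.log (ctr (cL T)) / 2))⁻¹ • cL T, ?_, ?_⟩
  · refine ContDiffAt.fun_smul ?_ contDiff_cL.contDiffAt
    have h1 : ContDiffAt ℝ ∞ (fun T : E[k] => Complex.log (ctr (cL T))) (isoL A) :=
      ContDiffAt.comp (g := Complex.log) (isoL A)
        ((Complex.contDiffAt_log (n := ∞) hA).restrict_scalars ℝ) hsm.contDiffAt
    have h2 := (h1.div_const 2).cexp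
    exact h2.inv (Complex.exp_ne_zero _)
  · have hev : ∀ᶠ T in 𝓝 (isoL A), ctr (cL T) ∈ Complex.slitPlane :=
      hsm.continuous.continuousAt (Complex.isOpen_slitPlane.mem_nhds hA)
    filter_upwards [hev] with T hT B hB
    have hB' : HasPosLift B := by
      obtain ⟨c, hc, hcB⟩ := exists_PinR_pinAd B
      rw [← hB, hctr B c hc hcB] at hT
      rcases lt_or_gt_of_ne (hre _ hT) with h0 | h0
      · refine ⟨pinNeg k * c, mul_mem pinNeg_mem_PinR hc, by
          rw [pinAd_mul', pinAd_scalar, one_mul, hcB], ?_⟩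
        rw [pv_pinNeg_mul, map_neg, Complex.neg_re]; linarith
      · exact ⟨c, hc, hcB, h0⟩
    refine ⟨hB', ?_⟩
    have h1 := cL_pinAd hB'.mem
    rw [hB'.pinAd] at h1
    rw [← hB, hctr B _ hB'.mem hB'.pinAd, hexp _ hB'.re_pos, h1, smul_smul, inv_mul_cancel₀,
      one_smul]
    intro h0
    have := hB'.re_pos
    rw [h0] at this
    simp at this

end PinLift

/-! ## The homomorphism `U(k) → Spin_c(2k)` -/

section UnitaryLift

variable {k : ℕ}

theorem stdJ_apply_even (v : Euc k) (i : Fin (2 * k)) (h : (i : ℕ) % 2 = 0) :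
    stdJ k v i = -v ⟨i + 1, by omega⟩ := by simp [stdJ, h]

theorem stdJ_apply_odd (v : Euc k) (i : Fin (2 * k)) (h : ¬ (i : ℕ) % 2 = 0) :
    stdJ k v i = v ⟨i - 1, by omega⟩ := by simp [stdJ, h]

theorem stdJ_sq (v : Euc k) : stdJ k (stdJ k v) = -v := by
  ext i
  by_cases h : (i : ℕ) % 2 = 0
  · rw [stdJ_apply_even _ _ h, stdJ_apply_odd _ _ (by simp; omega)]
    simp
  · rw [stdJ_apply_odd _ _ h, stdJ_apply_even _ _ (by simp; omega)]
    have : (⟨(i : ℕ) - 1 + 1, by omega⟩ : Fin (2 * k)) = i := by ext; simp; omega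
    simp [this]

def stdSwap (k : ℕ) (i : Fin (2 * k)) : Fin (2 * k) :=
  if h : (i : ℕ) % 2 = 0 then ⟨i + 1, by omega⟩ else ⟨i - 1, by omega⟩

theorem stdSwap_invol (i : Fin (2 * k)) : stdSwap k (stdSwap k i) = i := by
  ext
  by_cases h : (i : ℕ) % 2 = 0
  · have h2 : ¬ ((i : ℕ) + 1) % 2 = 0 := by omega
    simp [stdSwap, h, h2]
  · have h2 : ((i : ℕ) - 1) % 2 = 0 := by omega
    simp [stdSwap, h, h2]
    omega

theorem inner_stdJ (v w : Euc k) : inner ℝ (stdJ k v) w = -inner ℝ v (stdJ k w) := by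
  simp only [PiLp.inner_apply, RCLike.inner_apply, conj_trivial]
  rw [← Finset.sum_neg_distrib]
  refine Finset.sum_nbij' (stdSwap k) (stdSwap k) (by simp) (by simp)
    (fun i _ => stdSwap_invol i) (fun i _ => stdSwap_invol i) fun i _ => ?_
  by_cases h : (i : ℕ) % 2 = 0
  · have hs : stdSwap k i = ⟨i + 1, by omega⟩ := by simp [stdSwap, h]
    rw [stdJ_apply_even _ _ h, hs, stdJ_apply_odd _ _ (by simp; omega)]
    simp
  · have hs : stdSwap k i = ⟨i - 1, by omega⟩ := by simp [stdSwap, h]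
    rw [stdJ_apply_odd _ _ h, hs, stdJ_apply_even _ _ (by simp; omega)]
    have : (⟨(i : ℕ) - 1 + 1, by omega⟩ : Fin (2 * k)) = i := by ext; simp; omega
    simp [this]

theorem inner_stdJ_stdJ (v w : Euc k) : inner ℝ (stdJ k v) (stdJ k w) = inner ℝ v w := by
  rw [inner_stdJ, stdJ_sq, inner_neg_right, neg_neg]

theorem inner_stdJ_self (v : Euc k) : inner ℝ (stdJ k v) v = 0 := by
  have h := inner_stdJ v v
  rw [real_inner_comm] at h ⊢
  linarith

theorem norm_stdJ (v : Euc k) : ‖stdJ k v‖ = ‖v‖ := by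
  rw [← sq_eq_sq₀ (norm_nonneg _) (norm_nonneg _), ← real_inner_self_eq_norm_sq,
    ← real_inner_self_eq_norm_sq, inner_stdJ_stdJ]

/-- The isotropic vector `J v - i v`. -/
def isoVec (v : Euc k) : CCl k := cvec (stdJ k v) - Complex.I • cvec v

theorem cvec_anti (v w : Euc k) :
    cvec v * cvec w = ((-2 * inner ℝ v w : ℝ) : ℂ) • 1 - cvec w * cvec v := by
  rw [← Algebra.algebraMap_eq_smul_one, ← cvec_mul_add_swap, add_sub_cancel_right]

theorem isoVec_anti (v w : Euc k) : isoVec v * isoVec w = -(isoVec w * isoVec v) := by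
  simp only [isoVec, sub_mul, mul_sub, smul_mul_assoc, mul_smul_comm, smul_sub]
  rw [cvec_anti (stdJ k v) (stdJ k w), cvec_anti (stdJ k v) w, cvec_anti v (stdJ k w),
    cvec_anti v w, inner_stdJ_stdJ, inner_stdJ v w]
  simp only [smul_sub, smul_smul]
  push_cast
  match_scalars <;> ring_nf <;> simp

theorem isoVec_stdJ (v : Euc k) : isoVec (stdJ k v) = -Complex.I • isoVec v := by
  rw [isoVec, isoVec, stdJ_sq, cvec_neg, smul_sub, smul_smul, neg_mul, Complex.I_mul_I]
  simp
  abel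

theorem isoVec_add (v w : Euc k) : isoVec (v + w) = isoVec v + isoVec w := by
  simp only [isoVec, map_add, cvec_add, smul_add]; abel

theorem isoVec_smul (c : ℝ) (v : Euc k) : isoVec (c • v) = (c : ℂ) • isoVec v := by
  simp only [isoVec, map_smul, cvec_smul, smul_sub, smul_smul, mul_comm]

def cBasis (j : Fin k) : Euc k := single ⟨2 * j, by omega⟩ 1

theorem stdJ_cBasis (j : Fin k) :
    stdJ k (cBasis j) = single ⟨2 * j + 1, by omega⟩ 1 := by
  ext i
  by_cases h : (i : ℕ) % 2 = 0
  · rw [stdJ_apply_even _ _ h]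
    simp only [cBasis, EuclideanSpace.single_apply, Fin.ext_iff]
    rw [if_neg (by omega), if_neg (by omega), neg_zero]
  · rw [stdJ_apply_odd _ _ h]
    simp only [cBasis, EuclideanSpace.single_apply, Fin.ext_iff]
    congr 1
    simp; omega

theorem euc_induction {motive : Euc k → Prop} (add : ∀ v w, motive v → motive w → motive (v + w))
    (smul : ∀ (c : ℝ) v, motive v → motive (c • v)) (zero : motive 0)
    (even : ∀ j : Fin k, motive (cBasis j)) (odd : ∀ j : Fin k, motive (stdJ k (cBasis j)))
    (v : Euc k) : motive v := by
  have hv : v = ∑ i, v i • single i (1 : ℝ) := by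
    ext j; simp [Finset.sum_apply, Pi.single_apply]
  rw [hv]
  refine Finset.sum_induction _ motive add zero fun i _ => smul _ _ ?_
  by_cases h : (i : ℕ) % 2 = 0
  · convert even ⟨i / 2, by omega⟩ using 1
    rw [cBasis]; congr 1; ext; simp; omega
  · convert odd ⟨i / 2, by omega⟩ using 1
    rw [stdJ_cBasis]; congr 1; ext; simp; omega

def isoProd (l : List (Fin k)) : CCl k := (l.map fun j => isoVec (cBasis j)).prod

theorem isoVec_mul_isoProd {j : Fin k} {l : List (Fin k)} (h : j ∈ l) :
    isoVec (cBasis j) * isoProd l = 0 := by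
  induction l with
  | nil => simp at h
  | cons i l ih =>
    simp only [isoProd, List.map_cons, List.prod_cons] at ih ⊢
    by_cases hij : j = i
    · subst hij
      have h1 := isoVec_anti (cBasis j) (cBasis j)
      have h2 : (2 : ℂ) • (isoVec (cBasis j) * isoVec (cBasis j)) = 0 := by
        rw [two_smul]; nth_rewrite 1 [h1]; simp
      rw [← mul_assoc, (smul_eq_zero.mp h2).resolve_left two_ne_zero, zero_mul]
    · rw [← mul_assoc, isoVec_anti, neg_mul, mul_assoc, ih (List.mem_of_ne_of_mem hij h), mul_zero,
        neg_zero]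

/-- The vacuum vector. -/
def vacuum (k : ℕ) : CCl k := isoProd (List.finRange k)

theorem isoVec_mul_vacuum (v : Euc k) : isoVec v * vacuum k = 0 := by
  induction v using euc_induction with
  | add v w hv hw => rw [isoVec_add, add_mul, hv, hw, add_zero]
  | smul c v hv => rw [isoVec_smul, smul_mul_assoc, hv, smul_zero]
  | zero => simp [isoVec, cvec_eq_sum]
  | even j => exact isoVec_mul_isoProd (List.mem_finRange j)
  | odd j =>
    rw [isoVec_stdJ, smul_mul_assoc, vacuum, isoVec_mul_isoProd (List.mem_finRange j), smul_zero]

theorem unitaryLift_mul_vacuum {c : PinC k} (hc : c ∈ unitaryLift k) :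
    pv c * vacuum k = vacuum k := by
  induction hc using Subgroup.closure_induction with
  | mem x hx =>
    obtain ⟨ζ, v, -, hv, hx⟩ := hx
    have h1 : cvec (stdJ k v) * vacuum k = Complex.I • (cvec v * vacuum k) := by
      have := isoVec_mul_vacuum v
      rw [isoVec, sub_mul, smul_mul_assoc] at this
      exact sub_eq_zero.mp this
    have h2 : cvec v * cvec v = -1 := by rw [cvec_mul_self, hv]; simp
    rw [show pv x = _ from hx, add_mul, smul_mul_assoc, mul_assoc, h1, mul_smul_comm, ← mul_assoc,
      h2, ← Algebra.smul_def, smul_smul, neg_one_mul, smul_neg, ← neg_smul, ← add_smul]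
    have : (1 + ζ) / 2 + -((ζ - 1) / (2 * Complex.I) * Complex.I) = 1 := by
      have := Complex.I_ne_zero
      field_simp
      ring
    rw [this, one_smul]
  | one => rw [pv_one, one_mul]
  | mul x y _ _ hx hy => rw [pv_mul, mul_assoc, hy, hx]
  | inv x _ hx =>
    conv_lhs => rw [← hx]
    rw [← mul_assoc, pv_inv_mul, one_mul]

theorem exists_isoProd_sum (l : List (Fin k)) (hl : l.Nodup) :
    ∃ s : List (CCl k × CCl k), (1 : CCl k) = (s.map fun p => p.1 * isoProd l * p.2).sum := by
  induction l with
  | nil => exact ⟨[(1, 1)], by simp [isoProd]⟩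
  | cons j l ih =>
    obtain ⟨s, hs⟩ := ih (List.nodup_cons.mp hl).2
    have hj := (List.nodup_cons.mp hl).1
    set w := isoVec (cBasis j) with hw
    set w' : CCl k := cvec (stdJ k (cBasis j)) + Complex.I • cvec (cBasis j) with hw'
    have hn : ‖cBasis j‖ = 1 := by simp [cBasis]
    have h4 : w' * w + w * w' = (-4 : ℂ) • 1 := by
      have e1 : cvec (cBasis j) * cvec (cBasis j) = -1 := by rw [cvec_mul_self, hn]; simp
      have e2 : cvec (stdJ k (cBasis j)) * cvec (stdJ k (cBasis j)) = -1 := by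
        rw [cvec_mul_self, norm_stdJ, hn]; simp
      rw [hw, hw', isoVec]
      simp only [add_mul, mul_add, sub_mul, mul_sub, smul_mul_assoc, mul_smul_comm, e1, e2,
        smul_smul, smul_neg, Complex.I_mul_I]
      match_scalars <;> ring_nf <;> norm_num
    have hanti : ∀ i ∈ l, w' * isoVec (cBasis i) = -(isoVec (cBasis i) * w') := fun i hi => by
      have hij : j ≠ i := fun h => hj (h ▸ hi)
      have i1 : inner ℝ (cBasis j) (cBasis i) = 0 := by
        rw [cBasis, EuclideanSpace.inner_single_left]
        simp [cBasis, Fin.ext_iff]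
        intro h; exact hij (Fin.ext h)
      have i2 : inner ℝ (stdJ k (cBasis j)) (cBasis i) = 0 := by
        rw [stdJ_cBasis, EuclideanSpace.inner_single_left]
        simp [cBasis]
        omega
      have i3 : inner ℝ (cBasis j) (stdJ k (cBasis i)) = 0 := by
        rw [← neg_eq_zero, ← inner_stdJ, i2]
      rw [hw', isoVec]
      simp only [add_mul, mul_add, sub_mul, mul_sub, smul_mul_assoc, mul_smul_comm]
      rw [cvec_anti (stdJ k (cBasis j)) (stdJ k (cBasis i)), cvec_anti (stdJ k (cBasis j)),
        cvec_anti (cBasis j) (stdJ k (cBasis i)), cvec_anti (cBasis j), inner_stdJ_stdJ, i1, i2, i3]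
      simp only [smul_sub, smul_smul]
      push_cast
      module
    have hcomm : ∀ l' : List (Fin k), (∀ i ∈ l', w' * isoVec (cBasis i) =
        -(isoVec (cBasis i) * w')) → w' * isoProd l' = (-1 : ℂ) ^ l'.length • (isoProd l' * w') := by
      intro l' h
      induction l' with
      | nil => simp [isoProd]
      | cons i l' ih' =>
        have h1 := ih' fun i' hi' => h i' (List.mem_cons_of_mem _ hi')
        simp only [isoProd, List.map_cons, List.prod_cons, List.length_cons] at h1 ⊢
        rw [← mul_assoc, h i List.mem_cons_self, neg_mul, mul_assoc, h1, pow_succ, mul_smul_comm,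
          mul_assoc]
        simp
    have h5 := hcomm l hanti
    set ε : ℂ := (-1 : ℂ) ^ l.length with hε
    have h6 : isoProd l = (-1 / 4 : ℂ) • (w' * isoProd (j :: l)) +
        (-1 / 4 * ε : ℂ) • (isoProd (j :: l) * w') := by
      have e1 : isoProd (j :: l) = w * isoProd l := by simp [isoProd, hw]
      have e2 : isoProd (j :: l) * w' = ε • (w * (w' * isoProd l)) := by
        rw [h5, e1, mul_smul_comm, smul_smul, hε, ← mul_pow, mul_assoc]; simp
      have hεε : ε * ε = 1 := by rw [hε, ← mul_pow]; simp
      rw [e2, e1, smul_smul, mul_assoc (-1 / 4 : ℂ), hεε, mul_one, ← smul_add, ← mul_assoc,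
        ← mul_assoc, ← add_mul, h4, smul_mul_assoc, one_mul, smul_smul]
      norm_num
    refine ⟨s.map (fun p => ((-1 / 4 : ℂ) • (p.1 * w'), p.2)) ++
      s.map (fun p => ((-1 / 4 * ε : ℂ) • p.1, w' * p.2)), ?_⟩
    rw [hs]
    clear hs
    induction s with
    | nil => simp
    | cons p s ihs =>
      simp only [List.map_cons, List.sum_cons, ihs, List.map_append, List.sum_append, List.map_map]
      have : p.1 * isoProd l * p.2 = (-1 / 4 : ℂ) • (p.1 * w') * isoProd (j :: l) * p.2 +
          (-1 / 4 * ε : ℂ) • p.1 * isoProd (j :: l) * (w' * p.2) := by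
        rw [h6]
        simp only [mul_add, add_mul, smul_mul_assoc, mul_smul_comm, mul_assoc]
      rw [this]
      abel

theorem exists_unitaryLift_smooth : ∃ F : E[k] → CCl k, ContDiff ℝ ∞ F ∧
    ∀ c ∈ unitaryLift k, F (isoL (pinAd c)) = pv c := by
  obtain ⟨s, hs⟩ := exists_isoProd_sum (List.finRange k) (List.nodup_finRange k)
  obtain ⟨F, hF, hF'⟩ := exists_conj_sum_smooth (s.map fun p => (p.1, vacuum k * p.2))
  refine ⟨F, hF, fun c hc => ?_⟩
  rw [hF', List.map_map]
  have h1 : pv c⁻¹ * vacuum k = vacuum k := unitaryLift_mul_vacuum (inv_mem hc)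
  have : ((fun p : CCl k × CCl k => p.1 * pv c⁻¹ * p.2) ∘ fun p : CCl k × CCl k =>
      (p.1, vacuum k * p.2)) = fun p => p.1 * isoProd (List.finRange k) * p.2 := by
    funext p
    simp only [Function.comp]
    rw [mul_assoc p.1, ← mul_assoc (pv c⁻¹), h1, ← mul_assoc]
    rfl
  rw [this, ← hs, mul_one]

theorem unitaryLift_pinAd_injective {c d : PinC k} (hc : c ∈ unitaryLift k)
    (hd : d ∈ unitaryLift k) (h : pinAd c = pinAd d) : c = d := by
  obtain ⟨F, -, hF⟩ := exists_unitaryLift_smooth (k := k)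
  exact pv_injective (by rw [← hF c hc, ← hF d hd, h])

/-- The Hermitian product of `ℝⁿ = ℂᵏ`. -/
def hermJ (u x : Euc k) : ℂ := ⟨inner ℝ u x, inner ℝ (stdJ k u) x⟩

def smulJ (z : ℂ) (x : Euc k) : Euc k := z.re • x + z.im • stdJ k x

theorem exists_complexReflection {ζ : ℂ} (hζ : ‖ζ‖ = 1) {u : Euc k} (hu : ‖u‖ = 1) :
    ∃ c : PinC k, pv c = algebraMap ℂ (CCl k) ((1 + ζ) / 2) +
        ((ζ - 1) / (2 * Complex.I)) • (cvec u * cvec (stdJ k u)) ∧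
      ∀ x, pinAd c x = x + smulJ ((ζ - 1) * hermJ u x) u := by
  set θ := Complex.arg ζ
  have hζθ : ζ = Complex.exp (θ * Complex.I) := by
    have := Complex.norm_mul_exp_arg_mul_I ζ
    rw [hζ] at this
    simpa using this.symm
  set C := Real.cos (θ / 2)
  set S := Real.sin (θ / 2)
  have hCS : C ^ 2 + S ^ 2 = 1 := Real.cos_sq_add_sin_sq _
  have hre : ζ.re = 1 - 2 * S ^ 2 := by
    rw [hζθ, Complex.exp_ofReal_mul_I_re, show θ = 2 * (θ / 2) by ring, Real.cos_two_mul]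
    change 2 * C ^ 2 - 1 = _
    linarith
  have him : ζ.im = 2 * S * C := by
    rw [hζθ, Complex.exp_ofReal_mul_I_im, show θ = 2 * (θ / 2) by ring, Real.sin_two_mul]
  have hζe : ζ = ⟨1 - 2 * S ^ 2, 2 * S * C⟩ := Complex.ext hre him
  have hs : ‖(⟨C, S⟩ : ℂ)‖ = 1 := by
    rw [← sq_eq_sq₀ (norm_nonneg _) zero_le_one, Complex.sq_norm, Complex.normSq_mk]
    linarith
  have huJ : inner ℝ u (stdJ k u) = 0 := by rw [real_inner_comm]; exact inner_stdJ_self u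
  have huu : inner ℝ u u = 1 := by rw [real_inner_self_eq_norm_sq, hu]; norm_num
  set w : Euc k := -C • u + S • stdJ k u
  have hw : ‖w‖ = 1 := by
    rw [← sq_eq_sq₀ (norm_nonneg _) zero_le_one, ← real_inner_self_eq_norm_sq]
    simp only [w, inner_add_left, inner_add_right, inner_smul_left, inner_smul_right,
      inner_stdJ_stdJ, huJ, inner_stdJ_self, huu, conj_trivial]
    linarith
  refine ⟨pinScalar k ⟨C, S⟩ hs * (pinVec u * pinVec w), ?_, fun x => ?_⟩
  · rw [pv_mul, pv_mul, pv_pinScalar, pv_pinVec hu, pv_pinVec hw, cvec_add, cvec_smul, cvec_smul,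
      mul_add, mul_smul_comm, mul_smul_comm, cvec_mul_self, hu, mul_add, ← Algebra.smul_def,
      ← Algebra.smul_def, smul_smul, Algebra.algebraMap_eq_smul_one,
      Algebra.algebraMap_eq_smul_one, smul_smul, smul_smul]
    congr 2
    · rw [hζe]
      apply Complex.ext <;> simp [Complex.div_re, Complex.div_im, Complex.normSq_apply] <;> nlinarith
    · have hI : (ζ - 1) / (2 * Complex.I) = -(Complex.I / 2) * (ζ - 1) := by
        field_simp
        rw [Complex.I_sq]; ring
      rw [hI, hζe]
      apply Complex.ext <;> simp <;> nlinarith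
  · rw [pinAd_mul, pinAd_scalar, pinAd_mul, pinAd_vec hu, pinAd_vec hw]
    rw [show ∀ y, (1 : O[k]) y = y from fun y => rfl]
    simp only [Submodule.reflection_singleton_apply, hu, hw, smulJ, hermJ]
    have hwx : inner ℝ w x = -C * inner ℝ u x + S * inner ℝ (stdJ k u) x := by
      simp only [w, inner_add_left, inner_smul_left, conj_trivial]
    have huw : inner ℝ u w = -C := by
      simp only [w, inner_add_right, inner_smul_right, huJ, huu]; ring
    simp only [inner_sub_right, inner_smul_right, huw, hwx, Complex.mul_re, Complex.mul_im,
      Complex.sub_re, Complex.sub_im, Complex.one_re, Complex.one_im, hre, him, two_smul, map_one,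
      one_pow, div_one, w, inner_add_right]
    have hC2 : C ^ 2 = 1 - S ^ 2 := by linarith
    match_scalars <;> ring_nf <;> rw [hC2] <;> ring

theorem hermJ_stdJ (u x : Euc k) : hermJ u (stdJ k x) = Complex.I * hermJ u x := by
  apply Complex.ext
  · simp [hermJ, inner_stdJ]
  · simp [hermJ, inner_stdJ_stdJ]

theorem stdJ_smulJ (z : ℂ) (x : Euc k) : stdJ k (smulJ z x) = smulJ (Complex.I * z) x := by
  simp only [smulJ, map_add, map_smul, stdJ_sq, Complex.mul_re, Complex.mul_im, Complex.I_re,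
    Complex.I_im]
  module

theorem pinAd_stdJ_of_mem {c : PinC k} (hc : c ∈ unitaryLift k) (v : Euc k) :
    pinAd c (stdJ k v) = stdJ k (pinAd c v) := by
  induction hc using Subgroup.closure_induction generalizing v with
  | mem x hx =>
    obtain ⟨ζ, u, hζ, hu, hx⟩ := hx
    obtain ⟨c, hc, h⟩ := exists_complexReflection hζ hu
    have : x = c := pv_injective ((show pv x = _ from hx).trans hc.symm)
    rw [this, h, h, map_add, stdJ_smulJ, hermJ_stdJ]
    congr 2
    ring
  | one => simp [pinAd_one]
  | mul x y _ _ hx hy => rw [pinAd_mul, pinAd_mul, hy, hx]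
  | inv x _ hx =>
    apply (pinAd x).injective
    rw [hx, ← pinAd_mul, ← pinAd_mul, mul_inv_cancel]
    simp [pinAd_one]

theorem pinDeg_of_mem_unitaryLift {c : PinC k} (hc : c ∈ unitaryLift k) : pinDeg c = 0 := by
  have := pinDeg_unitaryLift_mul hc 1
  rwa [mul_one, pinDeg_one] at this

theorem exists_complexReflection_map {v w : Euc k} (hn : ‖v‖ = ‖w‖) (hvw : w ≠ v) :
    ∃ c ∈ unitaryLift k, pinAd c w = v ∧
      ∀ x, inner ℝ (v - w) x = 0 → inner ℝ (stdJ k (v - w)) x = 0 → pinAd c x = x := by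
  set d := v - w with hd
  have hd0 : d ≠ 0 := fun h => hvw (sub_eq_zero.mp h).symm
  have hdn : ‖d‖ ≠ 0 := norm_ne_zero_iff.mpr hd0
  set α := hermJ d v with hα
  have hre : 2 * α.re = ‖d‖ ^ 2 := by
    have h1 : α.re = inner ℝ d v := rfl
    have h2 : ‖d‖ ^ 2 = ‖v‖ ^ 2 - 2 * inner ℝ v w + ‖w‖ ^ 2 := norm_sub_sq_real v w
    rw [h1, hd, inner_sub_left, real_inner_self_eq_norm_sq, real_inner_comm, h2, ← hn]
    rw [real_inner_comm]
    ring
  have hα0 : α ≠ 0 := fun h => by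
    rw [h] at hre; simp at hre; exact hdn (pow_eq_zero_iff two_ne_zero |>.mp hre.symm)
  have hα0' : (starRingEnd ℂ) α ≠ 0 := (map_ne_zero _).mpr hα0
  have hdw : hermJ d w = -(starRingEnd ℂ) α := by
    have e1 : inner ℝ d w = inner ℝ d v - ‖d‖ ^ 2 := by
      rw [← real_inner_self_eq_norm_sq, ← inner_sub_right, hd, sub_sub_cancel]
    have e2 : inner ℝ (stdJ k d) w = inner ℝ (stdJ k d) v := by
      have := inner_stdJ_self d
      nth_rewrite 2 [hd] at this
      rw [inner_sub_right] at this
      linarith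
    apply Complex.ext
    · change inner ℝ d w = _
      rw [e1, ← hre]
      simp [hα, hermJ]; ring
    · change inner ℝ (stdJ k d) w = _
      rw [e2]
      simp [hα, hermJ]
  set ζ := -α / (starRingEnd ℂ) α
  have hζ : ‖ζ‖ = 1 := by
    simp only [ζ, norm_div, norm_neg, RCLike.norm_conj]
    exact div_self (norm_ne_zero_iff.mpr hα0)
  set u := ‖d‖⁻¹ • d with hu'
  have hu : ‖u‖ = 1 := by rw [hu', norm_smul, norm_inv, norm_norm, inv_mul_cancel₀ hdn]
  obtain ⟨c, hc, h⟩ := exists_complexReflection hζ hu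
  have herm : ∀ x, hermJ u x = (‖d‖⁻¹ : ℝ) * hermJ d x := fun x => by
    apply Complex.ext <;> simp [hermJ, hu', inner_smul_left]
  refine ⟨c, Subgroup.subset_closure ⟨ζ, u, hζ, hu, hc⟩, ?_, fun x h1 h2 => ?_⟩
  · rw [h, herm, hdw]
    have e : (ζ - 1) * ((‖d‖⁻¹ : ℝ) * -(starRingEnd ℂ) α) = ((‖d‖ : ℝ) : ℂ) := by
      have : α + (starRingEnd ℂ) α = ((‖d‖ ^ 2 : ℝ) : ℂ) := by
        rw [Complex.add_conj, hre]
      have hdn' : ((‖d‖ : ℝ) : ℂ) ≠ 0 := by exact_mod_cast hdn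
      simp only [ζ]
      push_cast at this ⊢
      field_simp
      linear_combination this
    rw [e, smulJ, hu', Complex.ofReal_re, Complex.ofReal_im, zero_smul, add_zero, smul_smul,
      mul_inv_cancel₀ hdn, one_smul, hd, add_sub_cancel]
  · have : hermJ d x = 0 := Complex.ext h1 h2
    rw [h, herm, this]
    simp [smulJ]

theorem exists_mem_unitaryLift (A : O[k])
    (hA : ∀ v, A (stdJ k v) = stdJ k (A v)) : ∃ c ∈ unitaryLift k, pinAd c = A := by
  let fix : O[k] → Submodule ℝ (Euc k) := fun A =>
    LinearMap.eqLocus (A.toLinearEquiv : Euc k →ₗ[ℝ] Euc k) LinearMap.id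
  have hfix : ∀ A v, v ∈ fix A ↔ A v = v := fun A v => Iff.rfl
  induction hn : 2 * k - Module.finrank ℝ (fix A) using Nat.strong_induction_on generalizing A with
  | _ n ih =>
    by_cases hv : ∃ v, A v ≠ v
    · obtain ⟨v, hv⟩ := hv
      obtain ⟨c, hc, h1, h2⟩ := exists_complexReflection_map (A.norm_map v).symm hv
      set B : O[k] := A.trans (pinAd c)
      have hB : ∀ x, B x = pinAd c (A x) := fun x => rfl
      have hle : fix A < fix B := by
        refine lt_of_le_of_ne (fun x hx => ?_) fun h => hv ?_
        · rw [hfix] at hx ⊢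
          rw [hB, hx]
          apply h2
          · have : inner ℝ (A v) x = inner ℝ v x := by
              conv_lhs => rw [← hx]
              exact A.inner_map_map _ _
            rw [inner_sub_left, this, sub_self]
          · have : inner ℝ (A (stdJ k v)) x = inner ℝ (stdJ k v) x := by
              conv_lhs => rw [← hx]
              exact A.inner_map_map _ _
            rw [map_sub, inner_sub_left, ← hA, this, sub_self]
        · rw [← hfix, h, hfix, hB, h1]
      have hlt := Submodule.finrank_lt_finrank_of_lt hle
      have hle' : Module.finrank ℝ (fix B) ≤ 2 * k := by
        simpa using Submodule.finrank_le (fix B)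
      obtain ⟨c', hc', h'⟩ := ih _ (by omega) B
        (fun x => by rw [hB, hB, hA, pinAd_stdJ_of_mem hc]) rfl
      refine ⟨c⁻¹ * c', mul_mem (inv_mem hc) hc', ?_⟩
      ext1 x
      rw [pinAd_mul, h', hB, ← pinAd_mul, inv_mul_cancel, pinAd_one]
      rfl
    · push Not at hv
      refine ⟨1, one_mem _, ?_⟩
      ext1 x
      rw [pinAd_one, hv]
      rfl

theorem det_pos_of_unitary (A : O[k]) (hA : ∀ v, A (stdJ k v) = stdJ k (A v)) :
    0 < LinearMap.det (A.toLinearEquiv : Euc k →ₗ[ℝ] Euc k) := by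
  obtain ⟨c, hc, rfl⟩ := exists_mem_unitaryLift A hA
  have h := pinDeg_of_mem_unitaryLift hc
  rw [← orthDeg_pinAd, orthDeg] at h
  by_contra h'
  rw [if_neg h'] at h
  exact one_ne_zero h

end UnitaryLift

/-! ## Hadamard's lemma -/

section Hadamard

open MeasureTheory Set

variable {E : Type*} [NormedAddCommGroup E] [NormedSpace ℝ E]

theorem contDiff_integral_unitInterval {G : E × ℝ → ℝ} (hG : ContDiff ℝ ∞ G) :
    ContDiff ℝ ∞ fun q => ∫ s in (0 : ℝ)..1, G (q, s) := by
  let χ : ContDiffBump (0 : ℝ) := ⟨2, 3, by norm_num, by norm_num⟩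
  let f : ℝ → ℝ := indicator (Icc (-1) 0) 1
  let g : E → ℝ → ℝ := fun q s => χ s * G (q, s)
  have hf : LocallyIntegrable f := by
    apply Integrable.locallyIntegrable
    rw [integrable_indicator_iff measurableSet_Icc]
    exact integrableOn_const (by simp)
  have hg : ContDiff ℝ ∞ (fun p : E × ℝ => g p.1 p.2) := by
    refine ContDiff.mul (χ.contDiff.comp contDiff_snd) ?_
    exact hG
  have h := contDiffOn_convolution_right_with_param (𝕜 := ℝ) (f := f) (n := ⊤) (μ := volume)
    (ContinuousLinearMap.mul ℝ ℝ) (g := g) (s := univ) (k := Metric.closedBall 0 3) isOpen_univ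
    (isCompact_closedBall _ _) (fun q s _ hs => by
      have : χ s = 0 := χ.zero_of_le_dist (by
        simp only [Metric.mem_closedBall, not_le] at hs; exact hs.le)
      simp [g, this]) hf (by rw [univ_prod_univ, contDiffOn_univ]; exact hg)
  rw [univ_prod_univ, contDiffOn_univ] at h
  have h2 : ContDiff ℝ ∞ fun q : E => (convolution f (g q) (ContinuousLinearMap.mul ℝ ℝ) volume) 0 :=
    h.comp (f := fun q : E => (q, (0 : ℝ))) (contDiff_prodMk_left 0)
  convert h2 using 2 with q
  rw [convolution_def]
  have h3 : ∀ t, (ContinuousLinearMap.mul ℝ ℝ) (f t) (g q (0 - t)) =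
      indicator (Icc (-1) 0) (fun t => G (q, -t)) t := fun t => by
    by_cases ht : t ∈ Icc (-1 : ℝ) 0
    · have : χ (-t) = 1 := χ.one_of_mem_closedBall (by
        simp only [Metric.mem_closedBall, dist_zero_right, norm_neg, Real.norm_eq_abs]
        change |t| ≤ 2
        rw [abs_le]; constructor <;> linarith [ht.1, ht.2])
      simp [f, ht, g, this]
    · simp [f, ht]
  simp only [h3]
  rw [integral_indicator measurableSet_Icc, integral_Icc_eq_integral_Ioc,
    ← intervalIntegral.integral_of_le (by norm_num),
    intervalIntegral.integral_comp_neg (fun t => G (q, t))]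
  simp

theorem exists_eq_linear_mul {w : E → ℝ} (hw : ContDiff ℝ ∞ w) (l : E →L[ℝ] ℝ) {d : E}
    (hd : l d = 1) (h0 : ∀ q, l q = 0 → w q = 0) :
    ∃ H : E → ℝ, ContDiff ℝ ∞ H ∧ ∀ q, w q = l q * H q := by
  let c : E × ℝ → E := fun p => p.1 - ((1 - p.2) * l p.1) • d
  have hc : ContDiff ℝ ∞ c := by
    refine contDiff_fst.sub (ContDiff.smul ?_ contDiff_const)
    exact (contDiff_const.sub contDiff_snd).mul (l.contDiff.comp contDiff_fst)
  have hdw : ContDiff ℝ ∞ fun q => fderiv ℝ w q d :=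
    (hw.fderiv_right (m := ∞) (by simp)).clm_apply contDiff_const
  refine ⟨_, contDiff_integral_unitInterval (hdw.comp hc), fun q => ?_⟩
  have hder : ∀ s : ℝ, HasDerivAt (fun s => w (c (q, s))) (fderiv ℝ w (c (q, s)) d * l q) s :=
    fun s => by
    have h1 : HasDerivAt (fun s => c (q, s)) (l q • d) s := by
      have : HasDerivAt (fun s : ℝ => (1 - s) * l q) (-1 * l q) s :=
        ((hasDerivAt_id s).const_sub 1).mul_const (l q)
      simpa [c] using (this.smul_const d).const_sub q
    have h2 := ((hw.differentiable (by simp)).differentiableAt (x := c (q, s))).hasFDerivAt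
    have h3 := h2.comp_hasDerivAt s h1
    rw [map_smul, smul_eq_mul, mul_comm] at h3
    exact h3
  have hint := intervalIntegral.integral_eq_sub_of_hasDerivAt (a := 0) (b := 1)
    (fun s _ => hder s) (Continuous.intervalIntegrable (by
      have : Continuous fun s : ℝ => fderiv ℝ w (c (q, s)) d :=
        (hdw.comp hc).continuous.comp (Continuous.prodMk_right q)
      fun_prop) _ _)
  rw [intervalIntegral.integral_mul_const] at hint
  have h1 : c (q, 1) = q := by simp [c]
  have h2 : w (c (q, 0)) = 0 := h0 _ (by simp [c, hd])
  rw [h1, h2, sub_zero] at hint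
  rw [← hint, mul_comm]
  rfl

theorem hadamard_euclidean [FiniteDimensional ℝ E] {y u : E → ℝ} {p : E}
    (hy : ∀ᶠ q in 𝓝 p, ContDiffAt ℝ ∞ y q) (hu : ∀ᶠ q in 𝓝 p, ContDiffAt ℝ ∞ u q)
    (h0 : ∀ᶠ q in 𝓝 p, y q = 0 → u q = 0) (hd : y p = 0 → fderiv ℝ y p ≠ 0) :
    ∃ h : E → ℝ, (∀ᶠ q in 𝓝 p, ContDiffAt ℝ ∞ h q) ∧ ∀ᶠ q in 𝓝 p, u q = y q * h q := by
  by_cases hp : y p = 0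
  swap
  · have hne : ∀ᶠ q in 𝓝 p, y q ≠ 0 := hy.self_of_nhds.continuousAt.eventually_ne hp
    refine ⟨fun q => u q / y q, ?_, ?_⟩
    · filter_upwards [hy, hu, hne] with q h1 h2 h3 using h2.div h1 h3
    · filter_upwards [hne] with q h3
      field_simp
  set l := fderiv ℝ y p with hl
  obtain ⟨d, hld⟩ : ∃ d, l d = 1 := by
    obtain ⟨d, h⟩ : ∃ d, l d ≠ 0 := by
      by_contra! h
      exact hd hp (ContinuousLinearMap.ext h)
    exact ⟨(l d)⁻¹ • d, by simp [h]⟩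
  let F : E → E := fun q => q + (y q - l q) • d
  have hF : ∀ q, ContDiffAt ℝ ∞ y q → ContDiffAt ℝ ∞ F q := fun q hq =>
    contDiffAt_id.add ((hq.sub l.contDiff.contDiffAt).smul contDiffAt_const)
  have hlF : ∀ q, l (F q) = y q := fun q => by simp [F, hld]
  have hdF : HasFDerivAt F ((ContinuousLinearEquiv.refl ℝ E : E ≃L[ℝ] E) : E →L[ℝ] E) p := by
    have h1 : HasFDerivAt y l p := (hy.self_of_nhds.differentiableAt (by simp)).hasFDerivAt
    have h2 : HasFDerivAt (fun q => y q - l q) (l - l) p := h1.sub l.hasFDerivAt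
    have h3 := (hasFDerivAt_id p).add (h2.smul_const d)
    rw [sub_self, ContinuousLinearMap.zero_smulRight, add_zero] at h3
    exact h3
  have hFp := hF p hy.self_of_nhds
  have hn : (∞ : WithTop ℕ∞) ≠ 0 := by simp
  set Φ := hFp.toOpenPartialHomeomorph F hdF hn with hΦ
  have hpΦ : p ∈ Φ.source := hFp.mem_toOpenPartialHomeomorph_source hdF hn
  have hΦF : ∀ q, Φ q = F q := fun q => rfl
  have hsymm : ContDiffAt ℝ ∞ Φ.symm (F p) := hFp.to_localInverse hdF hn
  have hev : ∀ᶠ q in 𝓝 p, ContDiffAt ℝ ∞ Φ.symm (F q) := by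
    have h1 : ∀ᶠ q in 𝓝 p, fderiv ℝ F q ∈ range ((↑) : (E ≃L[ℝ] E) → E →L[ℝ] E) := by
      have hc : ContinuousAt (fderiv ℝ F) p := (hFp.fderiv_right (m := ∞) (by simp)).continuousAt
      apply hc.eventually
      rw [hdF.fderiv]
      exact ContinuousLinearEquiv.nhds _
    filter_upwards [h1, hy, Φ.open_source.mem_nhds hpΦ] with q ⟨e, he⟩ hq hqs
    refine Φ.contDiffAt_symm (f₀' := e) (Φ.map_source hqs) ?_ ?_
    · change HasFDerivAt F (e : E →L[ℝ] E) (Φ.symm (Φ q))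
      rw [Φ.left_inv hqs, he]
      exact ((hF q hq).differentiableAt (by simp)).hasFDerivAt
    · change ContDiffAt ℝ ∞ F (Φ.symm (Φ q))
      rw [Φ.left_inv hqs]
      exact hF q hq
  have htend : Filter.Tendsto Φ.symm (𝓝 (F p)) (𝓝 p) := by
    have := hsymm.continuousAt.tendsto
    rwa [← hΦF p, Φ.left_inv hpΦ] at this
  have hgood : ∀ᶠ r in 𝓝 (F p), ContDiffAt ℝ ∞ (fun r => u (Φ.symm r)) r ∧
      (l r = 0 → u (Φ.symm r) = 0) := by
    have hr : ∀ᶠ r in 𝓝 (F p), r ∈ Φ.target := Φ.open_target.mem_nhds (Φ.map_source hpΦ)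
    filter_upwards [htend.eventually hev, htend.eventually hu, htend.eventually h0, hr]
      with r h1 h2 h3 h4
    have hFr : F (Φ.symm r) = r := Φ.right_inv h4
    rw [hFr] at h1
    refine ⟨h2.comp r h1, fun h => h3 ?_⟩
    rw [← hlF, hFr, h]
  obtain ⟨ε, hε, hball⟩ := Metric.eventually_nhds_iff_ball.mp hgood
  let χ : ContDiffBump (F p) := ⟨ε / 3, ε / 2, by positivity, by linarith⟩
  let w : E → ℝ := fun r => χ r * u (Φ.symm r)
  have hw : ContDiff ℝ ∞ w := by
    rw [contDiff_iff_contDiffAt]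
    intro r
    by_cases hr : r ∈ Metric.ball (F p) ε
    · exact χ.contDiff.contDiffAt.mul (hball r hr).1
    · have : ∀ᶠ r' in 𝓝 r, w r' = 0 := by
        have : ∀ᶠ r' in 𝓝 r, r' ∉ Metric.closedBall (F p) (ε / 2) := by
          apply Metric.isClosed_closedBall.isOpen_compl.mem_nhds
          simp only [Metric.mem_ball, mem_compl_iff, Metric.mem_closedBall] at hr ⊢
          linarith
        filter_upwards [this] with r' hr'
        have : χ r' = 0 := χ.zero_of_le_dist (by
          simp only [Metric.mem_closedBall, not_le] at hr'; exact hr'.le)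
        simp [w, this]
      exact contDiffAt_const.congr_of_eventuallyEq this
  obtain ⟨H, hH, hwH⟩ := exists_eq_linear_mul hw l hld fun r hr => by
    by_cases hb : r ∈ Metric.ball (F p) ε
    · simp [w, (hball r hb).2 hr]
    · have : χ r = 0 := χ.zero_of_le_dist (by
        simp only [Metric.mem_ball, not_lt] at hb
        change ε / 2 ≤ _; linarith)
      simp [w, this]
  refine ⟨fun q => H (F q), ?_, ?_⟩
  · filter_upwards [hy] with q hq using hH.contDiffAt.comp q (hF q hq)
  · have h1 : ∀ᶠ q in 𝓝 p, χ (F q) = 1 := (hFp.continuousAt.eventually χ.eventuallyEq_one)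
    filter_upwards [h1, Φ.open_source.mem_nhds hpΦ] with q hq hqs
    have := hwH (F q)
    rw [hlF] at this
    rw [← this]
    simp only [w, hq, one_mul]
    rw [← hΦF, Φ.left_inv hqs]

end Hadamard

/-! ## Smooth functions near a point -/

section SmoothNear

variable {k : ℕ} {M : Type u} [TopologicalSpace M] [ChartedSpace (Euc k) M]
variable {F : Type*} [NormedAddCommGroup F] [NormedSpace ℝ F]
variable {F' : Type*} [NormedAddCommGroup F'] [NormedSpace ℝ F']
variable {F'' : Type*} [NormedAddCommGroup F''] [NormedSpace ℝ F'']

/-- The function `f` is smooth on a neighbourhood of `m`. -/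
def SmAt (k : ℕ) {M : Type u} [TopologicalSpace M] [ChartedSpace (Euc k) M]
    {F : Type*} [NormedAddCommGroup F] [NormedSpace ℝ F] (f : M → F) (m : M) : Prop :=
  ∀ᶠ m' in 𝓝 m, ContMDiffAt (𝓡 (2 * k)) 𝓘(ℝ, F) ∞ f m'

namespace SmAt

theorem contMDiffAt {f : M → F} {m : M} (h : SmAt k f m) :
    ContMDiffAt (𝓡 (2 * k)) 𝓘(ℝ, F) ∞ f m := h.self_of_nhds

theorem continuousAt {f : M → F} {m : M} (h : SmAt k f m) : ContinuousAt f m :=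
  h.contMDiffAt.continuousAt

theorem nearby {f : M → F} {m : M} (h : SmAt k f m) : ∀ᶠ m' in 𝓝 m, SmAt k f m' :=
  h.eventually_nhds

theorem congr {f g : M → F} {m : M} (h : SmAt k f m) (hfg : ∀ᶠ m' in 𝓝 m, g m' = f m') :
    SmAt k g m := by
  filter_upwards [h, hfg.eventually_nhds] with m' h1 h2
  exact h1.congr_of_eventuallyEq h2

theorem congr_iff {f g : M → F} {m : M} (hfg : ∀ᶠ m' in 𝓝 m, f m' = g m') :
    SmAt k f m ↔ SmAt k g m := ⟨fun h => h.congr (hfg.mono fun _ h => h.symm), fun h => h.congr hfg⟩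

theorem of_contMDiff {f : M → F} (h : ContMDiff (𝓡 (2 * k)) 𝓘(ℝ, F) ∞ f) (m : M) : SmAt k f m :=
  .of_forall fun m' => h m'

theorem contMDiff {f : M → F} (h : ∀ m, SmAt k f m) : ContMDiff (𝓡 (2 * k)) 𝓘(ℝ, F) ∞ f :=
  fun m => (h m).contMDiffAt

theorem const (c : F) (m : M) : SmAt k (fun _ : M => c) m := of_contMDiff contMDiff_const m

theorem comp_of_eventually {G : F → F'} {f : M → F} {m : M} (hf : SmAt k f m)
    (hG : ∀ᶠ m' in 𝓝 m, ∃ G' : F → F', ContDiffAt ℝ ∞ G' (f m') ∧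
      ∀ᶠ m'' in 𝓝 m', G (f m'') = G' (f m'')) : SmAt k (fun m' => G (f m')) m := by
  filter_upwards [hf, hG] with m' h1 ⟨G', h2, h3⟩
  exact ContMDiffAt.congr_of_eventuallyEq (h2.contMDiffAt.comp m' h1) h3

theorem comp_at {G : F → F'} {f : M → F} {m : M} (hf : SmAt k f m)
    (hG : ∀ᶠ m' in 𝓝 m, ContDiffAt ℝ ∞ G (f m')) : SmAt k (fun m' => G (f m')) m :=
  hf.comp_of_eventually (hG.mono fun _ h => ⟨G, h, .of_forall fun _ => rfl⟩)

theorem comp {G : F → F'} (hG : ContDiff ℝ ∞ G) {f : M → F} {m : M} (hf : SmAt k f m) :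
    SmAt k (fun m' => G (f m')) m := hf.comp_at (.of_forall fun _ => hG.contDiffAt)

theorem prodMk {f : M → F} {g : M → F'} {m : M} (hf : SmAt k f m) (hg : SmAt k g m) :
    SmAt k (fun m' => (f m', g m')) m := by
  filter_upwards [hf, hg] with m' h1 h2 using h1.prodMk_space h2

theorem comp₂ {G : F × F' → F''} (hG : ContDiff ℝ ∞ G) {f : M → F} {g : M → F'} {m : M}
    (hf : SmAt k f m) (hg : SmAt k g m) : SmAt k (fun m' => G (f m', g m')) m :=
  (hf.prodMk hg).comp hG

theorem add {f g : M → F} {m : M} (hf : SmAt k f m) (hg : SmAt k g m) :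
    SmAt k (fun m' => f m' + g m') m := comp₂ contDiff_add hf hg

theorem sub {f g : M → F} {m : M} (hf : SmAt k f m) (hg : SmAt k g m) :
    SmAt k (fun m' => f m' - g m') m := comp₂ (contDiff_fst.sub contDiff_snd) hf hg

theorem neg {f : M → F} {m : M} (hf : SmAt k f m) : SmAt k (fun m' => -f m') m :=
  hf.comp contDiff_neg

theorem smul {f : M → ℝ} {g : M → F} {m : M} (hf : SmAt k f m) (hg : SmAt k g m) :
    SmAt k (fun m' => f m' • g m') m := comp₂ (contDiff_fst.smul contDiff_snd) hf hg

theorem mul {f g : M → ℝ} {m : M} (hf : SmAt k f m) (hg : SmAt k g m) :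
    SmAt k (fun m' => f m' * g m') m := comp₂ contDiff_mul hf hg

theorem inv {f : M → ℝ} {m : M} (hf : SmAt k f m) (h0 : f m ≠ 0) :
    SmAt k (fun m' => (f m')⁻¹) m :=
  hf.comp_at ((hf.continuousAt.eventually_ne h0).mono fun _ h => contDiffAt_inv ℝ h)

theorem sqrt {f : M → ℝ} {m : M} (hf : SmAt k f m) (h0 : f m ≠ 0) :
    SmAt k (fun m' => Real.sqrt (f m')) m :=
  hf.comp_at ((hf.continuousAt.eventually_ne h0).mono fun _ h => Real.contDiffAt_sqrt h)

theorem sum {ι : Type*} (s : Finset ι) {f : ι → M → F} {m : M} (hf : ∀ i ∈ s, SmAt k (f i) m) :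
    SmAt k (fun m' => ∑ i ∈ s, f i m') m := by
  classical
  induction s using Finset.induction_on with
  | empty => simpa using const 0 m
  | insert a s ha ih =>
    simp only [Finset.sum_insert ha]
    exact (hf a (Finset.mem_insert_self _ _)).add
      (ih fun i hi => hf i (Finset.mem_insert_of_mem hi))

theorem clm_apply {T : M → F →L[ℝ] F'} {f : M → F} {m : M} (hT : SmAt k T m) (hf : SmAt k f m) :
    SmAt k (fun m' => T m' (f m')) m := comp₂ (contDiff_fst.clm_apply contDiff_snd) hT hf

theorem clm_comp {T : M → F' →L[ℝ] F''} {S : M → F →L[ℝ] F'} {m : M} (hT : SmAt k T m)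
    (hS : SmAt k S m) : SmAt k (fun m' => (T m').comp (S m')) m :=
  comp₂ (contDiff_fst.clm_comp contDiff_snd) hT hS

theorem inner {G : Type*} [NormedAddCommGroup G] [InnerProductSpace ℝ G] {f g : M → G} {m : M}
    (hf : SmAt k f m) (hg : SmAt k g m) : SmAt k (fun m' => inner ℝ (f m') (g m')) m :=
  comp₂ (contDiff_fst.inner ℝ contDiff_snd) hf hg

theorem adjoint {T : M → E[k]} {m : M} (hT : SmAt k T m) :
    SmAt k (fun m' => ContinuousLinearMap.adjoint (T m')) m :=
  hT.comp (ContinuousLinearMap.adjoint (𝕜 := ℝ) (E := Euc k) (F := Euc k)).contDiff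

end SmAt

theorem clm_eq_sum (T : Euc k →L[ℝ] F) :
    T = ∑ i, (EuclideanSpace.proj i : Euc k →L[ℝ] ℝ).smulRight (T (single i 1)) := by
  ext v
  have hv : v = ∑ i, v i • single i (1 : ℝ) := by
    ext j; simp [Finset.sum_apply, Pi.single_apply]
  conv_lhs => rw [hv, map_sum]
  simp [ContinuousLinearMap.sum_apply]

theorem smAt_clm_iff {T : M → Euc k →L[ℝ] F} {m : M} :
    SmAt k T m ↔ ∀ v, SmAt k (fun m' => T m' v) m := by
  refine ⟨fun h v => h.clm_apply (.const v m), fun h => ?_⟩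
  have : T = fun m' => ∑ i, (EuclideanSpace.proj i : Euc k →L[ℝ] ℝ).smulRight
      (T m' (single i 1)) := by
    funext m'; exact clm_eq_sum _
  rw [this]
  refine SmAt.sum _ fun i _ => ?_
  refine (h (single i 1)).comp
    (G := fun w => (EuclideanSpace.proj i : Euc k →L[ℝ] ℝ).smulRight w) ?_
  exact ((ContinuousLinearMap.smulRightL ℝ (Euc k) F) (EuclideanSpace.proj i)).contDiff

theorem smAt_euc_iff {f : M → Euc k} {m : M} : SmAt k f m ↔ ∀ i, SmAt k (fun m' => f m' i) m := by
  refine ⟨fun h i => h.comp (EuclideanSpace.proj i : Euc k →L[ℝ] ℝ).contDiff, fun h => ?_⟩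
  have : f = fun m' => ∑ i, f m' i • single i (1 : ℝ) := by
    funext m'
    ext j; simp [Finset.sum_apply, Pi.single_apply]
  rw [this]
  exact SmAt.sum _ fun i _ => (h i).smul (.const _ m)

variable [IsManifold (𝓡 (2 * k)) ∞ M]

theorem smAt_hadamard {y u : M → ℝ} {m : M} (hy : SmAt k y m) (hu : SmAt k u m)
    (h0 : ∀ᶠ m' in 𝓝 m, y m' = 0 → u m' = 0) (hd : y m = 0 → ∂[k] y m ≠ 0) :
    ∃ h : M → ℝ, SmAt k h m ∧ ∀ᶠ m' in 𝓝 m, u m' = y m' * h m' := by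
  set φ := extChartAt (𝓡 (2 * k)) m with hφ
  have hsrc : φ.source ∈ 𝓝 m := extChartAt_source_mem_nhds m
  have htgt : φ.target ∈ 𝓝 (φ m) := extChartAt_target_mem_nhds m
  have hsymm : ∀ᶠ q in 𝓝 (φ m), ContMDiffAt 𝓘(ℝ, Euc k) (𝓡 (2 * k)) ∞ φ.symm q := by
    filter_upwards [eventually_eventually_nhds.mpr htgt] with q hq
    exact (contMDiffOn_extChartAt_symm m).contMDiffAt hq
  have htend : Filter.Tendsto φ.symm (𝓝 (φ m)) (𝓝 m) := by
    have := continuousAt_extChartAt_symm (I := 𝓡 (2 * k)) m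
    rw [ContinuousAt] at this
    rwa [extChartAt_to_inv] at this
  have hsm : ∀ {f : M → ℝ}, SmAt k f m → ∀ᶠ q in 𝓝 (φ m), ContDiffAt ℝ ∞ (fun q => f (φ.symm q)) q :=
    fun {f} hf => by
    filter_upwards [hsymm, htend.eventually hf] with q h1 h2
    exact contMDiffAt_iff_contDiffAt.mp (ContMDiffAt.comp q h2 h1)
  have hinv : ∀ᶠ m' in 𝓝 m, φ.symm (φ m') = m' := by
    filter_upwards [hsrc] with m' hm' using φ.left_inv hm'
  have hφs : ∀ᶠ m' in 𝓝 m, ContMDiffAt (𝓡 (2 * k)) 𝓘(ℝ, Euc k) ∞ φ m' := by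
    filter_upwards [chart_source_mem_nhds (Euc k) m] with m' hm'
    exact contMDiffAt_extChartAt' hm'
  obtain ⟨h, hh, heq⟩ := hadamard_euclidean (hsm hy) (hsm hu) (htend.eventually h0) (by
    intro hz hfd
    rw [hinv.self_of_nhds] at hz
    apply hd hz
    have := (hy.contMDiffAt.mdifferentiableAt (by simp)).mvfderiv
    rw [this]
    have e : writtenInExtChartAt (𝓡 (2 * k)) 𝓘(ℝ, ℝ) m y = fun q => y (φ.symm q) := by
      funext q; rfl
    rw [e]
    simp only [modelWithCornersSelf_coe, Set.range_id, fderivWithin_univ]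
    exact hfd)
  refine ⟨fun m' => h (φ m'), ?_, ?_⟩
  · have hc : Filter.Tendsto φ (𝓝 m) (𝓝 (φ m)) := continuousAt_extChartAt m
    filter_upwards [hφs, hc.eventually hh] with m' h1 h2
    exact h2.contMDiffAt.comp m' h1
  · have hc : Filter.Tendsto φ (𝓝 m) (𝓝 (φ m)) := continuousAt_extChartAt m
    filter_upwards [hc.eventually heq, hinv] with m' h1 h2
    simpa only [h2] using h1

theorem exists_bump [T2Space M] [CompactSpace M] {m : M} {U : Set M} (hU : U ∈ 𝓝 m) :
    ∃ χ : M → ℝ, ContMDiff (𝓡 (2 * k)) 𝓘(ℝ, ℝ) ∞ χ ∧ (∀ᶠ m' in 𝓝 m, χ m' = 1) ∧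
      tsupport χ ⊆ U ∧ ∀ m', 0 ≤ χ m' ∧ χ m' ≤ 1 := by
  obtain ⟨f, -, hf⟩ := (SmoothBumpFunction.nhds_basis_tsupport (I := 𝓡 (2 * k)) m).mem_iff.mp hU
  exact ⟨f, f.contMDiff, f.eventuallyEq_one, hf, fun m' => ⟨f.nonneg, f.le_one⟩⟩

theorem SmAt.exists_global [T2Space M] [CompactSpace M] {f : M → F} {m : M} (hf : SmAt k f m) :
    ∃ f' : M → F, ContMDiff (𝓡 (2 * k)) 𝓘(ℝ, F) ∞ f' ∧ ∀ᶠ m' in 𝓝 m, f' m' = f m' := by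
  obtain ⟨χ, h1, h2, h3, -⟩ := exists_bump (k := k) hf
  refine ⟨fun m' => χ m' • f m', fun m' => ?_, h2.mono fun m' h => by simp [h]⟩
  by_cases hm : m' ∈ tsupport χ
  · exact (h1 m').smul (h3 hm)
  · have : ∀ᶠ m'' in 𝓝 m', χ m'' • f m'' = 0 := by
      filter_upwards [(isClosed_tsupport χ).isOpen_compl.mem_nhds hm] with m'' h
      rw [image_eq_zero_of_notMem_tsupport h, zero_smul]
    exact contMDiffAt_const.congr_of_eventuallyEq this

theorem mvfderiv_congr {y y' : M → F} {m : M} (h : ∀ᶠ m' in 𝓝 m, y m' = y' m') :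
    ∂[k] y m = ∂[k] y' m := by
  have h1 := Filter.EventuallyEq.mfderiv_eq (I := 𝓡 (2 * k)) (I' := 𝓘(ℝ, F)) h
  simp only [mvfderiv]
  have h2 := h.self_of_nhds
  ext v
  simp only [ContinuousLinearMap.comp_apply]
  exact congrArg (fun L : Euc k →L[ℝ] F => L v) h1

theorem VSmoothNear.nearby {X : ∀ m : M, T[k] m} {m : M}
    (h : VSmoothNear X m) : ∀ᶠ m' in 𝓝 m, VSmoothNear X m' := h.eventually_nhds

theorem VSmoothNear.congr {X Y : ∀ m : M, T[k] m} {m : M}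
    (h : VSmoothNear X m) (hXY : ∀ᶠ m' in 𝓝 m, Y m' = X m') : VSmoothNear Y m := by
  filter_upwards [h, hXY.eventually_nhds] with m' h1 h2
  exact h1.congr_of_eventuallyEq (h2.mono fun m'' h => by simp only [h])

theorem VField.vSmoothNear (X : VField k M) (m : M) : VSmoothNear (fun m' => X m') m :=
  .of_forall fun m' => X.contMDiff m'

theorem VSmoothNear.mvfderiv [T2Space M] [CompactSpace M] {y : M → ℝ}
    {X : ∀ m : M, T[k] m} {m : M} (hX : VSmoothNear X m) (hy : SmAt k y m) :
    SmAt k (fun m' => ∂[k] y m' (X m')) m := by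
  obtain ⟨y', h1, h2⟩ := hy.exists_global
  have h3 : SmAt k (fun m' => ∂[k] y' m' (X m')) m := by
    filter_upwards [hX] with m' hm'
    have h4 := (h1.contMDiff_tangentMap (m := ∞) (by simp)).contMDiffAt.comp m' hm'
    exact (contMDiff_snd_tangentBundle_modelSpace ℝ 𝓘(ℝ, ℝ)).contMDiffAt.comp m' h4
  refine h3.congr ?_
  filter_upwards [h2.eventually_nhds] with m' hm'
  rw [mvfderiv_congr hm']

theorem VSmoothNear.exists_global [T2Space M] [CompactSpace M]
    {X : ∀ m : M, T[k] m} {m : M} (hX : VSmoothNear X m)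
    {U : Set M} (hU : U ∈ 𝓝 m) :
    ∃ (χ : M → ℝ) (Y : VField k M), (∀ᶠ m' in 𝓝 m, χ m' = 1) ∧ tsupport χ ⊆ U ∧
      ∀ m', Y m' = χ m' • X m' := by
  obtain ⟨χ, h1, h2, h3, -⟩ := exists_bump (k := k) (Filter.inter_mem hX hU)
  refine ⟨χ, ⟨fun m' => χ m' • X m', fun m' => ?_⟩, h2, fun _ h => (h3 h).2, fun m' => rfl⟩
  by_cases hm : m' ∈ tsupport χ
  · exact (h1 m').smul_section (h3 hm).1
  · have : ∀ᶠ m'' in 𝓝 m', χ m'' • X m'' = (0 : VField k M) m'' := by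
      filter_upwards [(isClosed_tsupport χ).isOpen_compl.mem_nhds hm] with m'' h
      rw [image_eq_zero_of_notMem_tsupport h, zero_smul]; rfl
    exact ((0 : VField k M).contMDiff m').congr_of_eventuallyEq
      (this.mono fun m'' h => by simp only [h])

end SmoothNear

/-! ## Local frames -/

section Frames

variable {k : ℕ} {M : Type u} [TopologicalSpace M] [ChartedSpace (Euc k) M]
variable {V : M → Type*} [∀ m, AddCommGroup (V m)] [∀ m, Module ℝ (V m)]

abbrev eqL (T : Euc k ≃ₗ[ℝ] Euc k) : E[k] := (T.toContinuousLinearEquiv : E[k])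

/-- The frames `e` give smooth coordinates near the point `m`. -/
def FrameAt (sm : (∀ m, V m) → M → Prop) (m : M) (e : ∀ m, Euc k ≃ₗ[ℝ] V m) : Prop :=
  ∀ᶠ m' in 𝓝 m, ∀ s, sm s m' ↔ SmAt k (fun m'' => (e m'').symm (s m'')) m'

theorem FrameAt.nearby {sm : (∀ m, V m) → M → Prop} {m : M} {e : ∀ m, Euc k ≃ₗ[ℝ] V m}
    (h : FrameAt sm m e) : ∀ᶠ m' in 𝓝 m, FrameAt sm m' e := h.eventually_nhds

theorem FrameAt.smooth_iff {sm : (∀ m, V m) → M → Prop} {m : M} {e : ∀ m, Euc k ≃ₗ[ℝ] V m}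
    (h : FrameAt sm m e) {s} : sm s m ↔ SmAt k (fun m' => (e m').symm (s m')) m := h.self_of_nhds s

theorem FrameAt.smooth {sm : (∀ m, V m) → M → Prop} {m : M} {e : ∀ m, Euc k ≃ₗ[ℝ] V m}
    (h : FrameAt sm m e) {v : M → Euc k} (hv : SmAt k v m) : sm (fun m' => e m' (v m')) m := by
  rw [h.smooth_iff]; simpa using hv

theorem FrameAt.smAt_trans {sm : (∀ m, V m) → M → Prop} {m : M} {e e' : ∀ m, Euc k ≃ₗ[ℝ] V m}
    (h : FrameAt sm m e) (h' : ∀ v, sm (fun m' => e' m' v) m) :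
    SmAt k (fun m' => eqL ((e' m').trans (e m').symm)) m := by
  rw [smAt_clm_iff]
  intro v
  exact h.smooth_iff.mp (h' v)

theorem smAt_symm {T : M → Euc k ≃ₗ[ℝ] Euc k} {m : M} (hT : SmAt k (fun m' => eqL (T m')) m) :
    SmAt k (fun m' => eqL (T m').symm) m := by
  have h : ∀ m', eqL (T m').symm = Ring.inverse (eqL (T m')) := fun m' => by
    have := ContinuousLinearMap.inverse_equiv (T m').toContinuousLinearEquiv
    rw [ContinuousLinearMap.ringInverse_eq_inverse]
    exact this.symm
  simp only [h]
  refine hT.comp_at (.of_forall fun m' => ?_)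
  let U : E[k]ˣ := (ContinuousLinearEquiv.unitsEquiv ℝ (Euc k)).symm
    (T m').toContinuousLinearEquiv
  exact contDiffAt_ringInverse ℝ U

theorem FrameAt.comp {sm : (∀ m, V m) → M → Prop} {m : M} {e : ∀ m, Euc k ≃ₗ[ℝ] V m}
    (h : FrameAt sm m e) {T : M → Euc k ≃ₗ[ℝ] Euc k} (hT : SmAt k (fun m' => eqL (T m')) m) :
    FrameAt sm m fun m' => (T m').trans (e m') := by
  filter_upwards [h, hT.nearby] with m' h1 h2 s
  rw [h1]
  refine ⟨fun hs => (smAt_symm h2).clm_apply hs, fun hs => ?_⟩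
  have := h2.clm_apply hs
  simpa using this

theorem FrameAt.of_smooth {sm : (∀ m, V m) → M → Prop} {m : M} {e e' : ∀ m, Euc k ≃ₗ[ℝ] V m}
    (h : FrameAt sm m e) (h' : ∀ v, sm (fun m' => e' m' v) m) : FrameAt sm m e' := by
  have h1 := h.comp (h.smAt_trans h')
  have : (fun m' => ((e' m').trans (e m').symm).trans (e m')) = e' := by
    funext m'; ext v; simp
  rwa [this] at h1

theorem exists_equiv_of_eventually_isUnit {T : M → E[k]} {m : M}
    (h : ∀ᶠ m' in 𝓝 m, IsUnit (T m')) :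
    ∃ S : M → Euc k ≃ₗ[ℝ] Euc k, ∀ᶠ m' in 𝓝 m, eqL (S m') = T m' := by
  classical
  refine ⟨fun m' => if hm : IsUnit (T m') then
    (ContinuousLinearEquiv.unitsEquiv ℝ (Euc k) hm.unit).toLinearEquiv else .refl ℝ _, ?_⟩
  filter_upwards [h] with m' hm
  ext v
  simp [hm]

variable [IsManifold (𝓡 (2 * k)) ∞ M]

theorem exists_tangent_frame (m : M) : ∃ e : ∀ m' : M, Euc k ≃ₗ[ℝ] T[k] m',
    FrameAt VSmoothNear m e := by
  classical
  let t := trivializationAt (Euc k) (T[k] : M → Type) m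
  have hb : t.baseSet ∈ 𝓝 m := t.open_baseSet.mem_nhds (mem_baseSet_trivializationAt _ _ m)
  let r : ∀ m' : M, Euc k ≃ₗ[ℝ] T[k] m' := fun _ => LinearEquiv.refl ℝ (Euc k)
  obtain ⟨e, he⟩ : ∃ e : ∀ m' : M, Euc k ≃ₗ[ℝ] T[k] m',
      ∀ m' (h : m' ∈ t.baseSet), e m' = (t.continuousLinearEquivAt ℝ m' h).symm.toLinearEquiv :=
    ⟨fun m' => if h : m' ∈ t.baseSet then
      (t.continuousLinearEquivAt ℝ m' h).symm.toLinearEquiv else r m', fun m' h => dif_pos h⟩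
  refine ⟨e, ?_⟩
  filter_upwards [eventually_eventually_nhds.mpr hb] with m' hm' s
  have h1 : ∀ᶠ m'' in 𝓝 m', (t ⟨m'', s m''⟩).2 = (e m'').symm (s m'') := by
    filter_upwards [hm'] with m'' hm''
    rw [he m'' hm'']
    rfl
  rw [← SmAt.congr_iff h1]
  refine Filter.eventually_congr ?_
  filter_upwards [hm'] with m'' hm''
  exact t.contMDiffAt_section_iff hm''

end Frames

section

variable {k : ℕ} {M : Type u} [TopologicalSpace M] [ChartedSpace (Euc k) M]
  [IsManifold (𝓡 (2 * k)) ∞ M] [T2Space M] [CompactSpace M] {Z : Set M} {m : M}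

/-! ## Local frames of the b-tangent bundle -/

theorem mvfderiv_mul_of_eq_zero {y h : M → ℝ} (hy : SmAt k y m) (hh : SmAt k h m) (h0 : y m = 0)
    (v : T[k] m) : ∂[k] (fun m' => y m' * h m') m v = h m * ∂[k] y m v := by
  have := mvfderiv_mul (hy.contMDiffAt.mdifferentiableAt (by simp))
    (hh.contMDiffAt.mdifferentiableAt (by simp))
  change ∂[k] (y * h) m v = _
  rw [this]
  simp [h0]

def BSmooth (Z : Set M) (s : ∀ m, BTangent k Z m) (m : M) : Prop :=
  ∃ X : bFields k Z, ∀ᶠ m' in 𝓝 m, s m' = bval X m'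

theorem bval_smul {X Y : bFields k Z} {f : M → ℝ} (hf : ContMDiff (𝓡 (2 * k)) 𝓘(ℝ, ℝ) ∞ f)
    (h : ∀ m', Y.1 m' = f m' • X.1 m') (m : M) : bval Y m = f m • bval X m := by
  rw [bval, bval, ← map_smul, ← sub_eq_zero, ← map_sub, Submodule.mkQ_apply,
    Submodule.Quotient.mk_eq_zero]
  refine Submodule.subset_span ⟨fun m' => f m' - f m, X, hf.sub contMDiff_const, sub_self _,
    fun m' => ?_⟩
  change Y.1 m' - f m • X.1 m' = _
  rw [h, sub_smul]

theorem bval_congr {X Y : bFields k Z} (h : ∀ᶠ m' in 𝓝 m, X.1 m' = Y.1 m') : bval X m = bval Y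
    m := by
  rw [bval, bval, ← sub_eq_zero, ← map_sub, Submodule.mkQ_apply, Submodule.Quotient.mk_eq_zero]
  obtain ⟨χ, h1, h2, h3, -⟩ := exists_bump (k := k) h
  refine Submodule.subset_span ⟨fun m' => 1 - χ m', X - Y, contMDiff_const.sub h1,
    by simp [h2.self_of_nhds], fun m' => ?_⟩
  by_cases hm : m' ∈ tsupport χ
  · have h4 : (X - Y).1 m' = 0 := sub_eq_zero.mpr (h3 hm)
    rw [h4, smul_zero]
  · simp only [image_eq_zero_of_notMem_tsupport hm, sub_zero, one_smul]

theorem anchor_bval (X : bFields k Z) (m : M) : anchor Z m (bval X m) = X.1 m := rfl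

theorem exists_bField_smul (X : bFields k Z) {f : M → ℝ}
    (hf : ContMDiff (𝓡 (2 * k)) 𝓘(ℝ, ℝ) ∞ f) : ∃ Y : bFields k Z, ∀ m, Y.1 m = f m • X.1 m :=
  ⟨⟨⟨fun m => f m • X.1 m, hf.smul_section X.1.contMDiff⟩, fun z hz y hy => by
    change ∂[k] y z (f z • X.1 z) = 0
    rw [map_smul, X.2 z hz y hy, smul_zero]⟩, fun m => rfl⟩

theorem IsLocalDefining.smAt {y : M → ℝ} {z : M} (h : IsLocalDefining (k := k) Z y z) :
    SmAt k y z := h.1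

theorem eventually_mvfderiv_ne_zero {y : M → ℝ} {z : M} (hy : SmAt k y z)
    (h : ∂[k] y z ≠ 0) : ∀ᶠ m in 𝓝 z, ∂[k] y m ≠ 0 := by
  obtain ⟨e, he⟩ := exists_tangent_frame (k := k) z
  obtain ⟨w, hw⟩ : ∃ w, ∂[k] y z w ≠ 0 := by
    by_contra! h'
    exact h (ContinuousLinearMap.ext h')
  have h1 : VSmoothNear (fun m => e m ((e z).symm w)) z := he.smooth (.const _ z)
  have h2 := (h1.mvfderiv hy).continuousAt.eventually_ne (y := 0) (by simpa using hw)
  filter_upwards [h2] with m hm h0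
  exact hm (by rw [h0]; rfl)

theorem IsLocalDefining.nearby {y : M → ℝ} {z : M} (h : IsLocalDefining (k := k) Z y z) :
    ∀ᶠ m in 𝓝 z, IsLocalDefining (k := k) Z y m := by
  filter_upwards [h.smAt.nearby, h.2.1.eventually_nhds,
    eventually_mvfderiv_ne_zero h.1 h.2.2] with m h1 h2 h3 using ⟨h1, h2, h3⟩

theorem IsLocalDefining.exists_eq_mul {y y' : M → ℝ} {z : M} (hz : z ∈ Z)
    (h : IsLocalDefining (k := k) Z y z) (h' : IsLocalDefining (k := k) Z y' z) :
    ∃ c : M → ℝ, SmAt k c z ∧ (∀ᶠ m in 𝓝 z, y' m = y m * c m) ∧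
      ∀ v, ∂[k] y' z v = c z * ∂[k] y z v := by
  obtain ⟨c, hc, hcy⟩ := smAt_hadamard h.smAt h'.smAt (by
    filter_upwards [h.2.1, h'.2.1] with m h1 h2 h3 using h2.mp (h1.mpr h3)) (fun _ => h.2.2)
  refine ⟨c, hc, hcy, fun v => ?_⟩
  rw [mvfderiv_congr hcy, mvfderiv_mul_of_eq_zero h.smAt hc (h.2.1.self_of_nhds.mp hz)]

theorem exists_bField {X : ∀ m : M, T[k] m} (hX : VSmoothNear X m)
    (ht : ∀ᶠ z in 𝓝 m, z ∈ Z → ∀ y, IsLocalDefining (k := k) Z y z → ∂[k] y z (X z) = 0) :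
    ∃ Y : bFields k Z, ∀ᶠ m' in 𝓝 m, Y.1 m' = X m' := by
  obtain ⟨χ, Y, h1, h2, h3⟩ := hX.exists_global ht
  refine ⟨⟨Y, fun z hz y hy => ?_⟩, h1.mono fun m' h => by change Y m' = _; rw [h3, h, one_smul]⟩
  rw [h3, map_smul]
  by_cases hm : z ∈ tsupport χ
  · rw [h2 hm hz y hy, smul_zero]
  · rw [image_eq_zero_of_notMem_tsupport hm, zero_smul]

def bdiag (i : Fin (2 * k)) (t : ℝ) : E[k] := ContinuousLinearMap.id ℝ _ + (t - 1) •
    (EuclideanSpace.proj i : Euc k →L[ℝ] ℝ).smulRight (single i (1 : ℝ))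

theorem bdiag_apply (i : Fin (2 * k)) (t : ℝ) (v : Euc k) (j : Fin (2 * k)) :
    bdiag i t v j = if j = i then t * v i else v j := by
  by_cases h : j = i
  · subst h; simp [bdiag]; ring
  · simp [bdiag, h]

theorem bdiag_injective (i : Fin (2 * k)) {t : ℝ} (ht : t ≠ 0) :
    Injective (bdiag i t) := by
  rw [injective_iff_map_eq_zero]
  intro v hv
  ext j
  have := congrArg (fun w : Euc k => w j) hv
  simp only [bdiag_apply, PiLp.zero_apply] at this ⊢
  split_ifs at this with h
  · rw [h]; exact (mul_eq_zero.mp this).resolve_left ht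
  · exact this

theorem smAt_bdiag (i : Fin (2 * k)) {y : M → ℝ} (hy : SmAt k y m) : SmAt k
    (fun m' => bdiag i (y m')) m :=
  (SmAt.const _ m).add ((hy.sub (.const _ m)).smul (.const _ m))

/-- Local frames of the tangent and the b-tangent bundle that are adapted to the local defining
function `y`. -/
structure BFrame (Z : Set M) (i : Fin (2 * k)) (m : M) (y : M → ℝ)
    (τ : ∀ m' : M, Euc k ≃ₗ[ℝ] T[k] m')
    (b : ∀ m' : M, Euc k ≃ₗ[ℝ] BTangent k Z m') : Prop where
  smooth : SmAt k y m
  mem_iff : ∀ᶠ m' in 𝓝 m, m' ∈ Z ↔ y m' = 0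
  tangent_frame : FrameAt VSmoothNear m τ
  mvfderiv : m ∈ Z → ∀ᶠ m' in 𝓝 m, ∀ v, ∂[k] y m' (τ m' v) = v i
  frame : FrameAt (BSmooth Z) m b
  anchor : ∀ᶠ m' in 𝓝 m, ∀ v, anchor Z m' (b m' v) = τ m' (bdiag i (y m') v)
  bval_eq : ∀ᶠ m' in 𝓝 m, ∀ (X : bFields k Z) (v : M → Euc k), SmAt k v m' →
    (∀ᶠ m'' in 𝓝 m', X.1 m'' = τ m'' (bdiag i (y m'') (v m''))) → bval X m' = b m' (v m')

theorem BFrame.nearby {i : Fin (2 * k)} {y : M → ℝ} {τ : ∀ m' : M, Euc k ≃ₗ[ℝ] T[k] m'}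
    {b : ∀ m' : M, Euc k ≃ₗ[ℝ] BTangent k Z m'} (h : BFrame Z i m y τ b) : ∀ᶠ m' in 𝓝 m, BFrame Z i
    m' y τ b := by
  have h1 : ∀ᶠ m' in 𝓝 m, m' ∈ Z → m ∈ Z := by
    by_cases hm : m ∈ Z
    · exact .of_forall fun _ _ => hm
    · have h0 : y m ≠ 0 := fun h0 => hm (h.mem_iff.self_of_nhds.mpr h0)
      filter_upwards [h.smooth.continuousAt.eventually_ne h0, h.mem_iff] with m' h2 h3 h4
      exact absurd (h3.mp h4) h2
  have h2 : ∀ᶠ m' in 𝓝 m, m ∈ Z → ∀ᶠ m'' in 𝓝 m', ∀ v, ∂[k] y m'' (τ m'' v) = v i := by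
    by_cases hm : m ∈ Z
    · exact ((h.mvfderiv hm).eventually_nhds).mono fun _ h _ => h
    · exact .of_forall fun _ h => absurd h hm
  filter_upwards [h.smooth.nearby, h.mem_iff.eventually_nhds, h.tangent_frame.nearby,
    h.frame.nearby, h.anchor.eventually_nhds,
    h.bval_eq.eventually_nhds, h1, h2] with m' a1 a2 a3 a4 a5 a6 a7 a8
  exact ⟨a1, a2, a3, fun hm => a8 (a7 hm), a4, a5, a6⟩

theorem exists_adapted_tangent_frame (i : Fin (2 * k)) {y : M → ℝ} (hy : SmAt k y m)
    (hd : ∂[k] y m ≠ 0) : ∃ τ : ∀ m' : M, Euc k ≃ₗ[ℝ] T[k] m', FrameAt VSmoothNear m τ ∧ ∀ᶠ m' in 𝓝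
    m, ∀ v, ∂[k] y m' (τ m' v) = v i := by
  obtain ⟨e, he⟩ := exists_tangent_frame (k := k) m
  let α : M → Euc k →L[ℝ] ℝ := fun m' =>
    LinearMap.toContinuousLinearMap ((∂[k] y m').toLinearMap ∘ₗ (e m').toLinearMap)
  have hαe : ∀ m' v, α m' v = ∂[k] y m' (e m' v) := fun m' v => rfl
  have hα : SmAt k α m := smAt_clm_iff.mpr fun v =>
    VSmoothNear.mvfderiv (he.smooth (.const v m)) hy
  obtain ⟨d, hd0, hdn⟩ : ∃ d : Euc k, α m d ≠ 0 ∧ ‖d‖ = 1 := by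
    obtain ⟨w, hw⟩ : ∃ w, ∂[k] y m w ≠ 0 := by
      by_contra! h'
      exact hd (ContinuousLinearMap.ext h')
    have h1 : α m ((e m).symm w) ≠ 0 := by rwa [hαe, apply_symm_apply]
    have h2 : ‖(e m).symm w‖ ≠ 0 := fun h => h1 (by rw [norm_eq_zero.mp h, map_zero])
    refine ⟨‖(e m).symm w‖⁻¹ • (e m).symm w, ?_, ?_⟩
    · rw [map_smul, smul_eq_mul]; exact mul_ne_zero (inv_ne_zero h2) h1
    · rw [norm_smul, norm_inv, norm_norm, inv_mul_cancel₀ h2]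
  let e0 : Euc k := single i 1
  let R : O[k] := Submodule.reflection (span ℝ {e0 - d})ᗮ
  have hR : R e0 = d := Submodule.reflection_sub (by simp [e0, hdn])
  let β : M → Euc k →L[ℝ] ℝ := fun m' => (α m').comp (R : E[k])
  have hβ : SmAt k β m := hα.clm_comp (.const _ m)
  have hβ0 : β m e0 ≠ 0 := by change α m (R e0) ≠ 0; rwa [hR]
  have hβe : SmAt k (fun m' => β m' e0) m := hβ.clm_apply (.const _ m)
  let T : M → E[k] := fun m' => ContinuousLinearMap.id ℝ _ +
    (β m' e0)⁻¹ • ((EuclideanSpace.proj i : Euc k →L[ℝ] ℝ) - β m').smulRight e0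
  have hT : SmAt k T m := by
    rw [smAt_clm_iff]
    intro v
    refine (SmAt.const v m).add ((hβe.inv hβ0).smul ?_)
    exact ((SmAt.const _ m).sub (hβ.clm_apply (.const _ m))).smul (.const _ m)
  have hTβ : ∀ m', β m' e0 ≠ 0 → ∀ v, β m' (T m' v) = v i := fun m' h v => by
    simp [T]
    field_simp
    ring
  have hunit : ∀ᶠ m' in 𝓝 m, IsUnit (T m') := by
    filter_upwards [hβe.continuousAt.eventually_ne hβ0] with m' h
    apply isUnit_of_injective
    rw [injective_iff_map_eq_zero]
    intro v hv
    have h1 : v i = 0 := by rw [← hTβ m' h v, hv, map_zero]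
    have h2 : T m' v = v + ((β m' e0)⁻¹ * (v i - β m' v)) • e0 := by
      simp [T, smul_smul]
    rw [h2] at hv
    have h3 := congrArg (fun w : Euc k => w i) hv
    simp [e0, h1] at h3
    rw [h1, zero_sub, mul_neg, neg_smul] at hv
    rcases h3 with h3 | h3
    · exact absurd h3 h
    · simpa [h3] using hv
  obtain ⟨S, hS⟩ := exists_equiv_of_eventually_isUnit hunit
  refine ⟨fun m' => (S m').trans (R.toLinearEquiv.trans (e m')), ?_, ?_⟩
  · have h1 := he.comp (T := fun _ => R.toLinearEquiv) (.const _ m)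
    exact h1.comp (hT.congr hS)
  · filter_upwards [hS, hβe.continuousAt.eventually_ne hβ0] with m' h1 h2 v
    rw [← hTβ m' h2 v, ← h1]
    rfl

theorem sum_euc (v : Euc k) : ∑ j, v j • single j (1 : ℝ) = v := by
  ext l; simp [Finset.sum_apply, Pi.single_apply]

theorem exists_local_bFrame (i : Fin (2 * k)) {y : M → ℝ} (hy : SmAt k y m)
    (hyZ : ∀ᶠ m' in 𝓝 m, m' ∈ Z ↔ y m' = 0) (hd : m ∈ Z → ∂[k] y m ≠ 0) : ∃
    (τ : ∀ m' : M, Euc k ≃ₗ[ℝ] T[k] m') (b : ∀ m' : M, Euc k →ₗ[ℝ] BTangent k Z m')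
    (B : Fin (2 * k) → bFields k Z), FrameAt VSmoothNear m τ ∧
    (m ∈ Z → ∀ᶠ m' in 𝓝 m, ∀ v, ∂[k] y m' (τ m' v) = v i) ∧ (∀ m' v, b m' v = ∑ j, v j • bval (B j)
    m') ∧ (∀ᶠ m' in 𝓝 m, ∀ j, (B j).1 m' = τ m' (bdiag i (y m') (single j 1))) ∧
    (∀ᶠ m' in 𝓝 m, ∀ X : bFields k Z, ∃ v : M → Euc k, SmAt k v m' ∧ ∀ᶠ m'' in 𝓝 m', X.1 m'' = τ m''
    (bdiag i (y m'') (v m''))) ∧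
    (∀ᶠ m' in 𝓝 m, ∀ (X : bFields k Z) (v : M → Euc k), SmAt k v m' →
    (∀ᶠ m'' in 𝓝 m', X.1 m'' = τ m'' (bdiag i (y m'') (v m''))) → bval X m' = b m' (v m')) ∧ ∀ᶠ m'
    in 𝓝 m, Function.Bijective (b m') := by
  obtain ⟨τ, hτ, hτy⟩ : ∃ τ : ∀ m' : M, Euc k ≃ₗ[ℝ] T[k] m', FrameAt VSmoothNear m τ ∧
      (m ∈ Z → ∀ᶠ m' in 𝓝 m, ∀ v, ∂[k] y m' (τ m' v) = v i) := by
    by_cases hm : m ∈ Z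
    · obtain ⟨τ, h1, h2⟩ := exists_adapted_tangent_frame i hy (hd hm)
      exact ⟨τ, h1, fun _ => h2⟩
    · obtain ⟨τ, h1⟩ := exists_tangent_frame (k := k) m
      exact ⟨τ, h1, fun h => absurd h hm⟩
  -- near `m`, the hypersurface is regular
  have hloc : ∀ᶠ z in 𝓝 m, z ∈ Z → IsLocalDefining (k := k) Z y z ∧
      ∀ᶠ m' in 𝓝 z, ∀ v, ∂[k] y m' (τ m' v) = v i := by
    by_cases hm : m ∈ Z
    · filter_upwards [IsLocalDefining.nearby ⟨hy, hyZ, hd hm⟩,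
        (hτy hm).eventually_nhds] with z h1 h2 _ using ⟨h1, h2⟩
    · have h0 : y m ≠ 0 := fun h0 => hm (hyZ.self_of_nhds.mpr h0)
      filter_upwards [hy.continuousAt.eventually_ne h0, hyZ] with m' h2 h3 h4
      exact absurd (h3.mp h4) h2
  have hB : ∀ j, ∃ B : bFields k Z, ∀ᶠ m' in 𝓝 m,
      B.1 m' = τ m' (bdiag i (y m') (single j 1)) := fun j => by
    refine exists_bField (hτ.smooth ((smAt_bdiag i hy).clm_apply (.const _ m))) ?_
    filter_upwards [hloc, hyZ] with z h1 h2 hz y' hy'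
    obtain ⟨c, -, -, hc⟩ := (h1 hz).1.exists_eq_mul hz hy'
    rw [hc, (h1 hz).2.self_of_nhds, bdiag_apply, if_pos rfl, h2.mp hz, zero_mul, mul_zero]
  choose B hB using hB
  have hB' : ∀ᶠ m' in 𝓝 m, ∀ j, (B j).1 m' = τ m' (bdiag i (y m') (single j 1)) :=
    Filter.eventually_all.mpr hB
  let b : ∀ m' : M, Euc k →ₗ[ℝ] BTangent k Z m' := fun m' =>
    { toFun := fun v => ∑ j, v j • bval (B j) m'
      map_add' := fun v w => by simp [add_smul, Finset.sum_add_distrib]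
      map_smul' := fun c v => by simp [mul_smul, Finset.smul_sum] }
  have hb : ∀ m' v, b m' v = ∑ j, v j • bval (B j) m' := fun _ _ => rfl
  have hanch : ∀ᶠ m' in 𝓝 m, ∀ v, anchor Z m' (b m' v) = τ m' (bdiag i (y m') v) := by
    filter_upwards [hB'] with m' h v
    rw [hb, map_sum]
    conv_rhs => rw [← sum_euc v, map_sum, map_sum]
    refine Finset.sum_congr rfl fun j _ => ?_
    rw [map_smul, map_smul, map_smul, anchor_bval, h]
  have hdiv : ∀ᶠ m' in 𝓝 m, ∀ X : bFields k Z, ∃ v : M → Euc k, SmAt k v m' ∧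
      ∀ᶠ m'' in 𝓝 m', X.1 m'' = τ m'' (bdiag i (y m'') (v m'')) := by
    filter_upwards [hτ.nearby, hloc.eventually_nhds, hy.nearby,
      hyZ.eventually_nhds] with m' h1 h2 h3 h4 X
    have hu : SmAt k (fun m'' => (τ m'').symm (X.1 m'')) m' :=
      h1.smooth_iff.mp (VField.vSmoothNear X.1 m')
    set u : M → Euc k := fun m'' => (τ m'').symm (X.1 m'') with hu'
    obtain ⟨h, hh, hhu⟩ := smAt_hadamard h3 (smAt_euc_iff.mp hu i) (by
      filter_upwards [h2, h4] with m'' g1 g2 g3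
      have hz := g2.mpr g3
      have := (g1 hz).2.self_of_nhds (u m'')
      rw [← this, hu', apply_symm_apply]
      exact X.2 m'' hz y (g1 hz).1) fun g3 => (h2.self_of_nhds (h4.self_of_nhds.mpr g3)).1.2.2
    refine ⟨fun m'' => u m'' + (h m'' - u m'' i) • single i (1 : ℝ),
      hu.add ((hh.sub (smAt_euc_iff.mp hu i)).smul (.const _ _)), ?_⟩
    filter_upwards [hhu] with m'' g1
    rw [← LinearEquiv.symm_apply_eq]
    ext j
    rw [bdiag_apply]
    change u m'' j = _
    split_ifs with hj
    · subst hj; simp [g1]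
    · simp [hj]
  have hval : ∀ᶠ m' in 𝓝 m, ∀ (X : bFields k Z) (v : M → Euc k), SmAt k v m' →
      (∀ᶠ m'' in 𝓝 m', X.1 m'' = τ m'' (bdiag i (y m'') (v m''))) → bval X m' = b m' (v m') := by
    filter_upwards [hB'.eventually_nhds] with m' h1 X v hv hX
    choose f hf hfv using fun j => (smAt_euc_iff.mp hv j).exists_global
    choose Y hY using fun j => exists_bField_smul (B j) (hf j)
    have hsum : ∀ m'', (∑ j, Y j : bFields k Z).1 m'' = ∑ j, (Y j).1 m'' := fun m'' =>
      map_sum (evalAt Z m'') _ _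
    have h2 : bval X m' = bval (∑ j, Y j) m' := by
      apply bval_congr
      filter_upwards [h1, hX, Filter.eventually_all.mpr hfv] with m'' g1 g2 g3
      rw [g2, hsum]
      nth_rewrite 1 [← sum_euc (v m'')]
      rw [map_sum, map_sum]
      refine Finset.sum_congr rfl fun j _ => ?_
      rw [hY, g3, g1, map_smul, map_smul]
    rw [h2, hb]
    have h3 : bval (∑ j, Y j) m' = ∑ j, bval (Y j) m' := map_sum ((bVanishing Z m').mkQ) _ _
    rw [h3]
    refine Finset.sum_congr rfl fun j _ => ?_
    rw [bval_smul (hf j) (hY j), (hfv j).self_of_nhds]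
  refine ⟨τ, b, B, hτ, hτy, hb, hB', hdiv, hval, ?_⟩
  filter_upwards [hdiv, hval, hanch, hB'.eventually_nhds, hloc, hy.nearby, hτ.nearby, hyZ,
    hyZ.eventually_nhds]
    with m' h8 h9 h1 h2 h3 h4 h5 h6 h7
  constructor
  · rw [injective_iff_map_eq_zero]
    intro v hv
    have e1 : bdiag i (y m') v = 0 := (τ m').injective (by rw [← h1, hv, map_zero, map_zero])
    by_cases hz : m' ∈ Z
    swap
    · exact bdiag_injective i (fun h => hz (h6.mpr h)) (by rw [e1, map_zero])
    have e2 : ∀ j, j ≠ i → v j = 0 := fun j hj => by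
      have := congrArg (fun w : Euc k => w j) e1
      simpa [bdiag_apply, hj] using this
    have e3 : v = v i • single i (1 : ℝ) := by
      ext j
      by_cases hj : j = i
      · subst hj; simp
      · simp [hj, e2 j hj]
    have hyB := (h3 hz).2
    let w : T[k] m' := τ m' (single i 1)
    have hw : ∂[k] y m' w = 1 := by rw [hyB.self_of_nhds]; simp
    have hsm : ∀ X : bFields k Z, SmAt k (fun m'' => ∂[k] y m'' (X.1 m'')) m' :=
      fun X => (VField.vSmoothNear X.1 m').mvfderiv h4
    let L : bFields k Z →ₗ[ℝ] ℝ :=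
      { toFun := fun X => ∂[k] (fun m'' => ∂[k] y m'' (X.1 m'')) m' w
        map_add' := fun X Y => by
          have := mvfderiv_add ((hsm X).contMDiffAt.mdifferentiableAt (by simp))
            ((hsm Y).contMDiffAt.mdifferentiableAt (by simp))
          rw [← add_apply, ← this]
          congr 2
          funext m''
          exact map_add _ _ _
        map_smul' := fun c X => by
          have := mvfderiv_smul (a := fun _ : M => c) (contMDiffAt_const (n := ∞)
            |>.mdifferentiableAt (by simp)) ((hsm X).contMDiffAt.mdifferentiableAt (by simp))
          have e : (fun m'' => ∂[k] y m'' ((c • X).1 m'')) =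
              (fun _ : M => c) • fun m'' => ∂[k] y m'' (X.1 m'') := by
            funext m''; exact map_smul (∂[k] y m'') c (X.1 m'')
          rw [e, this, mvfderiv_const]
          simp }
    have hL : ∀ Y ∈ bVanishing Z m', L Y = 0 := by
      intro Y hY
      have : bVanishing Z m' ≤ LinearMap.ker L := by
        rw [bVanishing, Submodule.span_le]
        rintro Y ⟨f, X, hf, hf0, hY⟩
        change ∂[k] (fun m'' => ∂[k] y m'' (Y.1 m'')) m' w = 0
        have e : (fun m'' => ∂[k] y m'' (Y.1 m'')) = fun m'' => f m'' * ∂[k] y m'' (X.1 m'') := by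
          funext m''; rw [hY, map_smul, smul_eq_mul]
        rw [e, mvfderiv_mul_of_eq_zero (.of_contMDiff hf m') (hsm X) hf0, X.2 m' hz y (h3 hz).1,
          zero_mul]
      exact this hY
    have hbi : bval (v i • B i) m' = 0 := by
      have e4 : b m' v = v i • bval (B i) m' := by
        rw [hb, Finset.sum_eq_single i]
        · intro j _ hj; rw [e2 j hj, zero_smul]
        · exact fun h => absurd (Finset.mem_univ _) h
      rw [hv] at e4
      rw [e4]; rfl
    have hLB := hL _ ((Submodule.Quotient.mk_eq_zero _).mp hbi)
    have hLBi : L (B i) = 1 := by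
      change ∂[k] (fun m'' => ∂[k] y m'' ((B i).1 m'')) m' w = 1
      rw [mvfderiv_congr (y' := y), hw]
      filter_upwards [h2, hyB] with m'' g1 g2
      rw [g1, g2, bdiag_apply, if_pos rfl]; simp
    rw [map_smul, hLBi, smul_eq_mul, mul_one] at hLB
    rw [e3, hLB, zero_smul]
  · intro q
    obtain ⟨X, rfl⟩ := Submodule.mkQ_surjective _ q
    obtain ⟨v, hv, hX⟩ := h8 X
    exact ⟨v m', (h9 X v hv hX).symm⟩

theorem IsHypersurface.exists_defining (hZ : IsHypersurface k Z) (m : M) :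
    ∃ y : M → ℝ, SmAt k y m ∧ (∀ᶠ m' in 𝓝 m, m' ∈ Z ↔ y m' = 0) ∧ (m ∈ Z → ∂[k] y m ≠ 0) := by
  by_cases hm : m ∈ Z
  · obtain ⟨y, hy⟩ := hZ.2 m hm
    exact ⟨y, hy.1, hy.2.1, fun _ => hy.2.2⟩
  · refine ⟨fun _ => 1, .const _ m, ?_, fun h => absurd h hm⟩
    filter_upwards [hZ.1.isOpen_compl.mem_nhds hm] with m' h
    simpa using h

theorem IsHypersurface.exists_bFrame (hZ : IsHypersurface k Z) (i : Fin (2 * k)) {y : M → ℝ}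
    (hy : SmAt k y m) (hyZ : ∀ᶠ m' in 𝓝 m, m' ∈ Z ↔ y m' = 0) (hd : m ∈ Z → ∂[k] y m ≠ 0) : ∃ τ b,
    BFrame Z i m y τ b := by
  classical
  have hiso : ∀ m' : M, Nonempty (Euc k ≃ₗ[ℝ] BTangent k Z m') := fun m' => by
    obtain ⟨y, h1, h2, h3⟩ := hZ.exists_defining m'
    obtain ⟨-, b, -, -, -, -, -, -, -, hb⟩ := exists_local_bFrame i h1 h2 h3
    exact ⟨LinearEquiv.ofBijective (b m') hb.self_of_nhds⟩
  let r := fun m' => (hiso m').some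
  obtain ⟨τ, b', B, hτ, hτy, hb', hB, hdiv, hval, hbij⟩ := exists_local_bFrame i hy hyZ hd
  obtain ⟨b, hb⟩ : ∃ b : ∀ m' : M, Euc k ≃ₗ[ℝ] BTangent k Z m',
      ∀ m', Function.Bijective (b' m') → ∀ v, b m' v = b' m' v := by
    refine ⟨fun m' => if h : Function.Bijective (b' m') then LinearEquiv.ofBijective (b' m') h
      else r m', fun m' h v => ?_⟩
    simp only [dif_pos h]; rfl
  have hval' : ∀ᶠ m' in 𝓝 m, ∀ (X : bFields k Z) (v : M → Euc k), SmAt k v m' →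
      (∀ᶠ m'' in 𝓝 m', X.1 m'' = τ m'' (bdiag i (y m'') (v m''))) → bval X m' = b m' (v m') := by
    filter_upwards [hval, hbij] with m' h1 h2 X v hv hX
    rw [hb m' h2, h1 X v hv hX]
  refine ⟨τ, b, hy, hyZ, hτ, hτy, ?_, ?_, hval'⟩
  · filter_upwards [hdiv, hval'.eventually_nhds, hbij.eventually_nhds]
      with m' h1 h2 h3 s
    constructor
    · rintro ⟨X, hX⟩
      obtain ⟨v, hv, hXv⟩ := h1 X
      refine hv.congr ?_
      filter_upwards [hX, h2, hv.nearby, hXv.eventually_nhds] with m'' g1 g2 g3 g4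
      rw [g1, LinearEquiv.symm_apply_eq]
      exact g2 X v g3 g4
    · intro hs
      choose f hf hfv using fun j => (smAt_euc_iff.mp hs j).exists_global
      choose Y hY using fun j => exists_bField_smul (B j) (hf j)
      refine ⟨∑ j, Y j, ?_⟩
      filter_upwards [Filter.eventually_all.mpr hfv, h3] with m'' g1 g2
      rw [show bval (∑ j, Y j) m'' = ∑ j, bval (Y j) m'' from map_sum ((bVanishing Z m'').mkQ) _ _]
      have : s m'' = b' m'' ((b m'').symm (s m'')) := by
        rw [← hb m'' g2, apply_symm_apply]
      rw [this, hb']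
      refine Finset.sum_congr rfl fun j _ => ?_
      rw [bval_smul (hf j) (hY j), g1]
  · filter_upwards [hbij, hB] with m' h1 h2 v
    rw [hb m' h1, hb', map_sum]
    conv_rhs => rw [← sum_euc v, map_sum, map_sum]
    refine Finset.sum_congr rfl fun j _ => ?_
    rw [map_smul, map_smul, map_smul, anchor_bval, h2]

theorem bval_smooth (X : bFields k Z) (m : M) : BSmooth Z (bval X) m := ⟨X, .of_forall fun _ => rfl⟩

theorem exists_bField_of_smooth {s : ∀ m : M, BTangent k Z m} (hs : ∀ m, BSmooth Z s m) :
    ∃ X : bFields k Z, ∀ m, s m = bval X m := by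
  choose X hX using hs
  have h : ∀ m, ∀ᶠ m' in 𝓝 m, (X m).1 m' = anchor Z m' (s m') := fun m =>
    (hX m).mono fun m' h => by rw [h, anchor_bval]
  let Y : VField k M := ⟨fun m => anchor Z m (s m), fun m =>
    ((X m).1.contMDiff m).congr_of_eventuallyEq ((h m).mono fun m' h => by simp only [h])⟩
  have hY : ∀ m, Y m = (X m).1 m := fun m => ((h m).self_of_nhds).symm
  refine ⟨⟨Y, fun z hz y hy => ?_⟩, fun m => ?_⟩
  · rw [hY]; exact (X z).2 z hz y hy
  · rw [(hX m).self_of_nhds]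
    exact bval_congr (h m)

theorem BFrame.isCanonicalAt_iff {i : Fin (2 * k)} {y : M → ℝ} {τ : ∀ m' : M, Euc k ≃ₗ[ℝ] T[k] m'}
    {b : ∀ m' : M, Euc k ≃ₗ[ℝ] BTangent k Z m'} (h : BFrame Z i m y τ b) (hm : m ∈ Z)
    (hd : ∂[k] y m ≠ 0) {e : BTangent k Z m} : IsCanonicalAt Z m e ↔ e = b m (single i 1) := by
  have hloc : IsLocalDefining (k := k) Z y m := ⟨h.smooth, h.mem_iff, hd⟩
  constructor
  · rintro ⟨X, y', Y, hy', hY, hYy, hX, rfl⟩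
    obtain ⟨c, hc, hyc, hdc⟩ := hloc.exists_eq_mul hm hy'
    have hu : SmAt k (fun m' => (τ m').symm (Y m')) m := h.tangent_frame.smooth_iff.mp hY
    set u : M → Euc k := fun m' => (τ m').symm (Y m') with hu'
    let v : M → Euc k := fun m' => y' m' • u m' +
      (c m' * u m' i - y' m' * u m' i) • single i (1 : ℝ)
    have hv : SmAt k v m := (hy'.smAt.smul hu).add (((hc.mul (smAt_euc_iff.mp hu i)).sub
      (hy'.smAt.mul (smAt_euc_iff.mp hu i))).smul (.const _ m))
    have := h.bval_eq.self_of_nhds X v hv (by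
      filter_upwards [hX, hyc] with m' g1 g2
      rw [g1, ← LinearEquiv.symm_apply_eq]
      ext j
      rw [bdiag_apply, map_smul]
      split_ifs with hj
      · subst hj; simp [v, u, g2]; ring
      · simp [v, u, hj])
    rw [this]
    congr 1
    have h0 : y' m = 0 := hy'.2.1.self_of_nhds.mp hm
    have h1 : c m * u m i = 1 := by
      rw [← (h.mvfderiv hm).self_of_nhds, ← hdc, hu', apply_symm_apply]
      exact hYy.self_of_nhds
    simp [v, h0, h1]
  · rintro rfl
    have hs : BSmooth Z (fun m' => b m' (single i 1)) m := h.frame.smooth (.const _ m)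
    obtain ⟨X, hX⟩ := hs
    refine ⟨X, y, fun m' => τ m' (single i 1), hloc,
      h.tangent_frame.smooth (.const _ m), ?_, ?_, hX.self_of_nhds⟩
    · filter_upwards [h.mvfderiv hm] with m' h
      rw [h]; simp
    · filter_upwards [hX, h.anchor] with m' h1 h2
      rw [← anchor_bval, ← h1, h2, ← map_smul]
      congr 1
      ext j
      rw [bdiag_apply]
      split_ifs with hj
      · subst hj; simp
      · simp [hj]

/-! ## Principal bundles generated by local sections -/

theorem smoothGroupNear_pin {a : M → PinC k} : SmoothGroupNear k a m ↔ SmAt k (fun m' => pv (a m'))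
    m := by
  constructor
  · intro h
    have h1 : ∀ i, SmAt k (fun m' => cclCoord k (pv (a m')) i) m := fun i =>
      h (fun b => cclCoord k (pv b) i) ⟨LinearMap.proj i ∘ₗ (cclCoord k).toLinearMap, fun b => rfl⟩
    have h2 : SmAt k (fun m' => cclCoord k (pv (a m'))) m := by
      filter_upwards [Filter.eventually_all.mpr h1] with m' h'
      exact contMDiffAt_pi_space.mpr h'
    have h3 := h2.comp (G := (cclCoord k).symm)
      (((cclCoord k).symm.toLinearMap.toContinuousLinearMap.contDiff (n := ∞)).restrict_scalars ℝ)
    simpa using h3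
  · rintro h c ⟨l, hl⟩
    simp only [hl]
    exact h.comp (contDiff_clinear l)

theorem smoothGroupNear_orth {a : M → O[k]} : SmoothGroupNear k a m ↔ SmAt k (fun m' => isoL (a m'))
    m := by
  constructor
  · intro h
    rw [smAt_clm_iff]
    intro v
    rw [smAt_euc_iff]
    intro i
    have h1 : SmAt k (fun m' => ((inner ℝ (single i (1 : ℝ)) (a m' v) : ℝ) : ℂ)) m :=
      h _ ⟨v, single i 1, fun A => rfl⟩
    have h2 := h1.comp (G := Complex.re) Complex.reCLM.contDiff
    simpa [EuclideanSpace.inner_single_left] using h2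
  · rintro h c ⟨v, w, hc⟩
    simp only [hc]
    exact ((SmAt.const w m).inner (h.clm_apply (.const v m))).comp (G := Complex.ofReal)
      Complex.ofRealCLM.contDiff

/-- Smooth maps into `G` form a sheaf of groups. -/
class SmoothGroupLaws (k : ℕ) (M : Type u) [TopologicalSpace M] [ChartedSpace (Euc k) M]
    (G : Type) [MatrixGroup G] : Prop where
  mul : ∀ {a b : M → G} {m : M}, SmoothGroupNear k a m → SmoothGroupNear k b m →
    SmoothGroupNear k (fun m' => a m' * b m') m
  inv : ∀ {a : M → G} {m : M}, SmoothGroupNear k a m → SmoothGroupNear k (fun m' => (a m')⁻¹) m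
  one : ∀ m : M, SmoothGroupNear k (fun _ => (1 : G)) m
  nearby : ∀ {a : M → G} {m : M}, SmoothGroupNear k a m → ∀ᶠ m' in 𝓝 m, SmoothGroupNear k a m'

theorem SmAt.cmul {f g : M → CCl k} (hf : SmAt k f m) (hg : SmAt k g m) : SmAt k
    (fun m' => f m' * g m') m := SmAt.comp₂ contDiff_cmul hf hg

theorem SmAt.csmul {f : M → ℂ} {g : M → CCl k} (hf : SmAt k f m) (hg : SmAt k g m) : SmAt k
    (fun m' => f m' • g m') m :=
  SmAt.comp₂ (G := fun p : ℂ × CCl k => p.1 • p.2) (contDiff_fst.fun_smul contDiff_snd) hf hg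

theorem pinDet_eq_ctr (a : PinC k) :
    pinDet a = ctr (reverse (involute (pv a)) * pv a) := by
  rw [show reverse (involute (pv a)) * pv a = _ from pinDet_spec a, ctr_algebraMap]

theorem smAt_reverse_involute {f : M → CCl k} (hf : SmAt k f m) : SmAt k
    (fun m' => reverse (involute (f m'))) m :=
  hf.comp (G := fun x => reverse (involute x))
    (contDiff_clinear (reverse ∘ₗ CliffordAlgebra.involute.toLinearMap))

theorem smAt_pinDet {a : M → PinC k} (h : SmAt k (fun m' => pv (a m')) m) : SmAt k
    (fun m' => pinDet (a m')) m := by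
  simp only [pinDet_eq_ctr]
  exact ((smAt_reverse_involute h).cmul h).comp (contDiff_clinear ctr)

theorem smAt_cinv {f : M → ℂ} (hf : SmAt k f m) (h0 : f m ≠ 0) : SmAt k (fun m' => (f m')⁻¹) m :=
  hf.comp_at ((hf.continuousAt.eventually_ne h0).mono fun _ h => contDiffAt_inv ℝ h)

instance : SmoothGroupLaws k M (PinC k) where
  mul ha hb := by
    rw [smoothGroupNear_pin] at *
    simp only [pv_mul]
    exact ha.cmul hb
  inv {a m} ha := by
    rw [smoothGroupNear_pin] at *
    simp only [pv_inv]
    exact (smAt_cinv (smAt_pinDet ha) (pinDet_ne_zero _)).csmul (smAt_reverse_involute ha)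
  one m := smoothGroupNear_pin.mpr (.const _ m)
  nearby h := by
    simp only [smoothGroupNear_pin] at *
    exact h.nearby

theorem isoL_inv (A : O[k]) : isoL A⁻¹ = adjoint (isoL A) := by
  rw [ContinuousLinearMap.eq_adjoint_iff]
  intro v w
  change inner ℝ (A.symm v) w = inner ℝ v (A w)
  rw [← A.inner_map_map, A.apply_symm_apply]

theorem isoL_injective : Injective (isoL (k := k)) := fun A B h => by
  ext1 v
  exact congrArg (fun T : E[k] => T v) h

instance : SmoothGroupLaws k M O[k] where
  mul ha hb := by
    rw [smoothGroupNear_orth] at *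
    exact ha.clm_comp hb
  inv ha := by
    rw [smoothGroupNear_orth] at *
    simp only [isoL_inv]
    exact ha.adjoint
  one m := smoothGroupNear_orth.mpr (.const _ m)
  nearby h := by
    simp only [smoothGroupNear_orth] at *
    exact h.nearby

theorem smoothGroupNear_congr {G : Type} [MatrixGroup G] {a b : M → G} (h : SmoothGroupNear k a m)
    (hab : ∀ᶠ m' in 𝓝 m, b m' = a m') : SmoothGroupNear k b m :=
  fun c hc => SmAt.congr (h c hc) (hab.mono fun m' h => by rw [h])

theorem smoothGroupNear_pinAd {a : M → PinC k} (h : SmoothGroupNear k a m) : SmoothGroupNear k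
    (fun m' => pinAd (a m')) m := by
  have h' := SmoothGroupLaws.inv h
  rw [smoothGroupNear_pin] at h h'
  rw [smoothGroupNear_orth, smAt_clm_iff]
  intro v
  have h1 : SmAt k (fun m' => cvec (pinAd (a m') v)) m := by
    simp only [cvec_pinAd]
    exact (h.cmul (.const _ m)).cmul h'
  -- recover a vector from its image in the Clifford algebra
  have h2 : ∀ w : Euc k, ∀ i, w i = -(ctr (cvec w * cE i)).re := fun w i => by
    rw [cvec_eq_sum, Finset.sum_mul, map_sum, Finset.sum_eq_single i]
    · rw [smul_mul_assoc, cE_sq, map_smul]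
      simp [ctr_one]
    · intro j _ hj
      have h3 := congrArg ctr (cE_anti hj)
      rw [map_neg, ctr_mul_comm] at h3
      rw [smul_mul_assoc, map_smul, ctr_mul_comm]
      have h4 : ctr (cE i * cE j) = 0 := by
        have : (2 : ℂ) * ctr (cE i * cE j) = 0 := by linear_combination h3
        simpa using this
      rw [h4, smul_zero]
    · simp
  rw [smAt_euc_iff]
  intro i
  have h3 : SmAt k (fun m' => -(ctr (cvec (pinAd (a m') v) * cE i)).re) m :=
    ((h1.cmul (.const _ m)).comp (contDiff_clinear ctr)).comp
      (G := fun z : ℂ => -z.re) (Complex.reCLM.contDiff.neg)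
  exact h3.congr (.of_forall fun m' => h2 _ i)

section

variable {G : Type} [MatrixGroup G]

/-- Near `m`, the smooth sections of `P` are the smooth multiples of the section `s`. -/
def BundleData.IsGen (k : ℕ) {M : Type u} [TopologicalSpace M] [ChartedSpace (Euc k) M]
    {G : Type} [MatrixGroup G] (P : BundleData.{u, v} G M) (s : ∀ m, P.Fib m) (m : M) : Prop :=
  ∀ᶠ m' in 𝓝 m, ∀ σ : ∀ m, P.Fib m, P.smooth σ m' ↔
    ∃ a : M → G, SmoothGroupNear k a m' ∧ ∀ᶠ m'' in 𝓝 m', σ m'' = P.act m'' (s m'') (a m'')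

variable {P : BundleData.{u, v} G M}

theorem BundleData.isPrincipal_of_gen [SmoothGroupLaws k M G] (h1 : ∀ m p, P.act m p 1 = p)
    (h2 : ∀ m p a b, P.act m p (a * b) = P.act m (P.act m p a) b)
    (h3 : ∀ m (p q : P.Fib m), ∃! a : G, P.act m p a = q)
    (h4 : ∀ m, ∃ s, P.IsGen k s m) : P.IsPrincipal k where
  act_one := h1
  act_mul := h2
  torsor := h3
  local_eq σ τ m h hσ := by
    obtain ⟨s, hs⟩ := h4 m
    obtain ⟨a, ha, haσ⟩ := (hs.self_of_nhds σ).mp hσ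
    refine (hs.self_of_nhds τ).mpr ⟨a, ha, ?_⟩
    filter_upwards [h, haσ] with m' g1 g2 using g1 ▸ g2
  smooth_open σ m hσ := by
    obtain ⟨s, hs⟩ := h4 m
    obtain ⟨a, ha, haσ⟩ := (hs.self_of_nhds σ).mp hσ
    filter_upwards [hs, SmoothGroupLaws.nearby ha, haσ.eventually_nhds]
      with m' g1 g2 g3 using (g1 σ).mpr ⟨a, g2, g3⟩
  exists_smooth m := by
    obtain ⟨s, hs⟩ := h4 m
    exact ⟨s, (hs.self_of_nhds s).mpr ⟨fun _ => 1, SmoothGroupLaws.one m,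
      .of_forall fun m' => (h1 _ _).symm⟩⟩
  smooth_iff σ a m hσ := by
    obtain ⟨s, hs⟩ := h4 m
    obtain ⟨b, hb, hbσ⟩ := (hs.self_of_nhds σ).mp hσ
    constructor
    · intro h
      obtain ⟨c, hc, hcσ⟩ := (hs.self_of_nhds _).mp h
      refine smoothGroupNear_congr (SmoothGroupLaws.mul (SmoothGroupLaws.inv hb) hc) ?_
      filter_upwards [hbσ, hcσ] with m' g1 g2
      rw [g1, ← h2] at g2
      rw [← (h3 m' _ _).unique g2 rfl, inv_mul_cancel_left]
    · intro ha
      refine (hs.self_of_nhds _).mpr ⟨_, SmoothGroupLaws.mul hb ha, ?_⟩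
      filter_upwards [hbσ] with m' g1
      rw [g1, h2]

theorem BundleData.IsPrincipal.isGen (hP : P.IsPrincipal k) {s : ∀ m, P.Fib m} (hs : P.smooth s m) :
    P.IsGen k s m := by
  filter_upwards [hP.smooth_open s m hs] with m' hs' σ
  choose a ha using fun m'' => (hP.torsor m'' (s m'') (σ m'')).exists
  have hσ : (fun m'' => P.act m'' (s m'') (a m'')) = σ := funext ha
  constructor
  · intro h
    exact ⟨a, (hP.smooth_iff s a m' hs').mp (by rwa [hσ]), .of_forall fun m'' => (ha m'').symm⟩
  · rintro ⟨c, hc, hcσ⟩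
    exact hP.local_eq _ σ m' (hcσ.mono fun _ h => h.symm) ((hP.smooth_iff s c m' hs').mpr hc)

theorem BundleData.IsPrincipal.surgery [SmoothGroupLaws k M G] (hP : P.IsPrincipal k) {x : M → ℝ}
    (hx : Continuous x) {g : ∀ m, P.Fib m → P.Fib m}
    (hg : ∀ z, x z = 0 → ∀ᶠ m in 𝓝 z, ∀ p a, g m (P.act m p a) = P.act m (g m p) a)
    (hgs : ∀ z, x z = 0 → ∀ᶠ m in 𝓝 z, ∀ σ, P.smooth σ m → P.smooth (fun m' => g m' (σ m')) m) :
    (P.surgery x g).IsPrincipal k := by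
  refine BundleData.isPrincipal_of_gen hP.act_one hP.act_mul hP.torsor fun m => ?_
  obtain ⟨s, hs⟩ := hP.exists_smooth m
  by_cases hm : x m = 0
  swap
  · refine ⟨s, ?_⟩
    filter_upwards [hP.isGen hs, hx.continuousAt.eventually_ne hm] with m' h1 h2 σ
    exact Iff.trans ⟨fun h => h.1 h2, fun h => ⟨fun _ => h, fun h0 => absurd h0 h2⟩⟩ (h1 σ)
  obtain ⟨t, ht1, ht2⟩ : ∃ t : ∀ m, P.Fib m, (∀ m', 0 ≤ x m' → t m' = s m') ∧
      ∀ m', x m' < 0 → t m' = g m' (s m') := by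
    classical
    exact ⟨fun m' => if 0 ≤ x m' then s m' else g m' (s m'), fun m' h => if_pos h,
      fun m' h => if_neg (not_le.mpr h)⟩
  refine ⟨t, ?_⟩
  filter_upwards [hP.isGen hs, hgs m hm, (hg m hm).eventually_nhds,
    hP.smooth_open s m hs] with m' h1 h2 h3 h4
  have key : ∀ σ : ∀ m, P.Fib m, (P.surgery x g).smooth σ m' ↔ ∃ a : M → G, SmoothGroupNear k a m' ∧
        ∀ᶠ m'' in 𝓝 m', σ m'' = P.act m'' (t m'') (a m'') := by
    intro σ
    rcases lt_trichotomy (x m') 0 with h | h | h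
    · have hne : ∀ᶠ m'' in 𝓝 m', x m'' < 0 := hx.continuousAt.eventually_lt continuousAt_const h
      have h5 := (hP.isGen (h2 s h4)).self_of_nhds σ
      have h6 : (P.surgery x g).smooth σ m' ↔ P.smooth σ m' :=
        ⟨fun h' => h'.1 h.ne, fun h' => ⟨fun _ => h', fun h0 => absurd h0 h.ne⟩⟩
      rw [h6, h5]
      refine exists_congr fun a => and_congr_right fun _ => Filter.eventually_congr ?_
      filter_upwards [hne] with m'' h7
      rw [ht2 _ h7]
    · constructor
      · intro h'
        obtain ⟨u, hu, huσ⟩ := h'.2 h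
        obtain ⟨a, ha, hau⟩ := (h1 u).mp hu
        refine ⟨a, ha, ?_⟩
        filter_upwards [huσ, hau, h3] with m'' g1 g2 g3
        by_cases h0 : 0 ≤ x m''
        · rw [ht1 _ h0, g1.1 h0, g2]
        · rw [ht2 _ (not_le.mp h0), g1.2 (not_le.mp h0), g2, g3]
      · rintro ⟨a, ha, haσ⟩
        refine ⟨fun h0 => absurd h h0, fun _ => ⟨fun m'' => P.act m'' (s m'') (a m''),
          (h1 _).mpr ⟨a, ha, .of_forall fun _ => rfl⟩, ?_⟩⟩
        filter_upwards [haσ, h3] with m'' g1 g3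
        refine ⟨fun h0 => ?_, fun h0 => ?_⟩
        · rw [g1, ht1 _ h0]
        · rw [g1, ht2 _ h0, g3]
    · have hne : ∀ᶠ m'' in 𝓝 m', 0 < x m'' := continuousAt_const.eventually_lt hx.continuousAt h
      have h6 : (P.surgery x g).smooth σ m' ↔ P.smooth σ m' :=
        ⟨fun h' => h'.1 h.ne', fun h' => ⟨fun _ => h', fun h0 => absurd h0 h.ne'⟩⟩
      rw [h6, h1]
      refine exists_congr fun a => and_congr_right fun _ => Filter.eventually_congr ?_
      filter_upwards [hne] with m'' h7
      rw [ht1 _ h7.le]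
  exact key

theorem BundleData.IsPrincipal.smooth_iff_map {P' : BundleData.{u, w} G M} (hP : P.IsPrincipal k)
    (hP' : P'.IsPrincipal k) (f : ∀ m, P.Fib m → P'.Fib m)
    (hf : ∀ m p a, f m (P.act m p a) = P'.act m (f m p) a)
    (hs : ∀ m, ∃ s, P.smooth s m ∧ P'.smooth (fun m' => f m' (s m')) m)
    (σ : ∀ m, P.Fib m) (m : M) : P.smooth σ m ↔ P'.smooth (fun m' => f m' (σ m')) m := by
  obtain ⟨s, h1, h2⟩ := hs m
  choose a ha using fun m'' => (hP.torsor m'' (s m'') (σ m'')).exists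
  have hσ : σ = fun m'' => P.act m'' (s m'') (a m'') := funext fun m'' => (ha m'').symm
  rw [hσ, hP.smooth_iff s a m h1]
  simp only [hf]
  exact (hP'.smooth_iff _ a m h2).symm

theorem BundleData.IsPrincipal.bijective {P' : BundleData.{u, w} G M} (hP : P.IsPrincipal k)
    (hP' : P'.IsPrincipal k) (f : ∀ m, P.Fib m → P'.Fib m)
    (hf : ∀ m p a, f m (P.act m p a) = P'.act m (f m p) a) (m : M) :
    Function.Bijective (f m) := by
  constructor
  · intro p q h
    obtain ⟨a, rfl, -⟩ := hP.torsor m p q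
    rw [hf] at h
    have := (hP'.torsor m (f m p) (f m p)).unique (hP'.act_one m _) h.symm
    rw [← this, hP.act_one]
  · intro q
    obtain ⟨s, -⟩ := hP.exists_smooth m
    obtain ⟨a, ha, -⟩ := hP'.torsor m (f m (s m)) q
    exact ⟨P.act m (s m) a, by rw [hf, ha]⟩

end

/-! ## Euclidean vector bundles -/

section GramMatrices

variable {V : Type*} [AddCommGroup V] [Module ℝ V]

def eqOf (T : E[k]) : Euc k ≃ₗ[ℝ] Euc k := open Classical in
  if h : Injective T then LinearEquiv.ofInjectiveEndo T.toLinearMap h else .refl ℝ _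

theorem eqOf_apply {T : E[k]} (h : Injective T) (v : Euc k) :
    eqOf T v = T v := by
  rw [eqOf, dif_pos h]; rfl

theorem eqL_eqOf {T : E[k]} (h : Injective T) : eqL (eqOf T) = T :=
  ContinuousLinearMap.ext (eqOf_apply h)

def gram (β : V →ₗ[ℝ] V →ₗ[ℝ] ℝ) (e : Euc k ≃ₗ[ℝ] V) : E[k] :=
  LinearMap.toContinuousLinearMap (∑ i, ((β.flip (e (single i 1))) ∘ₗ
    e.toLinearMap).smulRight (single i (1 : ℝ)))

theorem gram_inner (β : V →ₗ[ℝ] V →ₗ[ℝ] ℝ) (e : Euc k ≃ₗ[ℝ] V) (v w : Euc k) :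
    inner ℝ (gram β e v) w = β (e v) (e w) := by
  have h : gram β e v = ∑ i, β (e v) (e (single i 1)) • single i (1 : ℝ) := by
    simp [gram, LinearMap.sum_apply]
  rw [h, sum_inner]
  conv_rhs => rw [← sum_euc w, map_sum, map_sum]
  refine Finset.sum_congr rfl fun i _ => ?_
  rw [real_inner_smul_left, EuclideanSpace.inner_single_left, map_smul, map_smul]
  simp [mul_comm]

theorem gram_eq_iff {β : V →ₗ[ℝ] V →ₗ[ℝ] ℝ} {e : Euc k ≃ₗ[ℝ] V} {T : E[k]} :
    gram β e = T ↔ ∀ v w, β (e v) (e w) = inner ℝ (T v) w := by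
  constructor
  · rintro rfl v w
    exact (gram_inner β e v w).symm
  · intro h
    ext1 v
    exact ext_inner_right ℝ fun w => by rw [gram_inner, h]

theorem gram_eq_one_iff {β : V →ₗ[ℝ] V →ₗ[ℝ] ℝ} {e : Euc k ≃ₗ[ℝ] V} :
    gram β e = 1 ↔ ∀ v w, β (e v) (e w) = inner ℝ v w := gram_eq_iff

theorem gram_trans (β : V →ₗ[ℝ] V →ₗ[ℝ] ℝ) (e : Euc k ≃ₗ[ℝ] V) (T : Euc k ≃ₗ[ℝ] Euc k) :
    gram β (T.trans e) = (adjoint (eqL T) * gram β e) * eqL T := by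
  rw [gram_eq_iff]
  intro v w
  change β (e (T v)) (e (T w)) = inner ℝ (adjoint (eqL T) (gram β e (T v))) w
  rw [adjoint_inner_left, gram_inner]
  rfl

theorem gram_isPD {β : V →ₗ[ℝ] V →ₗ[ℝ] ℝ} (hs : ∀ u w, β u w = β w u)
    (hp : ∀ u, u ≠ 0 → 0 < β u u) (e : Euc k ≃ₗ[ℝ] V) : IsPD (gram β e) := by
  refine ⟨fun v w => ?_, fun v hv => ?_⟩
  · rw [gram_inner, real_inner_comm, gram_inner, hs]
  · rw [real_inner_comm, gram_inner]
    exact hp _ fun h => hv (e.map_eq_zero_iff.mp h)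

/-- The orthonormal frame that is obtained from `e` by symmetric orthonormalization. -/
def orthE (β : V →ₗ[ℝ] V →ₗ[ℝ] ℝ) (e : Euc k ≃ₗ[ℝ] V) : Euc k ≃ₗ[ℝ] V :=
  (eqOf (invSqrt (gram β e))).trans e

theorem orthE_apply {β : V →ₗ[ℝ] V →ₗ[ℝ] ℝ} (hs : ∀ u w, β u w = β w u)
    (hp : ∀ u, u ≠ 0 → 0 < β u u) (e : Euc k ≃ₗ[ℝ] V) (v : Euc k) :
    orthE β e v = e (invSqrt (gram β e) v) := by
  rw [orthE, LinearEquiv.trans_apply, eqOf_apply (gram_isPD hs hp e).invSqrt.injective]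

theorem gram_orthE {β : V →ₗ[ℝ] V →ₗ[ℝ] ℝ} (hs : ∀ u w, β u w = β w u)
    (hp : ∀ u, u ≠ 0 → 0 < β u u) (e : Euc k ≃ₗ[ℝ] V) : gram β (orthE β e) = 1 := by
  have h := gram_isPD hs hp e
  rw [gram_eq_one_iff]
  intro v w
  rw [orthE_apply hs hp, orthE_apply hs hp, ← gram_inner, ← h.invSqrt.symm, ← clm_mul_apply,
    ← clm_mul_apply, h.invSqrt_mul_self]
  rfl

theorem orthE_of_gram {β : V →ₗ[ℝ] V →ₗ[ℝ] ℝ} {e : Euc k ≃ₗ[ℝ] V} (h : gram β e = 1) :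
    orthE β e = e := by
  have h1 : eqOf (1 : E[k]) = .refl ℝ _ :=
    LinearEquiv.ext fun v => eqOf_apply Function.injective_id v
  rw [orthE, h, invSqrt_one, h1]
  rfl

theorem isoL_adjoint_mul (A : O[k]) :
    adjoint (isoL A) * isoL A = 1 := by
  rw [← isoL_inv]; ext1 v; exact A.symm_apply_apply v

theorem isoL_mul_adjoint (A : O[k]) :
    isoL A * adjoint (isoL A) = 1 := by
  rw [← isoL_inv]; ext1 v; exact A.apply_symm_apply v

theorem orthE_act {β : V →ₗ[ℝ] V →ₗ[ℝ] ℝ} (hs : ∀ u w, β u w = β w u)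
    (hp : ∀ u, u ≠ 0 → 0 < β u u) (e : Euc k ≃ₗ[ℝ] V) (A : O[k]) :
    orthE β (A.toLinearEquiv.trans e) = A.toLinearEquiv.trans (orthE β e) := by
  have h := gram_isPD hs hp e
  ext v
  rw [orthE_apply hs hp, gram_trans]
  have h1 := h.invSqrt_conj (U := isoL A) (V := adjoint (isoL A))
    (fun v w => (ContinuousLinearMap.adjoint_inner_right _ _ _).symm) (isoL_adjoint_mul A)
    (isoL_mul_adjoint A)
  change e (A (invSqrt (adjoint (isoL A) * gram β e * isoL A) v)) = _
  rw [h1]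
  change e ((isoL A * adjoint (isoL A)) (invSqrt (gram β e) (A v))) = _
  rw [isoL_mul_adjoint, LinearEquiv.trans_apply, orthE_apply hs hp]
  rfl

variable {V' : Type*} [AddCommGroup V'] [Module ℝ V']

def homL (b' : Euc k ≃ₗ[ℝ] V') (b : Euc k ≃ₗ[ℝ] V) (T : V →ₗ[ℝ] V') : E[k] :=
  LinearMap.toContinuousLinearMap (b'.symm.toLinearMap ∘ₗ T ∘ₗ b.toLinearMap)

theorem homL_apply (b' : Euc k ≃ₗ[ℝ] V') (b : Euc k ≃ₗ[ℝ] V) (T : V →ₗ[ℝ] V') (v : Euc k) :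
    homL b' b T v = b'.symm (T (b v)) := rfl

theorem apply_homL (b' : Euc k ≃ₗ[ℝ] V') (b : Euc k ≃ₗ[ℝ] V) (T : V →ₗ[ℝ] V') (v : Euc k) :
    b' (homL b' b T v) = T (b v) := b'.apply_symm_apply _

end GramMatrices

theorem SmAt.invSqrt {P : M → E[k]} (hP : SmAt k P m) (h : ∀ᶠ m' in 𝓝 m, IsPD (P m')) : SmAt k
    (fun m' => _root_.invSqrt (P m')) m := by
  filter_upwards [hP, h.eventually_nhds] with m' h1 h2
  obtain ⟨G, hG, hG'⟩ := h2.self_of_nhds.invSqrt_smooth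
  refine (hG.contMDiffAt.comp m' h1).congr_of_eventuallyEq ?_
  filter_upwards [h1.continuousAt.eventually hG', h2] with m'' g1 g2 using g1 g2

/-- `V` is a smooth Euclidean vector bundle with the metric `β`. -/
structure EucBundle.IsSmooth (k : ℕ) {M : Type u} [TopologicalSpace M] [ChartedSpace (Euc k) M]
    (V : EucBundle.{u, v} M) (β : ∀ m, V.Fib m →ₗ[ℝ] V.Fib m →ₗ[ℝ] ℝ) : Prop where
  metric_eq : ∀ m u w, V.metric m u w = β m u w
  symm : ∀ m u w, β m u w = β m w u
  pos : ∀ m u, u ≠ 0 → 0 < β m u u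
  frame : ∀ m, ∃ e : ∀ m, Euc k ≃ₗ[ℝ] V.Fib m, FrameAt V.smooth m e ∧
    SmAt k (fun m' => gram (β m') (e m')) m

namespace EucBundle.IsSmooth

variable {V : EucBundle.{u, v} M} {β : ∀ m, V.Fib m →ₗ[ℝ] V.Fib m →ₗ[ℝ] ℝ}

theorem smAt_gram (hV : V.IsSmooth k β) {e : ∀ m, Euc k ≃ₗ[ℝ] V.Fib m} (he : FrameAt V.smooth m e) :
    SmAt k (fun m' => gram (β m') (e m')) m := by
  obtain ⟨f, hf, hg⟩ := hV.frame m
  have h1 := hf.smAt_trans (fun v => he.smooth (.const v m))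
  have h2 : ∀ m', e m' = ((e m').trans (f m').symm).trans (f m') := fun m' => by ext; simp
  have h3 : SmAt k (fun m' => gram (β m') (((e m').trans (f m').symm).trans (f m'))) m := by
    simp only [gram_trans]
    exact (h1.adjoint.clm_comp hg).clm_comp h1
  exact h3.congr (.of_forall fun m' => by rw [← h2])

theorem smAt_form (hV : V.IsSmooth k β) {s t : ∀ m, V.Fib m} (hs : V.smooth s m) (ht : V.smooth t m)
    : SmAt k (fun m' => β m' (s m') (t m')) m := by
  obtain ⟨f, hf, hg⟩ := hV.frame m
  refine ((hg.clm_apply (hf.smooth_iff.mp hs)).inner (hf.smooth_iff.mp ht)).congr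
    (.of_forall fun m' => ?_)
  rw [gram_inner, apply_symm_apply, apply_symm_apply]

def orth (hV : V.IsSmooth k β) (e : Euc k ≃ₗ[ℝ] V.Fib m) : OFrame k V m :=
  ⟨orthE (β m) e, fun v w => by
    rw [hV.metric_eq]
    exact gram_eq_one_iff.mp (gram_orthE (hV.symm m) (hV.pos m) e) v w⟩

theorem orth_act (hV : V.IsSmooth k β) (e : Euc k ≃ₗ[ℝ] V.Fib m) (A : O[k]) : hV.orth
    (A.toLinearEquiv.trans e) = (hV.orth e).act A :=
  Subtype.ext (orthE_act (hV.symm m) (hV.pos m) e A)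

theorem frameAt_orth (hV : V.IsSmooth k β) {e : ∀ m, Euc k ≃ₗ[ℝ] V.Fib m}
    (he : FrameAt V.smooth m e) : FrameAt V.smooth m fun m' => (hV.orth (e m')).1 := by
  have hPD : ∀ m', IsPD (gram (β m') (e m')) := fun m' => gram_isPD (hV.symm m') (hV.pos m') _
  refine he.comp (T := fun m' => eqOf (invSqrt (gram (β m') (e m')))) ?_
  refine ((hV.smAt_gram he).invSqrt (.of_forall hPD)).congr (.of_forall fun m' => ?_)
  exact eqL_eqOf (hPD m').invSqrt.injective

theorem exists_frame (hV : V.IsSmooth k β) (m : M) :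
    ∃ p : ∀ m, OFrame k V m, FrameAt V.smooth m fun m' => (p m').1 := by
  obtain ⟨e, he, -⟩ := hV.frame m
  exact ⟨fun m' => hV.orth (e m'), hV.frameAt_orth he⟩

theorem smooth_iff_frameAt (hV : V.IsSmooth k β) {p : ∀ m, OFrame k V m} : (frameBundle k V).smooth
    p m ↔ FrameAt V.smooth m fun m' => (p m').1 := by
  obtain ⟨e, he, -⟩ := hV.frame m
  exact ⟨fun h => he.of_smooth h, fun h v => h.smooth (.const v m)⟩

end EucBundle.IsSmooth

def OFrame.diff {V : EucBundle.{u, v} M} (p q : OFrame k V m) : O[k] :=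
  ⟨q.1.trans p.1.symm, fun v => by
    have h : inner ℝ (p.1.symm (q.1 v)) (p.1.symm (q.1 v)) = inner ℝ v v := by
      rw [← p.2, apply_symm_apply, q.2]
    rw [real_inner_self_eq_norm_sq, real_inner_self_eq_norm_sq] at h
    exact (sq_eq_sq₀ (norm_nonneg _) (norm_nonneg _)).mp h⟩

theorem OFrame.act_diff {V : EucBundle.{u, v} M} (p q : OFrame k V m) : p.act (p.diff q) = q := by
  apply Subtype.ext
  ext v
  exact p.1.apply_symm_apply _

theorem OFrame.act_injective {V : EucBundle.{u, v} M} (p : OFrame k V m) : Injective p.act := fun A B h => by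
  ext1 v
  exact p.1.injective (congrArg (fun q : OFrame k V m => q.1 v) h)

theorem OFrame.diff_act {V : EucBundle.{u, v} M} (p : OFrame k V m) (A : O[k]) : p.diff (p.act A) =
    A := p.act_injective (p.act_diff _)

theorem OFrame.act_mul {V : EucBundle.{u, v} M} (p : OFrame k V m) (A B : O[k]) : p.act (A * B) =
    (p.act A).act B := rfl

theorem OFrame.act_one {V : EucBundle.{u, v} M} (p : OFrame k V m) : p.act 1 = p := rfl

namespace EucBundle.IsSmooth

variable {V : EucBundle.{u, v} M} {β : ∀ m, V.Fib m →ₗ[ℝ] V.Fib m →ₗ[ℝ] ℝ}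

theorem isGen (hV : V.IsSmooth k β) {p : ∀ m, OFrame k V m} (hp : FrameAt V.smooth m fun m' =>
    (p m').1) : (frameBundle k V).IsGen k p m := by
  filter_upwards [hp.nearby] with m' hp' σ
  constructor
  · intro h
    refine ⟨fun m'' => (p m'').diff (σ m''), ?_, .of_forall fun m'' => (OFrame.act_diff _ _).symm⟩
    rw [smoothGroupNear_orth]
    exact hp'.smAt_trans h
  · rintro ⟨A, hA, hAσ⟩ v
    rw [smoothGroupNear_orth] at hA
    rw [hp'.smooth_iff]
    refine (hA.clm_apply (.const v m')).congr ?_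
    filter_upwards [hAσ] with m'' h
    rw [h]
    exact (p m'').1.symm_apply_apply _

theorem principal (hV : V.IsSmooth k β) : (frameBundle k V).IsPrincipal k := by
  refine BundleData.isPrincipal_of_gen (fun m p => rfl) (fun m p A B => rfl)
    (fun m p q => ⟨OFrame.diff p q, OFrame.act_diff p q, fun A hA =>
      OFrame.act_injective p (hA.trans (OFrame.act_diff p q).symm)⟩) fun m => ?_
  obtain ⟨p, hp⟩ := hV.exists_frame m
  exact ⟨p, hV.isGen hp⟩

end EucBundle.IsSmooth

/-! ## The metrics on the tangent and the b-tangent bundle -/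

def metricForm (g : RMetric k M) (m : M) :
    T[k] m →ₗ[ℝ] T[k] m →ₗ[ℝ] ℝ :=
  LinearMap.mk₂ ℝ (fun v w => g.inner m v w) (fun v v' w => by simp) (fun c v w => by simp)
    (fun v w w' => by simp) (fun c v w => by simp)

theorem tangentEuc_isSmooth (g : RMetric k M) : (tangentEuc g).IsSmooth k (metricForm g) where
  metric_eq m u w := rfl
  symm m u w := g.symm m u w
  pos m u hu := g.pos m u hu
  frame m := by
    obtain ⟨e, he⟩ := exists_tangent_frame (k := k) m
    refine ⟨e, he, ?_⟩
    rw [smAt_clm_iff]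
    intro v
    rw [smAt_euc_iff]
    intro i
    have h1 : VSmoothNear (fun m' => e m' v) m := he.smooth (.const v m)
    have h2 : VSmoothNear (fun m' => e m' (single i 1)) m := he.smooth (.const _ m)
    have h3 : SmAt k (fun m' => g.inner m' (e m' v) (e m' (single i 1))) m := by
      filter_upwards [h1, h2] with m' g1 g2
      have h4 := ContMDiffAt.clm_bundle_apply₂ (F₁ := Euc k) (F₂ := Euc k) (F₃ := ℝ)
        (E₃ := Bundle.Trivial M ℝ) (g.contMDiff m') g1 g2
      rw [Bundle.contMDiffAt_totalSpace] at h4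
      exact h4.2
    refine h3.congr (.of_forall fun m' => ?_)
    have h4 := gram_inner (metricForm g m') (e m') v (single i 1)
    rw [EuclideanSpace.inner_single_right] at h4
    simp only [map_one, conj_trivial, one_mul] at h4
    exact h4

variable {Ω : BForm k Z} {J J' : BEnd k Z} {W W' : bFields k Z} {x f : M → ℝ} {N : VField k M}
  {g : RMetric k M} {o : TOrientation k M} {b : ∀ m, Euc k ≃ₗ[ℝ] BTangent k Z m}
  {τ : ∀ m : M, Euc k ≃ₗ[ℝ] T[k] m}
  (hk : 1 ≤ k) (hZ : IsHypersurface k Z) (hΩ : IsBSymplectic Z Ω) (hJ : IsCompatible Ω J)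

def bMetric (Ω : BForm k Z) (J : BEnd k Z) (m : M) :
    BTangent k Z m →ₗ[ℝ] BTangent k Z m →ₗ[ℝ] ℝ := (Ω m).compl₂ (J m)

theorem IsBSymplectic.swap (hΩ : IsBSymplectic Z Ω) (m : M) (u w : BTangent k Z m) :
    Ω m u w = -Ω m w u := by
  have h := hΩ.alternating m (u + w)
  rw [map_add, LinearMap.map_add₂, LinearMap.map_add₂, hΩ.alternating, hΩ.alternating] at h
  linarith

theorem smAt_gram_of_smooth {e : ∀ m : M, Euc k ≃ₗ[ℝ] BTangent k Z m} (he : FrameAt (BSmooth Z) m e)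
    {κ : ∀ m, BTangent k Z m →ₗ[ℝ] BTangent k Z m →ₗ[ℝ] ℝ} (hκ : ∀ X Y : bFields k Z, SmAt k
    (fun m' => κ m' (bval X m') (bval Y m')) m) : SmAt k (fun m' => gram (κ m') (e m')) m := by
  rw [smAt_clm_iff]
  intro v
  rw [smAt_euc_iff]
  intro i
  obtain ⟨X, hX⟩ := he.smooth (.const v m)
  obtain ⟨Y, hY⟩ := he.smooth (.const (single i (1 : ℝ)) m)
  refine (hκ X Y).congr ?_
  filter_upwards [hX, hY] with m' h1 h2
  have h4 := gram_inner (κ m') (e m') v (single i 1)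
  rw [EuclideanSpace.inner_single_right, h1, h2] at h4
  simpa using h4

theorem IsBSymplectic.smAt_gram (hΩ : IsBSymplectic Z Ω) {e : ∀ m : M, Euc k ≃ₗ[ℝ] BTangent k Z m}
    (he : FrameAt (BSmooth Z) m e) : SmAt k (fun m' => gram (Ω m') (e m')) m :=
  smAt_gram_of_smooth he fun X Y => .of_contMDiff (hΩ.smooth X Y) m

theorem IsCompatible.smAt_homL (hJ : IsCompatible Ω J) {e : ∀ m : M, Euc k ≃ₗ[ℝ] BTangent k Z m}
    (he : FrameAt (BSmooth Z) m e) : SmAt k (fun m' => homL (e m') (e m') (J m')) m := by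
  rw [smAt_clm_iff]
  intro v
  obtain ⟨X, hX⟩ := he.smooth (.const v m)
  obtain ⟨Y, hY⟩ := hJ.smooth X
  refine he.smooth_iff.mp ⟨Y, ?_⟩
  filter_upwards [hX] with m' h
  change J m' (e m' v) = _
  rw [h, hY]

theorem bTangentEuc_isSmooth (hk : 1 ≤ k) (hZ : IsHypersurface k Z)
    (hΩ : IsBSymplectic Z Ω) (hJ : IsCompatible Ω J) :
    (bTangentEuc Ω J).IsSmooth k (bMetric Ω J) where
  metric_eq m u w := rfl
  symm m := by
    intro (u : BTangent k Z m) (w : BTangent k Z m)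
    change Ω m u (J m w) = Ω m w (J m u)
    rw [← hJ.invariant m w (J m u), hJ.sq, map_neg, ← hΩ.swap]
  pos m u hu := hJ.pos m u hu
  frame m := by
    obtain ⟨y, h1, h2, h3⟩ := hZ.exists_defining m
    obtain ⟨τ, b, hb⟩ := hZ.exists_bFrame ⟨0, by omega⟩ h1 h2 h3
    refine ⟨b, hb.frame, smAt_gram_of_smooth hb.frame fun X Y => ?_⟩
    obtain ⟨Y', hY'⟩ := hJ.smooth Y
    refine (SmAt.of_contMDiff (hΩ.smooth X Y') m).congr (.of_forall fun m' => ?_)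
    change Ω m' (bval X m') (J m' (bval Y m')) = _
    rw [hY']

/-! ## Complex frames -/

section ComplexFrames

theorem exists_complex_equiv {V V' : Type*} [AddCommGroup V] [Module ℝ V] [FiniteDimensional ℝ V]
    [AddCommGroup V'] [Module ℝ V'] [FiniteDimensional ℝ V'] (J : V →ₗ[ℝ] V) (J' : V' →ₗ[ℝ] V')
    (hJ : ∀ v, J (J v) = -v) (hJ' : ∀ v, J' (J' v) = -v)
    (h : Module.finrank ℝ V = Module.finrank ℝ V') :
    ∃ T : V ≃ₗ[ℝ] V', ∀ v, T (J v) = J' (T v) := by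
  let f : ℂ →ₐ[ℝ] Module.End ℝ V := Complex.liftAux (A := Module.End ℝ V) J (LinearMap.ext fun v => hJ v)
  let f' : ℂ →ₐ[ℝ] Module.End ℝ V' := Complex.liftAux (A := Module.End ℝ V') J' (LinearMap.ext fun v => hJ' v)
  letI : Module ℂ V := Module.compHom V f.toRingHom
  letI : Module ℂ V' := Module.compHom V' f'.toRingHom
  haveI : IsScalarTower ℝ ℂ V := ⟨fun r z v => by
    change f (r • z) v = r • f z v
    rw [map_smul]; rfl⟩
  haveI : IsScalarTower ℝ ℂ V' := ⟨fun r z v => by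
    change f' (r • z) v = r • f' z v
    rw [map_smul]; rfl⟩
  haveI : FiniteDimensional ℂ V := FiniteDimensional.right ℝ ℂ V
  haveI : FiniteDimensional ℂ V' := FiniteDimensional.right ℝ ℂ V'
  have h1 := Module.finrank_mul_finrank ℝ ℂ V
  have h2 := Module.finrank_mul_finrank ℝ ℂ V'
  have h3 : Module.finrank ℂ V = Module.finrank ℂ V' := by
    rw [← h2, ← h1] at h
    exact Nat.eq_of_mul_eq_mul_left Module.finrank_pos h
  let T := LinearEquiv.ofFinrankEq V V' h3
  have hI : ∀ v : V, Complex.I • v = J v := fun v => by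
    have h4 : f Complex.I = J := Complex.liftAux_apply_I (A := Module.End ℝ V) J _
    exact congrArg (fun T : Module.End ℝ V => T v) h4
  have hI' : ∀ v : V', Complex.I • v = J' v := fun v => by
    have h4 : f' Complex.I = J' := Complex.liftAux_apply_I (A := Module.End ℝ V') J' _
    exact congrArg (fun T : Module.End ℝ V' => T v) h4
  exact ⟨T.restrictScalars ℝ, fun v => by
    change T (J v) = J' (T v)
    rw [← hI, map_smul, hI']⟩

variable {V : Type*} [AddCommGroup V] [Module ℝ V]

abbrev stdJL (k : ℕ) : E[k] := LinearMap.toContinuousLinearMap (stdJ k)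

def uMat (J : V →ₗ[ℝ] V) (b : Euc k ≃ₗ[ℝ] V) : E[k] := 1 - homL b b J * stdJL k

theorem apply_uMat (J : V →ₗ[ℝ] V) (b : Euc k ≃ₗ[ℝ] V) (v : Euc k) :
    b (uMat J b v) = b v - J (b (stdJ k v)) := by
  have : uMat J b v = v - homL b b J (stdJ k v) := rfl
  rw [this, map_sub, apply_homL]

/-- The unitary frame that is obtained by orthonormalizing the complex linear part of `b`. -/
def uOrth (β : V →ₗ[ℝ] V →ₗ[ℝ] ℝ) (J : V →ₗ[ℝ] V) (b : Euc k ≃ₗ[ℝ] V) : Euc k ≃ₗ[ℝ] V :=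
  orthE β ((eqOf (uMat J b)).trans b)

variable {β : V →ₗ[ℝ] V →ₗ[ℝ] ℝ} {J : V →ₗ[ℝ] V}

theorem orthE_stdJ (hs : ∀ u w, β u w = β w u) (hp : ∀ u, u ≠ 0 → 0 < β u u)
    (hJβ : ∀ u w, β (J u) (J w) = β u w) {B : Euc k ≃ₗ[ℝ] V} (hB : ∀ v, J (B v) = B (stdJ k v))
    (v : Euc k) : J (orthE β B v) = orthE β B (stdJ k v) := by
  have h := gram_isPD hs hp B
  have h1 : stdJL k * gram β B = gram β B * stdJL k := by
    ext1 v
    refine ext_inner_right ℝ fun w => ?_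
    change inner ℝ (stdJ k (gram β B v)) w = inner ℝ (gram β B (stdJ k v)) w
    rw [inner_stdJ, gram_inner, gram_inner, ← hB, ← hB, ← hJβ (B v), hB w, hB (stdJ k w), stdJ_sq,
      map_neg, map_neg, neg_neg]
  have h2 := h.invSqrt_comm h1
  rw [orthE_apply hs hp, orthE_apply hs hp, hB]
  exact congrArg (fun T : E[k] => B (T v)) h2

theorem uEquiv_stdJ (hJ : ∀ v, J (J v) = -v) {b : Euc k ≃ₗ[ℝ] V}
    (hb : Injective (uMat J b)) (v : Euc k) :
    J (((eqOf (uMat J b)).trans b) v) = ((eqOf (uMat J b)).trans b) (stdJ k v) := by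
  simp only [LinearEquiv.trans_apply]
  rw [eqOf_apply hb, eqOf_apply hb, apply_uMat, apply_uMat, map_sub, hJ, stdJ_sq, map_neg, map_neg]
  abel

theorem uOrth_stdJ (hs : ∀ u w, β u w = β w u) (hp : ∀ u, u ≠ 0 → 0 < β u u)
    (hJβ : ∀ u w, β (J u) (J w) = β u w) (hJ : ∀ v, J (J v) = -v) {b : Euc k ≃ₗ[ℝ] V}
    (hb : Injective (uMat J b)) (v : Euc k) :
    J (uOrth β J b v) = uOrth β J b (stdJ k v) := orthE_stdJ hs hp hJβ (uEquiv_stdJ hJ hb) v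

theorem apply_uMat_act (J : V →ₗ[ℝ] V) (b : Euc k ≃ₗ[ℝ] V) (A : O[k])
    (hA : ∀ v, A (stdJ k v) = stdJ k (A v)) (v : Euc k) :
    A (uMat J (A.toLinearEquiv.trans b) v) = uMat J b (A v) := by
  apply b.injective
  have h := apply_uMat J (A.toLinearEquiv.trans b) v
  change b (A _) = b (A v) - J (b (A (stdJ k v))) at h
  rw [h, apply_uMat, hA]

theorem uOrth_act (hs : ∀ u w, β u w = β w u) (hp : ∀ u, u ≠ 0 → 0 < β u u) {b : Euc k ≃ₗ[ℝ] V}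
    (hb : Injective (uMat J b)) (A : O[k])
    (hA : ∀ v, A (stdJ k v) = stdJ k (A v)) :
    uOrth β J (A.toLinearEquiv.trans b) = A.toLinearEquiv.trans (uOrth β J b) := by
  have h := apply_uMat_act J b A hA
  have hb' : Injective (uMat J (A.toLinearEquiv.trans b)) := fun v w hvw =>
    A.injective (hb (by rw [← h, ← h, hvw]))
  rw [uOrth, uOrth, ← orthE_act hs hp]
  congr 1
  ext v
  change b (A (eqOf _ v)) = b (eqOf _ (A v))
  rw [eqOf_apply hb', eqOf_apply hb, h]

theorem uMat_of_complex {b : Euc k ≃ₗ[ℝ] V} (hb : ∀ v, J (b v) = b (stdJ k v)) :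
    uMat J b = (2 : ℝ) • 1 := by
  ext1 v
  apply b.injective
  rw [apply_uMat, hb, stdJ_sq, map_neg]
  change _ = b ((2 : ℝ) • v)
  rw [two_smul, map_add, sub_neg_eq_add]

theorem injective_smul_one {c : ℝ} (hc : c ≠ 0) :
    Injective ((c • 1 : E[k])) := fun v w h => by
  have : c • v = c • w := h
  exact smul_right_injective _ hc this

theorem det_pos_of_symplectic {S : Euc k →ₗ[ℝ] Euc k} (hS : Injective S)
    (h : ∀ v w, inner ℝ (stdJ k (S v)) (S w) = inner ℝ (stdJ k v) w) : 0 < LinearMap.det S := by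
  -- `B` is the complex linear part of `2 S`
  let B : Euc k →ₗ[ℝ] Euc k := S - stdJ k ∘ₗ S ∘ₗ stdJ k
  have hSj : ∀ v, inner ℝ (stdJ k (S v)) (S (stdJ k v)) = inner ℝ v v := fun v => by
    rw [h, inner_stdJ_stdJ]
  have hpath : ∀ t ∈ Set.Icc (0 : ℝ) 1, Injective ((1 - t) • S + t • B) := by
    intro t ht
    rw [injective_iff_map_eq_zero]
    intro v hv
    have h1 : S v = t • stdJ k (S (stdJ k v)) := by
      have : (1 - t) • S v + t • (S v - stdJ k (S (stdJ k v))) = 0 := hv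
      rw [← sub_eq_zero, ← this]
      module
    have h2 : inner ℝ (stdJ k (S (stdJ k v))) (S v) = -inner ℝ v v := by
      rw [h, stdJ_sq, inner_neg_left]
    have h3 : inner ℝ (stdJ k (S (stdJ k v))) (S v) =
        t * inner ℝ (stdJ k (S (stdJ k v))) (stdJ k (S (stdJ k v))) := by
      conv_lhs => rw [h1]
      rw [real_inner_smul_right]
    have h4 : inner ℝ v v ≤ 0 := by
      have : 0 ≤ t * inner ℝ (stdJ k (S (stdJ k v))) (stdJ k (S (stdJ k v))) :=
        mul_nonneg ht.1 real_inner_self_nonneg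
      linarith
    by_contra hv0
    exact (real_inner_self_pos.mpr hv0).not_ge h4
  have hBi : Injective B := by simpa using hpath 1 (by norm_num)
  have hBj : ∀ v, stdJ k (B v) = B (stdJ k v) := fun v => by
    change stdJ k (S v - stdJ k (S (stdJ k v))) = S (stdJ k v) - stdJ k (S (stdJ k (stdJ k v)))
    rw [map_sub, stdJ_sq, stdJ_sq, map_neg, map_neg]; abel
  let β : Euc k →ₗ[ℝ] Euc k →ₗ[ℝ] ℝ := innerₗ (Euc k)
  have hs : ∀ u w : Euc k, β u w = β w u := fun u w => real_inner_comm w u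
  have hp : ∀ u : Euc k, u ≠ 0 → 0 < β u u := fun u hu => real_inner_self_pos.mpr hu
  let E : Euc k ≃ₗ[ℝ] Euc k := LinearEquiv.ofInjectiveEndo B hBi
  have hE : ∀ v, E v = B v := fun v => rfl
  have hU := gram_eq_one_iff.mp (gram_orthE hs hp E)
  let U : O[k] := ⟨orthE β E, fun v => by
    have h1 : inner ℝ (orthE β E v) (orthE β E v) = inner ℝ v v := hU v v
    rw [real_inner_self_eq_norm_sq, real_inner_self_eq_norm_sq] at h1
    exact (sq_eq_sq₀ (norm_nonneg _) (norm_nonneg _)).mp h1⟩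
  have hUdet := det_pos_of_unitary U fun v =>
    (orthE_stdJ hs hp inner_stdJ_stdJ (J := stdJ k) (B := E) (fun v => hBj v) v).symm
  have hR := (gram_isPD hs hp E).invSqrt
  have h2 : 0 < LinearMap.det B * LinearMap.det (U.toLinearEquiv : Euc k →ₗ[ℝ] Euc k) := by
    refine det_mul_det_pos fun t ht => ?_
    rw [injective_iff_map_eq_zero]
    intro v hv
    have h3 : (1 - t) • B v + t • orthE β E v = 0 := hv
    rw [orthE_apply hs hp, hE, ← map_smul, ← map_smul, ← map_add] at h3
    have h4 := hBi (h3.trans (map_zero B).symm)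
    by_contra hv0
    have h5 := hR.pos v hv0
    have h6 := real_inner_self_pos.mpr hv0
    have h7 : (1 - t) * inner ℝ v v + t * inner ℝ v (invSqrt (gram β E) v) = 0 := by
      rw [← real_inner_smul_right, ← real_inner_smul_right, ← inner_add_right, h4, inner_zero_right]
    rcases ht.1.eq_or_lt with h0 | h0
    · subst h0; simp at h7; exact hv0 h7
    · have : 0 < t * inner ℝ v (invSqrt (gram β E) v) := mul_pos h0 h5
      have := mul_nonneg (sub_nonneg.mpr ht.2) h6.le
      linarith
  have h8 := det_mul_det_pos hpath
  have h9 : 0 < LinearMap.det B := (pos_iff_pos_of_mul_pos h2).mpr hUdet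
  exact (pos_iff_pos_of_mul_pos h8).mpr h9

end ComplexFrames

theorem orthDeg_mul (A B : O[k]) : orthDeg (A * B) = orthDeg A + orthDeg B := by
  obtain ⟨a, -, rfl⟩ := exists_PinR_pinAd A
  obtain ⟨b, -, rfl⟩ := exists_PinR_pinAd B
  rw [← pinAd_mul', orthDeg_pinAd, orthDeg_pinAd, orthDeg_pinAd, pinDeg_mul]

theorem det_ne_zero_of_equiv {V : Type*} [AddCommGroup V] [Module ℝ V] (e : V ≃ₗ[ℝ] V) :
    LinearMap.det (e : V →ₗ[ℝ] V) ≠ 0 := (LinearEquiv.isUnit_det' e).ne_zero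

theorem continuous_det : Continuous fun T : E[k] => LinearMap.det (T : Euc k →ₗ[ℝ] Euc k) :=
  ContinuousLinearMap.continuous_det

theorem eventually_orthDeg_eq {A : M → O[k]} (h : ContinuousAt (fun m' => isoL (A m')) m) : ∀ᶠ m' in
    𝓝 m, orthDeg (A m') = orthDeg (A m) := by
  have h1 : ContinuousAt (fun m' => LinearMap.det ((A m').toLinearEquiv : Euc k →ₗ[ℝ] Euc k)) m :=
    continuous_det.continuousAt.comp h
  rcases (det_ne_zero_of_equiv (A m).toLinearEquiv).lt_or_gt with h0 | h0
  · filter_upwards [h1.eventually_lt continuousAt_const h0] with m' h2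
    rw [orthDeg, orthDeg, if_neg h2.not_gt, if_neg h0.not_gt]
  · filter_upwards [continuousAt_const.eventually_lt h1 h0] with m' h2
    rw [orthDeg, orthDeg, if_pos h2, if_pos h0]

theorem eventually_pinDeg_eq {a : M → PinC k} (h : SmoothGroupNear k a m) : ∀ᶠ m' in 𝓝 m, pinDeg
    (a m') = pinDeg (a m) := by
  simp only [← orthDeg_pinAd]
  exact eventually_orthDeg_eq (smoothGroupNear_orth.mp (smoothGroupNear_pinAd h)).continuousAt

theorem FrameAt.congr {V : M → Type*} [∀ m, AddCommGroup (V m)] [∀ m, Module ℝ (V m)]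
    {sm : (∀ m, V m) → M → Prop} {e e' : ∀ m, Euc k ≃ₗ[ℝ] V m} (h : FrameAt sm m e)
    (he : ∀ᶠ m' in 𝓝 m, e' m' = e m') : FrameAt sm m e' := by
  filter_upwards [h, he.eventually_nhds] with m' h1 h2 s
  rw [h1]
  exact SmAt.congr_iff (h2.mono fun m'' h3 => by rw [h3])

theorem pinVec_conj' (a : PinC k) (v : Euc k) : a * pinVec v * a⁻¹ = pinVec (pinAd a v) := by
  by_cases hv : ‖v‖ = 1
  · exact pinVec_conj a hv
  · rw [pinVec, dif_neg hv, pinVec, dif_neg (by rwa [LinearIsometryEquiv.norm_map]), mul_one,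
      mul_inv_cancel]

open Classical in
theorem mul_pinGamma_sign (a : PinC k) :
    a * ((if pinDeg a = 0 then 1 else pinScalar k (-1) (by simp)) * pinGamma k) =
      pinGamma k * a := by
  have key : pv (pinGamma k) * involute (pv a) = pv a * pv (pinGamma k) := by
    induction a using PinC.induction with
    | scalar z hz => rw [pv_pinScalar, AlgHom.commutes, Algebra.commutes]
    | vec v hv => rw [pv_pinVec hv, involute_cvec, mul_neg, pinGamma_mul_cvec, neg_neg]
    | mul a b ha hb => rw [pv_mul, map_mul, ← mul_assoc, ha, mul_assoc, hb, mul_assoc]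
    | inv a ha =>
      have h1 : involute (pv a) * involute (pv a⁻¹) = 1 := by
        rw [← map_mul, pv_mul_inv, map_one]
      calc pv (pinGamma k) * involute (pv a⁻¹)
          = pv a⁻¹ * (pv a * pv (pinGamma k)) * involute (pv a⁻¹) := by
            rw [← mul_assoc, pv_inv_mul, one_mul]
        _ = pv a⁻¹ * pv (pinGamma k) := by
            rw [← ha, mul_assoc, mul_assoc, h1, mul_one]
  apply pv_injective
  rcases pinDeg_zero_or_one a with h | h
  · rw [if_pos h, one_mul, pv_mul, pv_mul, ← key, pinDeg_eq_zero_iff.mp h]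
  · rw [if_neg (by rw [h]; decide), pv_mul, pv_mul _ (pinGamma k), pv_pinScalar, pv_mul, map_neg,
      map_one, neg_one_mul, mul_neg, ← key, pinDeg_eq_one_iff.mp h, mul_neg, neg_neg]

/-! ## The spin-c structure of a compatible complex structure -/

include hΩ hJ in
theorem IsCompatible.metric_symm (m : M) (u w : BTangent k Z m) : bMetric Ω J m u w = bMetric Ω J m
    w u := by
  change Ω m u (J m w) = Ω m w (J m u)
  rw [← hJ.invariant m w (J m u), hJ.sq, map_neg, ← hΩ.swap]

include hJ in
theorem IsCompatible.metric_invariant (m : M) (u w : BTangent k Z m) : bMetric Ω J m (J m u) (J m w)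
    = bMetric Ω J m u w := hJ.invariant m u (J m w)

theorem UFrame.diff_stdJ (b b' : UFrame Ω J m) (v : Euc k) : b.1.diff b'.1 (stdJ k v) = stdJ k
    (b.1.diff b'.1 v) := by
  apply b.1.1.injective
  change b.1.1 (b.1.1.symm (b'.1.1 (stdJ k v))) = b.1.1 (stdJ k (b.1.1.symm (b'.1.1 v)))
  rw [apply_symm_apply, ← b.2, apply_symm_apply, b'.2]

def uDiff (b b' : UFrame Ω J m) : PinC k :=
  (exists_mem_unitaryLift (b.1.diff b'.1) (b.diff_stdJ b')).choose

theorem uDiff_mem (b b' : UFrame Ω J m) : uDiff b b' ∈ unitaryLift k :=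
  (exists_mem_unitaryLift (b.1.diff b'.1) (b.diff_stdJ b')).choose_spec.1

theorem pinAd_uDiff (b b' : UFrame Ω J m) : pinAd (uDiff b b') = b.1.diff b'.1 :=
  (exists_mem_unitaryLift (b.1.diff b'.1) (b.diff_stdJ b')).choose_spec.2

theorem uDiff_eq {b b' : UFrame Ω J m} {c : PinC k} (hc : c ∈ unitaryLift k)
    (h : b'.1 = b.1.act (pinAd c)) : uDiff b b' = c :=
  unitaryLift_pinAd_injective (uDiff_mem b b') hc (by rw [pinAd_uDiff, h, OFrame.diff_act])

theorem uDiff_self (b : UFrame Ω J m) : uDiff b b = 1 :=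
  uDiff_eq (one_mem _) (by rw [pinAd_one, OFrame.act_one])

theorem act_uDiff (b b' : UFrame Ω J m) : b'.1 = b.1.act (pinAd (uDiff b b')) := by
  rw [pinAd_uDiff, OFrame.act_diff]

def acCoord (b : UFrame Ω J m) : (acBundle Ω J).Fib m → PinC k :=
  Quot.lift (fun q => uDiff b q.1 * q.2) (by
    rintro ⟨b₁, a₁⟩ ⟨b₂, a₂⟩ ⟨c, hc, h1, h2⟩
    simp only at h1 h2 ⊢
    have h3 : uDiff b b₁ = uDiff b b₂ * c := by
      refine uDiff_eq (mul_mem (uDiff_mem _ _) hc) ?_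
      rw [pinAd_mul', OFrame.act_mul, ← act_uDiff, h1]
    rw [h3, h2, mul_assoc])

def acMk (b : UFrame Ω J m) (a : PinC k) : (acBundle Ω J).Fib m := Quot.mk _ (b, a)

theorem acCoord_mk (b b' : UFrame Ω J m) (a : PinC k) : acCoord b (acMk b' a) = uDiff b b' * a := rfl

theorem acCoord_mk_self (b : UFrame Ω J m) (a : PinC k) : acCoord b (acMk b a) = a := by
  rw [acCoord_mk, uDiff_self, one_mul]

theorem acMk_coord (b : UFrame Ω J m) (p : (acBundle Ω J).Fib m) : acMk b (acCoord b p) = p := by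
  induction p using Quot.ind with
  | mk q => exact (Quot.sound ⟨uDiff b q.1, uDiff_mem _ _, act_uDiff _ _, rfl⟩).symm

theorem acMk_act (b : UFrame Ω J m) (a c : PinC k) : (acBundle Ω J).act m (acMk b a) c = acMk b
    (a * c) := rfl

theorem acCoord_act (b : UFrame Ω J m) (p : (acBundle Ω J).Fib m) (a : PinC k) : acCoord b
    ((acBundle Ω J).act m p a) = acCoord b p * a := by
  rw [← acMk_coord b p, acMk_act, acCoord_mk_self, acCoord_mk_self]

theorem smooth_uDiff {b b' : ∀ m, UFrame Ω J m} (hb : FrameAt (BSmooth Z) m fun m' => (b m').1.1)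
    (hb' : (frameBundle k (bTangentEuc Ω J)).smooth (fun m' => (b' m').1) m) : SmoothGroupNear k
    (fun m' => uDiff (b m') (b' m')) m := by
  rw [smoothGroupNear_pin]
  obtain ⟨F, hF, hF'⟩ := exists_unitaryLift_smooth (k := k)
  refine ((hb.smAt_trans hb').comp hF).congr (.of_forall fun m' => ?_)
  rw [← hF' _ (uDiff_mem _ _), pinAd_uDiff]
  rfl

theorem acBundle_smooth_iff {b : ∀ m, UFrame Ω J m} (hb : FrameAt (BSmooth Z) m fun m' =>
    (b m').1.1) (σ : ∀ m, (acBundle Ω J).Fib m) : (acBundle Ω J).smooth σ m ↔ SmoothGroupNear k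
    (fun m' => acCoord (b m') (σ m')) m := by
  constructor
  · rintro ⟨b', a, hb', ha, h⟩
    refine smoothGroupNear_congr (SmoothGroupLaws.mul (smooth_uDiff hb hb') ha) ?_
    filter_upwards [h] with m' h
    rw [h]; rfl
  · intro h
    exact ⟨b, _, fun v => hb.smooth (.const v m), h, .of_forall fun m' => (acMk_coord _ _).symm⟩

include hk hZ in
theorem exists_bTangent_frame (m : M) : ∃ b : ∀ m : M, Euc k ≃ₗ[ℝ] BTangent k Z m, FrameAt
    (BSmooth Z) m b := by
  obtain ⟨y, h1, h2, h3⟩ := hZ.exists_defining m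
  obtain ⟨τ, b, hb⟩ := hZ.exists_bFrame ⟨0, by omega⟩ h1 h2 h3
  exact ⟨b, hb.frame⟩

include hk hZ hJ in
theorem exists_complex_frame (m : M) : ∃ T : Euc k ≃ₗ[ℝ] BTangent k Z m, ∀ v, T (stdJ k v) = J m
    (T v) := by
  obtain ⟨b, -⟩ := exists_bTangent_frame hk hZ m
  haveI := (b m).finiteDimensional
  exact exists_complex_equiv (stdJ k) (J m) stdJ_sq (hJ.sq m) (b m).finrank_eq

include hk hZ hΩ hJ in
theorem FrameAt.uOrth {b : ∀ m : M, Euc k ≃ₗ[ℝ] BTangent k Z m} (hb : FrameAt (BSmooth Z) m b)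
    (hi : ∀ᶠ m' in 𝓝 m, Injective (uMat (J m') (b m'))) : FrameAt (BSmooth Z) m fun m' => uOrth
    (bMetric Ω J m') (J m') (b m') := by
  have h1 : SmAt k (fun m' => uMat (J m') (b m')) m :=
    (SmAt.const _ m).sub ((hJ.smAt_homL hb).clm_comp (.const _ m))
  have h2 := hb.comp (T := fun m' => eqOf (uMat (J m') (b m')))
    (h1.congr (hi.mono fun m' h => eqL_eqOf h))
  exact (bTangentEuc_isSmooth hk hZ hΩ hJ).frameAt_orth h2

include hk hZ hΩ hJ in
theorem exists_uFrame (m : M) : ∃ b : ∀ m, UFrame Ω J m, FrameAt (BSmooth Z) m fun m' => (b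
    m').1.1 := by
  have hV := bTangentEuc_isSmooth hk hZ hΩ hJ
  have hne : ∀ m', Nonempty (UFrame Ω J m') := fun m' => by
    obtain ⟨T, hT⟩ := exists_complex_frame hk hZ hJ m'
    exact ⟨⟨hV.orth T, orthE_stdJ (hJ.metric_symm hΩ m') (hJ.pos m') (hJ.metric_invariant m')
      fun v => (hT v).symm⟩⟩
  obtain ⟨f, hf⟩ := exists_bTangent_frame hk hZ m
  obtain ⟨T, hT⟩ := exists_complex_frame hk hZ hJ m
  have hb : FrameAt (BSmooth Z) m fun m' => (T.trans (f m).symm).trans (f m') :=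
    hf.comp (T := fun _ => T.trans (f m).symm) (.const _ m)
  set b : ∀ m', Euc k ≃ₗ[ℝ] BTangent k Z m' := fun m' => (T.trans (f m).symm).trans (f m') with hbdef
  have hbm : b m = T := by ext v; exact (f m).apply_symm_apply _
  have h1 : SmAt k (fun m' => uMat (J m') (b m')) m :=
    (SmAt.const _ m).sub ((hJ.smAt_homL hb).clm_comp (.const _ m))
  have hi : ∀ᶠ m' in 𝓝 m, Injective (uMat (J m') (b m')) := by
    have h2 : IsUnit (uMat (J m) (b m)) := by
      rw [hbm, uMat_of_complex fun v => (hT v).symm]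
      exact isUnit_of_injective (injective_smul_one two_ne_zero)
    filter_upwards [h1.continuousAt.eventually (Units.isOpen.mem_nhds h2)] with m' h3
    obtain ⟨U, hU⟩ := h3
    refine Function.LeftInverse.injective (g := (U⁻¹ : E[k]ˣ).1) fun v => ?_
    rw [← hU]
    exact congrArg (fun S : E[k] => S v) U.inv_mul
  obtain ⟨u, hu⟩ : ∃ u : ∀ m, UFrame Ω J m, ∀ m', Injective (uMat (J m') (b m')) →
      (u m').1.1 = uOrth (bMetric Ω J m') (J m') (b m') := by
    have : ∀ m', ∃ u : UFrame Ω J m', Injective (uMat (J m') (b m')) →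
        u.1.1 = uOrth (bMetric Ω J m') (J m') (b m') := fun m' => by
      by_cases h : Injective (uMat (J m') (b m'))
      · exact ⟨⟨hV.orth ((eqOf (uMat (J m') (b m'))).trans (b m')), uOrth_stdJ
          (hJ.metric_symm hΩ m') (hJ.pos m') (hJ.metric_invariant m') (hJ.sq m') h⟩, fun _ => rfl⟩
      · exact ⟨(hne m').some, fun h' => absurd h' h⟩
    choose u hu using this
    exact ⟨u, hu⟩
  exact ⟨u, (hb.uOrth hk hZ hΩ hJ hi).congr (hi.mono fun m' h => hu m' h)⟩

theorem acBundle_isGen {b : ∀ m, UFrame Ω J m} (hb : FrameAt (BSmooth Z) m fun m' => (b m').1.1) :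
    (acBundle Ω J).IsGen k (fun m' => acMk (b m') 1) m := by
  filter_upwards [hb.nearby] with m' hm' σ
  rw [acBundle_smooth_iff hm']
  constructor
  · intro h
    refine ⟨_, h, .of_forall fun m'' => ?_⟩
    rw [acMk_act, one_mul, acMk_coord]
  · rintro ⟨a, ha, h⟩
    refine smoothGroupNear_congr ha (h.mono fun m'' h => ?_)
    rw [h, acMk_act, one_mul, acCoord_mk_self]

include hk hZ hΩ hJ in
theorem acBundle_principal : (acBundle Ω J).IsPrincipal k := by
  refine BundleData.isPrincipal_of_gen (fun m p => ?_) (fun m p a c => ?_) (fun m p q => ?_)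
    fun m => ?_
  · obtain ⟨b, -⟩ := exists_uFrame hk hZ hΩ hJ m
    rw [← acMk_coord (b m) p, acMk_act, mul_one]
  · obtain ⟨b, -⟩ := exists_uFrame hk hZ hΩ hJ m
    rw [← acMk_coord (b m) p, acMk_act, acMk_act, acMk_act, mul_assoc]
  · obtain ⟨b, -⟩ := exists_uFrame hk hZ hΩ hJ m
    refine ⟨(acCoord (b m) p)⁻¹ * acCoord (b m) q, ?_, fun a ha => ?_⟩
    · change (acBundle Ω J).act m p _ = q
      conv_lhs => rw [← acMk_coord (b m) p]
      rw [acMk_act, acCoord_mk_self, mul_inv_cancel_left, acMk_coord]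
    · rw [← ha, acCoord_act, inv_mul_cancel_left]
  · obtain ⟨b, hb⟩ := exists_uFrame hk hZ hΩ hJ m
    exact ⟨_, acBundle_isGen hb⟩

theorem UFrame.isSymplectic (b : UFrame Ω J m) : IsSymplecticFrame Ω m b.1.1 := fun v w => by
  have h : Ω m (b.1.1 v) (J m (b.1.1 (-stdJ k w))) = inner ℝ v (-stdJ k w) := b.1.2 v (-stdJ k w)
  rw [b.2, map_neg, stdJ_sq, neg_neg] at h
  exact h.trans (by rw [inner_neg_right, inner_stdJ])

theorem IsSymplecticFrame.det_pos {b b' : Euc k ≃ₗ[ℝ] BTangent k Z m} (hb : IsSymplecticFrame Ω m b)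
    (hb' : IsSymplecticFrame Ω m b') : 0 < det[b.trans b'.symm] := by
  refine det_pos_of_symplectic (b.trans b'.symm).injective fun v w => ?_
  change inner ℝ (stdJ k (b'.symm (b v))) (b'.symm (b w)) = _
  rw [← hb', apply_symm_apply, apply_symm_apply, hb]

theorem sympGrad_eq (b : UFrame Ω J m) (p : OFrame k (bTangentEuc Ω J) m) : sympGrad Ω J m p =
    orthDeg (b.1.diff p) := by
  have hb := b.isSymplectic
  have key : (∃ b' : Euc k ≃ₗ[ℝ] BTangent k Z m, IsSymplecticFrame Ω m b' ∧
      0 < det[p.1.trans b'.symm]) ↔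
      0 < LinearMap.det ((b.1.diff p).toLinearEquiv : Euc k →ₗ[ℝ] Euc k) := by
    refine ⟨?_, fun h => ⟨b.1.1, hb, h⟩⟩
    rintro ⟨b', hb', h⟩
    have h1 := hb'.det_pos hb
    have h2 : ((b.1.diff p).toLinearEquiv : Euc k →ₗ[ℝ] Euc k) =
        ((b'.trans b.1.1.symm : Euc k ≃ₗ[ℝ] Euc k) : Euc k →ₗ[ℝ] Euc k) ∘ₗ
          ((p.1.trans b'.symm : Euc k ≃ₗ[ℝ] Euc k) : Euc k →ₗ[ℝ] Euc k) := by
      ext1 v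
      change b.1.1.symm (p.1 v) = b.1.1.symm (b' (b'.symm (p.1 v)))
      exact congrArg _ (b'.apply_symm_apply _).symm
    rw [h2, LinearMap.det_comp]
    exact mul_pos h1 h
  classical
  rw [sympGrad, orthDeg]
  by_cases h : 0 < LinearMap.det ((b.1.diff p).toLinearEquiv : Euc k →ₗ[ℝ] Euc k)
  · rw [if_pos h, if_pos (key.mpr h)]
  · rw [if_neg h, if_neg fun h' => h (key.mp h')]

theorem acSpinC_f (b : UFrame Ω J m) (a : PinC k) : (acSpinC Ω J).f m (acMk b a) = b.1.act (pinAd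
    a) := rfl

theorem acSpinC_isSpinC (hk : 1 ≤ k) (hZ : IsHypersurface k Z) (hΩ : IsBSymplectic Z Ω)
    (hJ : IsCompatible Ω J) : (acSpinC Ω J).IsSpinC where
  frame_principal := (bTangentEuc_isSmooth hk hZ hΩ hJ).principal
  frame_grading := by
    constructor
    · intro m p A
      obtain ⟨b, -⟩ := exists_uFrame hk hZ hΩ hJ m
      refine (sympGrad_eq (b m) (OFrame.act p A)).trans (Eq.trans ?_
        (congrArg (· + orthDeg A) (sympGrad_eq (b m) p).symm))
      exact orthDeg_mul ((b m).1.diff p) A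
    · intro σ m hσ
      obtain ⟨b, hb⟩ := exists_uFrame hk hZ hΩ hJ m
      have h := eventually_orthDeg_eq (A := fun m' => (b m').1.diff (σ m'))
        (hb.smAt_trans hσ).continuousAt
      filter_upwards [h] with m' h'
      exact (sympGrad_eq (b m') (σ m')).trans (h'.trans (sympGrad_eq (b m) (σ m)).symm)
  principal := acBundle_principal hk hZ hΩ hJ
  grading := by
    constructor
    · intro m p a
      obtain ⟨b, -⟩ := exists_uFrame hk hZ hΩ hJ m
      obtain ⟨c, rfl⟩ : ∃ c, acMk (b m) c = p := ⟨_, acMk_coord (b m) p⟩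
      exact pinDeg_mul c a
    · intro σ m hσ
      obtain ⟨b, hb⟩ := exists_uFrame hk hZ hΩ hJ m
      have h : ∀ m', (acSpinC Ω J).grad m' (σ m') = pinDeg (acCoord (b m') (σ m')) := fun m' => by
        conv_lhs => rw [← acMk_coord (b m') (σ m')]
        rfl
      simp only [h]
      exact eventually_pinDeg_eq ((acBundle_smooth_iff hb σ).mp hσ)
  map_act m p a := by
    obtain ⟨b, -⟩ := exists_uFrame hk hZ hΩ hJ m
    obtain ⟨c, rfl⟩ : ∃ c, acMk (b m) c = p := ⟨_, acMk_coord (b m) p⟩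
    change (b m).1.act (pinAd (c * a)) = _
    rw [pinAd_mul']
    rfl
  map_smooth σ m hσ := by
    obtain ⟨b, hb⟩ := exists_uFrame hk hZ hΩ hJ m
    have h : (fun m' => (acSpinC Ω J).f m' (σ m')) =
        fun m' => (b m').1.act (pinAd (acCoord (b m') (σ m'))) := by
      funext m'
      conv_lhs => rw [← acMk_coord (b m') (σ m')]
      rfl
    rw [h]
    exact ((bTangentEuc_isSmooth hk hZ hΩ hJ).principal.smooth_iff (fun m' => (b m').1) _ m
      fun v => hb.smooth (.const v m)).mpr
        (smoothGroupNear_pinAd ((acBundle_smooth_iff hb σ).mp hσ))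
  map_grading m p := by
    obtain ⟨b, -⟩ := exists_uFrame hk hZ hΩ hJ m
    obtain ⟨c, rfl⟩ : ∃ c, acMk (b m) c = p := ⟨_, acMk_coord (b m) p⟩
    change sympGrad Ω J m ((b m).1.act (pinAd c)) = pinDeg c
    rw [sympGrad_eq (b m), OFrame.diff_act, orthDeg_pinAd]

/-! ## The gauge transformations -/

theorem unitOf_act {V : EucBundle.{u, v} M} (p : OFrame k V m) (A : O[k]) (w : V.Fib m) :
    (p.act A).unitOf w = A⁻¹ (p.unitOf w) := by
  have h : (p.act A).1.symm w = A.symm (p.1.symm w) := rfl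
  rw [OFrame.unitOf, OFrame.unitOf, h, LinearIsometryEquiv.norm_map]
  exact (map_smul A.symm _ _).symm

theorem norm_unitOf {V : EucBundle.{u, v} M} (p : OFrame k V m) {w : V.Fib m} (hw : w ≠ 0) :
    ‖p.unitOf w‖ = 1 := norm_smul_inv_norm (𝕜 := ℝ) fun h => hw (p.1.symm.map_eq_zero_iff.mp h)

abbrev hrefl (v : Euc k) : O[k] := Submodule.reflection (span ℝ {v})ᗮ

theorem hrefl_conj (A : O[k]) (v : Euc k) : A * hrefl v * A⁻¹ = hrefl (A v) := by
  ext1 w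
  change A (hrefl v (A.symm w)) = hrefl (A v) w
  simp only [Submodule.reflection_orthogonal_apply, Submodule.reflection_singleton_apply]
  simp only [two_smul, map_neg, map_sub, map_add, LinearIsometryEquiv.map_smul, A.apply_symm_apply,
    LinearIsometryEquiv.norm_map]
  rw [← A.inner_map_map v, A.apply_symm_apply]

theorem hrefl_apply {v : Euc k} (hv : ‖v‖ = 1) (w : Euc k) :
    hrefl v w = w - (2 * inner ℝ v w) • v := by
  rw [Submodule.reflection_orthogonal_apply, Submodule.reflection_singleton_apply, hv]
  simp only [one_pow, div_one, smul_smul, neg_sub]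
  simp [mul_smul, two_smul, RCLike.ofReal_real_eq_id]

theorem reflGauge_act {V : EucBundle.{u, v} M} (w : ∀ m, V.Fib m) (m : M) (p : OFrame k V m)
    (A : O[k]) : reflGauge w m (p.act A) = (reflGauge w m p).act A := by
  have h := hrefl_conj A⁻¹ (p.unitOf (w m))
  rw [inv_inv, ← unitOf_act] at h
  change p.act (A * hrefl ((p.act A).unitOf (w m))) = p.act (hrefl (p.unitOf (w m)) * A)
  rw [← h]
  group

open Classical in
theorem chiralGauge_mk (w : ∀ m, BTangent k Z m) (b : UFrame Ω J m) (a : PinC k) : chiralGauge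
    (acSpinC Ω J) w m (acMk b a) = acMk b (pinGamma k * pinVec (b.1.unitOf (w m)) * a) := by
  have h1 : chiralGauge (acSpinC Ω J) w m (acMk b a) = acMk b (a *
      ((if pinDeg a = 0 then 1 else pinScalar k (-1) (by simp)) * pinGamma k *
        pinVec ((b.1.act (pinAd a)).unitOf (w m)))) := by
    unfold chiralGauge
    rfl
  have h2 : pinVec ((b.1.act (pinAd a)).unitOf (w m)) = a⁻¹ * pinVec (b.1.unitOf (w m)) * a := by
    have := pinVec_conj' a⁻¹ (b.1.unitOf (w m))
    rw [inv_inv, pinAd_inv] at this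
    exact (congrArg pinVec (unitOf_act b.1 (pinAd a) (w m))).trans this.symm
  rw [h1, h2]
  congr 1
  have h3 := mul_pinGamma_sign a
  rw [← mul_assoc, h3]
  group

theorem pinGamma_mul_pinVec {v : Euc k} (hv : ‖v‖ = 1) :
    pinAd (pinGamma k * pinVec v) = hrefl v := by
  rw [pinAd_mul', pinAd_pinGamma, pinAd_vec hv, hrefl, reflection_orthogonal_eq]

theorem pinGamma_mul_pinVec_sq {v : Euc k} (hv : ‖v‖ = 1) :
    (pinGamma k * pinVec v) * (pinGamma k * pinVec v) = 1 := by
  apply pv_injective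
  have h : pv (pinVec v) * pv (pinGamma k) = -(pv (pinGamma k) * pv (pinVec v)) := by
    rw [pv_pinVec hv, pinGamma_mul_cvec, neg_neg]
  calc pv ((pinGamma k * pinVec v) * (pinGamma k * pinVec v))
      = pv (pinGamma k) * (pv (pinVec v) * pv (pinGamma k)) * pv (pinVec v) := by
        simp only [pv_mul, mul_assoc]
    _ = -((pv (pinGamma k * pinGamma k)) * (pv (pinVec v) * pv (pinVec v))) := by
        rw [h, pv_mul]; simp only [mul_neg, neg_mul, mul_assoc]
    _ = pv 1 := by
        rw [pinGamma_sq, pv_one, one_mul, pv_pinVec hv, cvec_mul_self, hv]; simp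

include hk hZ in
theorem IsHypersurface.canonical_ne_zero {W : bFields k Z} (hW : ExtendsCanonical Z W) {z : M}
    (hz : z ∈ Z) : bval W z ≠ 0 := by
  obtain ⟨y, hy⟩ := hZ.2 z hz
  obtain ⟨τ, b, hb⟩ := hZ.exists_bFrame ⟨0, by omega⟩ hy.1 hy.2.1 fun _ => hy.2.2
  rw [(hb.isCanonicalAt_iff hz hy.2.2).mp (hW z hz)]
  intro h
  have h1 := (b z).map_eq_zero_iff.mp h
  have h2 := congrArg (fun v : Euc k => v ⟨0, by omega⟩) h1
  simp at h2

include hk hZ hΩ hJ in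
theorem chiralGauge_lifts {w : ∀ m, BTangent k Z m} (hw : w m ≠ 0) (p : (acSpinC Ω J).P.Fib m) :
    (acSpinC Ω J).f m (chiralGauge (acSpinC Ω J) w m p) = reflGauge (V := bTangentEuc Ω J) w m ((acSpinC Ω J).f m p) ∧
    chiralGauge (acSpinC Ω J) w m (chiralGauge (acSpinC Ω J) w m p) = p := by
  obtain ⟨b, -⟩ := exists_uFrame hk hZ hΩ hJ m
  obtain ⟨c, rfl⟩ : ∃ c, acMk (b m) c = p := ⟨_, acMk_coord (b m) p⟩
  have hn := norm_unitOf (b m).1 hw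
  rw [chiralGauge_mk, chiralGauge_mk, ← mul_assoc, pinGamma_mul_pinVec_sq hn, one_mul]
  refine ⟨?_, rfl⟩
  refine Eq.trans ?_ (reflGauge_act (V := bTangentEuc Ω J) w m (b m).1 (pinAd c)).symm
  rw [acSpinC_f, pinAd_mul', pinGamma_mul_pinVec hn]
  rfl

include hk hZ hΩ hJ in
theorem chiralGauge_act (w : ∀ m, BTangent k Z m) (m : M) (p : (acBundle Ω J).Fib m) (a : PinC k) :
    chiralGauge (acSpinC Ω J) w m ((acBundle Ω J).act m p a) = (acBundle Ω J).act m
    (chiralGauge (acSpinC Ω J) w m p) a := by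
  obtain ⟨b, -⟩ := exists_uFrame hk hZ hΩ hJ m
  obtain ⟨c, rfl⟩ : ∃ c, acMk (b m) c = p := ⟨_, acMk_coord (b m) p⟩
  rw [acMk_act, chiralGauge_mk, chiralGauge_mk, acMk_act, mul_assoc _ c a]

theorem SmAt.unitOf {b : ∀ m, OFrame k (bTangentEuc Ω J) m} (hb : FrameAt (BSmooth Z) m fun m' =>
    (b m').1) (W : bFields k Z) (hw : bval W m ≠ 0) : SmAt k (fun m' => (b m').unitOf (bval W m'))
    m := by
  have h1 : SmAt k (fun m' => (b m').1.symm (bval W m')) m := hb.smooth_iff.mp (bval_smooth W m)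
  refine (SmAt.inv (f := fun m' => ‖(b m').1.symm (bval W m')‖) ?_ ?_).smul h1
  · refine ((h1.inner h1).sqrt ?_).congr (.of_forall fun m' => norm_eq_sqrt_real_inner _)
    exact fun h => hw ((b m).1.symm.map_eq_zero_iff.mp (inner_self_eq_zero.mp h))
  · exact fun h => hw ((b m).1.symm.map_eq_zero_iff.mp (norm_eq_zero.mp h))

include hk hZ in
theorem eventually_bval_ne_zero {W : bFields k Z} (hw : bval W m ≠ 0) : ∀ᶠ m' in 𝓝 m, bval W m' ≠
    0 := by
  obtain ⟨b, hb⟩ := exists_bTangent_frame hk hZ m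
  have h1 : SmAt k (fun m' => (b m').symm (bval W m')) m := hb.smooth_iff.mp (bval_smooth W m)
  filter_upwards [h1.continuousAt.eventually_ne (y := 0) fun h => hw ((b m).symm.map_eq_zero_iff.mp h)]
    with m' h2 h3
  exact h2 (by rw [h3, map_zero])

theorem SmAt.cvec {f : M → Euc k} (hf : SmAt k f m) : SmAt k (fun m' => _root_.cvec (f m')) m :=
  hf.comp contDiff_cvec

include hk hZ hΩ hJ in
theorem chiralGauge_smooth (W : bFields k Z) (hw : bval W m ≠ 0) (σ : ∀ m, (acBundle Ω J).Fib m)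
    (hσ : (acBundle Ω J).smooth σ m) : (acBundle Ω J).smooth (fun m' => chiralGauge (acSpinC Ω J)
    (bval W) m' (σ m')) m := by
  obtain ⟨b, hb⟩ := exists_uFrame hk hZ hΩ hJ m
  rw [acBundle_smooth_iff hb] at hσ
  refine (acBundle_smooth_iff hb (fun m' => chiralGauge (acSpinC Ω J) (bval W) m' (σ m'))).mpr ?_
  have h1 : SmoothGroupNear k (fun m' => pinGamma k * pinVec ((b m').1.unitOf (bval W m'))) m := by
    rw [smoothGroupNear_pin]
    refine ((SmAt.const (pv (pinGamma k)) m).cmul (SmAt.unitOf hb W hw).cvec).congr ?_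
    filter_upwards [eventually_bval_ne_zero hk hZ hw] with m' h
    have hn : ‖(b m').1.unitOf (bval W m')‖ = 1 := norm_unitOf (b m').1 h
    rw [pv_mul, pv_pinVec hn]
  refine smoothGroupNear_congr (SmoothGroupLaws.mul h1 hσ) (.of_forall fun m' => ?_)
  conv_lhs => rw [← acMk_coord (b m') (σ m')]
  rw [chiralGauge_mk, acCoord_mk_self]

/-! ## Polar decomposition of symplectic forms -/

section Polar

variable {V : Type*} [AddCommGroup V] [Module ℝ V]

def polarOp (K : E[k]) : E[k] := K * invSqrt (-(K * K))

section

variable {K : E[k]} (hs : ∀ v w, inner ℝ (K v) w = -inner ℝ v (K w)) (hi : Injective K)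
include hs hi

theorem isPD_neg_sq : IsPD (-(K * K)) := by
  refine ⟨fun u v => ?_, fun v hv => ?_⟩
  · change inner ℝ (-K (K u)) v = inner ℝ u (-K (K v))
    rw [inner_neg_left, inner_neg_right, hs, hs, neg_neg]
  · change 0 < inner ℝ v (-K (K v))
    rw [inner_neg_right, ← hs]
    exact real_inner_self_pos.mpr fun h => hv (hi (by rw [h, map_zero]))

theorem invSqrt_neg_sq_comm : K * invSqrt (-(K * K)) = invSqrt (-(K * K)) * K :=
  (isPD_neg_sq hs hi).invSqrt_comm (X := K) (by simp [mul_assoc])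

theorem polarOp_sq : polarOp K * polarOp K = -1 := by
  have hc := invSqrt_neg_sq_comm hs hi
  have h1 := (isPD_neg_sq hs hi).invSqrt_mul_self
  simp only [polarOp]
  set R := invSqrt (-(K * K))
  calc (K * R) * (K * R) = R * (K * K) * R := by rw [← mul_assoc, hc, mul_assoc R K K]
    _ = -(R * -(K * K) * R) := by rw [mul_neg, neg_mul, neg_neg]
    _ = -1 := by rw [h1]

theorem polarOp_comm : K * polarOp K = polarOp K * K := by
  rw [polarOp, mul_assoc, ← invSqrt_neg_sq_comm hs hi]

theorem polarOp_skew (v w : Euc k) : inner ℝ (polarOp K v) w = -inner ℝ v (polarOp K w) := by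
  change inner ℝ (K (invSqrt (-(K * K)) v)) w = _
  rw [hs, (isPD_neg_sq hs hi).invSqrt.symm, polarOp, invSqrt_neg_sq_comm hs hi]
  rfl

theorem polarOp_pos {v : Euc k} (hv : v ≠ 0) : 0 < inner ℝ (K v) (polarOp K v) := by
  have h := isPD_neg_sq hs hi
  have h1 := h.invSqrt_mul_self
  rw [mul_assoc] at h1
  have h2 := (h.invSqrt.inv h1).pos v hv
  have h3 : inner ℝ v ((-(K * K) * invSqrt (-(K * K))) v) =
      -inner ℝ v (K (K (invSqrt (-(K * K)) v))) := inner_neg_right _ _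
  rwa [h3, ← hs] at h2

end

/-- `J` is the complex structure obtained from the symplectic form `Ω` and the Euclidean metric `κ`
by polar decomposition. -/
structure IsPolar (Ω κ : V →ₗ[ℝ] V →ₗ[ℝ] ℝ) (J : V →ₗ[ℝ] V) : Prop where
  sq : ∀ u, J (J u) = -u
  invariant : ∀ u w, Ω (J u) (J w) = Ω u w
  pos : ∀ u, u ≠ 0 → 0 < Ω u (J u)
  metric : ∀ u w, κ (J u) (J w) = κ u w

def polarMat (G K : E[k]) : E[k] :=
  invSqrt G * polarOp (invSqrt G * K * invSqrt G) * (invSqrt G * G)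

/-- Polar decomposition, computed in the frame `b`. -/
def polarJ (Ω κ : V →ₗ[ℝ] V →ₗ[ℝ] ℝ) (b : Euc k ≃ₗ[ℝ] V) : V →ₗ[ℝ] V :=
  b.toLinearMap ∘ₗ (polarMat (gram κ b) (gram Ω b)).toLinearMap ∘ₗ b.symm.toLinearMap

theorem homL_polarJ (Ω κ : V →ₗ[ℝ] V →ₗ[ℝ] ℝ) (b : Euc k ≃ₗ[ℝ] V) :
    homL b b (polarJ Ω κ b) = polarMat (gram κ b) (gram Ω b) := by
  ext1 v
  change b.symm (b (polarMat _ _ (b.symm (b v)))) = _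
  rw [b.symm_apply_apply, b.symm_apply_apply]

variable {Ω κ : V →ₗ[ℝ] V →ₗ[ℝ] ℝ} (ha : ∀ u w, Ω u w = -Ω w u) (hn : ∀ u, (∀ w, Ω u w = 0) → u = 0)
  (hs : ∀ u w, κ u w = κ w u) (hp : ∀ u, u ≠ 0 → 0 < κ u u)

include ha in
theorem gram_skew (b : Euc k ≃ₗ[ℝ] V) (v w : Euc k) :
    inner ℝ (gram Ω b v) w = -inner ℝ v (gram Ω b w) := by
  rw [gram_inner, real_inner_comm, gram_inner, ha]

include hn in
theorem gram_injective (b : Euc k ≃ₗ[ℝ] V) : Injective (gram Ω b) := by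
  rw [injective_iff_map_eq_zero]
  intro v hv
  refine b.map_eq_zero_iff.mp (hn _ fun w => ?_)
  rw [← b.apply_symm_apply w, ← gram_inner, hv, inner_zero_left]

include ha hn hs hp in
theorem isPolar_polarJ (b : Euc k ≃ₗ[ℝ] V) : IsPolar Ω κ (polarJ Ω κ b) := by
  have hG := gram_isPD hs hp b
  set S := invSqrt (gram κ b) with hS
  set p := orthE κ b with hpdef
  have hpb : ∀ v, p v = b (S v) := orthE_apply hs hp b
  have hκ := gram_eq_one_iff.mp (gram_orthE hs hp b)
  have hK : gram Ω p = S * gram Ω b * S := by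
    rw [gram_eq_iff]
    intro v w
    rw [hpb, hpb]
    change _ = inner ℝ (S (gram Ω b (S v))) w
    rw [hG.invSqrt.symm, gram_inner]
  have hsk := gram_skew ha p
  have hin := gram_injective hn p
  set j := polarOp (gram Ω p) with hj
  have hJ : ∀ v, polarJ Ω κ b (p v) = p (j v) := fun v => by
    have h1 : S (gram κ b (S v)) = v := congrArg (fun T : E[k] => T v) hG.invSqrt_mul_self
    change b (S (polarOp (S * gram Ω b * S) (S (gram κ b (b.symm (p v)))))) = p (j v)
    rw [hpb v, b.symm_apply_apply, h1, hpb, hj, hK]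
  have hjj : ∀ v, j (j v) = -v := fun v =>
    congrArg (fun T : E[k] => T v) (polarOp_sq hsk hin)
  have hcomm : ∀ v, gram Ω p (j v) = j (gram Ω p v) := fun v =>
    congrArg (fun T : E[k] => T v) (polarOp_comm hsk hin)
  have hsurj : ∀ u, ∃ v, u = p v := fun u => ⟨p.symm u, (p.apply_symm_apply u).symm⟩
  refine ⟨fun u => ?_, fun u w => ?_, fun u hu => ?_, fun u w => ?_⟩
  · obtain ⟨v, rfl⟩ := hsurj u
    rw [hJ, hJ, hjj, map_neg]
  · obtain ⟨v, rfl⟩ := hsurj u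
    obtain ⟨w, rfl⟩ := hsurj w
    rw [hJ, hJ, ← gram_inner, ← gram_inner, hcomm, polarOp_skew hsk hin, ← hj, hjj,
      inner_neg_right, neg_neg]
  · obtain ⟨v, rfl⟩ := hsurj u
    rw [hJ, ← gram_inner]
    exact polarOp_pos hsk hin fun h => hu (by rw [h, map_zero])
  · obtain ⟨v, rfl⟩ := hsurj u
    obtain ⟨w, rfl⟩ := hsurj w
    rw [hJ, hJ, hκ, hκ, polarOp_skew hsk hin, ← hj, hjj, inner_neg_right, neg_neg]

include ha hn hs hp in
theorem IsPolar.unique {J J' : V →ₗ[ℝ] V} (hJ : IsPolar Ω κ J) (hJ' : IsPolar Ω κ J')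
    (b : Euc k ≃ₗ[ℝ] V) : J = J' := by
  set p := orthE κ b
  have hκ := gram_eq_one_iff.mp (gram_orthE hs hp b)
  set K := gram Ω p with hK
  have key : ∀ {J : V →ₗ[ℝ] V}, IsPolar Ω κ J → IsPD (-(homL p p J * K)) ∧
      -(homL p p J * K) * -(homL p p J * K) = -(K * K) := by
    intro J hJ
    set j := homL p p J
    have hj : ∀ v, p (j v) = J (p v) := apply_homL p p J
    have hjj : ∀ v, j (j v) = -v := fun v => p.injective (by rw [hj, hj, hJ.sq, map_neg])
    have hjs : ∀ v w, inner ℝ (j v) w = -inner ℝ v (j w) := fun v w => by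
      rw [← hκ, ← hκ, hj, hj, ← hJ.metric (p v), hJ.metric (p v), ← hJ.metric (p v) (J (p w)), hJ.sq,
        map_neg, neg_neg]
    have hcomm : ∀ v, K (j v) = j (K v) := fun v => by
      refine ext_inner_right ℝ fun w => ?_
      rw [hjs, hK, gram_inner, gram_inner, hj, hj, ← hJ.invariant (p v) (J (p w)), hJ.sq, map_neg,
        neg_neg]
    have hKs := gram_skew ha p
    refine ⟨⟨fun u v => ?_, fun v hv => ?_⟩, ?_⟩
    · change inner ℝ (-j (K u)) v = inner ℝ u (-j (K v))
      rw [inner_neg_left, inner_neg_right, hjs, hKs, hcomm, neg_neg]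
    · change 0 < inner ℝ v (-j (K v))
      rw [inner_neg_right, ← hjs, real_inner_comm, hK, gram_inner, hj]
      exact hJ.pos _ fun h => hv (p.map_eq_zero_iff.mp h)
    · ext1 v
      change -j (K (-j (K v))) = -K (K v)
      rw [map_neg, map_neg, neg_neg, hcomm, hjj]
  have h1 := (key hJ).1.sq_inj (key hJ').1 ((key hJ).2.trans (key hJ').2.symm)
  have hi := gram_injective hn p
  have h2 : homL p p J = homL p p J' := by
    ext1 v
    obtain ⟨w, rfl⟩ := LinearMap.injective_iff_surjective (f := K.toLinearMap).mp hi v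
    exact neg_injective (congrArg (fun T : E[k] => T w) h1)
  ext u
  have h3 := congrArg (fun T : E[k] => p (T (p.symm u))) h2
  simpa only [apply_homL, p.apply_symm_apply] using h3

end Polar

/-! ## Partitions of unity -/

variable {F : Type*} [NormedAddCommGroup F] [NormedSpace ℝ F]

theorem SmAt.smul_of_tsupport {χ : M → ℝ} {f : M → F} (hχ : SmAt k χ m)
    (hf : m ∈ tsupport χ → SmAt k f m) : SmAt k (fun m' => χ m' • f m') m := by
  by_cases hm : m ∈ tsupport χ
  · exact hχ.smul (hf hm)
  · refine (SmAt.const (0 : F) m).congr ?_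
    filter_upwards [(isClosed_tsupport χ).isOpen_compl.mem_nhds hm] with m' h
    rw [image_eq_zero_of_notMem_tsupport h, zero_smul]

theorem exists_partition {U : M → Set M} (hU : ∀ m, U m ∈ 𝓝 m) :
    ∃ (s : Finset M) (χ : M → M → ℝ), (∀ i, ContMDiff (𝓡 (2 * k)) 𝓘(ℝ, ℝ) ∞ (χ i)) ∧
      (∀ i, tsupport (χ i) ⊆ U i) ∧ (∀ i m, 0 ≤ χ i m) ∧ ∀ m, ∑ i ∈ s, χ i m = 1 := by
  choose χ h1 h2 h3 h4 using fun m => exists_bump (k := k) (hU m)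
  obtain ⟨s, -, hs⟩ := isCompact_univ.elim_nhds_subcover (fun m => {m' | χ m m' = 1})
    fun m _ => h2 m
  have hpos : ∀ m, 0 < ∑ i ∈ s, χ i m := fun m => by
    obtain ⟨i, hi, hm⟩ := Set.mem_iUnion₂.mp (hs (Set.mem_univ m))
    refine lt_of_lt_of_le one_pos ?_
    rw [← show χ i m = 1 from hm]
    exact Finset.single_le_sum (fun j _ => (h4 j m).1) hi
  refine ⟨s, fun i m => (∑ j ∈ s, χ j m)⁻¹ * χ i m, fun i => ?_, fun i => ?_, fun i m => ?_,
    fun m => ?_⟩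
  · exact SmAt.contMDiff fun m => (SmAt.inv (SmAt.sum s fun j _ => .of_contMDiff (h1 j) m)
      (hpos m).ne').mul (.of_contMDiff (h1 i) m)
  · refine (closure_mono fun m hm => ?_).trans (h3 i)
    exact right_ne_zero_of_mul hm
  · exact mul_nonneg (inv_nonneg.mpr (hpos m).le) (h4 i m).1
  · rw [← Finset.mul_sum, inv_mul_cancel₀ (hpos m).ne']

theorem exists_glued_field (s : Finset M) {χ : M → M → ℝ}
    (hχ : ∀ i, ContMDiff (𝓡 (2 * k)) 𝓘(ℝ, ℝ) ∞ (χ i))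
    {X : M → ∀ m : M, T[k] m} (hX : ∀ i, ∀ m ∈ tsupport (χ i), VSmoothNear (X i) m) :
    ∃ N : VField k M, ∀ m, N m = ∑ i ∈ s, χ i m • X i m := by
  choose f hf using fun i : M => show ∃ f : VField k M, ∀ m, f m = χ i m • X i m from
    ⟨⟨fun m => χ i m • X i m, fun m => by
      by_cases hm : m ∈ tsupport (χ i)
      · exact (hχ i m).smul_section (hX i m hm).self_of_nhds
      · have : ∀ᶠ m'' in 𝓝 m, χ i m'' • X i m'' = (0 : VField k M) m'' := by
          filter_upwards [(isClosed_tsupport (χ i)).isOpen_compl.mem_nhds hm] with m'' h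
          rw [image_eq_zero_of_notMem_tsupport h, zero_smul]; rfl
        exact ((0 : VField k M).contMDiff m).congr_of_eventuallyEq
          (this.mono fun m'' h => by simp only [h])⟩, fun m => rfl⟩
  refine ⟨∑ i ∈ s, f i, fun m => ?_⟩
  simp only [← hf]
  classical
  induction s using Finset.induction_on with
  | empty => simp
  | insert i t hi ih =>
    rw [Finset.sum_insert hi, Finset.sum_insert hi, ← ih]; rfl

/-! ## Existence of compatible complex structures -/

theorem smAt_polarMat {G K : M → E[k]} (hG : SmAt k G m) (hK : SmAt k K m) (hGp : ∀ m', IsPD (G m'))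
    (hKs : ∀ m' v w, inner ℝ (K m' v) w = -inner ℝ v (K m' w)) (hKi : ∀ m', Injective (K m')) : SmAt
    k (fun m' => polarMat (G m') (K m')) m := by
  have hS := hG.invSqrt (.of_forall hGp)
  have hL := (hS.clm_comp hK).clm_comp hS
  have h1 : ∀ m', IsPD (-((invSqrt (G m') * K m' * invSqrt (G m')) *
      (invSqrt (G m') * K m' * invSqrt (G m')))) := fun m' => by
    refine isPD_neg_sq (fun v w => ?_) ?_
    · change inner ℝ (invSqrt (G m') (K m' (invSqrt (G m') v))) w =
        -inner ℝ v (invSqrt (G m') (K m' (invSqrt (G m') w)))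
      rw [(hGp m').invSqrt.symm, hKs, ← (hGp m').invSqrt.symm]
    · exact (hGp m').invSqrt.injective.comp ((hKi m').comp (hGp m').invSqrt.injective)
  exact (hS.clm_comp (hL.clm_comp ((hL.clm_comp hL).neg.invSqrt (.of_forall h1)))).clm_comp
    (hS.clm_comp hG)

include hk hZ in
theorem exists_metric : ∃ κ : BForm k Z, (∀ m u w, κ m u w = κ m w u) ∧ (∀ m u, u ≠ 0 → 0 < κ m u u)
    ∧ ∀ X Y : bFields k Z, ContMDiff (𝓡 (2 * k)) 𝓘(ℝ, ℝ) ∞ fun m => κ m (bval X m) (bval Y m) := by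
  choose b hb using exists_bTangent_frame (Z := Z) hk hZ
  obtain ⟨s, χ, h1, h2, h3, h4⟩ := exists_partition (k := k) fun m => (hb m).nearby
  refine ⟨fun m => ∑ i ∈ s, χ i m • (innerₗ (Euc k)).compl₁₂ (b i m).symm.toLinearMap
    (b i m).symm.toLinearMap, fun m u w => ?_, fun m u hu => ?_, fun X Y => ?_⟩
  · simp only [LinearMap.sum_apply, LinearMap.smul_apply]
    exact Finset.sum_congr rfl fun i _ => congrArg (χ i m * ·)
      (real_inner_comm ((b i m).symm w) ((b i m).symm u))
  · simp only [LinearMap.sum_apply, LinearMap.smul_apply]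
    have hpos : ∀ i, 0 < inner ℝ ((b i m).symm u) ((b i m).symm u) := fun i =>
      real_inner_self_pos.mpr fun h => hu ((b i m).symm.map_eq_zero_iff.mp h)
    obtain ⟨i, hi, hχ⟩ : ∃ i ∈ s, 0 < χ i m := by
      by_contra! h
      have := Finset.sum_nonpos h
      rw [h4] at this
      linarith
    exact Finset.sum_pos' (fun j _ => mul_nonneg (h3 j m) (hpos j).le) ⟨i, hi, mul_pos hχ (hpos i)⟩
  · refine SmAt.contMDiff fun m => ?_
    simp only [LinearMap.sum_apply, LinearMap.smul_apply]
    refine SmAt.sum s fun i _ => SmAt.smul_of_tsupport (.of_contMDiff (h1 i) m) fun hm => ?_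
    have hf : FrameAt (BSmooth Z) m (b i) := h2 i hm
    exact (hf.smooth_iff.mp (bval_smooth X m)).inner (hf.smooth_iff.mp (bval_smooth Y m))

include hk hZ hΩ in
theorem exists_polar {κ : BForm k Z} (hs : ∀ m u w, κ m u w = κ m w u)
    (hp : ∀ m u, u ≠ 0 → 0 < κ m u u) (hκ : ∀ X Y : bFields k Z, ContMDiff (𝓡 (2 * k)) 𝓘(ℝ, ℝ) ∞ fun
    m => κ m (bval X m) (bval Y m)) : ∃ J : BEnd k Z, IsCompatible Ω J ∧ ∀ m, IsPolar (Ω m) (κ m)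
    (J m) := by
  have hne : ∀ m : M, Nonempty (Euc k ≃ₗ[ℝ] BTangent k Z m) := fun m => by
    obtain ⟨b, -⟩ := exists_bTangent_frame (Z := Z) hk hZ m
    exact ⟨b m⟩
  have hP : ∀ (m : M) (b : Euc k ≃ₗ[ℝ] BTangent k Z m), IsPolar (Ω m) (κ m) (polarJ (Ω m) (κ m) b) :=
    fun m b => isPolar_polarJ (hΩ.swap m) (hΩ.nondegenerate m) (hs m) (hp m) b
  let J : BEnd k Z := fun m => polarJ (Ω m) (κ m) (hne m).some
  refine ⟨J, ⟨fun m => (hP m _).sq, fun m => (hP m _).invariant, fun m => (hP m _).pos,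
    fun X => ?_⟩, fun m => hP m _⟩
  refine exists_bField_of_smooth fun m => ?_
  obtain ⟨b, hb⟩ := exists_bTangent_frame (Z := Z) hk hZ m
  have h1 : ∀ m', J m' = polarJ (Ω m') (κ m') (b m') := fun m' =>
    (hP m' _).unique (hΩ.swap m') (hΩ.nondegenerate m') (hs m') (hp m') (hP m' _) (b m')
  refine hb.smooth_iff.mpr ?_
  have hG := smAt_gram_of_smooth hb fun X Y => SmAt.of_contMDiff (hκ X Y) m
  have h2 := smAt_polarMat hG (hΩ.smAt_gram hb) (fun m' => gram_isPD (hs m') (hp m') _)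
    (fun m' => gram_skew (hΩ.swap m') _) (fun m' => gram_injective (hΩ.nondegenerate m') _)
  refine (h2.clm_apply (hb.smooth_iff.mp (bval_smooth X m))).congr (.of_forall fun m' => ?_)
  rw [h1, ← homL_polarJ, homL_apply, apply_symm_apply]

include hk hZ hΩ in
theorem exists_compatible : ∃ J : BEnd k Z, IsCompatible Ω J := by
  obtain ⟨κ, h1, h2, h3⟩ := exists_metric hk hZ
  obtain ⟨J, hJ, -⟩ := exists_polar hk hZ hΩ h1 h2 h3
  exact ⟨J, hJ⟩

include hJ in
theorem IsCompatible.isPolar (m : M) : IsPolar (Ω m) (bMetric Ω J m) (J m) :=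
  ⟨hJ.sq m, hJ.invariant m, hJ.pos m, hJ.metric_invariant m⟩

/-! ## Existence of oriented defining functions and of extensions of the canonical section -/

theorem frameOrientation_eq_iff (q q' : Euc k ≃ₗ[ℝ] T[k] m) : frameOrientation q = frameOrientation
    q' ↔ 0 < det[q.trans q'.symm] := by
  rw [eq_comm, frameOrientation, frameOrientation, Module.Basis.orientation_eq_iff_det_pos]
  have h : ((basisFun (Fin (2 * k)) ℝ).toBasis.map q').det
      ((basisFun (Fin (2 * k)) ℝ).toBasis.map q) =
      det[q.trans q'.symm] := by
    rw [Module.Basis.det_map]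
    have h1 := (basisFun (Fin (2 * k)) ℝ).toBasis.det_comp
      ((q.trans q'.symm : Euc k ≃ₗ[ℝ] Euc k) : Euc k →ₗ[ℝ] Euc k)
      (basisFun (Fin (2 * k)) ℝ).toBasis
    rw [Module.Basis.det_self, mul_one] at h1
    exact h1
  rw [h]

theorem det_bdiag (i : Fin (2 * k)) (t : ℝ) :
    LinearMap.det (bdiag i t : Euc k →ₗ[ℝ] Euc k) = t := by
  let B := (basisFun (Fin (2 * k)) ℝ).toBasis
  rw [← LinearMap.det_toMatrix B]
  have h : LinearMap.toMatrix B B (bdiag i t : Euc k →ₗ[ℝ] Euc k) =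
      Matrix.diagonal fun j => if j = i then t else 1 := by
    ext a c
    rw [LinearMap.toMatrix_apply]
    have h1 : B.repr ((bdiag i t : Euc k →ₗ[ℝ] Euc k) (B c)) a =
        bdiag i t (single c 1) a := by simp [B]
    rw [h1, bdiag_apply, Matrix.diagonal_apply]
    by_cases hac : a = c
    · subst hac; by_cases hai : a = i
      · subst hai; simp
      · simp [hai]
    · by_cases hai : a = i
      · subst hai; simp [hac]
      · simp [hai, hac]
  rw [h, Matrix.det_diagonal, Finset.prod_ite_eq' Finset.univ i (fun _ => t)]
  simp

theorem anchorPreserves_iff {u : Euc k ≃ₗ[ℝ] BTangent k Z m} (hu : IsSymplecticFrame Ω m u)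
    {q : Euc k ≃ₗ[ℝ] T[k] m} (hq : ∀ v, q v = anchor Z m (u v)) : AnchorPreserves Ω o m ↔
    frameOrientation q = o m := by
  refine ⟨?_, fun h => ⟨u, q, hu, hq, h⟩⟩
  rintro ⟨b, q', hb, hq', h⟩
  rw [← h, frameOrientation_eq_iff]
  have h1 : q.trans q'.symm = u.trans b.symm := by
    ext1 v
    apply q'.injective
    change q' (q'.symm (q v)) = q' (b.symm (u v))
    rw [apply_symm_apply, hq', apply_symm_apply, hq]
  rw [h1]
  exact hu.det_pos hb

theorem frequently_notMem {y : M → ℝ} {z : M} (h : IsLocalDefining (k := k) Z y z) :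
    ∃ᶠ m in 𝓝 z, m ∉ Z := by
  intro h0
  refine h.2.2 ?_
  have h1 : ∀ᶠ m in 𝓝 z, y m = 0 := by
    filter_upwards [h0, h.2.1] with m h2 h3 using h3.mp (not_not.mp h2)
  rw [mvfderiv_congr h1]
  exact mvfderiv_const (I := 𝓡 (2 * k)) (M := M) (x := z) (c := (0 : ℝ))

theorem IsLocalDefining.exists_pos_mul {y y' : M → ℝ} {z : M} (hz : z ∈ Z)
    (h : IsLocalDefining (k := k) Z y z) (h' : IsLocalDefining (k := k) Z y' z)
    (hs : ∀ᶠ m in 𝓝 z, m ∉ Z → (0 < y m ↔ 0 < y' m)) :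
    ∃ c : M → ℝ, SmAt k c z ∧ 0 < c z ∧ (∀ᶠ m in 𝓝 z, y' m = y m * c m) ∧
      ∀ v, ∂[k] y' z v = c z * ∂[k] y z v := by
  obtain ⟨c, h1, h2, h3⟩ := IsLocalDefining.exists_eq_mul hz h h'
  refine ⟨c, h1, ?_, h2, h3⟩
  by_contra hc
  rcases (not_lt.mp hc).eq_or_lt with hc | hc
  · refine h'.2.2 (ContinuousLinearMap.ext fun v => ?_)
    rw [h3, hc, zero_mul]; rfl
  · obtain ⟨m, g1, g2, g3, g4, g5⟩ := ((frequently_notMem h).and_eventually (hs.and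
      (h2.and (h.2.1.and (h1.continuousAt.eventually_lt continuousAt_const hc))))).exists
    have hy : y m ≠ 0 := fun h0 => g1 (g4.mpr h0)
    have g6 := g2 g1
    rw [g3] at g6
    rcases hy.lt_or_gt with hy | hy
    · exact hy.not_gt (g6.mpr (mul_pos_of_neg_of_neg hy g5))
    · exact (g6.mp hy).not_gt (mul_neg_of_pos_of_neg hy g5)

include hk hZ hΩ in
theorem exists_anchor_sign (ho : IsOrientation o) {i : Fin (2 * k)} {y : M → ℝ}
    {τ : ∀ m' : M, Euc k ≃ₗ[ℝ] T[k] m'} {b : ∀ m' : M, Euc k ≃ₗ[ℝ] BTangent k Z m'}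
    (h : BFrame Z i m y τ b) : ∃ ε : ℝ, ε ≠ 0 ∧ ∀ᶠ m' in 𝓝 m, m' ∉ Z →
    (0 < ε * y m' ↔ AnchorPreserves Ω o m') := by
  obtain ⟨J, hJ⟩ := exists_compatible hk hZ hΩ
  obtain ⟨u, hu⟩ := exists_uFrame hk hZ hΩ hJ m
  obtain ⟨q, hq, hqo⟩ := ho m
  have hqF : FrameAt VSmoothNear m q := h.tangent_frame.of_smooth hq
  let κ₁ : M → ℝ := fun m' => LinearMap.det (eqL ((τ m').trans (q m').symm) : Euc k →ₗ[ℝ] Euc k)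
  let κ₂ : M → ℝ := fun m' =>
    LinearMap.det (eqL ((u m').1.1.trans (b m').symm) : Euc k →ₗ[ℝ] Euc k)
  have h1 : ContinuousAt κ₁ m := continuous_det.continuousAt.comp
    (hqF.smAt_trans fun v => h.tangent_frame.smooth (.const v m)).continuousAt
  have h2 : ContinuousAt κ₂ m := continuous_det.continuousAt.comp
    (h.frame.smAt_trans fun v => hu.smooth (.const v m)).continuousAt
  have h3 : κ₁ m ≠ 0 := det_ne_zero_of_equiv ((τ m).trans (q m).symm)
  have h4 : κ₂ m ≠ 0 := det_ne_zero_of_equiv ((u m).1.1.trans (b m).symm)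
  refine ⟨κ₁ m * κ₂ m, mul_ne_zero h3 h4, ?_⟩
  have h5 : ∀ᶠ m' in 𝓝 m, 0 < (κ₁ m * κ₂ m) * (κ₁ m' * κ₂ m') :=
    continuousAt_const.eventually_lt (continuousAt_const.mul (h1.mul h2))
      (mul_self_pos.mpr (mul_ne_zero h3 h4))
  filter_upwards [h5, h.mem_iff, h.anchor, hqo] with m' g1 g2 g3 g4 hm'
  have hy : y m' ≠ 0 := fun h0 => hm' (g2.mpr h0)
  have hi := bdiag_injective i hy
  let Q : Euc k ≃ₗ[ℝ] T[k] m' :=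
    ((u m').1.1.trans (b m').symm).trans ((eqOf (bdiag i (y m'))).trans (τ m'))
  have hQ : ∀ v, Q v = anchor Z m' ((u m').1.1 v) := fun v => by
    change τ m' (eqOf (bdiag i (y m')) ((b m').symm ((u m').1.1 v))) = _
    rw [eqOf_apply hi, ← g3]
    exact congrArg _ ((b m').apply_symm_apply _)
  have hsymp : IsSymplecticFrame Ω m' (u m').1.1 := (u m').isSymplectic
  rw [anchorPreserves_iff hsymp hQ, ← g4, frameOrientation_eq_iff]
  have h6 : ((Q.trans (q m').symm : Euc k ≃ₗ[ℝ] Euc k) : Euc k →ₗ[ℝ] Euc k) =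
      (eqL ((τ m').trans (q m').symm) : Euc k →ₗ[ℝ] Euc k) ∘ₗ
        ((bdiag i (y m') : Euc k →ₗ[ℝ] Euc k) ∘ₗ
          (eqL ((u m').1.1.trans (b m').symm) : Euc k →ₗ[ℝ] Euc k)) := by
    ext1 v
    change (q m').symm (τ m' (eqOf (bdiag i (y m')) ((b m').symm ((u m').1.1 v)))) = _
    rw [eqOf_apply hi]
    rfl
  rw [h6, LinearMap.det_comp, LinearMap.det_comp, det_bdiag]
  change 0 < κ₁ m * κ₂ m * y m' ↔ 0 < κ₁ m' * (y m' * κ₂ m')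
  rw [show κ₁ m' * (y m' * κ₂ m') = (κ₁ m' * κ₂ m') * y m' by ring]
  rcases (mul_pos_iff.mp g1) with ⟨g5, g6⟩ | ⟨g5, g6⟩
  · rw [mul_pos_iff_of_pos_left g5, mul_pos_iff_of_pos_left g6]
  · rw [← neg_mul_neg (κ₁ m * κ₂ m), ← neg_mul_neg (κ₁ m' * κ₂ m'),
      mul_pos_iff_of_pos_left (neg_pos.mpr g5), mul_pos_iff_of_pos_left (neg_pos.mpr g6)]

include hk hZ hΩ in
theorem exists_oriented_local_defining (ho : IsOrientation o) (m : M) : ∃ y : M → ℝ, ∀ᶠ m' in 𝓝 m,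
    SmAt k y m' ∧ (m' ∈ Z ↔ y m' = 0) ∧ (m' ∈ Z → IsLocalDefining (k := k) Z y m') ∧ ∀ᶠ m'' in 𝓝 m', m'' ∉ Z → (0 < y m'' ↔ AnchorPreserves Ω o m'') := by
  obtain ⟨y, h1, h2, h3⟩ := hZ.exists_defining m
  obtain ⟨τ, b, hb⟩ := hZ.exists_bFrame ⟨0, by omega⟩ h1 h2 h3
  obtain ⟨ε, hε, hs⟩ := exists_anchor_sign hk hZ hΩ ho hb
  have h4 : SmAt k (fun m' => ε * y m') m := (SmAt.const ε m).mul h1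
  have h5 : ∀ᶠ m' in 𝓝 m, m' ∈ Z ↔ ε * y m' = 0 := by
    filter_upwards [h2] with m' h
    rw [h, mul_eq_zero, or_iff_right hε]
  have h6 : ∀ᶠ m' in 𝓝 m, m' ∈ Z → ∂[k] (fun m' => ε * y m') m' ≠ 0 := by
    by_cases hm : m ∈ Z
    · refine (eventually_mvfderiv_ne_zero h4 fun h0 => h3 hm ?_).mono fun _ h _ => h
      ext v
      have h7 := mvfderiv_mul_of_eq_zero h1 (SmAt.const ε m) (h2.self_of_nhds.mp hm) v
      rw [show (fun m' => y m' * ε) = fun m' => ε * y m' from funext fun _ => mul_comm _ _, h0] at h7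
      exact (mul_eq_zero.mp h7.symm).resolve_left hε
    · filter_upwards [hZ.1.isOpen_compl.mem_nhds hm] with m' h h' using absurd h' h
  refine ⟨fun m' => ε * y m', ?_⟩
  filter_upwards [h4.nearby, h5.eventually_nhds, h6,
    hs.eventually_nhds] with m' g1 g2 g3 g4
  exact ⟨g1, g2.self_of_nhds, fun hz => ⟨g1, g2, g3 hz⟩, g4⟩

include hk hZ hΩ in
theorem exists_orientedDefining (ho : IsOrientation o) : ∃ x : M → ℝ, IsOrientedDefining Ω o x := by
  choose y hy using exists_oriented_local_defining hk hZ hΩ ho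
  obtain ⟨s, χ, h1, h2, h3, h4⟩ := exists_partition (k := k) hy
  have h5 : ∀ i m, χ i m ≠ 0 → m ∈ tsupport (χ i) := fun i m h => subset_tsupport _ h
  have h6 : ∀ m, ∃ i ∈ s, 0 < χ i m := fun m => by
    by_contra! h
    have := Finset.sum_nonpos h
    rw [h4] at this
    linarith
  have hsmooth : ∀ m, SmAt k (fun m => ∑ i ∈ s, χ i m * y i m) m := fun m =>
    SmAt.sum s fun i _ => SmAt.smul_of_tsupport (.of_contMDiff (h1 i) m) fun hm => (h2 i hm).1
  have hsign : ∀ m ∉ Z, (AnchorPreserves Ω o m → 0 < ∑ i ∈ s, χ i m * y i m) ∧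
      (¬ AnchorPreserves Ω o m → ∑ i ∈ s, χ i m * y i m < 0) := by
    intro m hm
    obtain ⟨i₀, hi₀, hχ⟩ := h6 m
    constructor <;> intro hA
    · have h7 : ∀ i, χ i m ≠ 0 → 0 < y i m := fun i h =>
        ((h2 i (h5 i m h)).2.2.2.self_of_nhds hm).mpr hA
      refine Finset.sum_pos' (fun i _ => ?_) ⟨i₀, hi₀, mul_pos hχ (h7 i₀ hχ.ne')⟩
      by_cases h : χ i m = 0
      · rw [h, zero_mul]
      · exact mul_nonneg (h3 i m) (h7 i h).le
    · have h7 : ∀ i, χ i m ≠ 0 → y i m < 0 := fun i h => by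
        have g1 := h2 i (h5 i m h)
        refine lt_of_le_of_ne (not_lt.mp fun h0 => hA (g1.2.2.2.self_of_nhds hm |>.mp h0)) fun h0 => hm (g1.2.1.mpr h0)
      refine Finset.sum_neg' (fun i _ => ?_) ⟨i₀, hi₀, mul_neg_of_pos_of_neg hχ (h7 i₀ hχ.ne')⟩
      by_cases h : χ i m = 0
      · rw [h, zero_mul]
      · exact mul_nonpos_of_nonneg_of_nonpos (h3 i m) (h7 i h).le
  refine ⟨fun m => ∑ i ∈ s, χ i m * y i m, ⟨SmAt.contMDiff hsmooth, fun m => ⟨fun hm => ?_, fun h => ?_⟩,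
    fun z hz h0 => ?_⟩, fun m hm => ⟨fun h => ?_, (hsign m hm).1⟩⟩
  · refine Finset.sum_eq_zero fun i _ => ?_
    by_cases h : χ i m = 0
    · rw [h, zero_mul]
    · rw [(h2 i (h5 i m h)).2.1.mp hm, mul_zero]
  · by_contra hm
    by_cases hA : AnchorPreserves Ω o m
    · exact ((hsign m hm).1 hA).ne' h
    · exact ((hsign m hm).2 hA).ne h
  · obtain ⟨i₀, hi₀, hχ⟩ := h6 z
    have g0 := h2 i₀ (h5 i₀ z hχ.ne')
    have hev : ∀ i, z ∈ tsupport (χ i) → ∀ᶠ m in 𝓝 z, m ∉ Z → (0 < y i m ↔ AnchorPreserves Ω o m) :=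
      fun i hi => (h2 i hi).2.2.2
    have hc : ∀ i, ∃ c : M → ℝ, SmAt k c z ∧ 0 < c z ∧
        (z ∈ tsupport (χ i) → ∀ᶠ m in 𝓝 z, y i m = y i₀ m * c m) := fun i => by
      by_cases hi : z ∈ tsupport (χ i)
      · obtain ⟨c, g1, g2, g3, -⟩ := IsLocalDefining.exists_pos_mul hz (g0.2.2.1 hz) ((h2 i hi).2.2.1 hz)
          (by
            filter_upwards [hev i hi, hev i₀ (h5 i₀ z hχ.ne')] with m k1 k2 k3
            rw [k1 k3, k2 k3])
        exact ⟨c, g1, g2, fun _ => g3⟩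
      · exact ⟨fun _ => 1, .const _ z, one_pos, fun h => absurd h hi⟩
    choose c hc1 hc2 hc3 using hc
    have h7 : ∀ᶠ m in 𝓝 z, ∑ i ∈ s, χ i m * y i m = y i₀ m * ∑ i ∈ s, χ i m * c i m := by
      have : ∀ i, ∀ᶠ m in 𝓝 z, χ i m * y i m = y i₀ m * (χ i m * c i m) := fun i => by
        by_cases hi : z ∈ tsupport (χ i)
        · filter_upwards [hc3 i hi] with m hm
          rw [hm]; ring
        · filter_upwards [(isClosed_tsupport (χ i)).isOpen_compl.mem_nhds hi] with m hm
          rw [image_eq_zero_of_notMem_tsupport hm]; ring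
      filter_upwards [(Filter.eventually_all_finset s).mpr fun i _ => this i] with m hm
      rw [Finset.mul_sum]
      exact Finset.sum_congr rfl hm
    have h8 : 0 < ∑ i ∈ s, χ i z * c i z :=
      Finset.sum_pos' (fun i _ => mul_nonneg (h3 i z) (hc2 i).le) ⟨i₀, hi₀, mul_pos hχ (hc2 i₀)⟩
    refine (g0.2.2.1 hz).2.2 (ContinuousLinearMap.ext fun v => ?_)
    have h9 := mvfderiv_mul_of_eq_zero (k := k) (y := y i₀) (h := fun m => ∑ i ∈ s, χ i m * c i m)
      g0.1 (SmAt.sum s fun i _ => (SmAt.of_contMDiff (h1 i) z).mul (hc1 i)) (g0.2.1.mp hz) v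
    rw [← mvfderiv_congr h7, h0] at h9
    exact (mul_eq_zero.mp h9.symm).resolve_left h8.ne'
  · by_contra hA
    exact ((hsign m hm).2 hA).not_gt h

include hk hZ in
theorem exists_normal_field {x : M → ℝ} (hx : IsGlobalDefining k Z x) : ∃ N : VField k M, ∀ z ∈ Z,
    ∀ᶠ m in 𝓝 z, ∂[k] x m (N m) = 1 := by
  have h0 : ∀ m : M, ∃ X : ∀ m' : M, T[k] m', ∀ᶠ m' in 𝓝 m, VSmoothNear X m' ∧
      (m ∉ Z → m' ∉ Z) ∧ (m ∈ Z → ∀ᶠ m'' in 𝓝 m', ∂[k] x m'' (X m'') = 1) := by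
    intro m
    by_cases hm : m ∈ Z
    · obtain ⟨τ, hτ, h⟩ := exists_adapted_tangent_frame (⟨0, by omega⟩ : Fin (2 * k))
        (SmAt.of_contMDiff hx.1 m) (hx.2.2 m hm)
      have h1 : VSmoothNear (fun m' => τ m' (single ⟨0, by omega⟩ 1)) m := hτ.smooth (.const _ m)
      refine ⟨fun m' => τ m' (single ⟨0, by omega⟩ 1), ?_⟩
      filter_upwards [h1.nearby, h.eventually_nhds] with m' g1 g2
      exact ⟨g1, fun h => absurd hm h, fun _ => g2.mono fun m'' g => by rw [g]; simp⟩
    · refine ⟨fun m' => (0 : VField k M) m', ?_⟩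
      filter_upwards [hZ.1.isOpen_compl.mem_nhds hm] with m' h
      exact ⟨VField.vSmoothNear _ m', fun _ => h, fun h => absurd h hm⟩
  choose X hX using h0
  obtain ⟨s, χ, h1, h2, h3, h4⟩ := exists_partition (k := k) hX
  obtain ⟨N, hN⟩ := exists_glued_field s h1 (X := X) fun i m hm => (h2 i hm).1
  refine ⟨N, fun z hz => ?_⟩
  have h5 : ∀ i, ∀ᶠ m in 𝓝 z, χ i m * ∂[k] x m (X i m) = χ i m := fun i => by
    by_cases hi : z ∈ tsupport (χ i)
    · have g := h2 i hi
      have hiZ : i ∈ Z := by_contra fun h => g.2.1 h hz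
      filter_upwards [g.2.2 hiZ] with m hm
      rw [hm, mul_one]
    · filter_upwards [(isClosed_tsupport (χ i)).isOpen_compl.mem_nhds hi] with m hm
      rw [image_eq_zero_of_notMem_tsupport hm, zero_mul]
  filter_upwards [(Filter.eventually_all_finset s).mpr fun i _ => h5 i] with m hm
  rw [hN, map_sum, ← h4 m]
  refine Finset.sum_congr rfl fun i hi => ?_
  rw [map_smul]
  exact hm i hi

include hk hZ in
theorem exists_extendsCanonical {x : M → ℝ} (hx : IsGlobalDefining k Z x) : ∃ W : bFields k Z,
    ExtendsCanonical Z W := by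
  obtain ⟨N, hN⟩ := exists_normal_field hk hZ hx
  let W : bFields k Z := ⟨⟨fun m => x m • N m, hx.1.smul_section N.contMDiff⟩, fun z hz y hy => by
    change ∂[k] y z (x z • N z) = 0
    rw [(hx.2.1 z).mp hz, map_smul, zero_smul]⟩
  exact ⟨W, fun z hz => ⟨W, x, fun m => N m, ⟨SmAt.of_contMDiff hx.1 z, .of_forall hx.2.1, hx.2.2 z hz⟩,
    VField.vSmoothNear N z, hN z hz, .of_forall fun _ => rfl, rfl⟩⟩

/-! ## Clutching maps -/

theorem VSmoothNear.smul {c : M → ℝ} {X : ∀ m : M, T[k] m} (hc : SmAt k c m) (hX : VSmoothNear X m)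
    : VSmoothNear (fun m' => c m' • X m') m := by
  obtain ⟨e, he⟩ := exists_tangent_frame (k := k) m
  refine he.smooth_iff.mpr ((hc.smul (he.smooth_iff.mp hX)).congr (.of_forall fun m' => ?_))
  exact map_smul (e m').symm _ _

theorem VSmoothNear.add {X Y : ∀ m : M, T[k] m} (hX : VSmoothNear X m) (hY : VSmoothNear Y m) :
    VSmoothNear (fun m' => X m' + Y m') m := by
  obtain ⟨e, he⟩ := exists_tangent_frame (k := k) m
  refine he.smooth_iff.mpr (((he.smooth_iff.mp hX).add (he.smooth_iff.mp hY)).congr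
    (.of_forall fun m' => ?_))
  exact map_add (e m').symm _ _

theorem pairing_eq_zero {V : Type*} [AddCommGroup V] [Module ℝ V] (β : V →ₗ[ℝ] V →ₗ[ℝ] ℝ)
    {u v w : V} {c s : ℝ} (h : u + c • w + s • v = 0) :
    β u u + c * β u w + s * β u v = 0 := by
  rw [← smul_eq_mul, ← smul_eq_mul, ← map_smul, ← map_smul, ← map_add, ← map_add, h, map_zero]

/-- The linear form `⟨w, ·⟩ / |w|²`, where `w` is the value of `W`. -/
def dualForm (Ω : BForm k Z) (J : BEnd k Z) (W : bFields k Z) (m : M) : BTangent k Z m →ₗ[ℝ] ℝ :=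
  (bMetric Ω J m (bval W m) (bval W m))⁻¹ • bMetric Ω J m (bval W m)

theorem dualForm_apply (m : M) (u : BTangent k Z m) : dualForm Ω J W m u =
    (bMetric Ω J m (bval W m) (bval W m))⁻¹ * bMetric Ω J m (bval W m) u := rfl

/-- The reflection in the hyperplane perpendicular to `W`. -/
def bRefl (Ω : BForm k Z) (J : BEnd k Z) (W : bFields k Z) (m : M) :
    BTangent k Z m →ₗ[ℝ] BTangent k Z m :=
  LinearMap.id - (2 : ℝ) • (dualForm Ω J W m).smulRight (bval W m)

theorem bRefl_apply (m : M) (u : BTangent k Z m) :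
    bRefl Ω J W m u = u - (2 * dualForm Ω J W m u) • bval W m := by
  change u - (2 : ℝ) • (dualForm Ω J W m u • bval W m) = _
  rw [smul_smul]

include hJ in
theorem IsCompatible.metric_pos {u : BTangent k Z m} (hu : u ≠ 0) : 0 < bMetric Ω J m u u := hJ.pos m u hu

include hJ in
theorem dualForm_self (hw : bval W m ≠ 0) : dualForm Ω J W m (bval W m) = 1 := inv_mul_cancel₀ (hJ.metric_pos hw).ne'

include hJ in
theorem bRefl_bRefl (hw : bval W m ≠ 0) (u : BTangent k Z m) : bRefl Ω J W m (bRefl Ω J W m u) =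
    u := by
  rw [bRefl_apply, bRefl_apply, map_sub, map_smul, dualForm_self hJ hw, smul_eq_mul, sub_sub,
    ← add_smul]
  have : 2 * dualForm Ω J W m u + 2 * (dualForm Ω J W m u - 2 * dualForm Ω J W m u * 1) = 0 := by
    ring
  rw [this, zero_smul, sub_zero]

def OFrame.toB (p : OFrame k (bTangentEuc Ω J) m) : Euc k ≃ₗ[ℝ] BTangent k Z m := p.1

theorem OFrame.metric_toB (p : OFrame k (bTangentEuc Ω J) m) (v w : Euc k) : bMetric Ω J m (p.toB v)
    (p.toB w) = inner ℝ v w := p.2 v w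

theorem bRefl_frame {q : Euc k ≃ₗ[ℝ] BTangent k Z m} (h0 : ∀ v w, bMetric Ω J m (q v) (q w) = inner
    ℝ v w) {c : Euc k} (hc : q c = bval W m) (v : Euc k) : bRefl Ω J W m (q v) = q
    (v - (2 * inner ℝ (‖c‖⁻¹ • c) v) • (‖c‖⁻¹ • c)) := by
  rw [bRefl_apply, dualForm_apply, ← hc, h0, h0, map_sub, map_smul, map_smul, smul_smul,
    real_inner_smul_left, real_inner_self_eq_norm_sq]
  congr 2
  rw [pow_two, mul_inv]; ring

theorem reflGauge_apply (hw : bval W m ≠ 0) (p : OFrame k (bTangentEuc Ω J) m) (v : Euc k) :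
    (reflGauge (V := bTangentEuc Ω J) (bval W) m p).toB v = bRefl Ω J W m (p.toB v) :=
  (congrArg p.toB (hrefl_apply (norm_unitOf p hw) v)).trans
    (bRefl_frame p.metric_toB (p.toB.apply_symm_apply (bval W m)) v).symm

def HomSmooth (A : ∀ m, BTangent k Z m →ₗ[ℝ] T[k] m) (m : M) : Prop :=
  ∀ s, BSmooth Z s m → VSmoothNear (fun m' => A m' (s m')) m

variable {A B : ∀ m, BTangent k Z m →ₗ[ℝ] T[k] m}

theorem HomSmooth.smul {c : M → ℝ} (hc : SmAt k c m) (hA : HomSmooth A m) : HomSmooth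
    (fun m' => c m' • A m') m := fun s hs => .smul hc (hA s hs)

theorem HomSmooth.add (hA : HomSmooth A m) (hB : HomSmooth B m) : HomSmooth (fun m' => A m' + B m')
    m := fun s hs => .add (hA s hs) (hB s hs)

theorem HomSmooth.congr (hA : HomSmooth A m) (h : ∀ᶠ m' in 𝓝 m, B m' = A m') : HomSmooth B m := fun s hs => (hA s hs).congr (h.mono fun m' h => by rw [h])

/-- `A` is smooth as a homomorphism from the surgery of the b-tangent bundle to the tangent
bundle. -/
def ClutchSmooth (Ω : BForm k Z) (J : BEnd k Z) (W : bFields k Z) (x : M → ℝ)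
    (A : ∀ m, BTangent k Z m →ₗ[ℝ] T[k] m) : Prop :=
  ∀ m, (x m ≠ 0 → HomSmooth A m) ∧ (x m = 0 → ∃ A', HomSmooth A' m ∧ ∀ᶠ m' in 𝓝 m,
    (0 ≤ x m' → A m' = A' m') ∧ (x m' < 0 → A m' = A' m' ∘ₗ bRefl Ω J W m'))

theorem ClutchSmooth.comb (hA : ClutchSmooth Ω J W x A) (hB : ClutchSmooth Ω J W x B) (c d : ℝ) :
    ClutchSmooth Ω J W x fun m => c • A m + d • B m := by
  refine fun m => ⟨fun hm => .add (.smul (.const c m) ((hA m).1 hm)) (.smul (.const d m) ((hB m).1 hm)),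
    fun hm => ?_⟩
  obtain ⟨A', h1, h2⟩ := (hA m).2 hm
  obtain ⟨B', h3, h4⟩ := (hB m).2 hm
  refine ⟨_, .add (.smul (.const c m) h1) (.smul (.const d m) h3), ?_⟩
  filter_upwards [h2, h4] with m' g1 g2
  refine ⟨fun h => by rw [g1.1 h, g2.1 h], fun h => ?_⟩
  rw [g1.2 h, g2.2 h, LinearMap.add_comp, LinearMap.smul_comp, LinearMap.smul_comp]

theorem finrank_tangent (m : M) : Module.finrank ℝ (T[k] m) = 2 * k :=
  finrank_euclideanSpace_fin (𝕜 := ℝ) (n := 2 * k)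

def homFrame (A : BTangent k Z m →ₗ[ℝ] T[k] m) (hA : Injective A) (p : Euc k ≃ₗ[ℝ] BTangent k Z m) :
    Euc k ≃ₗ[ℝ] T[k] m := haveI : FiniteDimensional ℝ (T[k] m) :=
    inferInstanceAs (FiniteDimensional ℝ (Euc k))
  LinearEquiv.ofBijective (A ∘ₗ p.toLinearMap) (by
    have h : Injective (A ∘ₗ p.toLinearMap) := hA.comp p.injective
    exact ⟨h, (LinearMap.injective_iff_surjective_of_finrank_eq_finrank (by
      rw [finrank_tangent, finrank_euclideanSpace_fin])).mp h⟩)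

/-- The map of orthonormal frames induced by the isometric part of `A`. -/
def clutchMap (g : RMetric k M) (A : ∀ m, BTangent k Z m →ₗ[ℝ] T[k] m)
    (hA : ∀ m, Injective (A m)) (m : M) (p : OFrame k (bTangentEuc Ω J) m) :
    OFrame k (tangentEuc g) m :=
  (tangentEuc_isSmooth g).orth (V := tangentEuc g) (homFrame (A m) (hA m) p.toB)

theorem clutchMap_apply (hA : ∀ m, Injective (A m)) (m : M)
    (p : OFrame k (bTangentEuc Ω J) m) : ∃ R : E[k], IsPD R ∧
      ∀ v, tangentFrame (clutchMap g A hA m p) v = A m (p.toB (R v)) :=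
  ⟨invSqrt (gram (metricForm g m) (homFrame (A m) (hA m) p.toB)),
    (gram_isPD ((tangentEuc_isSmooth g).symm m) ((tangentEuc_isSmooth g).pos m) _).invSqrt,
    orthE_apply (β := metricForm g m) ((tangentEuc_isSmooth g).symm m)
      ((tangentEuc_isSmooth g).pos m) (homFrame (A m) (hA m) p.toB)⟩

theorem clutchMap_act (hA : ∀ m, Injective (A m)) (m : M)
    (p : OFrame k (bTangentEuc Ω J) m) (T : O[k]) :
    clutchMap g A hA m (p.act T) = (clutchMap g A hA m p).act T := by
  have h : homFrame (A m) (hA m) (p.act T).toB =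
      T.toLinearEquiv.trans (homFrame (A m) (hA m) p.toB) := LinearEquiv.ext fun _ => rfl
  unfold clutchMap
  rw [h]
  exact (tangentEuc_isSmooth g).orth_act (V := tangentEuc g) _ T

theorem clutchMap_smooth_of (hA : ∀ m, Injective (A m)) {σ : ∀ m, OFrame k (bTangentEuc Ω J) m}
    (h : ∀ v, VSmoothNear (fun m' => A m' ((σ m').toB v)) m) : (frameBundle k (tangentEuc g)).smooth
    (fun m' => clutchMap g A hA m' (σ m')) m := by
  obtain ⟨e, he⟩ := exists_tangent_frame (k := k) m
  have h1 : FrameAt VSmoothNear m fun m' => homFrame (A m') (hA m') (σ m').toB := he.of_smooth h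
  exact (tangentEuc_isSmooth g).smooth_iff_frameAt.mpr ((tangentEuc_isSmooth g).frameAt_orth h1)

include hJ in
theorem clutchMap_smooth (hΩ : IsBSymplectic Z Ω) (hA : ∀ m, Injective (A m))
    (hAs : ClutchSmooth Ω J W x A) (hk : 1 ≤ k) (hZ : IsHypersurface k Z)
    (hW : ∀ m, x m = 0 → bval W m ≠ 0) (σ : ∀ m, OFrame k (bTangentEuc Ω J) m) (m : M)
    (hσ : ((frameBundle k (bTangentEuc Ω J)).surgery x (reflGauge (V := bTangentEuc Ω J) (bval W))).smooth σ m) :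
    (frameBundle k (tangentEuc g)).smooth (fun m' => clutchMap g A hA m' (σ m')) m := by
  refine clutchMap_smooth_of hA fun v => ?_
  by_cases hm : x m = 0
  · obtain ⟨s, hs, h1⟩ := hσ.2 hm
    obtain ⟨A', h2, h3⟩ := (hAs m).2 hm
    have hs' : BSmooth Z (fun m' => (s m').toB v) m := hs v
    refine (h2 _ hs').congr ?_
    filter_upwards [h1, h3, eventually_bval_ne_zero hk hZ (hW m hm)] with m' g1 g2 g3
    rcases le_or_gt 0 (x m') with h | h
    · rw [g1.1 h, g2.1 h]
    · have g4 : (σ m').toB v = bRefl Ω J W m' ((s m').toB v) :=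
        (congrArg (fun q : OFrame k (bTangentEuc Ω J) m' => q.toB v) (g1.2 h)).trans
          (reflGauge_apply g3 _ _)
      rw [g4, g2.2 h, LinearMap.comp_apply, bRefl_bRefl hJ g3]
  · have hσ' : BSmooth Z (fun m' => (σ m').toB v) m := hσ.1 hm v
    exact (hAs m).1 hm _ hσ'

include hk hZ in
theorem exists_transverse (hx : IsGlobalDefining k Z x) (hW : ExtendsCanonical Z W) : ∃ N : VField k
    M, (∀ m, W.1 m = x m • N m) ∧ ∀ z ∈ Z, ∂[k] x z (N z) = 1 := by
  have h0 : ∀ m : M, ∃ X : ∀ m' : M, T[k] m', ∀ᶠ m' in 𝓝 m, VSmoothNear X m' ∧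
      W.1 m' = x m' • X m' ∧ (m' ∈ Z → ∂[k] x m' (X m') = 1) := by
    intro m
    have hxm : SmAt k x m := SmAt.of_contMDiff hx.1 m
    by_cases hm : m ∈ Z
    · let i : Fin (2 * k) := ⟨0, by omega⟩
      obtain ⟨τ, b, hb⟩ := hZ.exists_bFrame i hxm (.of_forall hx.2.1) fun _ => hx.2.2 m hm
      let v : M → Euc k := fun m' => (b m').symm (bval W m')
      have hv : SmAt k v m := hb.frame.smooth_iff.mp (bval_smooth W m)
      have hvZ : ∀ᶠ m' in 𝓝 m, x m' = 0 → v m' = single i 1 := by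
        filter_upwards [hb.nearby] with m' hb' h
        have hm' := (hx.2.1 m').mpr h
        change (b m').symm (bval W m') = _
        rw [(hb'.isCanonicalAt_iff hm' (hx.2.2 m' hm')).mp (hW m' hm')]
        exact (b m').symm_apply_apply _
      have hh : ∀ j, j ≠ i → ∃ h : M → ℝ, SmAt k h m ∧ ∀ᶠ m' in 𝓝 m, v m' j = x m' * h m' :=
        fun j hj => smAt_hadamard hxm (smAt_euc_iff.mp hv j)
          (hvZ.mono fun m' h h' => by rw [h h']; simp [hj]) fun _ => hx.2.2 m hm
      have hh' : ∀ j, ∃ h : M → ℝ, SmAt k h m ∧ (j = i → h = fun m' => v m' i) ∧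
          (j ≠ i → ∀ᶠ m' in 𝓝 m, v m' j = x m' * h m') := fun j => by
        by_cases hj : j = i
        · exact ⟨fun m' => v m' i, smAt_euc_iff.mp hv i, fun _ => rfl, fun h => absurd hj h⟩
        · obtain ⟨h, h1, h2⟩ := hh j hj
          exact ⟨h, h1, fun h' => absurd h' hj, fun _ => h2⟩
      choose h h1 h2 h3 using hh'
      let u : M → Euc k := fun m' => WithLp.toLp 2 fun j => h j m'
      have hu : SmAt k u m := smAt_euc_iff.mpr h1
      refine ⟨fun m' => τ m' (u m'), ?_⟩
      have hev : ∀ᶠ m' in 𝓝 m, ∀ j, j ≠ i → v m' j = x m' * h j m' := by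
        refine Filter.eventually_all.mpr fun j => ?_
        by_cases hj : j = i
        · exact .of_forall fun _ h => absurd hj h
        · exact (h3 j hj).mono fun _ h _ => h
      filter_upwards [VSmoothNear.nearby (hb.tangent_frame.smooth hu), hev, hb.anchor,
        hb.mvfderiv hm, hvZ] with m' g1 g2 g3 g4 g5
      refine ⟨g1, ?_, fun hz => ?_⟩
      · have g6 : W.1 m' = τ m' (bdiag i (x m') (v m')) := by
          rw [← g3]
          exact ((congrArg _ ((b m').apply_symm_apply _)).trans (anchor_bval W m')).symm
        rw [g6, ← map_smul]
        congr 1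
        ext j
        rw [bdiag_apply]
        by_cases hj : j = i
        · subst hj; rw [if_pos rfl]; simp [u, h2 _ rfl]
        · rw [if_neg hj, g2 j hj]; simp [u]
      · rw [g4]
        change h i m' = 1
        rw [h2 i rfl]
        change v m' i = 1
        rw [g5 ((hx.2.1 m').mp hz)]
        simp
    · refine ⟨fun m' => (x m')⁻¹ • W.1 m', ?_⟩
      have h0 : x m ≠ 0 := fun h => hm ((hx.2.1 m).mpr h)
      filter_upwards [VSmoothNear.nearby (VSmoothNear.smul (hxm.inv h0) (VField.vSmoothNear W.1 m)),
        hxm.continuousAt.eventually_ne h0] with m' g1 g2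
      exact ⟨g1, by rw [smul_smul, mul_inv_cancel₀ g2, one_smul],
        fun hz => absurd ((hx.2.1 m').mp hz) g2⟩
  choose X hX using h0
  obtain ⟨s, χ, h1, h2, h3, h4⟩ := exists_partition (k := k) hX
  obtain ⟨N, hN⟩ := exists_glued_field s h1 (X := X) fun i m hm => (h2 i hm).1
  refine ⟨N, fun m => ?_, fun z hz => ?_⟩
  · rw [hN, Finset.smul_sum]
    calc W.1 m = (∑ i ∈ s, χ i m) • W.1 m := by rw [h4, one_smul]
      _ = ∑ i ∈ s, χ i m • W.1 m := Finset.sum_smul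
      _ = _ := Finset.sum_congr rfl fun i _ => by
        by_cases hi : m ∈ tsupport (χ i)
        · rw [(h2 i hi).2.1, smul_comm]
        · rw [image_eq_zero_of_notMem_tsupport hi, zero_smul, zero_smul, smul_zero]
  · rw [hN, map_sum, ← h4 z]
    refine Finset.sum_congr rfl fun i _ => ?_
    rw [map_smul]
    by_cases hi : z ∈ tsupport (χ i)
    · rw [(h2 i hi).2.2 hz]; simp
    · rw [image_eq_zero_of_notMem_tsupport hi]; simp

include hk hZ in
theorem anchor_injective (hm : m ∉ Z) : Injective (anchor (k := k) Z m) := by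
  obtain ⟨y, h1, h2, h3⟩ := hZ.exists_defining m
  obtain ⟨τ, b, hb⟩ := hZ.exists_bFrame ⟨0, by omega⟩ h1 h2 h3
  rw [injective_iff_map_eq_zero]
  intro u hu
  rw [← (b m).apply_symm_apply u, hb.anchor.self_of_nhds] at hu
  have h4 := (injective_iff_map_eq_zero _).mp (bdiag_injective ⟨0, by omega⟩ (t := y m)
    fun h => hm (h2.self_of_nhds.mpr h)) _ ((τ m).map_eq_zero_iff.mp hu)
  exact (b m).symm.map_eq_zero_iff.mp h4

include hk hZ in
theorem anchor_eq_zero (hW : ExtendsCanonical Z W) {z : M} (hz : z ∈ Z) {u : BTangent k Z z}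
    (hu : anchor Z z u = 0) : ∃ c : ℝ, u = c • bval W z := by
  let i : Fin (2 * k) := ⟨0, by omega⟩
  obtain ⟨y, h1, h2, h3⟩ := hZ.exists_defining z
  obtain ⟨τ, b, hb⟩ := hZ.exists_bFrame i h1 h2 h3
  rw [← (b z).apply_symm_apply u, hb.anchor.self_of_nhds] at hu
  have h4 := (τ z).map_eq_zero_iff.mp hu
  refine ⟨(b z).symm u i, ?_⟩
  rw [(hb.isCanonicalAt_iff hz (h3 hz)).mp (hW z hz), ← map_smul, ← LinearEquiv.symm_apply_eq]
  ext j
  have h5 := congrArg (fun v : Euc k => v j) h4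
  simp only [bdiag_apply] at h5
  by_cases hj : j = i
  · subst hj; simp
  · rw [if_neg hj] at h5; simp [hj, h5]

theorem mvfderiv_anchor (hx : IsGlobalDefining k Z x) {z : M} (hz : z ∈ Z) (u : BTangent k Z z) :
    ∂[k] x z (anchor Z z u) = 0 := by
  obtain ⟨X, rfl⟩ := (bVanishing (k := k) Z z).mkQ_surjective u
  exact X.2 z hz x ⟨SmAt.of_contMDiff hx.1 z, .of_forall hx.2.1, hx.2.2 z hz⟩

/-- `anchor + c N ⊗ ⟨w, ·⟩ / |w|²`. -/
def collar (Ω : BForm k Z) (J : BEnd k Z) (W : bFields k Z) (N : VField k M) (c : M → ℝ) (m : M) :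
    BTangent k Z m →ₗ[ℝ] T[k] m := anchor Z m + c m • (dualForm Ω J W m).smulRight (N m)

theorem collar_apply (c : M → ℝ) (m : M) (u : BTangent k Z m) :
    collar Ω J W N c m u = anchor Z m u + (c m * dualForm Ω J W m u) • N m := by
  change anchor Z m u + c m • (dualForm Ω J W m u • N m) = _
  rw [smul_smul]

theorem homSmooth_anchor (m : M) : HomSmooth (anchor (k := k) Z) m := by
  rintro s ⟨X, hX⟩
  exact (VField.vSmoothNear X.1 m).congr (hX.mono fun m' h => by rw [h, anchor_bval])

include hk hZ hΩ hJ in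
theorem homSmooth_collar {c : M → ℝ} (hc : SmAt k c m) (hw : bval W m ≠ 0) : HomSmooth
    (collar Ω J W N c) m := by
  have hV := bTangentEuc_isSmooth hk hZ hΩ hJ
  refine .add (homSmooth_anchor m) (.smul hc fun s hs => .smul ?_ (VField.vSmoothNear N m))
  exact ((hV.smAt_form (bval_smooth W m) (bval_smooth W m)).inv (hJ.metric_pos hw).ne').mul
    (hV.smAt_form (bval_smooth W m) hs)

/-- `f` is a smooth positive function with `|x| ≤ f` that agrees with `|x|` outside the region
where `W` is not zero. -/
structure IsCollar (x f : M → ℝ) (W : bFields k Z) : Prop where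
  smooth : ∀ m, SmAt k f m
  pos : ∀ m, 0 < f m
  abs_le : ∀ m, |x m| ≤ f m
  supp : ∀ m, (∀ᶠ m' in 𝓝 m, f m' = |x m'|) ∨ bval W m ≠ 0

include hZ in
theorem exists_collar_function (hx : IsGlobalDefining k Z x) {U : M → Prop}
    (hU : ∀ z ∈ Z, ∀ᶠ m in 𝓝 z, U m) {η : ℝ} (hη : 0 < η) : ∃ f : M → ℝ, (∀ m, SmAt k f m) ∧
    (∀ m, 0 < f m) ∧ (∀ m, |x m| ≤ f m) ∧ ∀ m, (∀ᶠ m' in 𝓝 m, f m' = |x m'|) ∨ (U m ∧ f m ≤ η) := by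
  have hxs : ∀ m, SmAt k x m := SmAt.of_contMDiff hx.1
  have h0 : ∀ m : M, ∀ᶠ m' in 𝓝 m, (m ∈ Z → U m' ∧ |x m'| < η / 2) ∧ (m ∉ Z → m' ∉ Z) := by
    intro m
    by_cases hm : m ∈ Z
    · have h1 : ∀ᶠ m' in 𝓝 m, |x m'| < η / 2 :=
        (hxs m).continuousAt.abs.eventually_lt continuousAt_const (by
          rw [(hx.2.1 m).mp hm, abs_zero]; exact half_pos hη)
      filter_upwards [hU m hm, h1] with m' g1 g2
      exact ⟨fun _ => ⟨g1, g2⟩, fun h => absurd hm h⟩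
    · filter_upwards [hZ.1.isOpen_compl.mem_nhds hm] with m' h
      exact ⟨fun h => absurd h hm, fun _ => h⟩
  obtain ⟨s, χ, h1, h2, h3, h4⟩ := exists_partition (k := k) h0
  classical
  let ρ : M → ℝ := fun m => ∑ i ∈ s with i ∈ Z, χ i m
  have hρ0 : ∀ m, 0 ≤ ρ m := fun m => Finset.sum_nonneg fun i _ => h3 i m
  have hρ1 : ∀ m, ρ m ≤ 1 := fun m => by
    rw [← h4 m]
    exact Finset.sum_le_sum_of_subset_of_nonneg (Finset.filter_subset _ _) fun i _ _ => h3 i m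
  have hρZ : ∀ m ∈ Z, ρ m = 1 := fun m hm => by
    rw [← h4 m]
    refine Finset.sum_filter_of_ne fun i _ hi => ?_
    by_contra hiZ
    exact (h2 i (subset_tsupport _ hi)).2 hiZ hm
  have hρs : ∀ m, SmAt k ρ m := fun m => SmAt.sum _ fun i _ => SmAt.of_contMDiff (h1 i) m
  let q : M → ℝ := fun m => x m * x m + η / 2 * (η / 2) * ρ m
  have hq : ∀ m, 0 < q m := fun m => by
    have h5 := mul_self_nonneg (x m)
    by_cases hm : m ∈ Z
    · have : 0 < η / 2 * (η / 2) * ρ m := by rw [hρZ m hm]; positivity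
      exact add_pos_of_nonneg_of_pos h5 this
    · have : 0 < x m * x m := mul_self_pos.mpr fun h => hm ((hx.2.1 m).mpr h)
      have := hρ0 m
      positivity
  refine ⟨fun m => Real.sqrt (q m), fun m => SmAt.sqrt (((hxs m).mul (hxs m)).add
    ((SmAt.const _ m).mul (hρs m))) (hq m).ne', fun m => Real.sqrt_pos.mpr (hq m), fun m => ?_,
    fun m => ?_⟩
  · rw [← Real.sqrt_mul_self_eq_abs]
    have := hρ0 m
    exact Real.sqrt_le_sqrt (le_add_of_nonneg_right (by positivity))
  · by_cases hm : ∃ i ∈ s, i ∈ Z ∧ m ∈ tsupport (χ i)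
    · obtain ⟨i, -, hi, hmi⟩ := hm
      obtain ⟨g1, g2⟩ := (h2 i hmi).1 hi
      refine .inr ⟨g1, ?_⟩
      rw [Real.sqrt_le_left hη.le]
      have g3 : x m * x m ≤ η / 2 * (η / 2) := by
        rw [← abs_mul_abs_self]
        exact mul_self_le_mul_self (abs_nonneg _) g2.le
      have g4 := hρ1 m
      have g5 : 0 < η / 2 * (η / 2) := by positivity
      change x m * x m + η / 2 * (η / 2) * ρ m ≤ η ^ 2
      nlinarith
    · push Not at hm
      left
      have h5 : ∀ i ∈ s, ∀ᶠ m' in 𝓝 m, i ∈ Z → χ i m' = 0 := fun i hi => by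
        by_cases hiZ : i ∈ Z
        · filter_upwards [(isClosed_tsupport (χ i)).isOpen_compl.mem_nhds (hm i hi hiZ)] with m' g _
          exact image_eq_zero_of_notMem_tsupport g
        · exact .of_forall fun _ h => absurd h hiZ
      filter_upwards [(Filter.eventually_all_finset s).mpr h5] with m' g
      have : ρ m' = 0 := Finset.sum_eq_zero fun i hi =>
        g i (Finset.mem_filter.mp hi).1 (Finset.mem_filter.mp hi).2
      change Real.sqrt (x m' * x m' + η / 2 * (η / 2) * ρ m') = _
      rw [this, mul_zero, add_zero, Real.sqrt_mul_self_eq_abs]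

/-- The coefficient of the correction of the anchor for which the result is smooth after surgery. -/
def collarCoeff (x f : M → ℝ) (m : M) : ℝ := if 0 ≤ x m then f m - x m else -(f m + x m)

section
variable (hx : IsGlobalDefining k Z x) (hW : ExtendsCanonical Z W) (hf : IsCollar x f W)
  (hN : ∀ m, W.1 m = x m • N m) (hNZ : ∀ z ∈ Z, ∂[k] x z (N z) = 1)
include hk hZ hΩ hJ hx hW hf hN hNZ

omit hx hNZ hZ hk hW hΩ in
theorem collar_of_neg (hw : bval W m ≠ 0) (h : x m < 0) : collar Ω J W N (collarCoeff x f) m =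
    collar Ω J W N (fun m => f m - x m) m ∘ₗ bRefl Ω J W m := by
  refine LinearMap.ext fun u => ?_
  rw [LinearMap.comp_apply, collar_apply, collar_apply, bRefl_apply, map_sub, map_sub, map_smul,
    map_smul, dualForm_self hJ hw, anchor_bval, hN, collarCoeff, if_neg (not_le.mpr h), smul_smul,
    sub_add, ← sub_smul, sub_eq_add_neg, ← neg_smul]
  congr 2
  rw [smul_eq_mul]; ring

omit hNZ hW in
theorem collar_clutchSmooth (hw : ∀ z ∈ Z, bval W z ≠ 0) :
    ClutchSmooth Ω J W x (collar Ω J W N (collarCoeff x f)) := by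
  have hxs : ∀ m, SmAt k x m := SmAt.of_contMDiff hx.1
  refine fun m => ⟨fun hm => ?_, fun hm => ?_⟩
  · rcases hf.supp m with h | h
    · refine (homSmooth_anchor m).congr ?_
      filter_upwards [h] with m' g
      have : collarCoeff x f m' = 0 := by
        unfold collarCoeff
        split_ifs with h'
        · rw [g, abs_of_nonneg h', sub_self]
        · rw [g, abs_of_neg (not_le.mp h'), neg_add_cancel, neg_zero]
      rw [collar, this, zero_smul, add_zero]
    · refine homSmooth_collar hk hZ hΩ hJ ?_ h
      rcases lt_or_gt_of_ne hm with h' | h'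
      · refine ((hf.smooth m).add (hxs m)).neg.congr ?_
        filter_upwards [(hxs m).continuousAt.eventually_lt continuousAt_const h'] with m' g
        exact if_neg (not_le.mpr g)
      · refine ((hf.smooth m).sub (hxs m)).congr ?_
        filter_upwards [continuousAt_const.eventually_lt (hxs m).continuousAt h'] with m' g
        exact if_pos (le_of_lt g)
  · have hwm := hw m ((hx.2.1 m).mpr hm)
    refine ⟨collar Ω J W N fun m => f m - x m, homSmooth_collar hk hZ hΩ hJ
      ((hf.smooth m).sub (hxs m)) hwm, ?_⟩
    filter_upwards [eventually_bval_ne_zero hk hZ hwm] with m' g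
    refine ⟨fun h => ?_, fun h => collar_of_neg hJ hf hN g h⟩
    simp only [collar, collarCoeff, if_pos h]

set_option maxHeartbeats 400000 in
theorem collar_deformation {u v : BTangent k Z m} {s : ℝ} (hs : 0 ≤ s) (huv : 0 ≤ bMetric Ω J m u v)
    (h : collar Ω J W N (collarCoeff x f) m u + s • anchor Z m v = 0) : u = 0 := by
  have hV := bTangentEuc_isSmooth hk hZ hΩ hJ
  have hsymm : ∀ u w, bMetric Ω J m u w = bMetric Ω J m w u := hV.symm m
  have hself : ∀ t : ℝ, 0 ≤ t → bMetric Ω J m u u + t + s * bMetric Ω J m u v = 0 → u = 0 := by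
    intro t ht h0
    by_contra hu
    have h1 := hJ.metric_pos hu
    have h2 := mul_nonneg hs huv
    linarith
  rw [collar_apply] at h
  by_cases hm : m ∈ Z
  · have hxm := (hx.2.1 m).mp hm
    have h1 := congrArg (∂[k] x m) h
    rw [map_add, map_add, map_smul, map_smul, mvfderiv_anchor hx hm, mvfderiv_anchor hx hm,
      hNZ m hm, map_zero, smul_zero, zero_add, add_zero] at h1
    have h2 : collarCoeff x f m = f m := by simp [collarCoeff, hxm]
    have h3 : dualForm Ω J W m u = 0 := by
      have h3 : collarCoeff x f m * dualForm Ω J W m u * 1 = 0 := h1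
      rw [mul_one, h2] at h3
      exact (mul_eq_zero.mp h3).resolve_left (hf.pos m).ne'
    rw [h3, mul_zero, zero_smul, add_zero, ← map_smul, ← map_add] at h
    obtain ⟨c, hc⟩ := anchor_eq_zero hk hZ hW hm h
    have h4 : bMetric Ω J m (bval W m) u = 0 := (mul_eq_zero.mp h3).resolve_left
      (inv_ne_zero (hJ.metric_pos (hZ.canonical_ne_zero hk hW hm)).ne')
    refine hself 0 le_rfl ?_
    have h5 := congrArg (bMetric Ω J m u) hc
    rw [map_add, map_smul, map_smul, hsymm u (bval W m), h4, smul_zero, smul_eq_mul] at h5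
    rw [add_zero, h5]
  · have hxm : x m ≠ 0 := fun h => hm ((hx.2.1 m).mpr h)
    obtain ⟨d, hd⟩ : ∃ d, dualForm Ω J W m u = d := ⟨_, rfl⟩
    have hd' : d = (bMetric Ω J m (bval W m) (bval W m))⁻¹ * bMetric Ω J m (bval W m) u := hd.symm
    rw [hd] at h
    have h3 : 0 ≤ collarCoeff x f m * (x m)⁻¹ := by
      have h4 := hf.abs_le m
      unfold collarCoeff
      split_ifs with h'
      · rw [abs_of_nonneg h'] at h4
        exact mul_nonneg (by linarith) (inv_nonneg.mpr h')
      · have h' := not_le.mp h'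
        rw [abs_of_neg h'] at h4
        exact mul_nonneg_of_nonpos_of_nonpos (by linarith) (inv_nonpos.mpr h'.le)
    have h5 := pairing_eq_zero (V := BTangent k Z m) (bMetric Ω J m) (u := u) (v := v)
      (w := bval W m) (c := collarCoeff x f m * d * (x m)⁻¹) (s := s) (by
        apply anchor_injective hk hZ hm
        rw [map_zero, map_add, map_add, map_smul, map_smul, anchor_bval, hN, smul_smul,
          inv_mul_cancel_right₀ hxm, h])
    rw [hsymm u (bval W m)] at h5
    refine hself _ ?_ h5
    have h6 : 0 ≤ (bMetric Ω J m (bval W m) (bval W m))⁻¹ := inv_nonneg.mpr (by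
      by_cases hw : bval W m = 0
      · exact (congrArg (bMetric Ω J m (bval W m)) hw).trans (LinearMap.map_zero _) |>.ge
      · exact (hJ.metric_pos hw).le)
    have h7 : ∀ a b c y e : ℝ, 0 ≤ a⁻¹ → 0 ≤ c * y → e = a⁻¹ * b → 0 ≤ c * e * y * b := by
      rintro a b c y e ha hcy rfl
      exact (mul_nonneg (mul_nonneg hcy ha) (mul_self_nonneg b)).trans_eq (by ring)
    exact h7 _ _ _ _ _ h6 h3 hd'

theorem collar_injective (m : M) :
    Injective (collar Ω J W N (collarCoeff x f) m) := by
  rw [injective_iff_map_eq_zero]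
  intro u hu
  refine collar_deformation hk hZ hΩ hJ hx hW hf hN hNZ (v := 0) (s := 0) le_rfl ?_ ?_
  · rw [map_zero]
  · rw [hu, zero_smul, add_zero]

theorem collar_isFrameClutching : IsFrameClutching Ω J W x g (clutchMap g
    (collar Ω J W N (collarCoeff x f)) (collar_injective hk hZ hΩ hJ hx hW hf hN hNZ)) where
  map_act := clutchMap_act _
  map_smooth := clutchMap_smooth hJ hΩ _ (collar_clutchSmooth hk hZ hΩ hJ hx hf hN
    fun _ hz => hZ.canonical_ne_zero hk hW hz) hk hZ
    fun m hm => hZ.canonical_ne_zero hk hW ((hx.2.1 m).mpr hm)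
  deformation m p s hs := by
    obtain ⟨R, hR, h⟩ := clutchMap_apply (g := g)
      (collar_injective hk hZ hΩ hJ hx hW hf hN hNZ) m p
    have h0 := p.metric_toB
    let L : Euc k →ₗ[ℝ] T[k] m :=
      collar Ω J W N (collarCoeff x f) m ∘ₗ p.toB.toLinearMap ∘ₗ R.toLinearMap +
        s • anchor Z m ∘ₗ p.toB.toLinearMap
    have hL : Injective L := by
      rw [injective_iff_map_eq_zero]
      intro v hv
      have h1 := collar_deformation hk hZ hΩ hJ hx hW hf hN hNZ (u := p.toB (R v)) (v := p.toB v) hs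
        (by rw [h0, real_inner_comm]; exact hR.nonneg v) hv
      exact hR.injective ((p.toB.map_eq_zero_iff.mp h1).trans (map_zero R).symm)
    intro v w hvw
    refine hL ?_
    have h2 : tangentFrame _ v + s • anchor Z m (p.toB v) =
      tangentFrame _ w + s • anchor Z m (p.toB w) := hvw
    rwa [h, h] at h2
  inward z hz p := by
    obtain ⟨R, hR, h⟩ := clutchMap_apply (g := g)
      (collar_injective hk hZ hΩ hJ hx hW hf hN hNZ) z p
    have h0 := p.metric_toB
    have hw := hZ.canonical_ne_zero hk hW hz
    set c := p.toB.symm (bval W z) with hc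
    have hpc : p.toB c = bval W z := p.toB.apply_symm_apply _
    have hc0 : c ≠ 0 := fun h => hw (by rw [← hpc, h]; exact map_zero p.toB)
    have h2 : collarCoeff x f z = f z := by simp [collarCoeff, (hx.2.1 z).mp hz]
    change 0 < ∂[k] x z (tangentFrame _ c)
    rw [h, collar_apply, map_add, mvfderiv_anchor hx hz, zero_add, map_smul, hNZ z hz,
      dualForm_apply, ← hpc, h0, h0, h2]
    change 0 < f z * ((inner ℝ c c)⁻¹ * inner ℝ c (R c)) * 1
    have := hf.pos z
    have h3 := real_inner_self_pos.mpr hc0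
    have h4 := hR.pos c hc0
    positivity

end

include hk hZ in
theorem exists_isCollar (hx : IsGlobalDefining k Z x) (hW : ExtendsCanonical Z W) : ∃ f, IsCollar x
    f W := by
  obtain ⟨f, h1, h2, h3, h4⟩ := exists_collar_function hZ hx (U := fun m => bval W m ≠ 0)
    (fun z hz => eventually_bval_ne_zero hk hZ (hZ.canonical_ne_zero hk hW hz)) one_pos
  exact ⟨f, h1, h2, h3, fun m => (h4 m).imp id And.left⟩

include hk hZ hΩ hJ in
theorem exists_isFrameClutching (hx : IsGlobalDefining k Z x) (hW : ExtendsCanonical Z W)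
    (g : RMetric k M) : ∃ φ, IsFrameClutching Ω J W x g φ := by
  obtain ⟨N, hN, hNZ⟩ := exists_transverse hk hZ hx hW
  obtain ⟨f, hf⟩ := exists_isCollar hk hZ hx hW
  exact ⟨_, collar_isFrameClutching hk hZ hΩ hJ hx hW hf hN hNZ⟩

/-! ## The clutched spin-c structure and its determinant line bundle -/

theorem sign_grading {a b : ℝ} (ha : a ≠ 0) (hb : b ≠ 0) :
    (if 0 < a * b then (0 : ZMod 2) else 1) =
      (if 0 < a then 0 else 1) + (if 0 < b then 0 else 1) := by
  rcases ha.lt_or_gt with ha | ha <;> rcases hb.lt_or_gt with hb | hb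
  · rw [if_pos (mul_pos_of_neg_of_neg ha hb), if_neg ha.not_gt, if_neg hb.not_gt]; decide
  · rw [if_neg (mul_neg_of_neg_of_pos ha hb).not_gt, if_neg ha.not_gt, if_pos hb]; decide
  · rw [if_neg (mul_neg_of_pos_of_neg ha hb).not_gt, if_pos ha, if_neg hb.not_gt]; decide
  · rw [if_pos (mul_pos ha hb), if_pos ha, if_pos hb]; decide

theorem det_trans_comm {V : Type*} [AddCommGroup V] [Module ℝ V] (p q r : Euc k ≃ₗ[ℝ] V) :
    det[p.trans r.symm] =
      det[q.trans r.symm] *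
        det[p.trans q.symm] := by
  rw [← LinearMap.det_comp]
  congr 1
  ext1 v
  exact congrArg r.symm (q.apply_symm_apply (p v)).symm

theorem DetLineIso.trans {P : BundleData.{u, v} (PinC k) M} {P' : BundleData.{u, v} (PinC k) M}
    {P'' : BundleData.{u, v} (PinC k) M} (h : DetLineIso P P') (h' : DetLineIso P' P'') :
    DetLineIso P P'' := by
  obtain ⟨L, hL⟩ := h
  obtain ⟨L', hL'⟩ := h'
  exact ⟨fun m => (L m).trans (L' m), fun s m => (hL s m).trans (hL' _ m)⟩

theorem SpinCData.Iso.detLineIso {V : EucBundle.{u, w} M} {S S' : SpinCData.{u, w, v} k V}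
    (h : S.Iso S') : DetLineIso S.P S'.P := by
  obtain ⟨-, φ, h1, h2, -, -⟩ := h
  have h1' : ∀ m p a, (φ m).symm (S'.P.act m p a) = S.P.act m ((φ m).symm p) a := fun m p a => by
    rw [Equiv.symm_apply_eq, h1, Equiv.apply_symm_apply]
  let L : ∀ m, detLine S.P m ≃ₗ[ℂ] detLine S'.P m := fun m =>
    { toFun := fun u => ⟨fun p => u.1 ((φ m).symm p), fun p a => (congrArg u.1 (h1' m p a)).trans (u.2 _ a)⟩
      invFun := fun u => ⟨fun p => u.1 (φ m p), fun p a => (congrArg u.1 (h1 m p a)).trans (u.2 _ a)⟩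
      map_add' := fun _ _ => rfl
      map_smul' := fun _ _ => rfl
      left_inv := fun u => Subtype.ext (funext fun p => congrArg u.1 ((φ m).symm_apply_apply p))
      right_inv := fun u => Subtype.ext (funext fun p => congrArg u.1 ((φ m).apply_symm_apply p)) }
  refine ⟨L, fun s m => ⟨fun hs σ hσ => ?_, fun hs σ hσ => ?_⟩⟩
  · refine hs (fun m' => (φ m').symm (σ m')) ((h2 _ m).mpr ?_)
    simpa only [Equiv.apply_symm_apply] using hσ
  · have := hs _ ((h2 σ m).mp hσ)
    simpa only [L, LinearEquiv.coe_mk, LinearMap.coe_mk, AddHom.coe_mk, Equiv.symm_apply_apply]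
      using this

theorem smoothNear_congr {f f' : M → ℂ} (h : SmoothNear k f m) (hf : ∀ᶠ m' in 𝓝 m, f' m' = f m') :
    SmoothNear k f' m := SmAt.congr (k := k) h hf

theorem smoothNear_const_mul {f : M → ℂ} (h : SmoothNear k f m) (c : ℂ) : SmoothNear k
    (fun m' => c * f m') m :=
  SmAt.comp (k := k) (G := fun z : ℂ => c * z) (contDiff_const.mul contDiff_id) h

theorem detLineIso_surgery {P : BundleData.{u, v} (PinC k) M} {x : M → ℝ} (hx : Continuous x)
    {γ : ∀ m, P.Fib m → P.Fib m} {d : ℂ} (hd : d * d = 1)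
    (hγ : ∀ z, x z = 0 → ∀ᶠ m in 𝓝 z, ∀ (u : detLine P m) p, u.1 (γ m p) = d * u.1 p)
    (hγs : ∀ z, x z = 0 → ∀ s, P.smooth s z → ∃ σ, (P.surgery x γ).smooth σ z ∧
      ∀ᶠ m in 𝓝 z, (0 ≤ x m → σ m = s m) ∧ (x m < 0 → σ m = γ m (s m))) :
    DetLineIso (P.surgery x γ) P := by
  classical
  let c : M → ℂ := fun m => if 0 ≤ x m then 1 else d
  have hc : ∀ m, c m * c m = 1 := fun m => by
    change (if 0 ≤ x m then (1 : ℂ) else d) * (if 0 ≤ x m then (1 : ℂ) else d) = 1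
    split_ifs
    · exact one_mul 1
    · exact hd
  let L : ∀ m, detLine (P.surgery x γ) m ≃ₗ[ℂ] detLine P m := fun m =>
    { toFun := fun u => ⟨fun p => c m * u.1 p, fun p a => by
        rw [mul_left_comm]; exact congrArg (c m * ·) (u.2 p a)⟩
      invFun := fun u => ⟨fun p => c m * u.1 p, fun p a => by
        rw [mul_left_comm]; exact congrArg (c m * ·) (u.2 p a)⟩
      map_add' := fun u v => Subtype.ext (funext fun p => mul_add (c m) (u.1 p) (v.1 p))
      map_smul' := fun r u => Subtype.ext (funext fun p => mul_left_comm (c m) r (u.1 p))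
      left_inv := fun u => Subtype.ext (funext fun p => by
        change c m * (c m * u.1 p) = u.1 p
        rw [← mul_assoc, hc, one_mul])
      right_inv := fun u => Subtype.ext (funext fun p => by
        change c m * (c m * u.1 p) = u.1 p
        rw [← mul_assoc, hc, one_mul]) }
  have hL : ∀ m (u : detLine (P.surgery x γ) m) p, (L m u).1 p = c m * u.1 p := fun _ _ _ => rfl
  refine ⟨L, fun s m => ?_⟩
  by_cases hm : x m = 0
  · have key : ∀ σ t : ∀ m, P.Fib m, (∀ᶠ m' in 𝓝 m, (0 ≤ x m' → σ m' = t m') ∧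
        (x m' < 0 → σ m' = γ m' (t m'))) →
        ∀ᶠ m' in 𝓝 m, (L m' (s m')).1 (t m') = (s m').1 (σ m') := by
      intro σ t h
      filter_upwards [h, hγ m hm] with m' g1 g2
      rw [hL]
      rcases le_or_gt 0 (x m') with h | h
      · rw [g1.1 h]
        simp only [c, if_pos h, one_mul]
      · rw [g1.2 h]
        simp only [c, if_neg (not_le.mpr h)]
        exact (g2 ⟨(s m').1, (s m').2⟩ (t m')).symm
    constructor
    · intro hs t ht
      obtain ⟨σ, h1, h2⟩ := hγs m hm t ht
      exact smoothNear_congr (hs σ h1) (key σ t h2)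
    · intro hs σ hσ
      obtain ⟨t, h1, h2⟩ := hσ.2 hm
      exact smoothNear_congr (hs t h1) ((key σ t h2).mono fun _ h => h.symm)
  · have hev : ∀ᶠ m' in 𝓝 m, c m' = c m := by
      rcases lt_or_gt_of_ne hm with h | h
      · filter_upwards [hx.continuousAt.eventually_lt continuousAt_const h] with m' g
        simp only [c, if_neg (not_le.mpr g), if_neg (not_le.mpr h)]
      · filter_upwards [continuousAt_const.eventually_lt hx.continuousAt h] with m' g
        simp only [c, if_pos (le_of_lt g), if_pos (le_of_lt h)]
    have hsm : ∀ σ, (P.surgery x γ).smooth σ m ↔ P.smooth σ m := fun σ =>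
      ⟨fun h => h.1 hm, fun h => ⟨fun _ => h, fun h0 => absurd h0 hm⟩⟩
    constructor
    · intro hs σ hσ
      refine smoothNear_congr (smoothNear_const_mul (hs σ ((hsm σ).mpr hσ)) (c m))
        (hev.mono fun m' h => ?_)
      rw [hL, h]
    · intro hs σ hσ
      refine smoothNear_congr (smoothNear_const_mul (hs σ ((hsm σ).mp hσ)) (c m))
        (hev.mono fun m' h => ?_)
      refine Eq.trans ?_ (congrArg (c m * ·) (hL m' (s m') (σ m'))).symm
      simp only [h, ← mul_assoc, hc, one_mul]

theorem chiralGauge_eq (w : ∀ m, BTangent k Z m) (m : M) (p : (acBundle Ω J).Fib m) :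
    ∃ c : PinC k, pinDet c = 1 ∧ pinDeg c = 0 ∧ chiralGauge (acSpinC Ω J) w m p =
      (acBundle Ω J).act m p (c * pinGamma k * pinVec (((acSpinC Ω J).f m p).unitOf (w m))) := by
  classical
  refine ⟨if (acSpinC Ω J).grad m p = 0 then 1 else pinScalar k (-1) (by simp), ?_, ?_, rfl⟩
  · split_ifs
    · exact pinDet_one
    · rw [pinDet_scalar]; norm_num
  · split_ifs
    · exact pinDeg_one
    · exact pinDeg_scalar _ _

open Classical in
theorem frameOrientation_isGrading (g : RMetric k M) (ho : IsOrientation o) :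
    (frameBundle k (tangentEuc g)).IsGrading orthDeg
      (fun m q => if frameOrientation q.1 = o m then 0 else 1) := by
  constructor
  · intro m q A
    obtain ⟨r, -, hr⟩ := ho m
    obtain ⟨q', rfl⟩ : ∃ q' : OFrame k (tangentEuc g) m, q' = q := ⟨_, rfl⟩
    let Q : Euc k ≃ₗ[ℝ] T[k] m := q'.1
    change (if frameOrientation (A.toLinearEquiv.trans Q) = o m then (0 : ZMod 2) else 1) =
      (if frameOrientation Q = o m then 0 else 1) + orthDeg A
    rw [← hr.self_of_nhds, frameOrientation_eq_iff, frameOrientation_eq_iff,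
      det_trans_comm (A.toLinearEquiv.trans Q) Q (r m),
      sign_grading (det_ne_zero_of_equiv _) (det_ne_zero_of_equiv _)]
    congr 1
    have h : (A.toLinearEquiv.trans Q).trans Q.symm = A.toLinearEquiv := by
      ext1 v; exact Q.symm_apply_apply _
    rw [h]
    rfl
  · intro σ m hσ
    obtain ⟨r, hr, hro⟩ := ho m
    obtain ⟨e, he⟩ := exists_tangent_frame (k := k) m
    have hr' : FrameAt VSmoothNear m r := he.of_smooth hr
    let S : ∀ m', Euc k ≃ₗ[ℝ] T[k] m' := fun m' => (σ m').1
    let κ : M → ℝ := fun m' => LinearMap.det (eqL ((S m').trans (r m').symm) : Euc k →ₗ[ℝ] Euc k)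
    have h1 : ContinuousAt κ m := continuous_det.continuousAt.comp
      (hr'.smAt_trans (e' := S) hσ).continuousAt
    have h2 : κ m ≠ 0 := det_ne_zero_of_equiv ((S m).trans (r m).symm)
    have h3 : ∀ᶠ m' in 𝓝 m, 0 < κ m' * κ m :=
      continuousAt_const.eventually_lt (h1.mul continuousAt_const) (mul_self_pos.mpr h2)
    have h4 : ∀ m', frameOrientation (r m') = o m' → (frameOrientation (S m') = o m' ↔ 0 < κ m') :=
      fun m' h => by rw [← h, frameOrientation_eq_iff]; rfl
    filter_upwards [h3, hro] with m' g1 g2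
    change (if frameOrientation (S m') = o m' then (0 : ZMod 2) else 1) =
      if frameOrientation (S m) = o m then 0 else 1
    have h5 : 0 < κ m' ↔ 0 < κ m := by
      rcases mul_pos_iff.mp g1 with ⟨a, b⟩ | ⟨a, b⟩
      · exact iff_of_true a b
      · exact iff_of_false a.not_gt b.not_gt
    have h6 := (h4 m' g2).trans (h5.trans (h4 m hro.self_of_nhds).symm)
    by_cases h : frameOrientation (S m) = o m
    · rw [if_pos h, if_pos (h6.mpr h)]
    · rw [if_neg h, if_neg (fun h' => h (h6.mp h'))]

variable {φ : ∀ m, OFrame k (bTangentEuc Ω J) m → OFrame k (tangentEuc g) m}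
  {φ' : ∀ m, OFrame k (bTangentEuc Ω J') m → OFrame k (tangentEuc g) m}

section
include hk hZ hΩ hJ

theorem surgery_principal (hx : Continuous x) (hw : ∀ m, x m = 0 → bval W m ≠ 0) :
    ((acBundle Ω J).surgery x (chiralGauge (acSpinC Ω J) (bval W))).IsPrincipal k :=
  (acBundle_principal hk hZ hΩ hJ).surgery hx
    (fun _ _ => .of_forall fun m p a => chiralGauge_act hk hZ hΩ hJ (bval W) m p a)
    fun z hz => (eventually_bval_ne_zero hk hZ (hw z hz)).mono fun _ h σ hσ =>
      chiralGauge_smooth hk hZ hΩ hJ W h σ hσ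

theorem surgery_map_smooth (hw : ∀ m, x m = 0 → bval W m ≠ 0) {σ : ∀ m, (acBundle Ω J).Fib m}
    (hσ : ((acBundle Ω J).surgery x (chiralGauge (acSpinC Ω J) (bval W))).smooth σ m) :
    ((frameBundle k (bTangentEuc Ω J)).surgery x (reflGauge (V := bTangentEuc Ω J) (bval W))).smooth (fun m' => (acSpinC Ω J).f m' (σ m')) m := by
  have hS := acSpinC_isSpinC hk hZ hΩ hJ
  refine ⟨fun hm => hS.map_smooth σ m (hσ.1 hm), fun hm => ?_⟩
  obtain ⟨s, h1, h2⟩ := hσ.2 hm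
  refine ⟨fun m' => (acSpinC Ω J).f m' (s m'), hS.map_smooth s m h1, ?_⟩
  filter_upwards [h2, eventually_bval_ne_zero hk hZ (hw m hm)] with m' g1 g2
  exact ⟨fun h => congrArg _ (g1.1 h), fun h => (congrArg _ (g1.2 h)).trans
    (chiralGauge_lifts hk hZ hΩ hJ g2 (s m')).1⟩

theorem chiralGauge_grad (hw : bval W m ≠ 0) (p : (acBundle Ω J).Fib m) : (acSpinC Ω J).grad m
    (chiralGauge (acSpinC Ω J) (bval W) m p) = (acSpinC Ω J).grad m p + 1 := by
  obtain ⟨c, -, hc, h⟩ := chiralGauge_eq (Ω := Ω) (J := J) (bval W) m p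
  refine (congrArg _ h).trans (((acSpinC_isSpinC hk hZ hΩ hJ).grading.act m p _).trans ?_)
  refine congrArg ((acSpinC Ω J).grad m p + ·) ?_
  have hv : ‖((acSpinC Ω J).f m p).unitOf (bval W m)‖ = 1 := norm_unitOf _ hw
  rw [pinDeg_mul, pinDeg_mul, hc, pinDeg_pinGamma, pinDeg_vec hv, zero_add, zero_add]

theorem surgery_isGrading (hx : Continuous x) (hw : ∀ m, x m = 0 → bval W m ≠ 0) :
    ((acBundle Ω J).surgery x (chiralGauge (acSpinC Ω J) (bval W))).IsGrading pinDeg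
      (surgeryGrading x (acSpinC Ω J).grad) := by
  have hS := acSpinC_isSpinC hk hZ hΩ hJ
  constructor
  · intro m p a
    have h := hS.grading.act m p a
    change surgeryGrading x (acSpinC Ω J).grad m ((acSpinC Ω J).P.act m p a) = _
    unfold surgeryGrading
    split_ifs
    · exact h
    · rw [h, add_right_comm]
  · intro σ m hσ
    by_cases hm : x m = 0
    · obtain ⟨s, h1, h2⟩ := hσ.2 hm
      have key : ∀ᶠ m' in 𝓝 m, surgeryGrading x (acSpinC Ω J).grad m' (σ m') =
          (acSpinC Ω J).grad m' (s m') := by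
        filter_upwards [h2, eventually_bval_ne_zero hk hZ (hw m hm)] with m' g1 g2
        unfold surgeryGrading
        split_ifs with h
        · exact congrArg _ (g1.1 h)
        · have h' := chiralGauge_grad hk hZ hΩ hJ g2 (s m')
          refine (congrArg (· + 1) ((congrArg _ (g1.2 (not_le.mp h))).trans h')).trans ?_
          change (acSpinC Ω J).grad m' (s m') + 1 + 1 = _
          rw [add_assoc, show (1 : ZMod 2) + 1 = 0 from by decide, add_zero]
      filter_upwards [key, hS.grading.locally_const s m h1] with m' g1 g2
      exact g1.trans (g2.trans key.self_of_nhds.symm)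
    · have h1 := hS.grading.locally_const σ m (hσ.1 hm)
      have hev : ∀ᶠ m' in 𝓝 m, (0 ≤ x m' ↔ 0 ≤ x m) := by
        rcases lt_or_gt_of_ne hm with h | h
        · filter_upwards [hx.continuousAt.eventually_lt continuousAt_const h] with m' g
          exact iff_of_false (not_le.mpr g) (not_le.mpr h)
        · filter_upwards [continuousAt_const.eventually_lt hx.continuousAt h] with m' g
          exact iff_of_true (le_of_lt g) (le_of_lt h)
      filter_upwards [h1, hev] with m' g1 g2
      unfold surgeryGrading
      by_cases h : 0 ≤ x m
      · rw [if_pos h, if_pos (g2.mpr h)]; exact g1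
      · rw [if_neg h, if_neg (fun h' => h (g2.mp h'))]; exact congrArg (· + 1) g1

omit hk hZ hΩ in
theorem deformation_det_pos (ha : Injective (anchor (k := k) Z m))
    (hφ : IsFrameClutching Ω J W x g φ) (p : OFrame k (bTangentEuc Ω J) m)
    {q r : Euc k ≃ₗ[ℝ] T[k] m} (hq : ∀ v, q v = tangentFrame (φ m p) v)
    (hr : ∀ v, r v = anchor Z m (p.toB v)) :
    0 < det[q.trans r.symm] := by
  have h := det_mul_det_pos (A := ((r.trans r.symm : Euc k ≃ₗ[ℝ] Euc k) : Euc k →ₗ[ℝ] Euc k))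
    (B := ((q.trans r.symm : Euc k ≃ₗ[ℝ] Euc k) : Euc k →ₗ[ℝ] Euc k)) (fun t ht => by
      rw [injective_iff_map_eq_zero]
      intro v hv
      have h1 : (1 - t) • r v + t • q v = 0 := by
        have h2 := congrArg r hv
        rw [map_zero] at h2
        have h3 : r ((1 - t) • r.symm (r v) + t • r.symm (q v)) = 0 := h2
        rwa [map_add, map_smul, map_smul, r.apply_symm_apply, r.apply_symm_apply] at h3
      rcases ht.1.eq_or_lt with rfl | h0
      · rw [sub_zero, one_smul, zero_smul, add_zero] at h1
        exact r.map_eq_zero_iff.mp h1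
      · have h3 := hφ.deformation m p ((1 - t) / t) (div_nonneg (sub_nonneg.mpr ht.2) h0.le)
        refine h3 (a₁ := v) (a₂ := 0) ?_
        have h4 : ∀ v, tangentFrame (φ m p) v + ((1 - t) / t) • anchor Z m (p.1 v) =
            q v + ((1 - t) / t) • r v := fun v => by rw [hq, hr]; rfl
        change tangentFrame (φ m p) v + ((1 - t) / t) • anchor Z m (p.1 v) =
          tangentFrame (φ m p) 0 + ((1 - t) / t) • anchor Z m (p.1 0)
        rw [h4, h4, map_zero, map_zero, smul_zero, add_zero]
        have h5 := congrArg (fun w => t⁻¹ • w) h1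
        simp only [smul_add, smul_smul, smul_zero, inv_mul_cancel₀ h0.ne', one_smul] at h5
        rw [add_comm, div_eq_inv_mul]
        exact h5)
  have h0 : r.trans r.symm = LinearEquiv.refl ℝ (Euc k) := by ext1 v; simp
  rw [h0, LinearEquiv.refl_toLinearMap, LinearMap.det_id, one_mul] at h
  exact h

open Classical in
theorem clutched_map_grading (ho : IsOrientation o) (h : IsClutchingChoice Ω o J W x g φ) (m : M)
    (p : (acBundle Ω J).Fib m) :
    (clutchedSpinC Ω o J W x g φ).gradO m ((clutchedSpinC Ω o J W x g φ).f m p) =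
      (clutchedSpinC Ω o J W x g φ).grad m p := by
  have hx := h.defining.1
  have hw : ∀ m, x m = 0 → bval W m ≠ 0 := fun m hm =>
    hZ.canonical_ne_zero hk h.canonical ((hx.2.1 m).mpr hm)
  have hoff : ∀ m ∉ Z, ∀ p : (acBundle Ω J).Fib m,
      (clutchedSpinC Ω o J W x g φ).gradO m ((clutchedSpinC Ω o J W x g φ).f m p) =
      (clutchedSpinC Ω o J W x g φ).grad m p := by
    intro m hm p
    obtain ⟨b, -⟩ := exists_uFrame hk hZ hΩ hJ m
    obtain ⟨a, rfl⟩ : ∃ c, acMk (b m) c = p := ⟨_, acMk_coord (b m) p⟩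
    have ha := anchor_injective hk hZ hm
    obtain ⟨r₀, -, hr₀⟩ := ho m
    let P : OFrame k (bTangentEuc Ω J) m := (b m).1.act (pinAd a)
    let q : Euc k ≃ₗ[ℝ] T[k] m := (φ m P).1
    let r := homFrame (anchor Z m) ha P.toB
    let r' := homFrame (anchor Z m) ha (b m).1.toB
    have h1 : 0 < det[q.trans r.symm] :=
      deformation_det_pos hJ ha h.clutching P (fun _ => rfl) fun _ => rfl
    have h2 : (if frameOrientation q = o m then (0 : ZMod 2) else 1) =
        (if frameOrientation r' = o m then 0 else 1) + pinDeg a := by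
      rw [← hr₀.self_of_nhds, frameOrientation_eq_iff, frameOrientation_eq_iff,
        det_trans_comm q r (r₀ m), det_trans_comm r r' (r₀ m),
        sign_grading (mul_ne_zero (det_ne_zero_of_equiv _) (det_ne_zero_of_equiv _)) h1.ne',
        if_pos h1, add_zero, sign_grading (det_ne_zero_of_equiv _) (det_ne_zero_of_equiv _),
        ← orthDeg_pinAd]
      congr 1
      have h3 : r.trans r'.symm = (pinAd a).toLinearEquiv := by
        ext1 v; exact r'.symm_apply_apply _
      rw [h3]
      rfl
    have h4 : frameOrientation r' = o m ↔ 0 < x m :=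
      (anchorPreserves_iff (b m).isSymplectic fun _ => rfl).symm.trans (h.defining.2 m hm).symm
    have hxm : x m ≠ 0 := fun h0 => hm ((hx.2.1 m).mpr h0)
    change (if frameOrientation q = o m then (0 : ZMod 2) else 1) =
      if 0 ≤ x m then pinDeg a else pinDeg a + 1
    rw [h2]
    rcases lt_or_gt_of_ne hxm with h5 | h5
    · rw [if_neg (not_le.mpr h5), if_neg (fun h' => h5.not_gt (h4.mp h')), add_comm]
    · rw [if_pos h5.le, if_pos (h4.mpr h5), zero_add]
  by_cases hm : m ∈ Z
  · have hP := surgery_principal hk hZ hΩ hJ hx.1.continuous hw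
    have hG := surgery_isGrading hk hZ hΩ hJ hx.1.continuous hw
    obtain ⟨σ, hσ⟩ := hP.exists_smooth m
    have h1 := hG.locally_const σ m hσ
    have h2 := (frameOrientation_isGrading g ho).locally_const _ m
      (h.clutching.map_smooth _ m (surgery_map_smooth hk hZ hΩ hJ hw hσ))
    obtain ⟨m', g1, g2, g3⟩ := ((frequently_notMem (k := k) (Z := Z) (y := x)
      ⟨SmAt.of_contMDiff hx.1 m, .of_forall hx.2.1, hx.2.2 m hm⟩).and_eventually (h1.and h2)).exists
    obtain ⟨a, ha, -⟩ := hP.torsor m (σ m) p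
    have h3 := g3.symm.trans ((hoff m' g1 (σ m')).trans g2)
    have h4 : (clutchedSpinC Ω o J W x g φ).f m ((acBundle Ω J).act m (σ m) a) =
        ((clutchedSpinC Ω o J W x g φ).f m (σ m)).act (pinAd a) :=
      (congrArg (φ m) ((acSpinC_isSpinC hk hZ hΩ hJ).map_act m (σ m) a)).trans
        (h.clutching.map_act m _ _)
    have h5 := (frameOrientation_isGrading g ho).act m ((clutchedSpinC Ω o J W x g φ).f m (σ m)) (pinAd a)
    have h6 := hG.act m (σ m) a
    rw [← ha]
    refine (congrArg _ h4).trans (h5.trans (Eq.trans ?_ h6.symm))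
    rw [orthDeg_pinAd]
    exact congrArg (· + pinDeg a) h3
  · exact hoff m hm p

theorem clutchedSpinC_isSpinC (ho : IsOrientation o) (h : IsClutchingChoice Ω o J W x g φ) :
    (clutchedSpinC Ω o J W x g φ).IsSpinC where
  frame_principal := (tangentEuc_isSmooth g).principal
  frame_grading := frameOrientation_isGrading g ho
  principal := surgery_principal hk hZ hΩ hJ h.defining.1.1.continuous fun m hm =>
    hZ.canonical_ne_zero hk h.canonical ((h.defining.1.2.1 m).mpr hm)
  grading := surgery_isGrading hk hZ hΩ hJ h.defining.1.1.continuous fun m hm =>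
    hZ.canonical_ne_zero hk h.canonical ((h.defining.1.2.1 m).mpr hm)
  map_act m p a := (congrArg (φ m) ((acSpinC_isSpinC hk hZ hΩ hJ).map_act m p a)).trans
    (h.clutching.map_act m _ _)
  map_smooth _ m hσ := h.clutching.map_smooth _ m (surgery_map_smooth hk hZ hΩ hJ (fun m hm =>
    hZ.canonical_ne_zero hk h.canonical ((h.defining.1.2.1 m).mpr hm)) hσ)
  map_grading := clutched_map_grading hk hZ hΩ hJ ho h

theorem clutched_detLineIso (h : IsClutchingChoice Ω o J W x g φ) :
    DetLineIso (clutchedSpinC Ω o J W x g φ).P (acSpinC Ω J).P := by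
  have hw : ∀ m, x m = 0 → bval W m ≠ 0 := fun m hm =>
    hZ.canonical_ne_zero hk h.canonical ((h.defining.1.2.1 m).mpr hm)
  refine detLineIso_surgery h.defining.1.1.continuous (d := (-1) ^ k) (by rw [← mul_pow]; simp)
    (fun z hz => ?_) fun z hz s hs => ?_
  · filter_upwards [eventually_bval_ne_zero hk hZ (hw z hz)] with m hm u p
    obtain ⟨c, hc, -, h1⟩ := chiralGauge_eq (Ω := Ω) (J := J) (bval W) m p
    refine (congrArg u.1 h1).trans ((u.2 p _).trans (congrArg (· * u.1 p) ?_))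
    have hv : ‖((acSpinC Ω J).f m p).unitOf (bval W m)‖ = 1 := norm_unitOf _ hm
    rw [pinDet_mul, pinDet_mul, hc, pinDet_pinGamma, pinDet_vec hv, one_mul, mul_one,
      ← inv_pow, inv_neg, inv_one]
  · classical
    refine ⟨fun m => if 0 ≤ x m then s m else chiralGauge (acSpinC Ω J) (bval W) m (s m),
      ⟨fun h0 => absurd hz h0, fun _ => ⟨s, hs, .of_forall fun m => ⟨fun h => if_pos h, fun h =>
        if_neg (not_le.mpr h)⟩⟩⟩, .of_forall fun m => ⟨fun h => if_pos h, fun h =>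
        if_neg (not_le.mpr h)⟩⟩

end

/-! ## Isomorphism of clutched structures that are close to each other -/

include hJ in
theorem uMat_injective (hJ' : IsCompatible Ω J') (b : UFrame Ω J m) : Injective
    (uMat (J' m) b.1.toB) := by
  rw [injective_iff_map_eq_zero]
  intro v hv
  have h1 := apply_uMat (J' m) b.1.toB v
  have h2 : b.1.toB (stdJ k v) = J m (b.1.toB v) := (b.2 v).symm
  rw [hv, map_zero, h2] at h1
  set u := b.1.toB v with hu
  have h3 : J' m u = -J m u := by
    conv_lhs => rw [sub_eq_zero.mp h1.symm]
    exact hJ'.sq m _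
  by_contra hv0
  have hu0 : u ≠ 0 := fun h => hv0 (b.1.toB.map_eq_zero_iff.mp h)
  have h4 := hJ.pos m u hu0
  have h5 := hJ'.pos m u hu0
  rw [h3, map_neg] at h5
  linarith

def uTransfer (hΩ : IsBSymplectic Z Ω) (hJ : IsCompatible Ω J) (hJ' : IsCompatible Ω J')
    (b : UFrame Ω J m) : UFrame Ω J' m :=
  ⟨⟨uOrth (bMetric Ω J' m) (J' m) b.1.toB, gram_eq_one_iff.mp
    (gram_orthE (hJ'.metric_symm hΩ m) (fun _ hu => hJ'.metric_pos hu) _)⟩,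
    uOrth_stdJ (hJ'.metric_symm hΩ m) (fun _ hu => hJ'.metric_pos hu) (hJ'.metric_invariant m)
      (hJ'.sq m) (uMat_injective hJ hJ' b)⟩

include hΩ hJ in
theorem uTransfer_act (hJ' : IsCompatible Ω J') (b b₁ : UFrame Ω J m) (A : O[k])
    (hA : ∀ v, A (stdJ k v) = stdJ k (A v)) (hb : b₁.1 = b.1.act A) : (uTransfer hΩ hJ hJ' b₁).1 =
    (uTransfer hΩ hJ hJ' b).1.act A := by
  refine Subtype.ext ((congrArg (fun q : OFrame k (bTangentEuc Ω J) m =>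
    uOrth (bMetric Ω J' m) (J' m) q.toB) hb).trans ?_)
  exact uOrth_act (hJ'.metric_symm hΩ m) (fun _ hu => hJ'.metric_pos hu)
    (uMat_injective hJ hJ' b) A hA

theorem smAt_posLift {A : M → O[k]} (hA : SmAt k (fun m' => isoL (A m')) m) (h : HasPosLift (A m)) :
    (∀ᶠ m' in 𝓝 m, HasPosLift (A m')) ∧ SmAt k (fun m' => pv (posLift (A m'))) m := by
  classical
  have key : ∀ m', HasPosLift (A m') → ContinuousAt (fun m' => isoL (A m')) m' →
      ∃ F : E[k] → CCl k, ContDiffAt ℝ ∞ F (isoL (A m')) ∧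
        ∀ᶠ m'' in 𝓝 m', HasPosLift (A m'') ∧ pv (posLift (A m'')) = F (isoL (A m'')) := by
    intro m' h' hc'
    obtain ⟨F, h1, h2⟩ := h'.smooth
    exact ⟨F, h1, (hc'.eventually h2).mono fun m'' h => h _ rfl⟩
  obtain ⟨_, _, h2⟩ := key m h hA.continuousAt
  refine ⟨h2.mono fun _ h => h.1, ?_⟩
  let L : E[k] → CCl k := fun T =>
    if h : ∃ B : O[k], isoL B = T then pv (posLift h.choose) else 0
  have hL : ∀ B : O[k], pv (posLift B) = L (isoL B) := fun B => by
    have h : ∃ B' : O[k], isoL B' = isoL B := ⟨B, rfl⟩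
    simp only [L, dif_pos h, isoL_injective h.choose_spec]
  refine SmAt.congr (hA.comp_of_eventually (G := L) ?_) (.of_forall fun m' => hL _)
  filter_upwards [h2, hA.nearby] with m' h3 h4
  obtain ⟨F, h5, h6⟩ := key m' h3.1 h4.continuousAt
  exact ⟨F, h5, h6.mono fun m'' h => (hL _).symm.trans h.2⟩

include hk hZ in
theorem smoothGroupNear_unitOf {b : ∀ m, OFrame k (bTangentEuc Ω J) m}
    (hb : FrameAt (BSmooth Z) m fun m' => (b m').toB) (hw : bval W m ≠ 0) : SmoothGroupNear k
    (fun m' => pinVec ((b m').unitOf (bval W m'))) m := by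
  rw [smoothGroupNear_pin]
  refine (SmAt.unitOf hb W hw).cvec.congr ?_
  filter_upwards [eventually_bval_ne_zero hk hZ hw] with m' h
  exact pv_pinVec (norm_unitOf (b m') h)

/-- Two identifications of the surgery of the b-tangent bundle with the tangent bundle, which need
not be deformations of the anchor. -/
structure GluingPair (Ω : BForm k Z) (J J' : BEnd k Z) (W W' : bFields k Z) (x : M → ℝ)
    (g : RMetric k M) (φ : ∀ m, OFrame k (bTangentEuc Ω J) m → OFrame k (tangentEuc g) m)
    (φ' : ∀ m, OFrame k (bTangentEuc Ω J') m → OFrame k (tangentEuc g) m) : Prop where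
  symplectic : IsBSymplectic Z Ω
  compatible : IsCompatible Ω J
  compatible' : IsCompatible Ω J'
  ne_zero : ∀ m, x m = 0 → bval W m ≠ 0
  ne_zero' : ∀ m, x m = 0 → bval W' m ≠ 0
  map_act : ∀ m p (A : O[k]), φ m (p.act A) = (φ m p).act A
  map_act' : ∀ m p (A : O[k]), φ' m (p.act A) = (φ' m p).act A
  map_smooth : ∀ (σ : ∀ m, OFrame k (bTangentEuc Ω J) m) (m : M),
    ((frameBundle k (bTangentEuc Ω J)).surgery x
      (reflGauge (V := bTangentEuc Ω J) (bval W))).smooth σ m →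
    (frameBundle k (tangentEuc g)).smooth (fun m' => φ m' (σ m')) m
  map_smooth' : ∀ (σ : ∀ m, OFrame k (bTangentEuc Ω J') m) (m : M),
    ((frameBundle k (bTangentEuc Ω J')).surgery x
      (reflGauge (V := bTangentEuc Ω J') (bval W'))).smooth σ m →
    (frameBundle k (tangentEuc g)).smooth (fun m' => φ' m' (σ m')) m

namespace GluingPair

variable (G : GluingPair Ω J J' W W' x g φ φ')
include G

def tr (b : UFrame Ω J m) : UFrame Ω J' m :=
  uTransfer G.symplectic G.compatible G.compatible' b

def diff (b : UFrame Ω J m) : O[k] := (φ' m (G.tr b).1).diff (φ m b.1)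

theorem act_diff (b : UFrame Ω J m) : (φ' m (G.tr b).1).act (G.diff b) = φ m b.1 :=
  OFrame.act_diff _ _

structure IsClose {m : M} (b : UFrame Ω J m) : Prop where
  lift : HasPosLift (G.diff b)
  reg : x m = 0 → 0 < (ctr (pv (pinVec ((G.tr b).1.unitOf (bval W' m)) * posLift (G.diff b) *
    (pinVec (b.1.unitOf (bval W m)))⁻¹))).re

theorem diff_act {b b₁ : UFrame Ω J m} {c : PinC k} (hc : c ∈ unitaryLift k)
    (hb : b₁.1 = b.1.act (pinAd c)) : (G.tr b₁).1 = (G.tr b).1.act (pinAd c) ∧ G.diff b₁ = pinAd c⁻¹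
    * G.diff b * (pinAd c⁻¹)⁻¹ := by
  have h1 : (G.tr b₁).1 = (G.tr b).1.act (pinAd c) :=
    uTransfer_act _ _ _ b b₁ _ (pinAd_stdJ_of_mem hc) hb
  refine ⟨h1, ((φ' m (G.tr b₁).1).act_injective ?_)⟩
  rw [G.act_diff b₁, hb, G.map_act, h1, G.map_act', ← OFrame.act_mul, ← G.act_diff b,
    ← OFrame.act_mul, pinAd_inv]
  congr 1
  group

theorem IsClose.act {b b₁ : UFrame Ω J m} {c : PinC k} (hc : c ∈ unitaryLift k)
    (hb : b₁.1 = b.1.act (pinAd c)) (h : G.IsClose b) : G.IsClose b₁ := by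
  obtain ⟨h1, h2⟩ := G.diff_act hc hb
  refine ⟨by rw [h2]; exact h.lift.conj c⁻¹, fun hm => ?_⟩
  have h3 : pinVec (b₁.1.unitOf (bval W m)) = c⁻¹ * pinVec (b.1.unitOf (bval W m)) * c := by
    have := pinVec_conj' c⁻¹ (b.1.unitOf (bval W m))
    rw [inv_inv, pinAd_inv] at this
    rw [this, hb]
    exact congrArg pinVec (unitOf_act b.1 (pinAd c) (bval W m))
  have h4 : pinVec ((G.tr b₁).1.unitOf (bval W' m)) =
      c⁻¹ * pinVec ((G.tr b).1.unitOf (bval W' m)) * c := by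
    have := pinVec_conj' c⁻¹ ((G.tr b).1.unitOf (bval W' m))
    rw [inv_inv, pinAd_inv] at this
    rw [this, h1]
    exact congrArg pinVec (unitOf_act (G.tr b).1 (pinAd c) (bval W' m))
  have h5 := h.reg hm
  rw [h3, h4, h2, h.lift.posLift_conj c⁻¹]
  have h6 : ∀ p q r : PinC k, c⁻¹ * p * c * (c⁻¹ * q * c⁻¹⁻¹) * (c⁻¹ * r * c)⁻¹ =
      c⁻¹ * (p * q * r⁻¹) * c⁻¹⁻¹ := fun p q r => by group
  rw [h6, pv_mul, pv_mul, ctr_conj]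
  exact h5

def iso (hc : ∀ {m} (b : UFrame Ω J m), G.IsClose b) (m : M) :
    (acBundle Ω J).Fib m → (acBundle Ω J').Fib m :=
  Quot.lift (fun q => acMk (G.tr q.1) (posLift (G.diff q.1) * q.2)) (by
    rintro ⟨b, a⟩ ⟨b', a'⟩ ⟨c, h, h1, h2⟩
    simp only at h1 h2 ⊢
    obtain ⟨h3, h4⟩ := G.diff_act h h1
    refine Quot.sound ⟨c, h, h3, ?_⟩
    simp only [h4, (hc b').lift.posLift_conj c⁻¹, h2]
    group)

variable (hc : ∀ {m} (b : UFrame Ω J m), G.IsClose b)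

theorem iso_mk (b : UFrame Ω J m) (a : PinC k) : G.iso hc m (acMk b a) = acMk (G.tr b)
    (posLift (G.diff b) * a) := rfl

theorem iso_act (hk : 1 ≤ k) (hZ : IsHypersurface k Z) (m : M)
    (p : (acBundle Ω J).Fib m) (a : PinC k) :
    G.iso hc m ((acBundle Ω J).act m p a) = (acBundle Ω J').act m (G.iso hc m p) a := by
  obtain ⟨b, -⟩ := exists_uFrame hk hZ G.symplectic G.compatible m
  obtain ⟨c, rfl⟩ : ∃ c, acMk (b m) c = p := ⟨_, acMk_coord (b m) p⟩
  exact congrArg (acMk (G.tr (b m))) (mul_assoc _ _ _).symm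

include hk hZ

theorem iso_smooth (hx : Continuous x) (m : M) :
    ∃ s, ((acBundle Ω J).surgery x (chiralGauge (acSpinC Ω J) (bval W))).smooth s m ∧
      ((acBundle Ω J').surgery x (chiralGauge (acSpinC Ω J') (bval W'))).smooth
        (fun m' => G.iso hc m' (s m')) m := by
  classical
  obtain ⟨b, hb⟩ := exists_uFrame hk hZ G.symplectic G.compatible m
  have hb' : FrameAt (BSmooth Z) m fun m' => (G.tr (b m')).1.toB :=
    FrameAt.uOrth hk hZ G.symplectic G.compatible' hb
      (.of_forall fun m' => uMat_injective G.compatible G.compatible' (b m'))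
  have hs : (frameBundle k (bTangentEuc Ω J)).smooth (fun m' => (b m').1) m :=
    fun v => hb.smooth (.const v m)
  have hs' : (frameBundle k (bTangentEuc Ω J')).smooth (fun m' => (G.tr (b m')).1) m :=
    fun v => hb'.smooth (.const v m)
  have hdiff : ∀ {p q : ∀ m, OFrame k (tangentEuc g) m},
      (frameBundle k (tangentEuc g)).smooth p m → (frameBundle k (tangentEuc g)).smooth q m →
      SmAt k (fun m' => isoL ((p m').diff (q m'))) m := fun hp hq =>
    FrameAt.smAt_trans ((tangentEuc_isSmooth g).smooth_iff_frameAt.mp hp) hq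
  have hsm : (acBundle Ω J).smooth (fun m' => acMk (b m') 1) m :=
    (acBundle_smooth_iff hb _).mpr (smoothGroupNear_congr (SmoothGroupLaws.one m)
      (.of_forall fun m' => acCoord_mk_self _ _))
  by_cases hm : x m = 0
  · let σ : ∀ m, OFrame k (bTangentEuc Ω J) m := fun m' =>
      if 0 ≤ x m' then (b m').1 else reflGauge (V := bTangentEuc Ω J) (bval W) m' (b m').1
    let σ' : ∀ m, OFrame k (bTangentEuc Ω J') m := fun m' =>
      if 0 ≤ x m' then (G.tr (b m')).1
      else reflGauge (V := bTangentEuc Ω J') (bval W') m' (G.tr (b m')).1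
    have h1 := G.map_smooth σ m ⟨fun h => absurd hm h, fun _ => ⟨_, hs, .of_forall fun m' =>
      ⟨fun h => if_pos h, fun h => if_neg (not_le.mpr h)⟩⟩⟩
    have h2 := G.map_smooth' σ' m ⟨fun h => absurd hm h, fun _ => ⟨_, hs', .of_forall fun m' =>
      ⟨fun h => if_pos h, fun h => if_neg (not_le.mpr h)⟩⟩⟩
    let A : M → O[k] := fun m' => (φ' m' (σ' m')).diff (φ m' (σ m'))
    have hApos : ∀ m', 0 ≤ x m' → A m' = G.diff (b m') := fun m' h => by
      simp only [A, σ, σ', if_pos h]; rfl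
    have hAneg : ∀ m', x m' < 0 → G.diff (b m') = hrefl ((G.tr (b m')).1.unitOf (bval W' m')) *
        A m' * (hrefl ((b m').1.unitOf (bval W m')))⁻¹ := fun m' h => by
      have h3 : (φ' m' ((G.tr (b m')).1.act (hrefl ((G.tr (b m')).1.unitOf (bval W' m'))))).act
          (A m') = φ m' ((b m').1.act (hrefl ((b m').1.unitOf (bval W m')))) := by
        simp only [A, σ, σ', if_neg (not_le.mpr h)]
        exact OFrame.act_diff _ _
      rw [G.map_act, G.map_act', ← G.act_diff (b m'), ← OFrame.act_mul, ← OFrame.act_mul] at h3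
      rw [OFrame.act_injective _ h3, mul_inv_cancel_right]
    have hAm : HasPosLift (A m) := by
      rw [hApos m hm.ge]; exact (hc (b m)).lift
    obtain ⟨hl, hC⟩ := smAt_posLift (hdiff h2 h1) hAm
    have hw := G.ne_zero m hm
    have hw' := G.ne_zero' m hm
    have hreg : SmAt k (fun m' => pv (pinVec ((G.tr (b m')).1.unitOf (bval W' m')) *
        posLift (A m') * (pinVec ((b m').1.unitOf (bval W m')))⁻¹)) m :=
      smoothGroupNear_pin.mp (SmoothGroupLaws.mul (SmoothGroupLaws.mul
        (smoothGroupNear_unitOf hk hZ (b := fun m' => (G.tr (b m')).1) hb' hw')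
        (smoothGroupNear_pin.mpr hC)) (SmoothGroupLaws.inv
          (smoothGroupNear_unitOf hk hZ (b := fun m' => (b m').1) hb hw)))
    have hpos := (continuousAt_const (y := (0 : ℝ))).eventually_lt (Complex.continuous_re.continuousAt.comp
      (hreg.comp (contDiff_clinear ctr)).continuousAt) (by
        have := (hc (b m)).reg hm
        rwa [← hApos m hm.ge] at this)
    refine ⟨fun m' => if 0 ≤ x m' then acMk (b m') 1 else
        chiralGauge (acSpinC Ω J) (bval W) m' (acMk (b m') 1),
      ⟨fun h => absurd hm h, fun _ => ⟨_, hsm, .of_forall fun m' =>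
        ⟨fun h => if_pos h, fun h => if_neg (not_le.mpr h)⟩⟩⟩,
      fun h => absurd hm h, fun _ => ⟨fun m' => acMk (G.tr (b m')) (posLift (A m')),
        (acBundle_smooth_iff hb' _).mpr (smoothGroupNear_congr (smoothGroupNear_pin.mpr hC)
          (.of_forall fun m' => acCoord_mk_self (G.tr (b m')) _)), ?_⟩⟩
    filter_upwards [hl, hpos, eventually_bval_ne_zero hk hZ hw,
      eventually_bval_ne_zero hk hZ hw'] with m' g1 g2 g3 g4
    constructor
    · intro h
      refine (congrArg (G.iso hc m') (if_pos h)).trans ((G.iso_mk hc (b m') 1).trans ?_)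
      rw [mul_one, hApos m' h]
    · intro h
      refine (congrArg (G.iso hc m') ((if_neg (not_le.mpr h)).trans
        (chiralGauge_mk (bval W) (b m') 1))).trans ((G.iso_mk hc (b m') _).trans
          (Eq.trans ?_ (chiralGauge_mk (bval W') (G.tr (b m')) (posLift (A m'))).symm))
      rw [mul_one]
      have n1 : ‖(b m').1.unitOf (bval W m')‖ = 1 := norm_unitOf (b m').1 g3
      have n2 : ‖(G.tr (b m')).1.unitOf (bval W' m')‖ = 1 := norm_unitOf (G.tr (b m')).1 g4
      set v := (b m').1.unitOf (bval W m') with hv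
      set v' := (G.tr (b m')).1.unitOf (bval W' m') with hv'
      have h3 : posLift (G.diff (b m')) =
          pinGamma k * (pinVec v' * posLift (A m') * (pinVec v)⁻¹) * (pinGamma k)⁻¹ := by
        refine posLift_eq (PinR_conj _ (mul_mem (mul_mem (pinVec_mem_PinR n2) g1.mem)
          (inv_mem (pinVec_mem_PinR n1)))) ?_ ?_
        · have h4 : pinGamma k * (pinVec v' * posLift (A m') * (pinVec v)⁻¹) * (pinGamma k)⁻¹ =
              (pinGamma k * pinVec v') * posLift (A m') * (pinGamma k * pinVec v)⁻¹ := by group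
          rw [h4, pinAd_mul', pinAd_mul', pinAd_inv, pinGamma_mul_pinVec n1,
            pinGamma_mul_pinVec n2, g1.pinAd, hAneg m' h]
        · rw [pv_mul, pv_mul, ctr_conj]
          exact g2
      rw [h3]
      congr 1
      group
  · refine ⟨fun m' => acMk (b m') 1, ⟨fun _ => hsm, fun h => absurd h hm⟩,
      fun _ => ?_, fun h => absurd h hm⟩
    refine (acBundle_smooth_iff hb' (fun m' => G.iso hc m' (acMk (b m') 1))).mpr ?_
    have h1 := G.map_smooth _ m ⟨fun _ => hs, fun h => absurd h hm⟩
    have h2 := G.map_smooth' _ m ⟨fun _ => hs', fun h => absurd h hm⟩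
    refine smoothGroupNear_congr (smoothGroupNear_pin.mpr (smAt_posLift (hdiff h2 h1)
      (hc (b m)).lift).2) (.of_forall fun m' => ?_)
    refine (acCoord_mk_self (G.tr (b m')) _).trans (mul_one _)

theorem clutchedSpinC_iso (hx : Continuous x)
    (hc : ∀ m, ∃ b : UFrame Ω J m, G.IsClose b) :
    (clutchedSpinC Ω o J W x g φ).Iso (clutchedSpinC Ω o J' W' x g φ') := by
  have hc' : ∀ {m} (b : UFrame Ω J m), G.IsClose b := fun {m} b => by
    obtain ⟨b₀, h⟩ := hc m
    exact h.act G (uDiff_mem b₀ b) (act_uDiff b₀ b)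
  have hP := surgery_principal hk hZ G.symplectic G.compatible hx G.ne_zero
  have hP' := surgery_principal hk hZ G.symplectic G.compatible' hx G.ne_zero'
  refine ⟨rfl, fun m => .ofBijective _ (hP.bijective hP' (G.iso hc') (G.iso_act hc' hk hZ) m),
    G.iso_act hc' hk hZ, hP.smooth_iff_map hP' (G.iso hc') (G.iso_act hc' hk hZ)
      (G.iso_smooth hk hZ hc' hx), fun m p => ?_, fun m p => ?_⟩
  · obtain ⟨b, -⟩ := exists_uFrame hk hZ G.symplectic G.compatible m
    obtain ⟨a, rfl⟩ : ∃ c, acMk (b m) c = p := ⟨_, acMk_coord (b m) p⟩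
    have h : pinDeg (posLift (G.diff (b m)) * a) = pinDeg a := by
      rw [pinDeg_mul, (hc' (b m)).lift.pinDeg, zero_add]
    change (if 0 ≤ x m then pinDeg (posLift (G.diff (b m)) * a)
      else pinDeg (posLift (G.diff (b m)) * a) + 1) = if 0 ≤ x m then pinDeg a else pinDeg a + 1
    rw [h]
  · obtain ⟨b, -⟩ := exists_uFrame hk hZ G.symplectic G.compatible m
    obtain ⟨a, rfl⟩ : ∃ c, acMk (b m) c = p := ⟨_, acMk_coord (b m) p⟩
    change φ' m ((G.tr (b m)).1.act (pinAd (posLift (G.diff (b m)) * a))) =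
      φ m ((b m).1.act (pinAd a))
    rw [G.map_act, G.map_act', pinAd_mul', OFrame.act_mul, (hc' (b m)).lift.pinAd, G.act_diff]

end GluingPair

/-! ## Isomorphism of clutched structures that are connected by a path -/

variable {ι : Type*} {F : Filter ι}

theorem IsPD.tendsto_invSqrt {P : ι → E[k]} {P₀ : E[k]} (h₀ : IsPD P₀)
    (h : Tendsto P F (𝓝 P₀)) (hP : ∀ᶠ i in F, IsPD (P i)) :
    Tendsto (fun i => _root_.invSqrt (P i)) F (𝓝 (_root_.invSqrt P₀)) := by
  obtain ⟨G, h1, h2⟩ := h₀.invSqrt_smooth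
  rw [h2.self_of_nhds h₀]
  refine (h1.continuousAt.tendsto.comp h).congr' ?_
  filter_upwards [h.eventually h2, hP] with i h3 h4 using (h3 h4).symm

def orthPart (K : E[k]) : E[k] := K * invSqrt (adjoint K * K)

theorem isPD_adjoint_mul {K : E[k]} (hK : Injective K) :
    IsPD (adjoint K * K) where
  symm v w := by
    rw [clm_mul_apply, clm_mul_apply, adjoint_inner_left,
      ContinuousLinearMap.adjoint_inner_right]
  pos v hv := by
    rw [clm_mul_apply, ContinuousLinearMap.adjoint_inner_right]
    exact real_inner_self_pos.mpr ((map_ne_zero_iff K hK).mpr hv)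

theorem orthPart_adjoint_mul {K : E[k]} (hK : Injective K) :
    adjoint (orthPart K) * orthPart K = 1 := by
  have h := isPD_adjoint_mul hK
  refine ContinuousLinearMap.ext fun v => ext_inner_right ℝ fun w => ?_
  rw [clm_mul_apply, adjoint_inner_left, orthPart, clm_mul_apply, clm_mul_apply,
    ← adjoint_inner_left, ← h.invSqrt.symm]
  exact congrArg (fun T : E[k] => inner ℝ (T v) w) h.invSqrt_mul_self

theorem tendsto_orthPart {K : ι → E[k]} {K₀ : E[k]}
    (h : Tendsto K F (𝓝 K₀)) (h₀ : Injective K₀) (hK : ∀ i, Injective (K i)) :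
    Tendsto (fun i => orthPart (K i)) F (𝓝 (orthPart K₀)) :=
  h.mul ((isPD_adjoint_mul h₀).tendsto_invSqrt
    (((adjoint (𝕜 := ℝ) (E := Euc k) (F := Euc k)).continuous.tendsto _ |>.comp
      h).mul h) (.of_forall fun i => isPD_adjoint_mul (hK i)))

theorem tendsto_posLift {A : ι → O[k]} (h : Tendsto (fun i => isoL (A i)) F (𝓝 1)) :
    (∀ᶠ i in F, HasPosLift (A i)) ∧ Tendsto (fun i => pv (posLift (A i))) F (𝓝 1) := by
  obtain ⟨G, h1, h2⟩ := (hasPosLift_one (k := k)).smooth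
  have h0 : isoL (1 : O[k]) = 1 := ContinuousLinearMap.ext fun _ => rfl
  rw [h0] at h1 h2
  have h3 := h.eventually h2
  refine ⟨h3.mono fun i h => (h _ rfl).1, ?_⟩
  have h4 := (h2.self_of_nhds 1 h0).2
  rw [posLift_one, pv_one] at h4
  rw [h4]
  exact (h1.continuousAt.tendsto.comp h).congr' (h3.mono fun i h => (h _ rfl).2.symm)

def transferGram (D : E[k]) : E[k] :=
  adjoint (-(stdJL k * D) * (1 - D * stdJL k)) * (1 - D * stdJL k)

def transferMat (D : E[k]) : E[k] := (1 - D * stdJL k) * invSqrt (transferGram D)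

theorem tendsto_transferMat {D : ι → E[k]} (h : Tendsto D F (𝓝 (stdJL k)))
    (hD : ∀ i, IsPD (transferGram (D i))) : Tendsto (fun i => transferMat (D i)) F (𝓝 1) := by
  have hJ : stdJL k * stdJL k = -1 := ContinuousLinearMap.ext fun v => stdJ_sq v
  have h1 : (1 - stdJL k * stdJL k : E[k]) = (2 : ℝ) • 1 := by
    rw [hJ, sub_neg_eq_add]
    exact ContinuousLinearMap.ext fun v => (two_smul ℝ v).symm
  have h2 : transferGram (stdJL k) = (4 : ℝ) • 1 := by
    rw [transferGram, hJ, sub_neg_eq_add, neg_neg, one_mul, ← two_smul ℝ]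
    refine ContinuousLinearMap.ext fun v => ext_inner_right ℝ fun w => ?_
    rw [clm_mul_apply]
    simp only [ContinuousLinearMap.smul_apply, ContinuousLinearMap.one_apply, map_smul,
      inner_smul_left, adjoint_inner_left]
    simp
    ring
  have hpd : ∀ c : ℝ, 0 < c → IsPD (c • (1 : E[k])) := fun c hc =>
    ⟨fun v w => by simp [inner_smul_left, inner_smul_right], fun v hv => by
      simpa [inner_smul_right] using mul_pos hc (real_inner_self_pos.mpr hv)⟩
  have h3 : _root_.invSqrt ((4 : ℝ) • (1 : E[k])) = (2⁻¹ : ℝ) • 1 :=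
    (hpd 4 (by norm_num)).invSqrt_eq (hpd _ (by norm_num)) (by
      simp only [smul_mul_assoc, mul_smul_comm, one_mul, smul_smul]; norm_num)
  have h4 : Tendsto (fun i => 1 - D i * stdJL k) F (𝓝 (1 - stdJL k * stdJL k)) :=
    tendsto_const_nhds.sub (h.mul tendsto_const_nhds)
  have h5 : Tendsto (fun i => transferGram (D i)) F (𝓝 (transferGram (stdJL k))) :=
    ((adjoint (𝕜 := ℝ) (E := Euc k) (F := Euc k)).continuous.tendsto _ |>.comp
      ((tendsto_const_nhds.mul h).neg.mul h4)).mul h4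
  rw [h2] at h5
  have h6 := h4.mul ((hpd 4 (by norm_num)).tendsto_invSqrt h5 (.of_forall hD))
  have h7 : ((2 : ℝ) • (1 : E[k])) * ((2⁻¹ : ℝ) • 1) = 1 := by
    ext1 v; simp [clm_mul_apply]
  rwa [h3, h1, h7] at h6

include hΩ hJ in
theorem uTransfer_gram (hJ' : IsCompatible Ω J') (b : UFrame Ω J m) : IsPD
    (transferGram (homL b.1.toB b.1.toB (J' m))) ∧ ∀ v, (uTransfer hΩ hJ hJ' b).1.toB v = b.1.toB
    (transferMat (homL b.1.toB b.1.toB (J' m)) v) := by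
  set D := homL b.1.toB b.1.toB (J' m) with hD
  have hU := uMat_injective hJ hJ' b
  have hs := hJ'.metric_symm hΩ m
  have hp : ∀ u, u ≠ 0 → 0 < bMetric Ω J' m u u := fun _ hu => hJ'.metric_pos hu
  have h1 : ∀ a c, Ω m (b.1.toB a) (J' m (b.1.toB c)) = inner ℝ a (-(stdJL k * D) c) := fun a c => by
    have h2 : J m (b.1.toB (-(stdJL k * D) c)) = J' m (b.1.toB c) := by
      have h3 : stdJ k (-(stdJL k * D) c) = D c := by
        rw [map_neg]; exact neg_eq_iff_eq_neg.mpr (stdJ_sq _)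
      exact ((b.2 _).trans (congrArg b.1.toB h3)).trans (apply_homL b.1.toB b.1.toB (J' m) c)
    rw [← h2]
    exact OFrame.metric_toB b.1 a _
  have h2 : gram (bMetric Ω J' m) ((eqOf (uMat (J' m) b.1.toB)).trans b.1.toB) =
      transferGram D := by
    refine ContinuousLinearMap.ext fun v => ext_inner_right ℝ fun w => ?_
    rw [gram_inner, transferGram, clm_mul_apply, adjoint_inner_left]
    rw [LinearEquiv.trans_apply, LinearEquiv.trans_apply, eqOf_apply hU, eqOf_apply hU]
    exact h1 _ _
  have h3 := gram_isPD hs hp ((eqOf (uMat (J' m) b.1.toB)).trans b.1.toB)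
  rw [h2] at h3
  refine ⟨h3, fun v => ?_⟩
  exact (orthE_apply hs hp _ v).trans ((congrArg b.1.toB (eqOf_apply hU _)).trans
    (congrArg (fun G => b.1.toB (uMat (J' m) b.1.toB (invSqrt G v))) h2))

def OFrame.toT (q : OFrame k (tangentEuc g) m) : Euc k ≃ₗ[ℝ] T[k] m := q.1

theorem clutchMap_coord {A : ∀ m, BTangent k Z m →ₗ[ℝ] T[k] m} (hA : ∀ m, Injective (A m))
    (p : OFrame k (bTangentEuc Ω J) m) (τ : OFrame k (tangentEuc g) m) (v : Euc k) :
    (clutchMap g A hA m p).toT v = τ.toT (orthPart (homL τ.toT p.toB (A m)) v) := by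
  have h1 : gram (metricForm g m) (homFrame (A m) (hA m) p.toB) =
      adjoint (homL τ.toT p.toB (A m)) * homL τ.toT p.toB (A m) := by
    refine ContinuousLinearMap.ext fun v => ext_inner_right ℝ fun w => ?_
    rw [gram_inner, clm_mul_apply, adjoint_inner_left]
    refine Eq.trans ?_ (τ.2 _ _)
    change metricForm g m _ _ = metricForm g m (τ.toT _) (τ.toT _)
    rw [apply_homL, apply_homL]
    rfl
  refine (orthE_apply (β := metricForm g m) ((tangentEuc_isSmooth g).symm m)
    ((tangentEuc_isSmooth g).pos m) (homFrame (A m) (hA m) p.toB) v).trans ?_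
  rw [h1, orthPart, clm_mul_apply, apply_homL]
  rfl

theorem homL_injective {A : BTangent k Z m →ₗ[ℝ] T[k] m} (hA : Injective A) (τ : Euc k ≃ₗ[ℝ] T[k] m)
    (b : Euc k ≃ₗ[ℝ] BTangent k Z m) : Injective (homL τ b A) :=
  τ.symm.injective.comp (hA.comp b.injective)

theorem isoL_diff_clutchMap {A A' : ∀ m, BTangent k Z m →ₗ[ℝ] T[k] m} (hA : ∀ m, Injective (A m))
    (hA' : ∀ m, Injective (A' m)) (p : OFrame k (bTangentEuc Ω J) m)
    (p' : OFrame k (bTangentEuc Ω J') m) (τ : OFrame k (tangentEuc g) m) {X : E[k]}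
    (hX : ∀ v, p'.toB v = p.toB (X v)) : isoL ((clutchMap g A' hA' m p').diff
    (clutchMap g A hA m p)) = adjoint (orthPart (homL τ.toT p.toB (A' m) * X)) * orthPart
    (homL τ.toT p.toB (A m)) ∧ Injective (homL τ.toT p.toB (A' m) * X) := by
  have h0 : homL τ.toT p.toB (A' m) * X = homL τ.toT p'.toB (A' m) :=
    ContinuousLinearMap.ext fun v => by
      rw [clm_mul_apply, homL_apply, homL_apply, hX]
  rw [h0]
  have hi := homL_injective (hA' m) τ.toT p'.toB
  refine ⟨ContinuousLinearMap.ext fun v => ?_, hi⟩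
  set E := (clutchMap g A' hA' m p').diff (clutchMap g A hA m p)
  have h1 : (clutchMap g A' hA' m p').toT (E v) = (clutchMap g A hA m p).toT v :=
    (clutchMap g A' hA' m p').toT.apply_symm_apply _
  rw [clutchMap_coord hA' p' τ, clutchMap_coord hA p τ] at h1
  rw [clm_mul_apply, ← τ.toT.injective h1]
  exact (congrArg (fun T : E[k] => T (E v)) (orthPart_adjoint_mul hi)).symm

theorem dualForm_coord (b : Euc k ≃ₗ[ℝ] BTangent k Z m) (v : Euc k) : dualForm Ω J W m (b v) =
    (inner ℝ (gram (Ω m) b (b.symm (bval W m))) (homL b b (J m) (b.symm (bval W m))))⁻¹ * inner ℝ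
    (gram (Ω m) b (b.symm (bval W m))) (homL b b (J m) v) := by
  rw [gram_inner, gram_inner, apply_homL, apply_homL, b.apply_symm_apply]
  rfl

theorem pv_inv_pinVec {k : ℕ} {v : Euc k} (hv : ‖v‖ = 1) : pv (pinVec v)⁻¹ = -cvec v := by
  have h1 : pv (pinVec v) * pv (pinVec v)⁻¹ = 1 := by rw [← pv_mul, mul_inv_cancel, pv_one]
  have h2 := congrArg (cvec v * ·) h1
  simp only [pv_pinVec hv, ← mul_assoc, cvec_mul_self, hv, mul_one] at h2
  simpa using congrArg Neg.neg h2

section ClutchPath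

variable {T : Type*} [TopologicalSpace T] {J : T → BEnd k Z} {W : T → bFields k Z}
  {A : ∀ (_ : T) (m : M), BTangent k Z m →ₗ[ℝ] T[k] m}

/-- The linear map `A`, composed with the reflection over `{x < 0}`. -/
def unfoldHom (Ω : BForm k Z) (J : BEnd k Z) (W : bFields k Z) (x : M → ℝ)
    (A : ∀ m, BTangent k Z m →ₗ[ℝ] T[k] m) (m : M) :
    BTangent k Z m →ₗ[ℝ] T[k] m := open Classical in if 0 ≤ x m then A m else A m ∘ₗ bRefl Ω J W m

/-- A continuous family of complex structures, normal fields and linear maps. -/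
structure IsClutchPath (Ω : BForm k Z) (J : T → BEnd k Z) (W : T → bFields k Z) (x : M → ℝ)
    (A : ∀ (_ : T) (m : M), BTangent k Z m →ₗ[ℝ] T[k] m) : Prop where
  symplectic : IsBSymplectic Z Ω
  compatible : ∀ t, IsCompatible Ω (J t)
  ne_zero : ∀ t m, x m = 0 → bval (W t) m ≠ 0
  injective : ∀ t m, Injective (A t m)
  smooth : ∀ t, ClutchSmooth Ω (J t) (W t) x (A t)
  continuous_J : ∀ t m (b : ∀ m, Euc k ≃ₗ[ℝ] BTangent k Z m), FrameAt (BSmooth Z) m b →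
    ContinuousAt (fun p : T × M => homL (b p.2) (b p.2) (J p.1 p.2)) (t, m)
  continuous_W : ∀ t m (b : ∀ m, Euc k ≃ₗ[ℝ] BTangent k Z m), FrameAt (BSmooth Z) m b →
    ContinuousAt (fun p : T × M => (b p.2).symm (bval (W p.1) p.2)) (t, m)
  continuous_hom : ∀ t m (b : ∀ m, Euc k ≃ₗ[ℝ] BTangent k Z m), FrameAt (BSmooth Z) m b →
    ∀ τ : ∀ m, Euc k ≃ₗ[ℝ] T[k] m, FrameAt VSmoothNear m τ →
    (x m ≠ 0 → ContinuousAt (fun p : T × M => homL (τ p.2) (b p.2) (A p.1 p.2)) (t, m)) ∧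
    (x m = 0 → ContinuousAt (fun p : T × M => homL (τ p.2) (b p.2)
      (unfoldHom Ω (J p.1) (W p.1) x (A p.1) p.2)) (t, m))

include hΩ in
theorem continuousAt_dualForm (hJ : ∀ t, IsCompatible Ω (J t)) {t₀ : T} {m₀ : M}
    (hb : FrameAt (BSmooth Z) m₀ b) (hD : ContinuousAt (fun p : T × M => homL (b p.2) (b p.2)
    (J p.1 p.2)) (t₀, m₀))
    (hW : ContinuousAt (fun p : T × M => (b p.2).symm (bval (W p.1) p.2)) (t₀, m₀))
    (hw : bval (W t₀) m₀ ≠ 0) (v : Euc k) : ContinuousAt (fun p : T × M => dualForm Ω (J p.1)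
    (W p.1) p.2 (b p.2 v)) (t₀, m₀) := by
  have hO : ContinuousAt (fun p : T × M => gram (Ω p.2) (b p.2)) (t₀, m₀) :=
    ContinuousAt.comp (f := Prod.snd) (g := fun m => gram (Ω m) (b m)) (x := (t₀, m₀))
      (hΩ.smAt_gram hb).continuousAt continuousAt_snd
  simp only [dualForm_coord]
  refine ContinuousAt.mul (ContinuousAt.inv₀ ((hO.clm_apply hW).inner (𝕜 := ℝ) (hD.clm_apply hW)) ?_)
    ((hO.clm_apply hW).inner (𝕜 := ℝ) (hD.clm_apply continuousAt_const))
  rw [gram_inner, apply_homL, apply_symm_apply]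
  exact ((hJ t₀).metric_pos hw).ne'

namespace IsClutchPath

variable (h : IsClutchPath Ω J W x A)
include h

theorem continuousAt_bRefl {t₀ : T} {m₀ : M} (hb : FrameAt (BSmooth Z) m₀ b)
    (hw : bval (W t₀) m₀ ≠ 0) : ContinuousAt (fun p : T × M => homL (b p.2) (b p.2)
    (bRefl Ω (J p.1) (W p.1) p.2)) (t₀, m₀) := by
  rw [continuousAt_clm_apply]
  intro v
  have h1 : ∀ p : T × M, homL (b p.2) (b p.2) (bRefl Ω (J p.1) (W p.1) p.2) v =
      v - (2 * dualForm Ω (J p.1) (W p.1) p.2 (b p.2 v)) • (b p.2).symm (bval (W p.1) p.2) :=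
    fun p => by
      rw [homL_apply, bRefl_apply, map_sub, map_smul, LinearEquiv.symm_apply_apply]
  simp only [h1]
  exact continuousAt_const.sub ((continuousAt_const.mul (continuousAt_dualForm h.symplectic
    h.compatible hb (h.continuous_J _ _ _ hb) (h.continuous_W _ _ _ hb) hw v)).smul
      (h.continuous_W _ _ _ hb))

include hk hZ

theorem pair (g : RMetric k M) (t t' : T) : GluingPair Ω (J t) (J t') (W t) (W t') x g
    (clutchMap g (A t) (h.injective t)) (clutchMap g (A t') (h.injective t')) where
  symplectic := h.symplectic
  compatible := h.compatible t
  compatible' := h.compatible t'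
  ne_zero := h.ne_zero t
  ne_zero' := h.ne_zero t'
  map_act := clutchMap_act _
  map_act' := clutchMap_act _
  map_smooth := clutchMap_smooth (h.compatible t) h.symplectic _ (h.smooth t) hk hZ (h.ne_zero t)
  map_smooth' := clutchMap_smooth (h.compatible t') h.symplectic _ (h.smooth t') hk hZ (h.ne_zero t')

theorem eventually_isClose (hx : Continuous x) (g : RMetric k M) (t₀ : T) (m₀ : M) :
    ∀ᶠ p : T × M in 𝓝 (t₀, m₀), ∃ b : UFrame Ω (J t₀) p.2, (h.pair hk hZ g t₀ p.1).IsClose b := by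
  obtain ⟨b, hb⟩ := exists_uFrame hk hZ h.symplectic (h.compatible t₀) m₀
  obtain ⟨τ, hτ⟩ := (tangentEuc_isSmooth g).exists_frame m₀
  let β : ∀ m, Euc k ≃ₗ[ℝ] BTangent k Z m := fun m => (b m).1.toB
  let θ : ∀ m, Euc k ≃ₗ[ℝ] T[k] m := fun m => (τ m).toT
  have hβ : FrameAt (BSmooth Z) m₀ β := hb
  have hθ : FrameAt VSmoothNear m₀ θ := hτ
  obtain ⟨c1, c2⟩ := h.continuous_hom t₀ m₀ β hβ θ hθ
  have hDc := h.continuous_J t₀ m₀ β hβ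
  have hWc := h.continuous_W t₀ m₀ β hβ
  have hD0 : ∀ m, homL (β m) (β m) (J t₀ m) = stdJL k := fun m =>
    ContinuousLinearMap.ext fun v => (congrArg (β m).symm ((b m).2 v)).trans
      ((β m).symm_apply_apply _)
  let X : T × M → E[k] := fun p => transferMat (homL (β p.2) (β p.2) (J p.1 p.2))
  have hXg := fun p : T × M => uTransfer_gram h.symplectic (h.compatible t₀) (h.compatible p.1)
    (b p.2)
  have hX : Tendsto X (𝓝 (t₀, m₀)) (𝓝 1) := by
    refine tendsto_transferMat ?_ fun p => (hXg p).1
    rw [← hD0 m₀]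
    exact hDc
  let G := fun p : T × M => h.pair hk hZ g t₀ p.1
  let e : T × M → T × M := fun p => (t₀, p.2)
  have he : Tendsto e (𝓝 (t₀, m₀)) (𝓝 (t₀, m₀)) :=
    (continuous_const.prodMk continuous_snd).tendsto' _ _ rfl
  let K : T × M → E[k] := fun p => homL (θ p.2) (β p.2) (A p.1 p.2)
  have lim : ∀ (F : Filter (T × M)) (K₀ : E[k]), F ≤ 𝓝 (t₀, m₀) → Tendsto e F F →
      Injective K₀ → Tendsto K F (𝓝 K₀) → (∀ᶠ p in F, HasPosLift ((G p).diff (b p.2))) ∧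
      Tendsto (fun p => pv (posLift ((G p).diff (b p.2)))) F (𝓝 1) := by
    intro F K₀ hF heF hK₀ hK
    refine tendsto_posLift ?_
    have h1 : Tendsto (fun p => K p * X p) F (𝓝 K₀) := by
      simpa using hK.mul (hX.mono_left hF)
    have h2 := fun p : T × M => isoL_diff_clutchMap (h.injective t₀) (h.injective p.1) (b p.2).1
      (uTransfer h.symplectic (h.compatible t₀) (h.compatible p.1) (b p.2)).1 (τ p.2) (hXg p).2
    have h3 : ∀ p, isoL ((G p).diff (b p.2)) =
        adjoint (orthPart (K p * X p)) * orthPart (K (e p)) := fun p => (h2 p).1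
    simp only [h3]
    have h4 := ((adjoint (𝕜 := ℝ) (E := Euc k) (F := Euc k)).continuous.tendsto
      _ |>.comp (tendsto_orthPart h1 hK₀ fun p => (h2 p).2)).mul (tendsto_orthPart (hK.comp heF) hK₀
        fun p => homL_injective (h.injective t₀ p.2) (θ p.2) (β p.2))
    rwa [orthPart_adjoint_mul hK₀] at h4
  by_cases hm : x m₀ = 0
  · have hw := h.ne_zero t₀ m₀ hm
    let w : T × M → Euc k := fun p => (β p.2).symm (bval (W p.1) p.2)
    let R : T × M → E[k] := fun p =>
      homL (β p.2) (β p.2) (bRefl Ω (J p.1) (W p.1) p.2)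
    let B : T × M → E[k] := fun p =>
      homL (θ p.2) (β p.2) (unfoldHom Ω (J p.1) (W p.1) x (A p.1) p.2)
    have hR : Tendsto R (𝓝 (t₀, m₀)) (𝓝 (R (t₀, m₀))) := h.continuousAt_bRefl hβ hw
    have hB : Tendsto B (𝓝 (t₀, m₀)) (𝓝 (B (t₀, m₀))) := c2 hm
    have hw0 : w (t₀, m₀) ≠ 0 := (map_ne_zero_iff _ (β m₀).symm.injective).mpr hw
    have hwe : ∀ᶠ p in 𝓝 (t₀, m₀), w p ≠ 0 := hWc.eventually_ne hw0
    have hB0 : Injective (B (t₀, m₀)) :=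
      homL_injective (by unfold unfoldHom; rw [if_pos hm.ge]; exact h.injective t₀ m₀) _ _
    have hRi : Injective (R (t₀, m₀)) := fun u v huv => (β m₀).injective <| by
      have : bRefl Ω (J t₀) (W t₀) m₀ (bRefl Ω (J t₀) (W t₀) m₀ (β m₀ u)) =
          bRefl Ω (J t₀) (W t₀) m₀ (bRefl Ω (J t₀) (W t₀) m₀ (β m₀ v)) :=
        congrArg _ ((β m₀).symm.injective huv)
      rwa [bRefl_bRefl (h.compatible t₀) hw, bRefl_bRefl (h.compatible t₀) hw] at this
    have hwv : ∀ y : T × M → Euc k, Tendsto y (𝓝 (t₀, m₀)) (𝓝 (w (t₀, m₀))) →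
        Tendsto (fun p => cvec (‖y p‖⁻¹ • y p)) (𝓝 (t₀, m₀))
          (𝓝 (cvec (‖w (t₀, m₀)‖⁻¹ • w (t₀, m₀)))) := fun y hy =>
      (contDiff_cvec.continuous.tendsto _).comp
        ((hy.norm.inv₀ (norm_ne_zero_iff.mpr hw0)).smul hy)
    have hpos := lim (𝓝 (t₀, m₀) ⊓ 𝓟 {p | 0 ≤ x p.2}) (B (t₀, m₀)) inf_le_left
      (he.inf (tendsto_principal_principal.mpr fun _ h => h)) hB0
      ((hB.mono_left inf_le_left).congr' (eventually_inf_principal.mpr (.of_forall fun p hp => by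
        change homL _ _ (unfoldHom Ω (J p.1) (W p.1) x (A p.1) p.2) = homL _ _ (A p.1 p.2)
        unfold unfoldHom; rw [if_pos (show 0 ≤ x p.2 from hp)])))
    have hneg := lim (𝓝 (t₀, m₀) ⊓ 𝓟 {p | x p.2 < 0}) (B (t₀, m₀) * R (t₀, m₀)) inf_le_left
      (he.inf (tendsto_principal_principal.mpr fun _ h => h)) (hB0.comp hRi)
      (((hB.mul hR).mono_left inf_le_left).congr' (eventually_inf_principal.mpr
        (hwe.mono fun p hp hp' => ContinuousLinearMap.ext fun v => by
          change homL _ _ (unfoldHom Ω (J p.1) (W p.1) x (A p.1) p.2) (homL _ _ _ v) =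
            homL _ _ (A p.1 p.2) v
          have hp0 : bval (W p.1) p.2 ≠ 0 := fun h0 => hp (by
            change (β p.2).symm (bval (W p.1) p.2) = 0
            rw [h0, map_zero])
          unfold unfoldHom
          rw [if_neg (not_le.mpr (show x p.2 < 0 from hp')), homL_apply, homL_apply, homL_apply,
            LinearMap.comp_apply, apply_symm_apply, bRefl_bRefl (h.compatible p.1) hp0])))
    let y : T × M → Euc k := fun p => ((G p).tr (b p.2)).1.toB.symm (bval (W p.1) p.2)
    have hy : Tendsto y (𝓝 (t₀, m₀)) (𝓝 (w (t₀, m₀))) := by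
      have h1 : Tendsto (fun p => Ring.inverse (X p)) (𝓝 (t₀, m₀)) (𝓝 (Ring.inverse 1)) :=
        (NormedRing.inverse_continuousAt (1 : E[k]ˣ)).tendsto.comp hX
      have h2 : Tendsto (fun p => Ring.inverse (X p) (w p)) (𝓝 (t₀, m₀)) (𝓝 (w (t₀, m₀))) := by
        have h := (((continuous_fst (X := E[k]) (Y := Euc k)).clm_apply
          continuous_snd).tendsto (Ring.inverse 1, w (t₀, m₀))).comp (h1.prodMk_nhds hWc)
        simp only [Ring.inverse_one, ContinuousLinearMap.one_apply] at h
        exact h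
      refine h2.congr' ?_
      have h3 : ∀ᶠ Q : E[k] in 𝓝 1, IsUnit Q := Units.isOpen.mem_nhds isUnit_one
      filter_upwards [hX.eventually h3] with p hp
      have h4 : X p (y p) = w p := (β p.2).injective (((hXg p).2 (y p)).symm.trans
        ((((G p).tr (b p.2)).1.toB.apply_symm_apply _).trans ((β p.2).apply_symm_apply _).symm))
      rw [← h4, ← clm_mul_apply, Ring.inverse_mul_cancel _ hp]
      rfl
    have hn : ∀ v : Euc k, v ≠ 0 → ‖‖v‖⁻¹ • v‖ = 1 := fun v hv => by
      rw [norm_smul, norm_inv, norm_norm, inv_mul_cancel₀ (norm_ne_zero_iff.mpr hv)]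
    have hreg : Tendsto (fun p => (ctr (cvec (‖y p‖⁻¹ • y p) * pv (posLift ((G p).diff (b p.2))) *
        -cvec (‖w (e p)‖⁻¹ • w (e p)))).re) (𝓝 (t₀, m₀) ⊓ 𝓟 {p | 0 ≤ x p.2}) (𝓝 1) := by
      have hmul : ∀ {f f' : T × M → CCl k} {a a' : CCl k} {F : Filter (T × M)},
          Tendsto f F (𝓝 a) → Tendsto f' F (𝓝 a') → Tendsto (fun p => f p * f' p) F (𝓝 (a * a')) :=
        fun {_ _ a a' _} hf hf' => (contDiff_cmul.continuous.tendsto (a, a')).comp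
          (hf.prodMk_nhds hf')
      have h1 := hmul (hmul ((hwv y hy).mono_left inf_le_left) hpos.2)
        ((hwv _ (hWc.tendsto.comp he)).mono_left inf_le_left).neg
      have h2 := hn _ hw0
      have h3 := ((Complex.continuous_re.comp (contDiff_clinear ctr).continuous).tendsto _).comp h1
      have h4 : cvec (‖w (t₀, m₀)‖⁻¹ • w (t₀, m₀)) * 1 * -cvec (‖w (t₀, m₀)‖⁻¹ • w (t₀, m₀)) =
          (1 : CCl k) := by
        rw [mul_one, mul_neg, cvec_mul_self, h2]; simp
      rw [h4, Function.comp_apply, ctr_one, Complex.one_re] at h3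
      exact h3
    have hev := hpos.1.and (hreg.eventually (lt_mem_nhds zero_lt_one))
    filter_upwards [eventually_inf_principal.mp hev, eventually_inf_principal.mp hneg.1, hwe,
      he.eventually hwe] with p g1 g2 g3 g4
    refine ⟨b p.2, ?_, fun hp => ?_⟩
    · rcases le_or_gt 0 (x p.2) with hp | hp
      exacts [(g1 hp).1, g2 hp]
    · have g5 := (g1 hp.ge).2
      have hy0 : y p ≠ 0 := fun h0 => g3 ((map_eq_zero_iff _ (β p.2).symm.injective).mpr
        ((map_eq_zero_iff _ ((G p).tr (b p.2)).1.toB.symm.injective).mp h0))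
      change 0 < (ctr (pv (pinVec (‖y p‖⁻¹ • y p) * posLift ((G p).diff (b p.2)) *
        (pinVec (‖w (e p)‖⁻¹ • w (e p)))⁻¹))).re
      rw [pv_mul, pv_mul, pv_pinVec (hn _ hy0), pv_inv_pinVec (hn _ g4)]
      exact g5
  · have h1 := lim (𝓝 (t₀, m₀)) (K (t₀, m₀)) le_rfl he
      (homL_injective (h.injective t₀ m₀) _ _) (c1 hm)
    have h2 : ContinuousAt (fun p : T × M => x p.2) (t₀, m₀) := (hx.comp continuous_snd).continuousAt
    filter_upwards [h1.1, h2.eventually_ne hm] with p h3 h4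
    exact ⟨b p.2, h3, fun h0 => absurd h0 h4⟩

end IsClutchPath

theorem SpinCData.Iso.symm {V : EucBundle.{u, v} M} {S S' : SpinCData.{u, v, w} k V}
    (h : S.Iso S') : S'.Iso S := by
  obtain ⟨h0, φ, h1, h2, h3, h4⟩ := h
  refine ⟨h0.symm, fun m => (φ m).symm, fun m p a => ?_, fun σ m => ?_, fun m p => ?_, fun m p => ?_⟩
  · rw [Equiv.symm_apply_eq, h1, Equiv.apply_symm_apply]
  · rw [h2]; simp
  · rw [← h3, Equiv.apply_symm_apply]
  · rw [← h4, Equiv.apply_symm_apply]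

theorem SpinCData.Iso.trans {V : EucBundle.{u, v} M} {S S' S'' : SpinCData.{u, v, w} k V}
    (h : S.Iso S') (h' : S'.Iso S'') : S.Iso S'' := by
  obtain ⟨h0, φ, h1, h2, h3, h4⟩ := h
  obtain ⟨g0, ψ, g1, g2, g3, g4⟩ := h'
  refine ⟨h0.trans g0, fun m => (φ m).trans (ψ m), fun m p a => ?_, fun σ m => ?_, fun m p => ?_,
    fun m p => ?_⟩
  · simp only [Equiv.trans_apply, h1, g1]
  · rw [h2, g2]; rfl
  · simp only [Equiv.trans_apply, h3, g3]
  · simp only [Equiv.trans_apply, h4, g4]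

theorem IsClutchPath.iso [PreconnectedSpace T]
    (h : IsClutchPath Ω J W x A) (hk : 1 ≤ k) (hZ : IsHypersurface k Z) (hx : Continuous x)
    (g : RMetric k M) (t t' : T) :
    (clutchedSpinC Ω o (J t) (W t) x g (clutchMap g (A t) (h.injective t))).Iso
      (clutchedSpinC Ω o (J t') (W t') x g (clutchMap g (A t') (h.injective t'))) := by
  let P : T → T → Prop := fun t t' =>
    (clutchedSpinC Ω o (J t) (W t) x g (clutchMap g (A t) (h.injective t))).Iso
      (clutchedSpinC Ω o (J t') (W t') x g (clutchMap g (A t') (h.injective t')))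
  haveI : Std.Symm P := ⟨fun _ _ h => h.symm⟩
  refine PreconnectedSpace.induction₂ P (fun t₀ => ?_) ⟨fun _ _ _ h h' => h.trans h'⟩ t t'
  have h1 := (isCompact_univ (X := M)).eventually_forall_of_forall_eventually (x₀ := t₀)
    (P := fun t m => ∃ b : UFrame Ω (J t₀) m, (h.pair hk hZ g t₀ t).IsClose b)
    fun m _ => h.eventually_isClose hk hZ hx g t₀ m
  exact h1.mono fun t ht => (h.pair hk hZ g t₀ t).clutchedSpinC_iso hk hZ hx fun m => ht m trivial

end ClutchPath

section CollarPath

theorem continuousAt_polarMat {X : Type*} [TopologicalSpace X] {G K : X → E[k]} {x : X}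
    (hG : ContinuousAt G x) (hK : ContinuousAt K x) (hGp : ∀ y, IsPD (G y))
    (hKs : ∀ y v w, inner ℝ (K y v) w = -inner ℝ v (K y w))
    (hKi : ∀ y, Injective (K y)) : ContinuousAt (fun y => polarMat (G y) (K y)) x := by
  have hS : ContinuousAt (fun y => invSqrt (G y)) x := (hGp x).tendsto_invSqrt hG (.of_forall hGp)
  have hL := (hS.mul hK).mul hS
  have h1 : ∀ y, IsPD (-((invSqrt (G y) * K y * invSqrt (G y)) *
      (invSqrt (G y) * K y * invSqrt (G y)))) := fun y => by
    refine isPD_neg_sq (fun v w => ?_) ((hGp y).invSqrt.injective.comp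
      ((hKi y).comp (hGp y).invSqrt.injective))
    change inner ℝ (invSqrt (G y) (K y (invSqrt (G y) v))) w =
      -inner ℝ v (invSqrt (G y) (K y (invSqrt (G y) w)))
    rw [(hGp y).invSqrt.symm, hKs, ← (hGp y).invSqrt.symm]
  exact (hS.mul (hL.mul ((h1 x).tendsto_invSqrt (hL.mul hL).neg (.of_forall h1)))).mul (hS.mul hG)

theorem gram_comb {V : Type*} [AddCommGroup V] [Module ℝ V] {κ β β' : V →ₗ[ℝ] V →ₗ[ℝ] ℝ} {a c : ℝ}
    (h : ∀ u v, κ u v = a * β u v + c * β' u v) (e : Euc k ≃ₗ[ℝ] V) :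
    gram κ e = a • gram β e + c • gram β' e := by
  refine ContinuousLinearMap.ext fun v => ext_inner_right ℝ fun w => ?_
  rw [gram_inner, h, ContinuousLinearMap.add_apply, ContinuousLinearMap.smul_apply,
    ContinuousLinearMap.smul_apply, inner_add_left, real_inner_smul_left, real_inner_smul_left,
    gram_inner, gram_inner]

variable {T : Type*} [TopologicalSpace T]

theorem continuousAt_comp_snd {E : Type*} [TopologicalSpace E] {h : M → E} {t : T}
    (hh : ContinuousAt h m) : ContinuousAt (fun p : T × M => h p.2) (t, m) :=
  ContinuousAt.comp (x := (t, m)) (f := Prod.snd) hh continuousAt_snd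

theorem HomSmooth.smAt_homL {A : ∀ m, BTangent k Z m →ₗ[ℝ] T[k] m} (hA : HomSmooth A m)
    (hb : FrameAt (BSmooth Z) m b) (hτ : FrameAt VSmoothNear m τ) : SmAt k
    (fun m' => homL (τ m') (b m') (A m')) m :=
  smAt_clm_iff.mpr fun v => hτ.smooth_iff.mp (hA _ (hb.smooth (.const v m)))

theorem continuousAt_interp {E : Type*} [NormedAddCommGroup E] [NormedSpace ℝ E] {h h' : M → E}
    {t : unitInterval} (hh : SmAt k h m) (hh' : SmAt k h' m) : ContinuousAt
    (fun p : unitInterval × M => (1 - (p.1 : ℝ)) • h p.2 + (p.1 : ℝ) • h' p.2) (t, m) := by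
  have ht : ContinuousAt (fun p : unitInterval × M => (p.1 : ℝ)) (t, m) :=
    (continuous_subtype_val.comp continuous_fst).continuousAt
  exact ((continuousAt_const.sub ht).smul (continuousAt_comp_snd hh.continuousAt)).add
    (ht.smul (continuousAt_comp_snd hh'.continuousAt))

include hΩ in
theorem continuousAt_collar {J : T → BEnd k Z} {W : T → bFields k Z} {N : T → VField k M}
    {c : M → ℝ} (hJ : ∀ t, IsCompatible Ω (J t)) {t₀ : T} {m₀ : M} (hb : FrameAt (BSmooth Z) m₀ b)
    (hτ : FrameAt VSmoothNear m₀ τ) (hD : ContinuousAt (fun p : T × M => homL (b p.2) (b p.2)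
    (J p.1 p.2)) (t₀, m₀))
    (hW : ContinuousAt (fun p : T × M => (b p.2).symm (bval (W p.1) p.2)) (t₀, m₀))
    (hN : ContinuousAt (fun p : T × M => (τ p.2).symm (N p.1 p.2)) (t₀, m₀))
    (hw : bval (W t₀) m₀ ≠ 0) (hc : ContinuousAt c m₀) : ContinuousAt
    (fun p : T × M => homL (τ p.2) (b p.2) (collar Ω (J p.1) (W p.1) (N p.1) c p.2)) (t₀, m₀) := by
  rw [continuousAt_clm_apply]
  intro v
  have h1 : ∀ p : T × M, homL (τ p.2) (b p.2) (collar Ω (J p.1) (W p.1) (N p.1) c p.2) v =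
      homL (τ p.2) (b p.2) (anchor Z p.2) v +
        (c p.2 * dualForm Ω (J p.1) (W p.1) p.2 (b p.2 v)) • (τ p.2).symm (N p.1 p.2) := fun p => by
    rw [homL_apply, collar_apply, map_add, map_smul]; rfl
  simp only [h1]
  exact ((continuousAt_comp_snd ((homSmooth_anchor m₀).smAt_homL hb hτ).continuousAt).clm_apply
    continuousAt_const).add (((continuousAt_comp_snd hc).mul
      (continuousAt_dualForm hΩ hJ hb hD hW hw v)).smul hN)

theorem bval_interp (W W' : bFields k Z) (a c : ℝ) (m : M) :
    bval (a • W + c • W') m = a • bval W m + c • bval W' m := by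
  simp only [bval, map_add, map_smul]

include hk hZ

theorem ExtendsCanonical.interp {W W' : bFields k Z} (hW : ExtendsCanonical Z W)
    (hW' : ExtendsCanonical Z W') (t : ℝ) : ExtendsCanonical Z ((1 - t) • W + t • W') := by
  intro z hz
  obtain ⟨y, h1, h2, h3⟩ := hZ.exists_defining z
  obtain ⟨τ, b, hb⟩ := hZ.exists_bFrame ⟨0, by omega⟩ h1 h2 h3
  have hd := h3 hz
  have h := hW z hz
  rw [hb.isCanonicalAt_iff hz hd] at h
  have h' := hW' z hz
  rw [hb.isCanonicalAt_iff hz hd] at h'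
  rw [hb.isCanonicalAt_iff hz hd, bval_interp, h, h', ← add_smul, sub_add_cancel, one_smul]

variable {N' : VField k M}

omit hk hZ in
include hΩ hJ in
theorem IsCompatible.metric_smooth (X Y : bFields k Z) : ContMDiff (𝓡 (2 * k)) 𝓘(ℝ, ℝ) ∞ fun m =>
    bMetric Ω J m (bval X m) (bval Y m) := by
  obtain ⟨Y', hY⟩ := hJ.smooth Y
  have h : ∀ m, bMetric Ω J m (bval X m) (bval Y m) = Ω m (bval X m) (bval Y' m) :=
    fun m => congrArg (Ω m (bval X m)) (hY m)
  simp only [h]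
  exact hΩ.smooth X Y'

include hΩ hJ in
theorem exists_compatible_path (hJ' : IsCompatible Ω J') : ∃ Jt : unitInterval → BEnd k Z,
    (∀ t, IsCompatible Ω (Jt t)) ∧ Jt 0 = J ∧ Jt 1 = J' ∧ ∀ t m
    (b : ∀ m, Euc k ≃ₗ[ℝ] BTangent k Z m), FrameAt (BSmooth Z) m b → ContinuousAt
    (fun p : unitInterval × M => homL (b p.2) (b p.2) (Jt p.1 p.2)) (t, m) := by
  obtain ⟨κ, κ_apply⟩ : ∃ κ : unitInterval → BForm k Z, ∀ t m u v, κ t m u v =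
      (1 - (t : ℝ)) * bMetric Ω J m u v + (t : ℝ) * bMetric Ω J' m u v :=
    ⟨fun t m => (1 - (t : ℝ)) • bMetric Ω J m + (t : ℝ) • bMetric Ω J' m, fun _ _ _ _ => rfl⟩
  have κs : ∀ t m u v, κ t m u v = κ t m v u := fun t m u v => by
    rw [κ_apply, κ_apply, hJ.metric_symm hΩ m u v, hJ'.metric_symm hΩ m u v]
  have κp : ∀ t m u, u ≠ 0 → 0 < κ t m u u := fun t m u hu => by
    rw [κ_apply]
    have h1 := hJ.metric_pos hu
    have h2 := hJ'.metric_pos hu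
    rcases t.2.1.eq_or_lt with h | h
    · rw [← h]; simpa using h1
    · exact add_pos_of_nonneg_of_pos (mul_nonneg (sub_nonneg.mpr t.2.2) h1.le) (mul_pos h h2)
  have κsm : ∀ t (X Y : bFields k Z),
      ContMDiff (𝓡 (2 * k)) 𝓘(ℝ, ℝ) ∞ fun m => κ t m (bval X m) (bval Y m) := fun t X Y => by
    simp only [κ_apply]
    exact (contMDiff_const.mul (hJ.metric_smooth hΩ X Y)).add
      (contMDiff_const.mul (hJ'.metric_smooth hΩ X Y))
  choose Jt hJt hJp using fun t => exists_polar hk hZ hΩ (κs t) (κp t) (κsm t)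
  have hend : ∀ (t : unitInterval) {J₁ : BEnd k Z}, IsCompatible Ω J₁ →
      (∀ m, κ t m = bMetric Ω J₁ m) → Jt t = J₁ := fun t J₁ h₁ hκ => funext fun m => by
    obtain ⟨b, -⟩ := exists_bTangent_frame (Z := Z) hk hZ m
    have h2 := h₁.isPolar m
    rw [← hκ m] at h2
    exact (hJp t m).unique (hΩ.swap m) (hΩ.nondegenerate m) (κs t m) (κp t m) h2 (b m)
  refine ⟨Jt, hJt, hend 0 hJ fun m => LinearMap.ext₂ fun u v => by simp [κ_apply],
    hend 1 hJ' fun m => LinearMap.ext₂ fun u v => by simp [κ_apply], ?_⟩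
  intro t m b hb
  have h1 : ∀ p : unitInterval × M, homL (b p.2) (b p.2) (Jt p.1 p.2) =
      polarMat (gram (κ p.1 p.2) (b p.2)) (gram (Ω p.2) (b p.2)) := fun p => by
    rw [← homL_polarJ, (hJp p.1 p.2).unique (hΩ.swap p.2) (hΩ.nondegenerate p.2) (κs p.1 p.2)
      (κp p.1 p.2) (isPolar_polarJ (hΩ.swap p.2) (hΩ.nondegenerate p.2) (κs p.1 p.2)
      (κp p.1 p.2) (b p.2)) (b p.2)]
  have h2 : ∀ p : unitInterval × M, gram (κ p.1 p.2) (b p.2) =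
      (1 - (p.1 : ℝ)) • gram (bMetric Ω J p.2) (b p.2) +
        (p.1 : ℝ) • gram (bMetric Ω J' p.2) (b p.2) := fun p =>
    gram_comb (κ_apply p.1 p.2) (b p.2)
  simp only [h1]
  refine continuousAt_polarMat ?_ (continuousAt_comp_snd
    (h := fun m => gram (Ω m) (b m)) (hΩ.smAt_gram hb).continuousAt)
    (fun p => gram_isPD (κs p.1 p.2) (κp p.1 p.2) _) (fun p => gram_skew (hΩ.swap p.2) _)
    fun p => gram_injective (hΩ.nondegenerate p.2) _
  simp only [h2]
  have h3 : SmAt k (fun m => gram (bMetric Ω J m) (b m)) m :=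
    smAt_gram_of_smooth hb fun X Y => .of_contMDiff (hJ.metric_smooth hΩ X Y) m
  have h4 : SmAt k (fun m => gram (bMetric Ω J' m) (b m)) m :=
    smAt_gram_of_smooth hb fun X Y => .of_contMDiff (hJ'.metric_smooth hΩ X Y) m
  exact continuousAt_interp (h := fun m => gram (bMetric Ω J m) (b m))
    (h' := fun m => gram (bMetric Ω J' m) (b m)) h3 h4

include hΩ in
theorem collar_iso (hx : IsGlobalDefining k Z x) (hJ : IsCompatible Ω J) (hJ' : IsCompatible Ω J')
    (hW : ExtendsCanonical Z W) (hW' : ExtendsCanonical Z W') (hN : ∀ m, W.1 m = x m • N m)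
    (hNZ : ∀ z ∈ Z, ∂[k] x z (N z) = 1) (hN' : ∀ m, W'.1 m = x m • N' m)
    (hNZ' : ∀ z ∈ Z, ∂[k] x z (N' z) = 1) (hf : ∀ t : unitInterval, IsCollar x f
    ((1 - (t : ℝ)) • W + (t : ℝ) • W'))
    (hs : ∀ m, (∀ᶠ m' in 𝓝 m, f m' = |x m'|) ∨ ∀ t : unitInterval, bval
    ((1 - (t : ℝ)) • W + (t : ℝ) • W') m ≠ 0)
    (hA : ∀ m, Injective (collar Ω J W N (collarCoeff x f) m))
    (hA' : ∀ m, Injective (collar Ω J' W' N' (collarCoeff x f) m)) :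
    (clutchedSpinC Ω o J W x g (clutchMap g _ hA)).Iso (clutchedSpinC Ω o J' W' x g
    (clutchMap g _ hA')) := by
  obtain ⟨Jt, hJt, J0, J1, cJ⟩ := exists_compatible_path hk hZ hΩ hJ hJ'
  obtain ⟨Wt, hWd⟩ : ∃ Wt : unitInterval → bFields k Z,
      ∀ t, Wt t = (1 - (t : ℝ)) • W + (t : ℝ) • W' := ⟨_, fun _ => rfl⟩
  obtain ⟨Nt, hNd⟩ : ∃ Nt : unitInterval → VField k M,
      ∀ t m, Nt t m = (1 - (t : ℝ)) • N m + (t : ℝ) • N' m :=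
    ⟨fun t => (1 - (t : ℝ)) • N + (t : ℝ) • N', fun _ _ => rfl⟩
  simp only [← hWd] at hf hs
  have hNt : ∀ t m, (Wt t).1 m = x m • Nt t m := fun t m => by
    have h1 : (Wt t).1 m = (1 - (t : ℝ)) • W.1 m + (t : ℝ) • W'.1 m := by rw [hWd]; rfl
    rw [h1, hNd, hN, hN', smul_add, smul_comm (x m), smul_comm (x m)]
  have hNtZ : ∀ t, ∀ z ∈ Z, ∂[k] x z (Nt t z) = 1 := fun t z hz => by
    rw [hNd, map_add, map_smul, map_smul, hNZ z hz, hNZ' z hz]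
    simp
  have hWt : ∀ t, ExtendsCanonical Z (Wt t) := fun t => by
    rw [hWd]; exact hW.interp hk hZ hW' t
  have cW : ∀ t m (b : ∀ m, Euc k ≃ₗ[ℝ] BTangent k Z m), FrameAt (BSmooth Z) m b →
      ContinuousAt (fun p : unitInterval × M => (b p.2).symm (bval (Wt p.1) p.2)) (t, m) := by
    intro t m b hb
    simp only [hWd, bval_interp, map_add, map_smul]
    exact continuousAt_interp (h := fun m => (b m).symm (bval W m))
      (h' := fun m => (b m).symm (bval W' m)) (hb.smooth_iff.mp (bval_smooth W m)) (hb.smooth_iff.mp (bval_smooth W' m))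
  have hw : ∀ t m, x m = 0 → bval (Wt t) m ≠ 0 := fun t m hm =>
    hZ.canonical_ne_zero hk (hWt t) ((hx.2.1 m).mpr hm)
  have hxc := hx.1.continuous
  have key : IsClutchPath Ω Jt Wt x fun t => collar Ω (Jt t) (Wt t) (Nt t) (collarCoeff x f) :=
    { symplectic := hΩ
      compatible := hJt
      ne_zero := hw
      injective := fun t => collar_injective hk hZ hΩ (hJt t) hx (hWt t) (hf t) (hNt t) (hNtZ t)
      smooth := fun t => collar_clutchSmooth hk hZ hΩ (hJt t) hx (hf t) (hNt t)
        fun z hz => hZ.canonical_ne_zero hk (hWt t) hz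
      continuous_J := cJ
      continuous_W := cW
      continuous_hom := fun t m b hb τ hτ => by
        have cN : ContinuousAt (fun p : unitInterval × M => (τ p.2).symm (Nt p.1 p.2)) (t, m) := by
          have h : ∀ p : unitInterval × M, (τ p.2).symm (Nt p.1 p.2) =
              (1 - (p.1 : ℝ)) • (τ p.2).symm (N p.2) + (p.1 : ℝ) • (τ p.2).symm (N' p.2) := fun p => by
            rw [← map_smul, ← map_smul, ← map_add, hNd]
          simp only [h]
          exact continuousAt_interp (h := fun m => (τ m).symm (N m))
            (h' := fun m => (τ m).symm (N' m)) (hτ.smooth_iff.mp (N.vSmoothNear m))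
            (hτ.smooth_iff.mp (N'.vSmoothNear m))
        have hfc : ContinuousAt f m := ((hf t).smooth m).continuousAt
        have cC := fun (h : bval (Wt t) m ≠ 0) (c : M → ℝ) (hc : ContinuousAt c m) =>
          continuousAt_collar (N := Nt) hΩ hJt hb hτ (cJ t m b hb) (cW t m b hb) cN h hc
        refine ⟨fun hm => ?_, fun hm => ?_⟩
        · rcases hs m with h | h
          · refine ContinuousAt.congr (continuousAt_comp_snd
              (h := fun m => homL (τ m) (b m) (anchor Z m))
              ((homSmooth_anchor (Z := Z) m).smAt_homL hb hτ).continuousAt) ?_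
            filter_upwards [continuousAt_snd.eventually h] with p hp
            have h0 : collarCoeff x f p.2 = 0 := by
              unfold collarCoeff
              split_ifs with h1
              · rw [hp, abs_of_nonneg h1, sub_self]
              · rw [hp, abs_of_neg (not_le.mp h1)]; ring
            rw [collar, h0, zero_smul, add_zero]
          · refine cC (h t) _ ?_
            rcases lt_or_gt_of_ne hm with h1 | h1
            · refine (hfc.add hxc.continuousAt).neg.congr ?_
              filter_upwards [hxc.continuousAt.eventually (gt_mem_nhds h1)] with m' h2
              exact (if_neg (not_le.mpr h2)).symm
            · refine (hfc.sub hxc.continuousAt).congr ?_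
              filter_upwards [hxc.continuousAt.eventually (lt_mem_nhds h1)] with m' h2
              exact (if_pos h2.le).symm
        · refine (cC (hw t m hm) (fun m => f m - x m) (hfc.sub hxc.continuousAt)).congr ?_
          have h0 : (b m).symm (bval (Wt t) m) ≠ 0 :=
            (map_ne_zero_iff _ (b m).symm.injective).mpr (hw t m hm)
          filter_upwards [(cW t m b hb).eventually_ne h0] with p hp
          unfold unfoldHom
          split_ifs with h1
          · rw [collar, collar, collarCoeff, if_pos h1]
          · have hp0 : bval (Wt p.1) p.2 ≠ 0 := fun h0 => hp (by rw [h0, map_zero])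
            rw [collar_of_neg (hJt p.1) (hf p.1) (hNt p.1) hp0 (not_le.mp h1)]
            refine congrArg _ (LinearMap.ext fun u => ?_)
            rw [LinearMap.comp_apply, LinearMap.comp_apply, bRefl_bRefl (hJt p.1) hp0] }
  have W0 : Wt 0 = W := by simp [hWd]
  have W1 : Wt 1 = W' := by simp [hWd]
  have N0 : Nt 0 = N := ContMDiffSection.ext fun m => by simp [hNd]
  have N1 : Nt 1 = N' := ContMDiffSection.ext fun m => by simp [hNd]
  have fin : ∀ {J₀ J₁ : BEnd k Z} {W₀ W₁ : bFields k Z} {N₀ N₁ : VField k M}, Jt 0 = J₀ → Jt 1 = J₁ →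
      Wt 0 = W₀ → Wt 1 = W₁ → Nt 0 = N₀ → Nt 1 = N₁ →
      ∀ (hA : ∀ m, Injective (collar Ω J₀ W₀ N₀ (collarCoeff x f) m))
        (hA' : ∀ m, Injective (collar Ω J₁ W₁ N₁ (collarCoeff x f) m)),
      (clutchedSpinC Ω o J₀ W₀ x g (clutchMap g _ hA)).Iso
        (clutchedSpinC Ω o J₁ W₁ x g (clutchMap g _ hA')) := by
    rintro _ _ _ _ _ _ rfl rfl rfl rfl rfl rfl _ _
    exact key.iso hk hZ hxc g 0 1
  exact fin J0 J1 W0 W1 N0 N1 hA hA'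

end CollarPath

section Interpolation

variable {V U : Type*} [AddCommGroup V] [Module ℝ V] [AddCommGroup U] [Module ℝ U]

/-- The interpolation between `Ψ` and `a`, where the image of `w` is interpolated separately. -/
def interpHom (Ψ a : V →ₗ[ℝ] U) (ℓ : V →ₗ[ℝ] ℝ) (w : V) (N : U) (p t : ℝ) : V →ₗ[ℝ] U :=
  ℓ.smulRight ((1 - p) • Ψ w + p • N) + ((1 - t) • Ψ + t • a) ∘ₗ (LinearMap.id - ℓ.smulRight w)

variable {Ψ a : V →ₗ[ℝ] U} {ℓ : V →ₗ[ℝ] ℝ} {w : V} {N : U} {p t : ℝ}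

theorem interpHom_apply (u : V) : interpHom Ψ a ℓ w N p t u =
    ℓ u • ((1 - p) • Ψ w + p • N) + ((1 - t) • Ψ (u - ℓ u • w) + t • a (u - ℓ u • w)) := rfl

theorem eq_zero_of_interpHom (hℓ : ℓ w = 1) {ξ f : ℝ} (ha : a w = ξ • N) (hf : 0 < f)
    (ht : t ∈ Set.Icc (0 : ℝ) 1) (hL : ∀ p ∈ Set.Icc (0 : ℝ) 1, p * (1 - t) ≤ f →
      Injective (interpHom Ψ a ℓ w N p t)) {u : V}
    (hu : (1 - t) • Ψ u + t • (a u + ((f - ξ) * ℓ u) • N) = 0) : u = 0 := by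
  have h1t := sub_nonneg.mpr ht.2
  have htf := mul_nonneg ht.1 hf.le
  have hμ : 0 < (1 - t) + t * f := by
    rcases ht.1.eq_or_lt with h | h
    · rw [← h]; norm_num
    · exact add_pos_of_nonneg_of_pos h1t (mul_pos h hf)
  set μ := (1 - t) + t * f
  have hp1 : t * f / μ ≤ 1 := (div_le_one hμ).mpr (le_add_of_nonneg_left h1t)
  have h1 := hL (t * f / μ) ⟨div_nonneg htf hμ.le, hp1⟩ (by
    rw [div_mul_eq_mul_div, div_le_iff₀ hμ]
    have : t * f * (1 - t) ≤ f * (1 - t) :=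
      mul_le_mul_of_nonneg_right (mul_le_of_le_one_left hf.le ht.2) h1t
    exact this.trans (mul_le_mul_of_nonneg_left (le_add_of_nonneg_right htf) hf.le))
  have h2 : interpHom Ψ a ℓ w N (t * f / μ) t (u - ℓ u • w + (μ * ℓ u) • w) =
      (1 - t) • Ψ u + t • (a u + ((f - ξ) * ℓ u) • N) := by
    have h3 : ℓ (u - ℓ u • w + (μ * ℓ u) • w) = μ * ℓ u := by
      rw [map_add, map_sub, map_smul, map_smul, hℓ]; simp
    rw [interpHom_apply, h3, add_sub_cancel_right, map_sub, map_sub, map_smul, map_smul, ha]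
    have h4 : μ * (1 - t * f / μ) = 1 - t := by
      rw [mul_sub, mul_div_cancel₀ _ hμ.ne', mul_one]; exact add_sub_cancel_right _ _
    have h5 : μ * (t * f / μ) = t * f := mul_div_cancel₀ _ hμ.ne'
    have h6 : (μ * ℓ u) • ((1 - t * f / μ) • Ψ w + (t * f / μ) • N) =
        (ℓ u * (1 - t)) • Ψ w + (ℓ u * (t * f)) • N := by
      rw [smul_add, smul_smul, smul_smul, mul_comm μ, mul_assoc, mul_assoc, h4, h5]
    rw [h6]
    module
  rw [hu, ← map_zero (interpHom Ψ a ℓ w N (t * f / μ) t)] at h2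
  have h3 := h1 h2
  have h4 : ℓ u = 0 := by
    have := congrArg ℓ h3
    rw [map_add, map_sub, map_smul, map_smul, hℓ, map_zero, smul_eq_mul, mul_one, sub_self, zero_add,
      smul_eq_mul, mul_one] at this
    exact (mul_eq_zero.mp this).resolve_left hμ.ne'
  simpa [h4] using h3

theorem interpHom_injective (hℓ : ℓ w = 1) (ha : a w = 0) {d : U →ₗ[ℝ] ℝ} (hd : ∀ u, d (a u) = 0)
    (hdN : d N = 1) (hdΨ : 0 < d (Ψ w)) (hker : ∀ u, a u = 0 → ∃ c : ℝ, u = c • w)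
    (hdef : ∀ s : ℝ, 0 ≤ s → Injective (Ψ + s • a)) (hp : p ∈ Set.Icc (0 : ℝ) 1)
    (ht : t ∈ Set.Icc (0 : ℝ) 1) (h : p * (1 - t) = 0) :
    Injective (interpHom Ψ a ℓ w N p t) := by
  rw [injective_iff_map_eq_zero]
  intro u hu
  rw [interpHom_apply] at hu
  have hv : ℓ (u - ℓ u • w) = 0 := by rw [map_sub, map_smul, hℓ]; simp
  set v := u - ℓ u • w with hvd
  suffices hs : ℓ u = 0 ∧ v = 0 by
    rw [hvd, hs.1, zero_smul, sub_zero] at hs; exact hs.2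
  rcases ht.2.eq_or_lt with rfl | h1
  · rw [sub_self, zero_smul, zero_add, one_smul] at hu
    have h2 := congrArg d hu
    rw [map_add, map_smul, map_add, map_smul, map_smul, hd, hdN, map_zero, add_zero, smul_eq_mul,
      smul_eq_mul, smul_eq_mul, mul_one] at h2
    have h3 : 0 < (1 - p) * d (Ψ w) + p := by
      rcases hp.1.eq_or_lt with h | h
      · rw [← h]; simpa using hdΨ
      · exact add_pos_of_nonneg_of_pos (mul_nonneg (sub_nonneg.mpr hp.2) hdΨ.le) h
    have h4 := (mul_eq_zero.mp h2).resolve_right h3.ne'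
    rw [h4, zero_smul, zero_add] at hu
    obtain ⟨c, hc⟩ := hker v hu
    rw [hc, map_smul, hℓ, smul_eq_mul, mul_one] at hv
    exact ⟨h4, by rw [hc, hv, zero_smul]⟩
  · have h1t : 0 < 1 - t := sub_pos.mpr h1
    have hp0 := (mul_eq_zero.mp h).resolve_right h1t.ne'
    rw [hp0, sub_zero, one_smul, zero_smul, add_zero] at hu
    have h2 : (Ψ + (t / (1 - t)) • a) (v + (ℓ u / (1 - t)) • w) = 0 := by
      have h3 : (1 - t) • (Ψ + (t / (1 - t)) • a) (v + (ℓ u / (1 - t)) • w) = 0 := by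
        rw [LinearMap.add_apply, LinearMap.smul_apply, map_add, map_add, map_smul, map_smul, ha,
          smul_zero, add_zero, smul_add, smul_add, smul_smul, smul_smul, mul_div_cancel₀ _ h1t.ne',
          mul_div_cancel₀ _ h1t.ne', ← hu]
        abel
      exact (smul_eq_zero.mp h3).resolve_left h1t.ne'
    have h3 := (injective_iff_map_eq_zero _).mp (hdef _ (div_nonneg ht.1 h1t.le)) _ h2
    have h4 := congrArg ℓ h3
    rw [map_add, hv, map_smul, hℓ, map_zero, zero_add, smul_eq_mul, mul_one] at h4
    rw [h4, zero_smul, add_zero] at h3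
    exact ⟨(div_eq_zero_iff.mp h4).resolve_right h1t.ne', h3⟩

theorem exists_pos_of_eventually {X : Type*} [TopologicalSpace X] [CompactSpace X] {h : X → ℝ}
    (hc : Continuous h) (h0 : ∀ q, 0 ≤ h q) {G : X → Prop}
    (hG : ∀ q, h q = 0 → ∀ᶠ q' in 𝓝 q, G q') : ∃ η : ℝ, 0 < η ∧ ∀ q, h q ≤ η → G q := by
  have hS : IsCompact {q | ¬ ∀ᶠ q' in 𝓝 q, G q'} :=
    (isOpen_setOf_eventually_nhds.isClosed_compl).isCompact
  rcases Set.eq_empty_or_nonempty {q | ¬ ∀ᶠ q' in 𝓝 q, G q'} with he | he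
  · exact ⟨1, one_pos, fun q _ => by
      by_contra hq
      exact (he ▸ (show q ∈ {q | ¬ ∀ᶠ q' in 𝓝 q, G q'} from fun h => hq h.self_of_nhds) :
        q ∈ (∅ : Set X))⟩
  · obtain ⟨q₀, h1, h2⟩ := hS.exists_isMinOn he hc.continuousOn
    have h3 : 0 < h q₀ := (h0 q₀).lt_of_ne fun h => h1 (hG q₀ h.symm)
    refine ⟨h q₀ / 2, half_pos h3, fun q hq => ?_⟩
    by_contra h4
    have h5 : h q₀ ≤ h q := h2 (show ¬ ∀ᶠ q' in 𝓝 q, G q' from fun h => h4 h.self_of_nhds)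
    linarith

end Interpolation

include hk hZ hΩ hJ in
theorem IsFrameClutching.exists_hom (hw : ∀ m, x m = 0 → bval W m ≠ 0)
    (hφ : IsFrameClutching Ω J W x g φ) : ∃ (Φ : ∀ m, BTangent k Z m →ₗ[ℝ] T[k] m)
    (hΦ : ∀ m, Injective (Φ m)), ClutchSmooth Ω J W x Φ ∧ φ = clutchMap g Φ hΦ ∧
    (∀ m (s : ℝ), 0 ≤ s → Injective (Φ m + s • anchor (k := k) Z m)) ∧
      ∀ z ∈ Z, 0 < ∂[k] x z (Φ z (bval W z)) := by
  let b : ∀ m, OFrame k (bTangentEuc Ω J) m := fun m => ((exists_uFrame hk hZ hΩ hJ m).choose m).1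
  let Φ : ∀ m, BTangent k Z m →ₗ[ℝ] T[k] m := fun m =>
    (φ m (b m)).toT.toLinearMap ∘ₗ (b m).toB.symm.toLinearMap
  have hΦ : ∀ m (p : OFrame k (bTangentEuc Ω J) m) v, Φ m (p.toB v) = (φ m p).toT v := fun m p v => by
    have h : φ m p = (φ m (b m)).act ((b m).diff p) :=
      (congrArg (φ m) (OFrame.act_diff (b m) p).symm).trans (hφ.map_act m _ _)
    exact (congrArg (fun q : OFrame k (tangentEuc g) m => q.toT v) h).symm
  have hinj : ∀ m, Injective (Φ m) := fun m =>
    (φ m (b m)).toT.injective.comp (b m).toB.symm.injective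
  have hsm : ∀ {σ : ∀ m, OFrame k (bTangentEuc Ω J) m} {p : ∀ m, OFrame k (bTangentEuc Ω J) m} {m : M},
      FrameAt (BSmooth Z) m (fun m' => (p m').toB) →
      (frameBundle k (tangentEuc g)).smooth (fun m' => φ m' (σ m')) m →
      HomSmooth (fun m' => (φ m' (σ m')).toT.toLinearMap ∘ₗ (p m').toB.symm.toLinearMap) m :=
    fun hp hσ s hs =>
      ((tangentEuc_isSmooth g).smooth_iff_frameAt.mp hσ).smooth (hp.smooth_iff.mp hs)
  refine ⟨Φ, hinj, fun m => ?_, ?_, fun m s hs => ?_, fun z hz => hφ.inward z hz (b z)⟩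
  · obtain ⟨p, hp⟩ := exists_uFrame hk hZ hΩ hJ m
    have hps : (frameBundle k (bTangentEuc Ω J)).smooth (fun m' => (p m').1) m :=
      fun v => hp.smooth (.const v m)
    refine ⟨fun hm => ?_, fun hm => ?_⟩
    · refine (hsm (p := fun m' => (p m').1) hp
        (hφ.map_smooth _ m ⟨fun _ => hps, fun h => absurd h hm⟩)).congr (.of_forall fun m' => ?_)
      refine LinearMap.ext fun u => ?_
      rw [← (p m').1.toB.apply_symm_apply u, hΦ]
      exact congrArg (φ m' (p m').1).toT ((p m').1.toB.symm_apply_apply _).symm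
    · classical
      let σ : ∀ m, OFrame k (bTangentEuc Ω J) m := fun m' =>
        if 0 ≤ x m' then (p m').1 else reflGauge (V := bTangentEuc Ω J) (bval W) m' (p m').1
      refine ⟨_, hsm (σ := σ) (p := fun m' => (p m').1) hp (hφ.map_smooth _ m
        ⟨fun h => absurd hm h, fun _ => ⟨_, hps, .of_forall fun m' =>
          ⟨fun h => if_pos h, fun h => if_neg (not_le.mpr h)⟩⟩⟩), ?_⟩
      filter_upwards [eventually_bval_ne_zero hk hZ (hw m hm)] with m' hw'
      refine ⟨fun h => LinearMap.ext fun u => ?_, fun h => LinearMap.ext fun u => ?_⟩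
      · rw [← (p m').1.toB.apply_symm_apply u, hΦ]
        simp only [σ, if_pos h]
        exact congrArg (φ m' (p m').1).toT ((p m').1.toB.symm_apply_apply _).symm
      · obtain ⟨v, hv⟩ := (p m').1.toB.surjective (bRefl Ω J W m' u)
        have h1 : u = (reflGauge (V := bTangentEuc Ω J) (bval W) m' (p m').1).toB v := by
          rw [reflGauge_apply hw', hv, bRefl_bRefl hJ hw']
        have h2 : (p m').1.toB.symm (bRefl Ω J W m' u) = v := by
          rw [← hv, LinearEquiv.symm_apply_apply]
        have h3 := congrArg (φ m') (show σ m' = _ from if_neg (not_le.mpr h))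
        exact ((congrArg (Φ m') h1).trans (hΦ m' _ v)).trans
          (congrArg₂ (fun (q : OFrame k (tangentEuc g) m') w => q.toT w) h3 h2).symm
  · funext m p
    refine Subtype.ext ?_
    have h1 : homFrame (Φ m) (hinj m) p.toB = (φ m p).toT := LinearEquiv.ext (hΦ m p)
    exact ((congrArg (orthE (metricForm g m)) h1).trans
      (orthE_of_gram (gram_eq_one_iff.mpr (φ m p).2))).symm
  · intro u v huv
    have h1 : ∀ u, tangentFrame (φ m (b m)) ((b m).toB.symm u) +
        s • anchor Z m ((b m).toB ((b m).toB.symm u)) = (Φ m + s • anchor (k := k) Z m) u := fun u => by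
      rw [apply_symm_apply]; rfl
    exact (b m).toB.symm.injective (hφ.deformation m (b m) s hs ((h1 u).trans (huv.trans (h1 v).symm)))

include hJ in
theorem ClutchSmooth.continuousAt {A : ∀ m, BTangent k Z m →ₗ[ℝ] T[k] m} (hk : 1 ≤ k)
    (hZ : IsHypersurface k Z) (hw : ∀ m, x m = 0 → bval W m ≠ 0) (hA : ClutchSmooth Ω J W x A)
    (hb : FrameAt (BSmooth Z) m b) (hτ : FrameAt VSmoothNear m τ) :
    (x m ≠ 0 → SmAt k (fun m' => homL (τ m') (b m') (A m')) m) ∧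
    (x m = 0 → SmAt k (fun m' => homL (τ m') (b m') (unfoldHom Ω J W x A m')) m) := by
  refine ⟨fun hm => ((hA m).1 hm).smAt_homL hb hτ, fun hm => ?_⟩
  obtain ⟨A', h1, h2⟩ := (hA m).2 hm
  refine (h1.smAt_homL hb hτ).congr ?_
  filter_upwards [h2, eventually_bval_ne_zero hk hZ (hw m hm)] with m' h3 h4
  unfold unfoldHom
  split_ifs with h
  · rw [h3.1 h]
  · rw [h3.2 (not_le.mp h)]
    refine congrArg _ (LinearMap.ext fun u => ?_)
    rw [LinearMap.comp_apply, LinearMap.comp_apply, bRefl_bRefl hJ h4]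

def clutchInterp (Ω : BForm k Z) (J : BEnd k Z) (W : bFields k Z) (N : VField k M)
    (Ψ : ∀ m, BTangent k Z m →ₗ[ℝ] T[k] m)
    (q : (unitInterval × unitInterval) × M) :
    BTangent k Z q.2 →ₗ[ℝ] T[k] q.2 :=
  interpHom (Ψ q.2) (anchor Z q.2) (dualForm Ω J W q.2) (bval W q.2) (N q.2) q.1.1 q.1.2

include hk hZ hΩ hJ in
theorem eventually_interpHom_injective {Ψ : ∀ m, BTangent k Z m →ₗ[ℝ] T[k] m}
    {q : (unitInterval × unitInterval) × M} (hb : FrameAt (BSmooth Z) q.2 b)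
    (hτ : FrameAt VSmoothNear q.2 τ) (hΨ : SmAt k (fun m' => homL (τ m') (b m') (Ψ m')) q.2)
    (hw : bval W q.2 ≠ 0) (hq : Injective (clutchInterp Ω J W N Ψ q)) : ∀ᶠ q' in 𝓝 q, Injective
    (clutchInterp Ω J W N Ψ q') := by
  obtain ⟨q₁, m⟩ := q
  let K : (unitInterval × unitInterval) × M → E[k] := fun q => homL (τ q.2) (b q.2)
    (clutchInterp Ω J W N Ψ q)
  have cw := continuousAt_comp_snd (t := q₁) (h := fun m => (b m).symm (bval W m))
    (hb.smooth_iff.mp (bval_smooth W m)).continuousAt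
  have cN := continuousAt_comp_snd (t := q₁) (h := fun m => (τ m).symm (N m))
    (hτ.smooth_iff.mp (N.vSmoothNear m)).continuousAt
  have cΨ := continuousAt_comp_snd (t := q₁) (h := fun m => homL (τ m) (b m) (Ψ m)) hΨ.continuousAt
  have ca := continuousAt_comp_snd (t := q₁) (h := fun m => homL (τ m) (b m) (anchor Z m))
    ((homSmooth_anchor (Z := Z) m).smAt_homL hb hτ).continuousAt
  have cℓ := fun v => continuousAt_dualForm (T := unitInterval × unitInterval) (t₀ := q₁)
    (J := fun _ => J) (W := fun _ => W) hΩ (fun _ => hJ) hb (continuousAt_comp_snd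
      (h := fun m => homL (b m) (b m) (J m)) (hJ.smAt_homL hb).continuousAt) cw hw v
  have cp : Continuous fun q : (unitInterval × unitInterval) × M => (q.1.1 : ℝ) :=
    continuous_subtype_val.comp (continuous_fst.comp continuous_fst)
  have ct : Continuous fun q : (unitInterval × unitInterval) × M => (q.1.2 : ℝ) :=
    continuous_subtype_val.comp (continuous_snd.comp continuous_fst)
  have hK : ContinuousAt K (q₁, m) := by
    rw [continuousAt_clm_apply]
    intro v
    have h1 : ∀ q, K q v = dualForm Ω J W q.2 (b q.2 v) •
        ((1 - (q.1.1 : ℝ)) • homL (τ q.2) (b q.2) (Ψ q.2) ((b q.2).symm (bval W q.2)) +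
          (q.1.1 : ℝ) • (τ q.2).symm (N q.2)) + ((1 - (q.1.2 : ℝ)) • homL (τ q.2) (b q.2) (Ψ q.2)
            (v - dualForm Ω J W q.2 (b q.2 v) • (b q.2).symm (bval W q.2)) +
          (q.1.2 : ℝ) • homL (τ q.2) (b q.2) (anchor Z q.2)
            (v - dualForm Ω J W q.2 (b q.2 v) • (b q.2).symm (bval W q.2))) := fun q => by
      have h2 : b q.2 (v - dualForm Ω J W q.2 (b q.2 v) • (b q.2).symm (bval W q.2)) =
          b q.2 v - dualForm Ω J W q.2 (b q.2 v) • bval W q.2 := by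
        rw [map_sub, map_smul, apply_symm_apply]
      have h3 : K q v = (τ q.2).symm (clutchInterp Ω J W N Ψ q (b q.2 v)) := rfl
      rw [h3, clutchInterp, interpHom_apply]
      simp only [homL_apply, h2, apply_symm_apply, map_add, map_smul]
    simp only [h1]
    have cv := (continuousAt_const (y := v)).sub ((cℓ v).smul cw)
    exact ((cℓ v).smul (((continuousAt_const.sub cp.continuousAt).smul (cΨ.clm_apply cw)).add
      (cp.continuousAt.smul cN))).add (((continuousAt_const.sub ct.continuousAt).smul
        (cΨ.clm_apply cv)).add (ct.continuousAt.smul (ca.clm_apply cv)))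
  have h1 : IsUnit (K (q₁, m)) := isUnit_of_injective
    ((τ m).symm.injective.comp (hq.comp (b m).injective))
  filter_upwards [hK.eventually (Units.isOpen.mem_nhds h1)] with q' hq₁
  obtain ⟨⟨_, K', _, h2⟩, hq'⟩ := hq₁
  have h3 : Function.LeftInverse K' (K q') := fun v => by
    rw [← clm_mul_apply, ← hq']; exact congrArg (fun T : E[k] => T v) h2
  intro u u' huu
  refine (b q'.2).symm.injective (h3.injective ?_)
  change (τ q'.2).symm (clutchInterp Ω J W N Ψ q' (b q'.2 _)) =
    (τ q'.2).symm (clutchInterp Ω J W N Ψ q' (b q'.2 _))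
  rw [apply_symm_apply, apply_symm_apply, huu]

section Independence

variable {x' : M → ℝ}

theorem homL_comb {V U : Type*} [AddCommGroup V] [Module ℝ V] [AddCommGroup U] [Module ℝ U]
    (τ : Euc k ≃ₗ[ℝ] U) (b : Euc k ≃ₗ[ℝ] V) (P Q : V →ₗ[ℝ] U) (c d : ℝ) :
    homL τ b (c • P + d • Q) = c • homL τ b P + d • homL τ b Q :=
  ContinuousLinearMap.ext fun v => by
    simp only [homL_apply, ContinuousLinearMap.add_apply, ContinuousLinearMap.smul_apply,
      LinearMap.add_apply, LinearMap.smul_apply, map_add, map_smul]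

theorem unfoldHom_comb (A B : ∀ m, BTangent k Z m →ₗ[ℝ] T[k] m) (c d : ℝ) (m : M) :
    unfoldHom Ω J W x (fun m => c • A m + d • B m) m =
      c • unfoldHom Ω J W x A m + d • unfoldHom Ω J W x B m := by
  unfold unfoldHom
  split_ifs
  · rfl
  · rw [LinearMap.add_comp, LinearMap.smul_comp, LinearMap.smul_comp]

theorem injective_interp {V U : Type*} [AddCommGroup V] [Module ℝ V] [AddCommGroup U] [Module ℝ U]
    {Ψ a : V →ₗ[ℝ] U} (hΨ : ∀ s : ℝ, 0 ≤ s → Injective (Ψ + s • a))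
    (ha : Injective a) {t : ℝ} (ht : t ∈ Set.Icc (0 : ℝ) 1) :
    Injective ((1 - t) • Ψ + t • a) := by
  rcases ht.2.eq_or_lt with rfl | h1
  · simpa using ha
  · have h : 0 < 1 - t := sub_pos.mpr h1
    have h2 : (1 - t) • Ψ + t • a = (1 - t) • (Ψ + (t / (1 - t)) • a) := by
      rw [smul_add, smul_smul, mul_div_cancel₀ _ h.ne']
    rw [h2]
    exact (smul_right_injective U h.ne').comp (hΨ _ (div_nonneg ht.1 h.le))

theorem collarCoeff_eq_zero (h : f m = |x m|) : collarCoeff x f m = 0 := by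
  unfold collarCoeff
  split_ifs with h1
  · rw [h, abs_of_nonneg h1, sub_self]
  · rw [h, abs_of_neg (not_le.mp h1)]; ring

include hZ in
theorem IsClutchingChoice.of_defining (h : IsClutchingChoice Ω o J W x g φ)
    (hx' : IsOrientedDefining Ω o x') : IsClutchingChoice Ω o J W x' g φ ∧
    (clutchedSpinC Ω o J W x g φ).Iso (clutchedSpinC Ω o J W x' g φ) := by
  obtain ⟨hx, hs⟩ := h.defining
  have e0 : ∀ m, x' m = 0 ↔ x m = 0 := fun m => (hx'.1.2.1 m).symm.trans (hx.2.1 m)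
  have e1 : ∀ m ∉ Z, (0 < x m ↔ 0 < x' m) := fun m hm => (hs m hm).trans (hx'.2 m hm).symm
  have e2 : ∀ m, 0 ≤ x' m ↔ 0 ≤ x m := fun m => by
    by_cases hm : m ∈ Z
    · rw [(hx.2.1 m).mp hm, (hx'.1.2.1 m).mp hm]
    · have := e1 m hm
      rw [le_iff_lt_or_eq, le_iff_lt_or_eq, this, eq_comm, e0, eq_comm (b := x m)]
  have e3 : ∀ m, x' m < 0 ↔ x m < 0 := fun m => by rw [← not_le, ← not_le, e2]
  have hsu : ∀ {G : Type} (P : BundleData.{u, u} G M) γ (σ : ∀ m, P.Fib m) m,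
      (P.surgery x γ).smooth σ m ↔ (P.surgery x' γ).smooth σ m := fun P γ σ m => by
    simp only [BundleData.surgery, ne_eq, e0, e2, e3]
  refine ⟨⟨hx', h.compatible, h.canonical, ⟨h.clutching.map_act, fun σ m hσ =>
    h.clutching.map_smooth σ m ((hsu (frameBundle k (bTangentEuc Ω J)) _ σ m).mpr hσ), h.clutching.deformation, fun z hz p => ?_⟩⟩,
    rfl, fun m => Equiv.refl _, fun _ _ _ => rfl, fun σ m => hsu (acBundle Ω J) _ σ m, fun m p => ?_,
    fun _ _ => rfl⟩
  · obtain ⟨c, -, hc, -, h1⟩ := IsLocalDefining.exists_pos_mul hz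
      (⟨SmAt.of_contMDiff hx.1 z, .of_forall hx.2.1, hx.2.2 z hz⟩)
      (⟨SmAt.of_contMDiff hx'.1.1 z, .of_forall hx'.1.2.1, hx'.1.2.2 z hz⟩) (.of_forall e1)
    rw [h1]
    exact mul_pos hc (h.clutching.inward z hz p)
  · change surgeryGrading x' (acSpinC Ω J).grad m p = surgeryGrading x (acSpinC Ω J).grad m p
    simp only [surgeryGrading, e2]

include hk hZ hΩ

include hJ in
theorem ClutchSmooth.iso (hw : ∀ m, x m = 0 → bval W m ≠ 0) (hx : Continuous x)
    {B B' : ∀ m, BTangent k Z m →ₗ[ℝ] T[k] m} (hB : ClutchSmooth Ω J W x B)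
    (hB' : ClutchSmooth Ω J W x B') (h : ∀ (t : unitInterval) m, Injective
    ((1 - (t : ℝ)) • B m + (t : ℝ) • B' m)) (hi : ∀ m, Injective (B m))
    (hi' : ∀ m, Injective (B' m)) : (clutchedSpinC Ω o J W x g (clutchMap g B hi)).Iso
    (clutchedSpinC Ω o J W x g (clutchMap g B' hi')) := by
  have key : IsClutchPath Ω (fun _ : unitInterval => J) (fun _ => W) x
      fun t m => (1 - (t : ℝ)) • B m + (t : ℝ) • B' m :=
    { symplectic := hΩ
      compatible := fun _ => hJ
      ne_zero := fun _ => hw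
      injective := h
      smooth := fun t => hB.comb hB' _ _
      continuous_J := fun t m b hb => continuousAt_comp_snd (h := fun m => homL (b m) (b m) (J m))
        (hJ.smAt_homL hb).continuousAt
      continuous_W := fun t m b hb => continuousAt_comp_snd (h := fun m => (b m).symm (bval W m))
        (hb.smooth_iff.mp (bval_smooth W m)).continuousAt
      continuous_hom := fun t m b hb τ hτ => by
        have h1 := hB.continuousAt hJ hk hZ hw hb hτ
        have h2 := hB'.continuousAt hJ hk hZ hw hb hτ
        exact ⟨fun hm => (continuousAt_interp (h := fun m => homL (τ m) (b m) (B m)) (h' := fun m =>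
            homL (τ m) (b m) (B' m)) (h1.1 hm) (h2.1 hm)).congr
            (.of_forall fun p => (homL_comb _ _ _ _ _ _).symm),
          fun hm => (continuousAt_interp (h := fun m => homL (τ m) (b m) (unfoldHom Ω J W x B m))
            (h' := fun m => homL (τ m) (b m) (unfoldHom Ω J W x B' m)) (h1.2 hm) (h2.2 hm)).congr
            (.of_forall fun p => (homL_comb _ _ _ _ _ _).symm.trans
              (congrArg (homL (τ p.2) (b p.2)) (unfoldHom_comb B B' _ _ p.2).symm))⟩ }
  have fin : ∀ {A A' : ∀ m, BTangent k Z m →ₗ[ℝ] T[k] m},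
      (∀ m, (1 - ((0 : unitInterval) : ℝ)) • B m + ((0 : unitInterval) : ℝ) • B' m = A m) →
      (∀ m, (1 - ((1 : unitInterval) : ℝ)) • B m + ((1 : unitInterval) : ℝ) • B' m = A' m) →
      ∀ (hA : ∀ m, Injective (A m)) (hA' : ∀ m, Injective (A' m)),
      (clutchedSpinC Ω o J W x g (clutchMap g _ hA)).Iso
        (clutchedSpinC Ω o J W x g (clutchMap g _ hA')) := by
    intro A A' h0 h1
    obtain rfl := funext h0
    obtain rfl := funext h1
    exact fun _ _ => key.iso hk hZ hx g 0 1
  exact fin (fun m => by simp) (fun m => by simp) hi hi'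

include hJ in
theorem IsFrameClutching.iso_collar (hx : IsGlobalDefining k Z x) (hW : ExtendsCanonical Z W)
    (hN : ∀ m, W.1 m = x m • N m) (hNZ : ∀ z ∈ Z, ∂[k] x z (N z) = 1)
    (hφ : IsFrameClutching Ω J W x g φ) : ∃ η : ℝ, 0 < η ∧ ∀ f, IsCollar x f W →
    (∀ m, (∀ᶠ m' in 𝓝 m, f m' = |x m'|) ∨ (bval W m ≠ 0 ∧ f m ≤ η)) → ∀ hA : ∀ m, Injective
    (collar Ω J W N (collarCoeff x f) m), (clutchedSpinC Ω o J W x g φ).Iso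
    (clutchedSpinC Ω o J W x g (clutchMap g _ hA)) := by
  have hw : ∀ m, x m = 0 → bval W m ≠ 0 := fun m hm =>
    hZ.canonical_ne_zero hk hW ((hx.2.1 m).mpr hm)
  have hxc := hx.1.continuous
  obtain ⟨Φ, hΦ, hsm, rfl, hdef, hin⟩ := hφ.exists_hom hk hZ hΩ hJ hw
  obtain ⟨η, hη, hG⟩ := exists_pos_of_eventually
    (X := (unitInterval × unitInterval) × M) (h := fun q => (q.1.1 : ℝ) * (1 - (q.1.2 : ℝ)) + |x q.2|)
    (G := fun q => Injective (clutchInterp Ω J W N (unfoldHom Ω J W x Φ) q))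
    (by fun_prop) (fun q => add_nonneg (mul_nonneg q.1.1.2.1 (sub_nonneg.mpr q.1.2.2.2)) (abs_nonneg _))
    fun q hq => by
      obtain ⟨h1, h2⟩ := (add_eq_zero_iff_of_nonneg (mul_nonneg q.1.1.2.1 (sub_nonneg.mpr q.1.2.2.2))
        (abs_nonneg _)).mp hq
      rw [abs_eq_zero] at h2
      have hz := (hx.2.1 q.2).mpr h2
      obtain ⟨b, hb⟩ := exists_bTangent_frame hk hZ q.2
      obtain ⟨τ, hτ⟩ := (tangentEuc_isSmooth g).exists_frame q.2
      refine eventually_interpHom_injective hk hZ hΩ hJ hb hτ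
        ((hsm.continuousAt hJ hk hZ hw hb hτ).2 h2) (hw _ h2) ?_
      have h3 : unfoldHom Ω J W x Φ q.2 = Φ q.2 := if_pos h2.ge
      rw [clutchInterp, h3]
      exact interpHom_injective (d := (∂[k] x q.2).toLinearMap)
        (dualForm_self hJ (hw _ h2)) (by rw [anchor_bval, hN, h2, zero_smul])
        (mvfderiv_anchor hx hz) (hNZ _ hz) (hin _ hz) (fun u hu => anchor_eq_zero hk hZ hW hz hu)
        (hdef _) q.1.1.2 q.1.2.2 h1
  refine ⟨η / 2, half_pos hη, fun f hf hs hA => ?_⟩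
  have hC := collar_clutchSmooth hk hZ hΩ hJ hx hf hN fun z hz => hZ.canonical_ne_zero hk hW hz
  have hinj : ∀ (t : unitInterval) m, Injective
      ((1 - (t : ℝ)) • Φ m + (t : ℝ) • collar Ω J W N (collarCoeff x f) m) := by
    intro t m
    rcases hs m with h | ⟨hwm, hfm⟩
    · have h0 := h.self_of_nhds
      rw [collar, collarCoeff_eq_zero h0, zero_smul, add_zero]
      refine injective_interp (hdef m) (anchor_injective hk hZ fun hm => ?_) t.2
      rw [(hx.2.1 m).mp hm, abs_zero] at h0
      exact (hf.pos m).ne' h0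
    · rw [injective_iff_map_eq_zero]
      have hL : ∀ p ∈ Set.Icc (0 : ℝ) 1, p * (1 - (t : ℝ)) ≤ f m → Injective
          (interpHom (unfoldHom Ω J W x Φ m) (anchor Z m) (dualForm Ω J W m) (bval W m) (N m) p t) :=
        fun p hp h => hG ((⟨p, hp⟩, t), m) (by
          have := hf.abs_le m
          change p * (1 - (t : ℝ)) + |x m| ≤ η
          linarith)
      have key := @eq_zero_of_interpHom _ _ _ _ _ _ (unfoldHom Ω J W x Φ m) (anchor Z m)
        (dualForm Ω J W m) (bval W m) (N m) t (dualForm_self hJ hwm) (x m) (f m)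
        (by rw [anchor_bval, hN]) (hf.pos m) t.2 hL
      intro u hu
      rw [LinearMap.add_apply, LinearMap.smul_apply, LinearMap.smul_apply] at hu
      rcases le_or_gt 0 (x m) with h | h
      · have h3 : unfoldHom Ω J W x Φ m = Φ m := if_pos h
        rw [collar_apply, collarCoeff, if_pos h, ← h3] at hu
        exact key hu
      · have h3 : Φ m u = unfoldHom Ω J W x Φ m (bRefl Ω J W m u) := by
          rw [unfoldHom, if_neg (not_le.mpr h), LinearMap.comp_apply, bRefl_bRefl hJ hwm]
        rw [collar_of_neg hJ hf hN hwm h, h3, LinearMap.comp_apply, collar_apply] at hu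
        rw [← bRefl_bRefl hJ hwm u, key hu, map_zero]
  exact hsm.iso hk hZ hΩ hJ hw hxc hC hinj hΦ hA

theorem clutchedSpinC_iso_of_choices (h : IsClutchingChoice Ω o J W x g φ)
    (h' : IsClutchingChoice Ω o J' W' x' g φ') :
    (clutchedSpinC Ω o J W x g φ).Iso (clutchedSpinC Ω o J' W' x' g φ') := by
  obtain ⟨h₁, hi⟩ := h'.of_defining hZ h.defining
  refine SpinCData.Iso.trans ?_ hi.symm
  have hx := h.defining.1
  have hW := h.canonical
  have hW' := h₁.canonical
  obtain ⟨N, hN, hNZ⟩ := exists_transverse hk hZ hx hW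
  obtain ⟨N', hN', hNZ'⟩ := exists_transverse hk hZ hx hW'
  obtain ⟨η, hη, hi⟩ := h.clutching.iso_collar (o := o) hk hZ hΩ h.compatible hx hW hN hNZ
  obtain ⟨η', hη', hi'⟩ := h₁.clutching.iso_collar (o := o) hk hZ hΩ h₁.compatible hx hW' hN' hNZ'
  obtain ⟨f, hf1, hf2, hf3, hf4⟩ := exists_collar_function hZ hx
    (U := fun m => ∀ t : unitInterval, bval ((1 - (t : ℝ)) • W + (t : ℝ) • W') m ≠ 0) (fun z hz => by
      obtain ⟨b, hb⟩ := exists_bTangent_frame hk hZ z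
      refine (isCompact_univ.eventually_forall_of_forall_eventually
        (P := fun m (t : unitInterval) => bval ((1 - (t : ℝ)) • W + (t : ℝ) • W') m ≠ 0)
        fun t _ => ?_).mono fun m hm t => hm t (Set.mem_univ t)
      have hc : ContinuousAt (fun p : unitInterval × M => (b p.2).symm
          (bval ((1 - (p.1 : ℝ)) • W + (p.1 : ℝ) • W') p.2)) (t, z) := by
        simp only [bval_interp, map_add, map_smul]
        exact continuousAt_interp (h := fun m => (b m).symm (bval W m))
          (h' := fun m => (b m).symm (bval W' m)) (hb.smooth_iff.mp (bval_smooth W z))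
          (hb.smooth_iff.mp (bval_smooth W' z))
      have h0 := hc.eventually_ne (y := 0) ((map_ne_zero_iff _ (b z).symm.injective).mpr
        (hZ.canonical_ne_zero hk (hW.interp hk hZ hW' t) hz))
      exact ((continuous_swap.tendsto (z, t)).eventually h0).mono fun p hp h => hp (by
        exact (congrArg (b p.1).symm h).trans (map_zero _))) (lt_min hη hη')
  have hf : ∀ t : unitInterval, IsCollar x f ((1 - (t : ℝ)) • W + (t : ℝ) • W') := fun t =>
    ⟨hf1, hf2, hf3, fun m => (hf4 m).imp_right fun h => h.1 t⟩
  have hs := fun m => (hf4 m).imp_right And.left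
  have e0 : (1 - ((0 : unitInterval) : ℝ)) • W + ((0 : unitInterval) : ℝ) • W' = W := by simp
  have e1 : (1 - ((1 : unitInterval) : ℝ)) • W + ((1 : unitInterval) : ℝ) • W' = W' := by simp
  have f0 := e0 ▸ hf 0
  have f1 := e1 ▸ hf 1
  have hA := collar_injective hk hZ hΩ h.compatible hx hW f0 hN hNZ
  have hA' := collar_injective hk hZ hΩ h₁.compatible hx hW' f1 hN' hNZ'
  refine (hi f f0 (fun m => (hf4 m).imp_right fun h => ⟨?_, h.2.trans (min_le_left _ _)⟩) hA).trans
    ((collar_iso hk hZ hΩ hx h.compatible h₁.compatible hW hW' hN hNZ hN' hNZ' hf hs hA hA').trans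
      (hi' f f1 (fun m => (hf4 m).imp_right fun h => ⟨?_, h.2.trans (min_le_right _ _)⟩) hA').symm)
  · have := h.1 0
    rwa [e0] at this
  · have := h.1 1
    rwa [e1] at this

end Independence

end

theorem theoremA1 (k : ℕ) (hk : 1 ≤ k) {M : Type u} [TopologicalSpace M] [T2Space M]
    [CompactSpace M] [ChartedSpace (Euc k) M] [IsManifold (𝓡 (2 * k)) ∞ M]
    (o : TOrientation k M) (ho : IsOrientation o)
    (Z : Set M) (hZ : IsHypersurface k Z) (Ω : BForm k Z) (hΩ : IsBSymplectic Z Ω) :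
    -- the data that enter the construction exist
    (∃ x : M → ℝ, IsOrientedDefining Ω o x) ∧
    (∃ J : BEnd k Z, IsCompatible Ω J) ∧
    (∃ W : bFields k Z, ExtendsCanonical Z W) ∧
    -- a compatible complex structure gives a spin-c structure on the b-tangent bundle
    (∀ J : BEnd k Z, IsCompatible Ω J → (acSpinC Ω J).IsSpinC) ∧
    -- along `Z`, the gauge transformation `Γ e/|e|` is an involution that lifts the reflection
    (∀ J : BEnd k Z, IsCompatible Ω J → ∀ W : bFields k Z, ExtendsCanonical Z W →
      ∀ z ∈ Z, ∀ p : (acSpinC Ω J).P.Fib z,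
        (acSpinC Ω J).f z (chiralGauge (acSpinC Ω J) (bval W) z p) =
          reflGauge (V := bTangentEuc Ω J) (bval W) z ((acSpinC Ω J).f z p) ∧
        chiralGauge (acSpinC Ω J) (bval W) z (chiralGauge (acSpinC Ω J) (bval W) z p) = p) ∧
    ∀ g : RMetric k M,
      -- for all `x`, `J`, `W`, the surgery of the frame bundle of `bTM` is that of `TM`
      (∀ (x : M → ℝ) (J : BEnd k Z) (W : bFields k Z), IsOrientedDefining Ω o x →
        IsCompatible Ω J → ExtendsCanonical Z W → ∃ φ, IsFrameClutching Ω J W x g φ) ∧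
      -- clutching gives a spin-c structure on `TM`, and it has the asserted determinant line bundle
      (∀ x J W φ, IsClutchingChoice Ω o J W x g φ →
        (clutchedSpinC Ω o J W x g φ).IsSpinC ∧
        ∀ J' : BEnd k Z, IsCompatible Ω J' →
          DetLineIso (clutchedSpinC Ω o J W x g φ).P (acSpinC Ω J').P) ∧
      -- up to isomorphism, it does not depend on the choices
      (∀ x J W φ x' J' W' φ', IsClutchingChoice Ω o J W x g φ →
        IsClutchingChoice Ω o J' W' x' g φ' →
        (clutchedSpinC Ω o J W x g φ).Iso (clutchedSpinC Ω o J' W' x' g φ')) := by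

  refine ⟨exists_orientedDefining hk hZ hΩ ho, exists_compatible hk hZ hΩ, ?_,
    fun J hJ => acSpinC_isSpinC hk hZ hΩ hJ, fun J hJ W hW z hz p =>
      chiralGauge_lifts hk hZ hΩ hJ (hZ.canonical_ne_zero hk hW hz) p, fun g =>
    ⟨fun x J W hx hJ hW => exists_isFrameClutching hk hZ hΩ hJ hx.1 hW g,
      fun x J W φ h => ⟨clutchedSpinC_isSpinC hk hZ hΩ h.compatible ho h, fun J' hJ' => ?_⟩,
      fun x J W φ x' J' W' φ' h h' => clutchedSpinC_iso_of_choices hk hZ hΩ h h'⟩⟩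
  · obtain ⟨x, hx⟩ := exists_orientedDefining hk hZ hΩ ho
    exact exists_extendsCanonical hk hZ hx.1
  · obtain ⟨φ', hφ'⟩ := exists_isFrameClutching hk hZ hΩ hJ' h.defining.1 h.canonical g
    have h' : IsClutchingChoice Ω o J' W x g φ' := ⟨h.defining, hJ', h.canonical, hφ'⟩
    exact (clutchedSpinC_iso_of_choices hk hZ hΩ h h').detLineIso.trans
      (clutched_detLineIso hk hZ hΩ hJ' h')

end
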